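/- **Model.** Let $\{e_i\}_{i\in\mathbb Z}$ be i.i.d. random elements of a measurable space $\mathcal S$, $H:[0,1]\times\mathcal S^{\mathbb N}\to\mathbb R$ a measurable function and $\xi_i(x)=H(x,\mathcal F_i)$ with $\mathcal F_i=(\ldots,e_{i-1},e_i)$, where $\mathbb E\,\xi_i(x)=0$ for $x\in[0,1]$. For each sample size $n$ one observes $$Y_{ij}=m_i(X_{ij})+\xi_i(X_{ij})+\sigma(X_{ij})\varepsilon_{ij},\qquad 1\le i\le n,\ 1\le j\le N_i ,$$ where the $X_{ij}$ are i.i.d. with density $f$ on $[0,1]$; the $\varepsilon_{ij}$ are i.i.d. with mean $0$ and variance $1$; the $N_i$ are i.i.d. copies of a random variable $N$ with values in $\{1,2,\ldots\}$ and $\mathbb P(N>1)>0$, whose law may depend on $n$; and the families $\{e_i\}$, $\{X_{ij}\}$, $\{\varepsilon_{ij}\}$, $\{N_i\}$ are mutually independent. For a fixed $\epsilon\in(0,1/2)$ and, for all large $n$, an integer $k_0=k_0(n)$ with $k_0/n\in(\epsilon,1-\epsilon)$, we have $m_i=m_{\mathrm{pre}}$ for $i\le k_0$ and $m_i=m_{\mathrm{post}}$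 for $i>k_0$, with $m_{\mathrm{pre}},m_{\mathrm{post}}$ not depending on $n$; put $\Delta=m_{\mathrm{post}}-m_{\mathrm{pre}}$. Let $G(x,x')=\sum_{h\in\mathbb Z}\mathrm{Cov}(\xi_h(x),\xi_0(x'))$ and $\delta_H(i,r)=\sup_{x\in[0,1]}\|H(x,\mathcal F_i)-H(x,\mathcal F_i^*)\|_{r}$, where $\|\cdot\|_r$ is the $L^r(\mathbb P)$ norm and $\mathcal F_i^*$ is $\mathcal F_i$ with $e_0$ replaced by a copy $e_0^*$ of $e_0$ that is independent of $\{e_i\}$. **Estimators.** Let $p\ge1$ and let $J_n\ge1$ for all large $n$. Let $\boldsymbol B(x)\in\mathbb R^{J_n+p}$ be the vector of B-splines of order $p$ on $[0,1]$ with interior knots $l/(J_n+1)$, $1\le l\le J_n$ (and boundary knots $0$ and $1$, each repeated $p$ times). Put $\widehat{\mathbf V}=n^{-1}\sum_{i=1}^nN_i^{-1}\sum_{j=1}^{N_i}\boldsymbol B(X_{ij})\boldsymbol B^\top(X_{ij})$ and $$D_k(x)=\boldsymbol B^\top(x)\widehat{\mathbf V}^{-1}\Big\{\sum_{i=1}^k\frac1{N_i}\sum_{j=1}^{N_i}\boldsymbol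 B(X_{ij})Y_{ij}-\frac kn\sum_{i=1}^n\frac1{N_i}\sum_{j=1}^{N_i}\boldsymbol B(X_{ij})Y_{ij}\Big\}.$$ Let $\widehat k_{n,2}$ and $\widehat k_{n,\infty}$ be any maximizers of $\|D_k\|_{L^2[0,1]}^2$ and of $\sup_{x\in[0,1]}|D_k(x)|$, respectively, over the integers $k$ with $\epsilon n\le k\le(1-\epsilon)n$. **Assumptions.** * (A1) $m_{\mathrm{pre}},m_{\mathrm{post}}$ are $q$ times continuously differentiable on $[0,1]$ with $\nu$-Hölder $q$-th derivative, for some integer $q>0$ and $\nu\in(0,1]$; put $q^*=q+\nu$. * (A2) $c_f\le f\le C_f$ on $[0,1]$ for some constants $c_f,C_f>0$. * (A3) $\sigma^2$ is bounded on $[0,1]$ and $\mathbb E|\varepsilon_{ij}|^{r_1}<\infty$ for some integer $r_1\ge3$. * (A4) $G$ is $\mu$-Hölder on $[0,1]^2$ for some $\mu\in(0,1]$, $\inf_{x\in[0,1]}G(x,x)>0$, and $\sup_{x\in[0,1]}\mathbb E|m(x)+\xi_0(x)|^{r_2}<\infty$ for $m=m_{\mathrm{pre}},m_{\mathrm{post}}$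 and some integer $r_2\ge3$. * (A5) $\delta_H(i,r_2)=O(i^{-\beta})$ as $i\to\infty$ for some $\beta\ge3$. * (A6) $p\ge q^*$ and, with $r=\min\{r_1,r_2\}$ and $\Lambda_n=\sum_{s=1}^r\mathbb E(N^{s-r})J_n^{-s}$, one of the following holds: * $\mathbb E(N^{-1})J_n\to\infty$, $J_n^{-q^*-1/2}n^{1/2}\{\mathbb E(N^{-1})\}^{-1/2}\log^{1/2}n\to0$ and $J_n^{\frac{7r-6}{3r-2}}\Lambda_n^{2/r}n^{-\frac{r-2}{3r-2}}\{\mathbb E(N^{-1})\}^{-1}\log n\to0$; * $\mathbb E(N^{-1})J_n=O(1)$, $J_n^{-q^*}n^{1/2}\log^{1/2}n\to0$ and $J_n^{\frac{10r-8}{3r-2}}\Lambda_n^{2/r}n^{-\frac{r-2}{3r-2}}\log n\to0$. **Theorem.** 1. Under (A1)–(A5), if $nJ_n^{-q^*}=o(1+J_n\mathbb E(N^{-1}))$, $n^{-1/2}J_n\log n=o(1)$ and $\|\Delta\|_{L^2[0,1]}>0$, then $$|\widehat k_{n,2}-k_0|=O_p\big(\max\{1,\,J_n\mathbb E(N^{-1})\}\big).$$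 2. Under (A1)–(A6), if $\sup_{x\in[0,1]}|\Delta(x)|>0$, then $$|\widehat k_{n,\infty}-k_0|=O_p\Big(n^{1/2}\log^{1/2}n\,\max\big\{1,\,J_n^{1/2}\{\mathbb E(N^{-1})\}^{1/2}\big\}\Big).$$ -/

import Mathlib

open MeasureTheory ProbabilityTheory Filter Topology Asymptotics
open scoped ENNReal NNReal Matrix

namespace FTSBreak

noncomputable section

/-! ### B-splines on `[0,1]` with equally spaced interior knots -/

/-- The knot sequence for splines of order `p` with `J` interior knots: `0` repeated `p` times
(`l = 0, …, p-1`), the interior knots `1/(J+1), …, J/(J+1)`, and then `1` repeated `p` times. -/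
def knot (p J l : ℕ) : ℝ := max 0 (min 1 (((l : ℝ) + 1 - p) / ((J : ℝ) + 1)))

/-- Cox–de Boor recursion: `bsplineRec p J k l` is the `l`-th B-spline of order `k + 1` for the
knots `knot p J`. The last nonempty knot interval is closed at `1`; terms with coincident knots
are `0` by the convention `a / 0 = 0`. -/
def bsplineRec (p J : ℕ) : ℕ → ℕ → ℝ → ℝ
  | 0, l, x =>
      open Classical in
      if knot p J l ≤ x ∧
          (x < knot p J (l + 1) ∨ (x = 1 ∧ knot p J l < 1 ∧ knot p J (l + 1) = 1))
      then 1 else 0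
  | k + 1, l, x =>
      (x - knot p J l) / (knot p J (l + k + 1) - knot p J l) * bsplineRec p J k l x
        + (knot p J (l + k + 2) - x) / (knot p J (l + k + 2) - knot p J (l + 1))
          * bsplineRec p J k (l + 1) x

/-- The vector `B(x)` of the `J + p` B-splines of order `p` (for `p ≥ 1`). -/
def bspline (p J : ℕ) (x : ℝ) : Fin (J + p) → ℝ := fun l => bsplineRec p J (p - 1) l x

/-! ### Norms and function classes on `[0,1]` -/

/-- The `L²[0,1]` norm. -/
def l2Norm (g : ℝ → ℝ) : ℝ := Real.sqrt (∫ x in (0 : ℝ)..1, g x ^ 2)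

/-- The sup norm on `[0,1]`. -/
def supNorm (g : ℝ → ℝ) : ℝ := ⨆ x : Set.Icc (0 : ℝ) 1, |g x|

/-- The class of functions on `[0,1]` whose `q`-th derivative is `ν`-Hölder. -/
def IsHolder (q : ℕ) (ν : ℝ) (g : ℝ → ℝ) : Prop :=
  ContDiffOn ℝ q g (Set.Icc 0 1) ∧
    ∃ L : ℝ, ∀ s ∈ Set.Icc (0 : ℝ) 1, ∀ t ∈ Set.Icc (0 : ℝ) 1,
      |iteratedDerivWithin q g (Set.Icc 0 1) t - iteratedDerivWithin q g (Set.Icc 0 1) s|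
        ≤ L * |t - s| ^ ν

/-- The class of `μ`-Hölder functions on `[0,1]²`. -/
def IsHolder₂ (μ : ℝ) (G : ℝ → ℝ → ℝ) : Prop :=
  ∃ L : ℝ, ∀ s ∈ Set.Icc (0 : ℝ) 1, ∀ s' ∈ Set.Icc (0 : ℝ) 1,
    ∀ t ∈ Set.Icc (0 : ℝ) 1, ∀ t' ∈ Set.Icc (0 : ℝ) 1,
      |G t t' - G s s'| ≤ L * Real.sqrt ((t - s) ^ 2 + (t' - s') ^ 2) ^ μ

/-- `k` maximizes `Q` over the integers of `[ε n, (1-ε) n]`. -/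
def IsArgmax (ε : ℝ) (n : ℕ) (Q : ℕ → ℝ) (k : ℕ) : Prop :=
  (ε * n ≤ k ∧ (k : ℝ) ≤ (1 - ε) * n) ∧
    ∀ k' : ℕ, ε * n ≤ k' → (k' : ℝ) ≤ (1 - ε) * n → Q k' ≤ Q k

/-! ### The model -/

/-- The objects of the model
`Y i j = m i (X i j) + ξ i (X i j) + σ (X i j) * err i j`, `1 ≤ i ≤ n`, `1 ≤ j ≤ N n i`, with
`ξ i = H (·, (e i, e (i-1), …))` and `m i = mPre` for `i ≤ k₀ n`, `m i = mPost` for `i > k₀ n`.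
The law of the numbers of observations `N n i` may change with the sample size `n`. -/
structure Model (Ω S : Type*) where
  /-- innovations -/
  e : ℤ → Ω → S
  /-- the independent copy of `e 0` used in the dependence measure -/
  eStar : Ω → S
  /-- the filter -/
  H : ℝ → (ℕ → S) → ℝ
  /-- design points -/
  X : ℕ → ℕ → Ω → ℝ
  /-- density of the design points -/
  f : ℝ → ℝ
  /-- measurement errors -/
  err : ℕ → ℕ → Ω → ℝ
  /-- standard deviation function -/
  σ : ℝ → ℝ
  /-- numbers of observations: sample size, then curve -/
  N : ℕ → ℕ → Ω → ℕ
  /-- mean function up to the break -/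
  mPre : ℝ → ℝ
  /-- mean function after the break -/
  mPost : ℝ → ℝ
  /-- break point, for each sample size -/
  k₀ : ℕ → ℕ

namespace Model

variable {Ω S : Type*} (M : Model Ω S)

/-- `(e i, e (i-1), e (i-2), …)`. -/
def past (i : ℤ) (ω : Ω) : ℕ → S := fun k => M.e (i - k) ω

/-- `past i` with `e 0` replaced by its independent copy. -/
def pastStar (i : ℤ) (ω : Ω) : ℕ → S :=
  fun k => if i - (k : ℤ) = 0 then M.eStar ω else M.e (i - k) ω

/-- The random function `ξ i`. -/
def ξ (i : ℤ) (x : ℝ) (ω : Ω) : ℝ := M.H x (M.past i ω)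

/-- The mean function of curve `i` at sample size `n`. -/
def mean (n i : ℕ) : ℝ → ℝ := if i ≤ M.k₀ n then M.mPre else M.mPost

/-- The jump. -/
def Δ (x : ℝ) : ℝ := M.mPost x - M.mPre x

/-- The observations. -/
def Y (n i j : ℕ) (ω : Ω) : ℝ :=
  M.mean n i (M.X i j ω) + M.ξ i (M.X i j ω) ω + M.σ (M.X i j ω) * M.err i j ω

/-- `N_i⁻¹ ∑_j B(X_ij) Y_ij`. -/
def score (p J n i : ℕ) (ω : Ω) : Fin (J + p) → ℝ :=
  (M.N n i ω : ℝ)⁻¹ • ∑ j ∈ Finset.Icc 1 (M.N n i ω), M.Y n i j ω • bspline p J (M.X i j ω)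

/-- `V̂ = n⁻¹ ∑_i N_i⁻¹ ∑_j B(X_ij) B(X_ij)ᵀ`. -/
def Vhat (p J n : ℕ) (ω : Ω) : Matrix (Fin (J + p)) (Fin (J + p)) ℝ :=
  (n : ℝ)⁻¹ • ∑ i ∈ Finset.Icc 1 n, (M.N n i ω : ℝ)⁻¹ •
    ∑ j ∈ Finset.Icc 1 (M.N n i ω),
      Matrix.vecMulVec (bspline p J (M.X i j ω)) (bspline p J (M.X i j ω))

/-- The curve
`x ↦ B(x)ᵀ V̂⁻¹ {∑_{i≤k} N_i⁻¹ ∑_j B(X_ij) Y_ij - (k/n) ∑_{i≤n} N_i⁻¹ ∑_j B(X_ij) Y_ij}`. -/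
def cusum (p J n k : ℕ) (ω : Ω) (x : ℝ) : ℝ :=
  bspline p J x ⬝ᵥ ((M.Vhat p J n ω)⁻¹ *ᵥ
    (∑ i ∈ Finset.Icc 1 k, M.score p J n i ω
      - ((k : ℝ) / n) • ∑ i ∈ Finset.Icc 1 n, M.score p J n i ω))

/-- `khat` is an `L²`-based break point estimator with trimming `ε`, spline order `p` and `J n`
interior knots (any choice among several maximizers is allowed). -/
def IsL2Estimator (ε : ℝ) (p : ℕ) (J : ℕ → ℕ) (khat : ℕ → Ω → ℕ) : Prop :=
  ∀ᶠ n : ℕ in atTop, ∀ ω,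
    IsArgmax ε n (fun k => l2Norm (M.cusum p (J n) n k ω) ^ 2) (khat n ω)

/-- `khat` is a sup-norm-based break point estimator. -/
def IsSupEstimator (ε : ℝ) (p : ℕ) (J : ℕ → ℕ) (khat : ℕ → Ω → ℕ) : Prop :=
  ∀ᶠ n : ℕ in atTop, ∀ ω,
    IsArgmax ε n (fun k => supNorm (M.cusum p (J n) n k ω)) (khat n ω)

variable [MeasurableSpace Ω] (P : Measure Ω)

/-- The long-run covariance function `G`. -/
def longRunCov (x x' : ℝ) : ℝ := ∑' h : ℤ, cov[M.ξ h x, M.ξ 0 x'; P]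

/-- The physical dependence measure `δ_H(i, r)`. -/
def depMeasure (i : ℕ) (r : ℝ≥0∞) : ℝ≥0∞ :=
  ⨆ x ∈ Set.Icc (0 : ℝ) 1,
    eLpNorm (fun ω => M.H x (M.past i ω) - M.H x (M.pastStar i ω)) r P

/-- `E(N⁻¹)` at sample size `n`. -/
def EInvN (n : ℕ) : ℝ := ∫ ω, (M.N n 1 ω : ℝ)⁻¹ ∂P

/-- `∑_{s=1}^r E(N^{s-r}) J^{-s}` at sample size `n`. -/
def momentSum (r n J : ℕ) : ℝ :=
  ∑ s ∈ Finset.Icc 1 r, (∫ ω, (M.N n 1 ω : ℝ) ^ ((s : ℤ) - (r : ℤ)) ∂P) * (J : ℝ) ^ (-(s : ℤ))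

/-- The standing assumptions on the model, with trimming constant `ε`. -/
structure Standing [MeasurableSpace S] (ε : ℝ) : Prop where
  e_meas : ∀ i, Measurable (M.e i)
  e_indep : iIndepFun M.e P
  e_ident : ∀ i, IdentDistrib (M.e i) (M.e 0) P P
  eStar_ident : IdentDistrib M.eStar (M.e 0) P P
  eStar_indep : IndepFun M.eStar (fun ω i => M.e i ω) P
  H_meas : Measurable (Function.uncurry M.H)
  ξ_integrable : ∀ x ∈ Set.Icc (0 : ℝ) 1, Integrable (M.ξ 0 x) P
  ξ_mean : ∀ x ∈ Set.Icc (0 : ℝ) 1, ∫ ω, M.ξ 0 x ω ∂P = 0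
  X_meas : ∀ i j, Measurable (M.X i j)
  X_indep : iIndepFun (fun ij : ℕ × ℕ => M.X ij.1 ij.2) P
  f_meas : Measurable M.f
  X_law : ∀ i j, P.map (M.X i j) =
    (volume.restrict (Set.Icc (0 : ℝ) 1)).withDensity (fun x => ENNReal.ofReal (M.f x))
  err_meas : ∀ i j, Measurable (M.err i j)
  err_indep : iIndepFun (fun ij : ℕ × ℕ => M.err ij.1 ij.2) P
  err_ident : ∀ i j, IdentDistrib (M.err i j) (M.err 0 0) P P
  err_memLp : MemLp (M.err 0 0) 2 P
  err_mean : ∫ ω, M.err 0 0 ω ∂P = 0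
  err_var : Var[M.err 0 0; P] = 1
  σ_meas : Measurable M.σ
  N_meas : ∀ n i, Measurable (M.N n i)
  N_pos : ∀ n i ω, 1 ≤ M.N n i ω
  N_indep : ∀ n, iIndepFun (M.N n) P
  N_ident : ∀ n i, IdentDistrib (M.N n i) (M.N n 1) P P
  N_gt_one : ∀ n, 0 < P {ω | 1 < M.N n 1 ω}
  /-- The innovations, design points, errors and numbers of observations are mutually
  independent. -/
  indep : ∀ n, iIndep
    ![⨆ i, MeasurableSpace.comap (M.e i) inferInstance,
      ⨆ i, ⨆ j, MeasurableSpace.comap (M.X i j) inferInstance,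
      ⨆ i, ⨆ j, MeasurableSpace.comap (M.err i j) inferInstance,
      ⨆ i, MeasurableSpace.comap (M.N n i) inferInstance] P
  /-- The break point lies in the trimmed range. -/
  break_mem : ∀ᶠ n : ℕ in atTop, ε < (M.k₀ n : ℝ) / n ∧ (M.k₀ n : ℝ) / n < 1 - ε

/-- Smoothness of the mean functions. -/
def SmoothMeans (q : ℕ) (ν : ℝ) : Prop :=
  0 < q ∧ 0 < ν ∧ ν ≤ 1 ∧ IsHolder q ν M.mPre ∧ IsHolder q ν M.mPost

/-- The design density is bounded above and away from zero. -/
def DesignDensity : Prop :=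
  ∃ c C : ℝ, 0 < c ∧ ∀ x ∈ Set.Icc (0 : ℝ) 1, c ≤ M.f x ∧ M.f x ≤ C

/-- Bounded variance function and moments of the errors. -/
def ErrorMoments (r₁ : ℕ) : Prop :=
  (∃ C : ℝ, ∀ x ∈ Set.Icc (0 : ℝ) 1, M.σ x ^ 2 ≤ C) ∧ 3 ≤ r₁ ∧ MemLp (M.err 0 0) r₁ P

/-- Long-run covariance function and moments of the trajectories `η = m + ξ`. -/
def TrajectoryMoments (r₂ : ℕ) : Prop :=
  (∃ μ : ℝ, 0 < μ ∧ μ ≤ 1 ∧ IsHolder₂ μ (M.longRunCov P)) ∧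
  (∃ c : ℝ, 0 < c ∧ ∀ x ∈ Set.Icc (0 : ℝ) 1, c ≤ M.longRunCov P x x) ∧
  3 ≤ r₂ ∧
  ∃ C : ℝ≥0, ∀ x ∈ Set.Icc (0 : ℝ) 1,
    eLpNorm (fun ω => M.mPre x + M.ξ 0 x ω) r₂ P ≤ C ∧
    eLpNorm (fun ω => M.mPost x + M.ξ 0 x ω) r₂ P ≤ C

/-- Polynomial decay of the dependence measure. -/
def DependenceDecay (r₂ : ℕ) : Prop :=
  ∃ β : ℝ, 3 ≤ β ∧ ∃ C : ℝ, ∀ᶠ i : ℕ in atTop,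
    M.depMeasure P i r₂ ≤ ENNReal.ofReal (C * (i : ℝ) ^ (-β))

/-- Spline order and number of knots, with `qs = q + ν`, `r = min r₁ r₂` and
`a_n = (log n)^{1/2}`; the two alternatives are the regimes `E(N⁻¹) J_n ≫ 1` and
`E(N⁻¹) J_n ≲ 1`. -/
def KnotRates (p : ℕ) (J : ℕ → ℕ) (qs : ℝ) (r : ℕ) : Prop :=
  qs ≤ p ∧
  ((Tendsto (fun n => M.EInvN P n * J n) atTop atTop ∧
    Tendsto (fun n : ℕ => (J n : ℝ) ^ (-qs - 1 / 2) * (n : ℝ) ^ (1 / 2 : ℝ)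
      * M.EInvN P n ^ (-(1 / 2) : ℝ) * Real.log n ^ (1 / 2 : ℝ)) atTop (𝓝 0) ∧
    Tendsto (fun n : ℕ => (J n : ℝ) ^ ((7 * (r : ℝ) - 6) / (3 * r - 2))
      * M.momentSum P r n (J n) ^ (2 / (r : ℝ)) * (n : ℝ) ^ (-(((r : ℝ) - 2) / (3 * r - 2)))
      * (M.EInvN P n)⁻¹ * Real.log n) atTop (𝓝 0)) ∨
   ((fun n => M.EInvN P n * J n) =O[atTop] (fun _ => (1 : ℝ)) ∧
    Tendsto (fun n : ℕ => (J n : ℝ) ^ (-qs) * (n : ℝ) ^ (1 / 2 : ℝ)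
      * Real.log n ^ (1 / 2 : ℝ)) atTop (𝓝 0) ∧
    Tendsto (fun n : ℕ => (J n : ℝ) ^ ((10 * (r : ℝ) - 8) / (3 * r - 2))
      * M.momentSum P r n (J n) ^ (2 / (r : ℝ)) * (n : ℝ) ^ (-(((r : ℝ) - 2) / (3 * r - 2)))
      * Real.log n) atTop (𝓝 0)))

end Model

/-- `Z n = O_p(a n)`. -/
def IsBigOP {Ω : Type*} [MeasurableSpace Ω] (P : Measure Ω) (Z : ℕ → Ω → ℝ) (a : ℕ → ℝ) : Prop :=
  ∀ δ : ℝ, 0 < δ → ∃ K : ℝ, 0 < K ∧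
    ∀ᶠ n : ℕ in atTop, P {ω | K * a n < |Z n ω|} ≤ ENNReal.ofReal δ

end

end FTSBreak

/-! The CUSUM curve is a spline whose coefficients are `V̂⁻¹` applied to centered partial sums of
the scores. A score has mean exactly `E B(X) m_i(X)`, so the curve is a noise spline minus `tent k`
times the spline with coefficients `V̂⁻¹ E B(X) Δ(X)` (`cusum_eq`). The tent peaks at `k₀` with
height at least `ε² n` and falls off with slope at least `ε` on both sides. The signal spline need
not be close to `Δ`: it is enough that its norm stays away from zero, which follows by duality once
`J → ∞` (`exists_signal_lower_bound`). Locating a maximizer is then deterministic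
(`tent_argmax_of_increment`, `tent_argmax_of_bound`).

Inverting `V̂` costs a factor of order `J`. Stability of the B-spline basis, a consequence of
Marsden's identity, makes the population Gram matrix coercive at scale `1/J`; it is also banded with
row sums `O(1/J)`. Chebyshev's inequality, entry by entry, carries this over to `V̂` with
probability `1 - O(J²/n)` (`exists_goodGram_Vhat`). The inverse is then `O(J)` in the Euclidean norm
by coercivity and in the sup norm by off-diagonal decay (`exists_abs_inv_mulVec_le`).

The scores are dependent through `ξ_i`. Averaging `H` over all but the last `m+1` innovations and
telescoping in `m` splits a centered score into layers (`exists_layered`). The `m`-th layer has size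
`(m+1)⁻³` and is independent along each residue class modulo `m+1`. Kolmogorov's maximal inequality
and a truncated Chernoff bound apply to each class. Giving every class a fixed summable share of the
deviation recombines them into `Layered.maximal` and `Layered.deviation`.

Put `a = max 1 (J E(N⁻¹))`. A coefficient of a centered score has variance of order at most `a/J²`,
so the noise from `d` curves has squared `L²` norm of order at most `a d`, while moving `d` steps
away from `k₀` lowers the tent by order `d`. Hence distances much larger than `a` are impossible,
uniformly in `d` by dyadic peeling; this is the `L²` rate. In the sup norm the whole noise process
is `O(√(n a log n))`, and division by the slope of the tent gives the second rate. -/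

namespace FTSBreak

/-! ### B-splines on the knot cells -/

/-- `x` lies in the `t`-th knot cell; the last cell is closed at `1`. -/
def InCell (J t : ℕ) (x : ℝ) : Prop :=
  t ≤ J ∧ (t : ℝ) / (J + 1) ≤ x ∧ (x < ((t : ℝ) + 1) / (J + 1) ∨ (t = J ∧ x = 1))

lemma exists_inCell (J : ℕ) {x : ℝ} (hx : x ∈ Set.Icc (0 : ℝ) 1) : ∃ t, InCell J t x := by
  obtain ⟨h0, h1⟩ := hx
  have hJ : (0 : ℝ) < J + 1 := by positivity
  rcases h1.lt_or_eq with h1 | h1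
  · refine ⟨⌊x * (J + 1)⌋₊, ?_, ?_, Or.inl ?_⟩
    · have : ⌊x * (J + 1)⌋₊ < J + 1 := by
        rw [Nat.floor_lt (by positivity)]
        push_cast
        nlinarith
      omega
    · rw [div_le_iff₀ hJ]
      exact Nat.floor_le (by positivity)
    · rw [lt_div_iff₀ hJ]
      exact Nat.lt_floor_add_one _
  · refine ⟨J, le_rfl, ?_, Or.inr ⟨rfl, h1⟩⟩
    rw [h1, div_le_one hJ]
    linarith

lemma InCell.mem_Icc {J t : ℕ} {x : ℝ} (h : InCell J t x) : x ∈ Set.Icc (0 : ℝ) 1 := by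
  obtain ⟨ht, h1, h2⟩ := h
  have hJ : (0 : ℝ) < J + 1 := by positivity
  refine ⟨le_trans (by positivity) h1, ?_⟩
  rcases h2 with h2 | h2
  · refine h2.le.trans ?_
    rw [div_le_one hJ]
    have : (t : ℝ) ≤ J := by exact_mod_cast ht
    linarith
  · exact h2.2.le

lemma InCell.le_right {J t : ℕ} {x : ℝ} (h : InCell J t x) : x ≤ ((t : ℝ) + 1) / (J + 1) := by
  obtain ⟨ht, h1, h2 | ⟨rfl, rfl⟩⟩ := h
  · exact h2.le
  · rw [div_self (by positivity)]

lemma knot_mono (p J : ℕ) : Monotone (knot p J) := by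
  intro a b hab
  unfold knot
  have : (a : ℝ) ≤ b := by exact_mod_cast hab
  gcongr

/-- The first `p` knots coincide at `0`, so the breakpoint `s / (J+1)` carries the index `s + p -
1`; writing `l + 1 = s + p` avoids truncated subtraction. -/
lemma knot_eq {p J : ℕ} (s l : ℕ) (hs : s ≤ J + 1) (hl : l + 1 = s + p) :
    knot p J l = (s : ℝ) / (J + 1) := by
  unfold knot
  have h1 : (l : ℝ) + 1 = s + p := by exact_mod_cast hl
  have h2 : (s : ℝ) ≤ J + 1 := by exact_mod_cast hs
  rw [h1, add_sub_cancel_right, min_eq_right, max_eq_right (by positivity)]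
  rw [div_le_one (by positivity)]
  exact h2

lemma knot_le_left {p J t l : ℕ} (ht : t ≤ J) (hl : l + 1 ≤ t + p) (hp : 1 ≤ p) :
    knot p J l ≤ (t : ℝ) / (J + 1) := by
  rw [← knot_eq (p := p) (J := J) t (t + p - 1) (by omega) (by omega)]
  exact knot_mono p J (by omega)

lemma right_le_knot {p J t l : ℕ} (ht : t ≤ J) (hl : t + p ≤ l) :
    ((t : ℝ) + 1) / (J + 1) ≤ knot p J l := by
  have := knot_eq (p := p) (J := J) (t + 1) (t + p) (by omega) (by omega)
  push_cast at this
  rw [← this]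
  exact knot_mono p J hl

lemma bsplineRec_zero_of_inCell {p J t : ℕ} (hp : 1 ≤ p) (l : ℕ) {x : ℝ} (h : InCell J t x) :
    bsplineRec p J 0 l x = if l + 1 = t + p then 1 else 0 := by
  have hmem := h.mem_Icc
  have hJ : (0 : ℝ) < J + 1 := by positivity
  obtain ⟨ht, h1, h2⟩ := h
  unfold bsplineRec
  by_cases hl : l + 1 = t + p
  · rw [if_pos hl, if_pos]
    have e1 := knot_eq (p := p) (J := J) t l (by omega) hl
    have e2 := knot_eq (p := p) (J := J) (t + 1) (l + 1) (by omega) (by omega)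
    push_cast at e2
    refine ⟨e1 ▸ h1, ?_⟩
    rcases h2 with h2 | ⟨rfl, rfl⟩
    · left; rw [e2]; exact h2
    · right
      refine ⟨rfl, ?_, ?_⟩
      · rw [e1, div_lt_one hJ]; linarith
      · rw [e2, div_self hJ.ne']
  · rw [if_neg hl, if_neg]
    rintro ⟨h3, h4⟩
    rcases lt_or_gt_of_ne hl with hlt | hgt
    · have h5 : knot p J (l + 1) ≤ (t : ℝ) / (J + 1) := knot_le_left ht (by omega) hp
      rcases h4 with h4 | ⟨h6, h7, h8⟩
      · linarith
      · rw [h8] at h5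
        have : (t : ℝ) / (J + 1) < 1 := by
          rw [div_lt_one hJ]
          have : (t : ℝ) ≤ J := by exact_mod_cast ht
          linarith
        linarith
    · have h5 : ((t : ℝ) + 1) / (J + 1) ≤ knot p J l := right_le_knot ht (by omega)
      rcases h2 with h2 | ⟨rfl, rfl⟩
      · linarith
      · rw [div_self hJ.ne'] at h5
        rcases h4 with h4 | ⟨h6, h7, h8⟩
        · have : knot p t (l + 1) ≤ 1 := by unfold knot; simp
          linarith
        · linarith

/-- In cell `t` the only nonzero function of the lowest order has index `t + p - 1`. The recursion
for `l` uses only `l` and `l + 1`, so after `k` steps this index must lie between `l` and `l + k`.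
-/
lemma bsplineRec_eq_zero_of_inCell {p J t : ℕ} (hp : 1 ≤ p) {x : ℝ} (h : InCell J t x) (k : ℕ) :
    ∀ l, ¬ (l + 1 ≤ t + p ∧ t + p ≤ l + k + 1) → bsplineRec p J k l x = 0 := by
  induction k with
  | zero =>
    intro l hl
    rw [bsplineRec_zero_of_inCell hp l h, if_neg (by omega)]
  | succ k ih =>
    intro l hl
    rw [bsplineRec, ih l (by omega), ih (l + 1) (by omega)]
    simp

/-- For an active index the cell lies between the two knots of each recursion coefficient, so both
coefficients are nonnegative; for the other indices the lower-order spline vanishes, whatever the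
sign of its coefficient. -/
lemma bsplineRec_nonneg_of_inCell {p J t : ℕ} (hp : 1 ≤ p) {x : ℝ} (h : InCell J t x) (k : ℕ) :
    ∀ l, 0 ≤ bsplineRec p J k l x := by
  induction k with
  | zero =>
    intro l
    rw [bsplineRec_zero_of_inCell hp l h]
    split_ifs <;> norm_num
  | succ k ih =>
    intro l
    rw [bsplineRec]
    have hr := h.le_right
    have hl := h.2.1
    refine add_nonneg ?_ ?_
    · by_cases ha : l + 1 ≤ t + p ∧ t + p ≤ l + k + 1
      · have h1 : knot p J l ≤ _ := knot_le_left h.1 ha.1 hp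
        have h2 := right_le_knot h.1 ha.2
        exact mul_nonneg (div_nonneg (by linarith) (by linarith)) (ih l)
      · rw [bsplineRec_eq_zero_of_inCell hp h k l ha, mul_zero]
    · by_cases ha : l + 1 + 1 ≤ t + p ∧ t + p ≤ l + 1 + k + 1
      · have h1 : knot p J (l + 1) ≤ _ := knot_le_left h.1 ha.1 hp
        have h2 : _ ≤ knot p J (l + k + 2) := right_le_knot h.1 (by omega)
        exact mul_nonneg (div_nonneg (by linarith) (by linarith)) (ih (l + 1))
      · rw [bsplineRec_eq_zero_of_inCell hp h k (l + 1) ha, mul_zero]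

/-- One step of the de Boor algorithm. -/
lemma sum_bsplineRec_succ {p J t : ℕ} (hp : 1 ≤ p) {x : ℝ} (h : InCell J t x) {k : ℕ}
    (hk : k + 1 < p) (c c' : ℕ → ℝ)
    (hc : ∀ l, knot p J (l + 1) < knot p J (l + k + 2) →
      (x - knot p J (l + 1)) * c (l + 1) + (knot p J (l + k + 2) - x) * c l
        = (knot p J (l + k + 2) - knot p J (l + 1)) * c' (l + 1)) :
    ∑ l ∈ Finset.range (J + p), c l * bsplineRec p J (k + 1) l x
      = ∑ l ∈ Finset.range (J + p), c' l * bsplineRec p J k l x := by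
  have hr := h.le_right
  have hl := h.2.1
  have ht := h.1
  -- Since `k + 1 < p`, the lower-order splines at the two ends of the index range vanish on the
  -- cell. The index can therefore be shifted by one without boundary terms, and both halves of the
  -- recursion meet at index `l + 1`.
  have z0 : bsplineRec p J k 0 x = 0 := bsplineRec_eq_zero_of_inCell hp h k 0 (by omega)
  have zd : bsplineRec p J k (J + p) x = 0 := bsplineRec_eq_zero_of_inCell hp h k _ (by omega)
  set F : ℕ → ℝ := fun l => c l * ((x - knot p J l) / (knot p J (l + k + 1) - knot p J l)
    * bsplineRec p J k l x) with hF
  set G : ℕ → ℝ := fun l => c l * ((knot p J (l + k + 2) - x)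
    / (knot p J (l + k + 2) - knot p J (l + 1)) * bsplineRec p J k (l + 1) x) with hG
  have e1 : ∑ l ∈ Finset.range (J + p), c l * bsplineRec p J (k + 1) l x
      = ∑ l ∈ Finset.range (J + p), F l + ∑ l ∈ Finset.range (J + p), G l := by
    rw [← Finset.sum_add_distrib]
    refine Finset.sum_congr rfl fun l _ => ?_
    rw [bsplineRec, mul_add]
  have e2 : ∑ l ∈ Finset.range (J + p), F l = ∑ l ∈ Finset.range (J + p), F (l + 1) := by
    have a1 := Finset.sum_range_succ F (J + p)
    have a2 := Finset.sum_range_succ' F (J + p)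
    have a3 : F 0 = 0 := by simp [hF, z0]
    have a4 : F (J + p) = 0 := by simp [hF, zd]
    linarith
  have e3 : ∑ l ∈ Finset.range (J + p), c' l * bsplineRec p J k l x
      = ∑ l ∈ Finset.range (J + p), c' (l + 1) * bsplineRec p J k (l + 1) x := by
    have a1 := Finset.sum_range_succ (fun l => c' l * bsplineRec p J k l x) (J + p)
    have a2 := Finset.sum_range_succ' (fun l => c' l * bsplineRec p J k l x) (J + p)
    simp only [z0, zd, mul_zero, add_zero] at a1 a2
    linarith
  rw [e1, e2, e3, ← Finset.sum_add_distrib]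
  refine Finset.sum_congr rfl fun l _ => ?_
  by_cases ha : l + 1 + 1 ≤ t + p ∧ t + p ≤ l + 1 + k + 1
  · have h1 : knot p J (l + 1) ≤ _ := knot_le_left h.1 ha.1 hp
    have h2 : _ ≤ knot p J (l + k + 2) := right_le_knot h.1 (by omega)
    have hlt : knot p J (l + 1) < knot p J (l + k + 2) := by
      refine h1.trans_lt (lt_of_lt_of_le ?_ h2)
      gcongr
      linarith
    have := hc l hlt
    have hne : knot p J (l + k + 2) - knot p J (l + 1) ≠ 0 := by linarith
    simp only [hF, hG]
    have e4 : l + 1 + k + 1 = l + k + 2 := by ring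
    rw [e4]
    field_simp
    linear_combination bsplineRec p J k (l + 1) x * this
  · simp only [hF, hG, bsplineRec_eq_zero_of_inCell hp h k (l + 1) ha, mul_zero, add_zero]

lemma sum_bsplineRec_eq_one {p J t : ℕ} (hp : 1 ≤ p) {x : ℝ} (h : InCell J t x) (k : ℕ)
    (hk : k < p) : ∑ l ∈ Finset.range (J + p), bsplineRec p J k l x = 1 := by
  induction k with
  | zero =>
    simp_rw [bsplineRec_zero_of_inCell hp _ h]
    have ht := h.1
    rw [Finset.sum_eq_single (t + p - 1)]
    · rw [if_pos (by omega)]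
    · intro b _ hb
      rw [if_neg (by omega)]
    · intro hb
      exact absurd (Finset.mem_range.2 (by omega)) hb
  | succ k ih =>
    have := sum_bsplineRec_succ hp h hk (fun _ => 1) (fun _ => 1) (fun l _ => by ring)
    simp only [one_mul] at this
    rw [this]
    exact ih (by omega)

/-- Marsden's identity. -/
lemma marsden {p J t : ℕ} (hp : 1 ≤ p) {x : ℝ} (h : InCell J t x) (y : ℝ) (k : ℕ) (hk : k < p) :
    ∑ l ∈ Finset.range (J + p),
      (∏ i ∈ Finset.range k, (y - knot p J (l + i + 1))) * bsplineRec p J k l x = (y - x) ^ k := by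
  induction k with
  | zero => simpa using sum_bsplineRec_eq_one hp h 0 hk
  | succ k ih =>
    have := sum_bsplineRec_succ hp h hk
      -- Consecutive coefficients share all but one factor. What remains is linear interpolation of
      -- `y - x` between two knots, which produces the extra factor `y - x` in the coefficients of
      -- lower order.
      (fun l => ∏ i ∈ Finset.range (k + 1), (y - knot p J (l + i + 1)))
      (fun l => (y - x) * ∏ i ∈ Finset.range k, (y - knot p J (l + i + 1))) (fun l _ => by
        have e1 : ∏ i ∈ Finset.range (k + 1), (y - knot p J (l + 1 + i + 1))
            = (∏ i ∈ Finset.range k, (y - knot p J (l + 1 + i + 1)))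
              * (y - knot p J (l + k + 2)) := by
          rw [Finset.prod_range_succ, show l + 1 + k + 1 = l + k + 2 by ring]
        have e2 : ∏ i ∈ Finset.range (k + 1), (y - knot p J (l + i + 1))
            = (∏ i ∈ Finset.range k, (y - knot p J (l + 1 + i + 1))) * (y - knot p J (l + 1)) := by
          rw [Finset.prod_range_succ']
          congr 1
          refine Finset.prod_congr rfl fun i _ => ?_
          congr 2
          ring
        simp only [e1, e2]
        ring)
    rw [this]
    simp_rw [mul_assoc]
    rw [← Finset.mul_sum, ih (by omega), pow_succ]
    ring

lemma exists_poly_bsplineRec {p J t : ℕ} (hp : 1 ≤ p) (k : ℕ) : ∀ l, ∃ q : Polynomial ℝ,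
    q.natDegree ≤ k ∧ ∀ x, InCell J t x → bsplineRec p J k l x = q.eval x := by
  induction k with
  | zero =>
    intro l
    refine ⟨Polynomial.C (if l + 1 = t + p then 1 else 0), Polynomial.natDegree_C _ |>.le, fun x hx => ?_⟩
    rw [bsplineRec_zero_of_inCell hp l hx, Polynomial.eval_C]
  | succ k ih =>
    intro l
    obtain ⟨q₁, hq₁, hq₁'⟩ := ih l
    obtain ⟨q₂, hq₂, hq₂'⟩ := ih (l + 1)
    have aux : ∀ (a b : ℝ) (q : Polynomial ℝ), q.natDegree ≤ k →
        ((Polynomial.C a * Polynomial.X + Polynomial.C b) * q).natDegree ≤ k + 1 := by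
      intro a b q hq
      refine Polynomial.natDegree_mul_le.trans ?_
      have := Polynomial.natDegree_linear_le (a := a) (b := b)
      omega
    refine ⟨(Polynomial.C (1 / (knot p J (l + k + 1) - knot p J l)) * Polynomial.X
        + Polynomial.C (- knot p J l / (knot p J (l + k + 1) - knot p J l))) * q₁
      + (Polynomial.C (-1 / (knot p J (l + k + 2) - knot p J (l + 1))) * Polynomial.X
        + Polynomial.C (knot p J (l + k + 2) / (knot p J (l + k + 2) - knot p J (l + 1)))) * q₂,
      Polynomial.natDegree_add_le_of_degree_le (aux _ _ _ hq₁) (aux _ _ _ hq₂), fun x hx => ?_⟩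
    rw [bsplineRec, hq₁' x hx, hq₂' x hx]
    simp
    ring

lemma bsplineRec_eq_zero_of_notMem {p J : ℕ} {x : ℝ} (hx : x ∉ Set.Icc (0 : ℝ) 1) (k : ℕ) :
    ∀ l, bsplineRec p J k l x = 0 := by
  induction k with
  | zero =>
    intro l
    rw [bsplineRec, if_neg]
    have h0 : ∀ l, 0 ≤ knot p J l := fun l => by unfold knot; simp
    have h1 : ∀ l, knot p J l ≤ 1 := fun l => by unfold knot; simp
    rintro ⟨h2, h3 | h3⟩
    · exact hx ⟨(h0 l).trans h2, (h3.trans_le (h1 _)).le⟩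
    · exact hx ⟨(h0 l).trans h2, h3.1.le⟩
  | succ k ih =>
    intro l
    rw [bsplineRec, ih, ih]
    simp

lemma measurable_bsplineRec (p J k : ℕ) : ∀ l, Measurable (bsplineRec p J k l) := by
  induction k with
  | zero =>
    intro l
    refine Measurable.ite ?_ measurable_const measurable_const
    refine (measurableSet_le measurable_const measurable_id).inter
      ((measurableSet_lt measurable_id measurable_const).union ?_)
    exact (measurableSet_eq_fun measurable_id measurable_const).inter (MeasurableSet.const _)
  | succ k ih =>
    intro l
    have := ih l
    have := ih (l + 1)
    change Measurable (fun x => (x - knot p J l) / (knot p J (l + k + 1) - knot p J l)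
      * bsplineRec p J k l x + (knot p J (l + k + 2) - x)
        / (knot p J (l + k + 2) - knot p J (l + 1)) * bsplineRec p J k (l + 1) x)
    fun_prop

lemma measurable_bspline (p J : ℕ) (l : Fin (J + p)) : Measurable (fun x => bspline p J x l) :=
  measurable_bsplineRec p J (p - 1) l

lemma bspline_of_notMem {p J : ℕ} {x : ℝ} (hx : x ∉ Set.Icc (0 : ℝ) 1) (l : Fin (J + p)) :
    bspline p J x l = 0 := bsplineRec_eq_zero_of_notMem hx _ _

lemma bspline_nonneg {p : ℕ} (J : ℕ) (hp : 1 ≤ p) (x : ℝ) (l : Fin (J + p)) :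
    0 ≤ bspline p J x l := by
  by_cases hx : x ∈ Set.Icc (0 : ℝ) 1
  · obtain ⟨t, ht⟩ := exists_inCell J hx
    exact bsplineRec_nonneg_of_inCell hp ht _ _
  · rw [bspline_of_notMem hx]

lemma sum_bspline {p : ℕ} (J : ℕ) (hp : 1 ≤ p) {x : ℝ} (hx : x ∈ Set.Icc (0 : ℝ) 1) :
    ∑ l, bspline p J x l = 1 := by
  obtain ⟨t, ht⟩ := exists_inCell J hx
  rw [← sum_bsplineRec_eq_one hp ht (p - 1) (by omega), Finset.sum_range]
  rfl

lemma sum_bspline_le {p : ℕ} (J : ℕ) (hp : 1 ≤ p) (x : ℝ) : ∑ l, bspline p J x l ≤ 1 := by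
  by_cases hx : x ∈ Set.Icc (0 : ℝ) 1
  · exact (sum_bspline J hp hx).le
  · simp [bspline_of_notMem hx]

lemma bspline_le_one {p : ℕ} (J : ℕ) (hp : 1 ≤ p) (x : ℝ) (l : Fin (J + p)) :
    bspline p J x l ≤ 1 :=
  (Finset.single_le_sum (fun i _ => bspline_nonneg J hp x i) (Finset.mem_univ l)).trans
    (sum_bspline_le J hp x)

lemma bspline_support {p J : ℕ} (hp : 1 ≤ p) {x : ℝ} {l : Fin (J + p)} (h : bspline p J x l ≠ 0) :
    ∃ t, InCell J t x ∧ t ≤ l ∧ (l : ℕ) + 1 ≤ t + p := by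
  by_cases hx : x ∈ Set.Icc (0 : ℝ) 1
  · obtain ⟨t, ht⟩ := exists_inCell J hx
    refine ⟨t, ht, ?_⟩
    by_contra hcon
    refine h (bsplineRec_eq_zero_of_inCell hp ht _ _ fun hh => hcon ?_)
    omega
  · exact absurd (bspline_of_notMem hx l) h

lemma bspline_support_Icc {p J : ℕ} (hp : 1 ≤ p) {x : ℝ} {l : Fin (J + p)}
    (h : bspline p J x l ≠ 0) :
    x ∈ Set.Icc (((l : ℝ) + 1 - p) / (J + 1)) (((l : ℝ) + 1) / (J + 1)) := by
  obtain ⟨t, ht, h1, h2⟩ := bspline_support hp h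
  have h1' : (t : ℝ) ≤ (l : ℕ) := by exact_mod_cast h1
  have h2' : ((l : ℕ) : ℝ) + 1 ≤ t + p := by exact_mod_cast h2
  constructor
  · refine le_trans ?_ ht.2.1
    gcongr
    linarith
  · refine ht.le_right.trans ?_
    gcongr

lemma inCell_unique {J t t' : ℕ} {x : ℝ} (h : InCell J t x) (h' : InCell J t' x) : t = t' := by
  have e : ∀ {t t' : ℕ}, InCell J t x → InCell J t' x → t < t' → False := by
    intro t t' h h' hlt
    have hJ : (0 : ℝ) < J + 1 := by positivity
    obtain ⟨a, b, c | ⟨c, d⟩⟩ := h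
    · have : ((t : ℝ) + 1) / (J + 1) ≤ t' / (J + 1) := by
        gcongr
        exact_mod_cast hlt
      linarith [h'.2.1]
    · have := h'.1
      omega
  rcases lt_trichotomy t t' with hh | hh | hh
  · exact (e h h' hh).elim
  · exact hh
  · exact (e h' h hh).elim

lemma bspline_banded {p J : ℕ} (hp : 1 ≤ p) {x : ℝ} {l l' : Fin (J + p)}
    (h : bspline p J x l * bspline p J x l' ≠ 0) : (l : ℕ) < l' + p ∧ (l' : ℕ) < l + p := by
  obtain ⟨t, ht, h1, h2⟩ := bspline_support hp (left_ne_zero_of_mul h)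
  obtain ⟨t', ht', h1', h2'⟩ := bspline_support hp (right_ne_zero_of_mul h)
  have := inCell_unique ht ht'
  omega

end FTSBreak

namespace FTSBreak

/-! ### Stability of the B-spline basis -/

/-- Norms on the finite-dimensional space of polynomials of degree below `p` are equivalent: the
integral is continuous, homogeneous of degree two and positive off zero, so it has a positive
minimum on the unit sphere. -/
lemma exists_coeff_bound (p : ℕ) : ∃ C : ℝ, 0 < C ∧ ∀ a : Fin p → ℝ,
    ∑ m, a m ^ 2 ≤ C * ∫ u in (0 : ℝ)..1, (∑ m, a m * u ^ (m : ℕ)) ^ 2 := by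
  set F : EuclideanSpace ℝ (Fin p) → ℝ :=
    fun a => ∫ u in (0 : ℝ)..1, (∑ m, a m * u ^ (m : ℕ)) ^ 2 with hF
  have hcont : Continuous F := by
    apply intervalIntegral.continuous_parametric_intervalIntegral_of_continuous'
    unfold Function.uncurry
    fun_prop
  have hpos : ∀ a, a ≠ 0 → 0 < F a := by
    intro a ha
    have h0 : 0 ≤ F a := intervalIntegral.integral_nonneg zero_le_one fun u _ => sq_nonneg _
    refine lt_of_le_of_ne h0 fun h => ha ?_
    set q : Polynomial ℝ := ∑ m, Polynomial.C (a m) * Polynomial.X ^ (m : ℕ) with hq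
    have hqe : ∀ u, q.eval u = ∑ m, a m * u ^ (m : ℕ) := by
      intro u
      simp [hq, Polynomial.eval_finsetSum]
    have hz : ∀ u ∈ Set.Ioc (0 : ℝ) 1, q.eval u = 0 := by
      intro u hu
      by_contra hne
      have : 0 < F a := by
        refine intervalIntegral.integral_pos zero_lt_one (by fun_prop)
          (fun _ _ => sq_nonneg _) ⟨u, ⟨hu.1.le, hu.2⟩, ?_⟩
        rw [← hqe]
        positivity
      linarith
    have hq0 : q = 0 := Polynomial.eq_zero_of_infinite_isRoot q
      ((Set.Ioc_infinite (zero_lt_one' ℝ)).mono hz)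
    ext m
    have : q.coeff m = a m := by
      simp only [hq, Polynomial.finsetSum_coeff, Polynomial.coeff_C_mul, Polynomial.coeff_X_pow]
      rw [Finset.sum_eq_single m]
      · simp
      · intro b _ hb
        rw [if_neg (fun h => hb (Fin.ext h.symm)), mul_zero]
      · simp
    rw [← this, hq0]
    simp
  have hscale : ∀ (r : ℝ) a, F (r • a) = r ^ 2 * F a := by
    intro r a
    simp only [hF]
    rw [← intervalIntegral.integral_const_mul]
    congr 1
    ext u
    rw [← mul_pow, Finset.mul_sum]
    congr 2
    ext m
    simp
    ring
  have hnorm : ∀ a : EuclideanSpace ℝ (Fin p), ∑ m, a m ^ 2 = ‖a‖ ^ 2 := by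
    intro a
    rw [EuclideanSpace.norm_sq_eq]
    simp
  have key : ∃ C : ℝ, 0 < C ∧ ∀ a, ‖a‖ ^ 2 ≤ C * F a := by
    -- The sphere is empty exactly when `p = 0`, where there is nothing to minimize over.
    rcases (Metric.sphere (0 : EuclideanSpace ℝ (Fin p)) 1).eq_empty_or_nonempty with he | hne
    · refine ⟨1, one_pos, fun a => ?_⟩
      have : a = 0 := by
        by_contra ha
        have : (‖a‖⁻¹ • a) ∈ Metric.sphere (0 : EuclideanSpace ℝ (Fin p)) 1 := by
          simp [norm_smul, ha]
        rw [he] at this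
        exact this
      rw [this, one_mul]
      have h0 : 0 ≤ F 0 := intervalIntegral.integral_nonneg zero_le_one fun u _ => sq_nonneg _
      simpa using h0
    · obtain ⟨a₀, ha₀, hmin⟩ := (isCompact_sphere (0 : EuclideanSpace ℝ (Fin p)) 1).exists_isMinOn
        hne hcont.continuousOn
      have ha₀' : a₀ ≠ 0 := by
        rintro rfl
        simp at ha₀
      have hF0 := hpos a₀ ha₀'
      refine ⟨(F a₀)⁻¹, by positivity, fun a => ?_⟩
      by_cases ha : a = 0
      · have h0 : 0 ≤ F a := intervalIntegral.integral_nonneg zero_le_one fun u _ => sq_nonneg _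
        rw [ha] at h0 ⊢
        simpa using mul_nonneg (inv_nonneg.2 hF0.le) h0
      · have hmem : (‖a‖⁻¹ • a) ∈ Metric.sphere (0 : EuclideanSpace ℝ (Fin p)) 1 := by
          simp [norm_smul, ha]
        have h1 := hmin hmem
        simp only [Set.mem_ofPred_eq, hscale] at h1
        have hn : 0 < ‖a‖ := norm_pos_iff.2 ha
        rw [inv_mul_eq_div, le_div_iff₀ hF0]
        rw [inv_pow, inv_mul_eq_div, le_div_iff₀ (by positivity)] at h1
        linarith
  obtain ⟨C, hC, h⟩ := key
  refine ⟨C, hC, fun a => ?_⟩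
  have := h (WithLp.toLp 2 a)
  rw [← hnorm] at this
  simpa [hF] using this

lemma abs_coeff_prod_X_sub_C_le {K : ℝ} (hK : 0 ≤ K) (k : ℕ) (κ : ℕ → ℝ)
    (hκ : ∀ i < k, |κ i| ≤ K) : ∀ i,
    |(∏ j ∈ Finset.range k, (Polynomial.X - Polynomial.C (κ j))).coeff i| ≤ (1 + K) ^ k := by
  induction k with
  | zero =>
    intro i
    simp only [Finset.range_zero, Finset.prod_empty, Polynomial.coeff_one, pow_zero]
    split_ifs <;> simp
  | succ k ih =>
    intro i
    have ih' := ih fun j hj => hκ j (by omega)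
    rw [Finset.prod_range_succ, mul_sub, Polynomial.coeff_sub, Polynomial.coeff_mul_C, pow_succ]
    have h1 : |(((∏ j ∈ Finset.range k, (Polynomial.X - Polynomial.C (κ j))))
        * Polynomial.X).coeff i| ≤ (1 + K) ^ k := by
      cases i with
      | zero => simp; positivity
      | succ i => rw [Polynomial.coeff_mul_X]; exact ih' i
    refine (abs_sub _ _).trans ?_
    rw [abs_mul]
    have h2 := mul_le_mul (ih' i) (hκ k (by omega)) (abs_nonneg _) (by positivity)
    linarith

/-- These are the knots that occur in Marsden's coefficients for splines active on cell `t`.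
Clamping to `[0,1]` does not increase their distance to the left end of the cell, which itself lies
in `[0,1]`. -/
lemma abs_knot_sub_le {p J t l : ℕ} (hp : 1 ≤ p) (ht : t ≤ J) (h1 : t + 1 ≤ l)
    (h2 : l + 2 ≤ t + 2 * p) : |knot p J l - (t : ℝ) / (J + 1)| ≤ p / (J + 1) := by
  have hJ : (0 : ℝ) < J + 1 := by positivity
  have ht' : (t : ℝ) ≤ J := by exact_mod_cast ht
  have h1' : (t : ℝ) + 1 ≤ l := by exact_mod_cast h1
  have h2' : (l : ℝ) + 2 ≤ t + 2 * p := by exact_mod_cast h2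
  have a0 : (0 : ℝ) ≤ (t : ℝ) / (J + 1) := by positivity
  have a1 : (t : ℝ) / (J + 1) ≤ 1 := by rw [div_le_one hJ]; linarith
  have hd : |((l : ℝ) + 1 - p) / (J + 1) - (t : ℝ) / (J + 1)| ≤ p / (J + 1) := by
    rw [← sub_div, abs_div, abs_of_pos hJ]
    gcongr
    rw [abs_le]
    constructor <;> linarith
  rw [abs_le] at hd ⊢
  unfold knot
  have hpp : (0 : ℝ) ≤ p / (J + 1) := by positivity
  constructor
  · have : (t : ℝ) / (J + 1) - p / (J + 1) ≤ min 1 (((l : ℝ) + 1 - p) / (J + 1)) :=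
      le_min (by linarith) (by linarith)
    linarith [le_max_right 0 (min 1 (((l : ℝ) + 1 - p) / (J + 1)))]
  · have : max 0 (min 1 (((l : ℝ) + 1 - p) / (J + 1))) ≤ (t : ℝ) / (J + 1) + p / (J + 1) :=
      max_le (by linarith) ((min_le_right _ _).trans (by linarith))
    linarith

lemma inCell_affine {J t : ℕ} (ht : t ≤ J) {u : ℝ} (hu : u ∈ Set.Ico (0 : ℝ) 1) :
    InCell J t ((J + 1 : ℝ)⁻¹ * u + t / (J + 1)) := by
  have hJ : (0 : ℝ) < J + 1 := by positivity
  refine ⟨ht, ?_, Or.inl ?_⟩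
  · have : 0 ≤ (J + 1 : ℝ)⁻¹ * u := mul_nonneg (by positivity) hu.1
    linarith
  · rw [inv_mul_eq_div, ← add_div]
    exact div_lt_div_of_pos_right (by linarith [hu.2]) hJ

lemma sum_range_bsplineRec_eq_active {p J t : ℕ} (hp : 1 ≤ p) {x : ℝ} (h : InCell J t x)
    (c : ℕ → ℝ) : ∑ l ∈ Finset.range (J + p), c l * bsplineRec p J (p - 1) l x
      = ∑ r : Fin p, c (t + r) * bsplineRec p J (p - 1) (t + r) x := by
  have ht := h.1
  rw [← Finset.sum_range (fun r => c (t + r) * bsplineRec p J (p - 1) (t + r) x)]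
  have e : ∑ r ∈ Finset.range p, c (t + r) * bsplineRec p J (p - 1) (t + r) x
      = ∑ l ∈ (Finset.range p).map ⟨fun r => t + r, add_right_injective t⟩,
          c l * bsplineRec p J (p - 1) l x := by
    rw [Finset.sum_map]
    rfl
  rw [e]
  symm
  refine Finset.sum_subset ?_ ?_
  · intro l hl
    simp only [Finset.mem_map, Finset.mem_range, Function.Embedding.coeFn_mk] at hl ⊢
    omega
  · intro l _ hl
    rw [bsplineRec_eq_zero_of_inCell hp h, mul_zero]
    intro hh
    refine hl ?_
    simp only [Finset.mem_map, Finset.mem_range, Function.Embedding.coeFn_mk]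
    exact ⟨l - t, by omega, by omega⟩

/-- After rescaling cell `t` to `[0,1]`, the `p` active B-splines are polynomials `Q r` of degree
below `p`. Marsden's identity writes the monomials as combinations of the `Q r` with a matrix `γ`
whose entries are bounded uniformly in `J` and `t`. This matrix inverts the coefficient matrix of
the `Q r`, so B-spline coefficients are bounded by monomial coefficients, hence by the `L²` norm on
the cell. -/
lemma exists_local_stability {p : ℕ} (hp : 1 ≤ p) : ∃ C : ℝ, 0 < C ∧ ∀ (J t : ℕ), t ≤ J →
    ∀ (c : ℕ → ℝ) (r : Fin p), c (t + r) ^ 2 ≤ C * ∫ u in (0 : ℝ)..1,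
      (∑ l ∈ Finset.range (J + p),
        c l * bsplineRec p J (p - 1) l ((J + 1 : ℝ)⁻¹ * u + t / (J + 1))) ^ 2 := by
  obtain ⟨C, hC, hcoef⟩ := exists_coeff_bound p
  -- The factor before `C` bounds the sum of the squared entries in a row of `γ`.
  refine ⟨p * ((1 + p : ℝ) ^ (p - 1)) ^ 2 * C, by positivity, fun J t ht c r => ?_⟩
  have hJ : (0 : ℝ) < J + 1 := by positivity
  set h : ℝ := (J + 1 : ℝ)⁻¹ with hh
  have hhpos : 0 < h := by positivity
  set x₀ : ℝ := (t : ℝ) / (J + 1) with hx₀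
  choose q hqdeg hq using fun r : Fin p => exists_poly_bsplineRec (p := p) (J := J) (t := t) hp
    (p - 1) (t + r)
  set Q : Fin p → Polynomial ℝ := fun r => (q r).comp
    (Polynomial.C h * Polynomial.X + Polynomial.C x₀) with hQ
  have hQdeg : ∀ r, (Q r).natDegree < p := by
    intro r
    have h1 : (Q r).natDegree ≤ (q r).natDegree * 1 := by
      refine Polynomial.natDegree_comp_le.trans ?_
      gcongr
      exact Polynomial.natDegree_linear_le
    have := hqdeg r
    omega
  have hQe : ∀ r : Fin p, ∀ u ∈ Set.Ico (0 : ℝ) 1,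
      bsplineRec p J (p - 1) (t + r) (h * u + x₀) = (Q r).eval u := by
    intro r u hu
    rw [hq r (h * u + x₀) (inCell_affine ht hu)]
    simp [hQ]
  set κ : Fin p → ℕ → ℝ := fun r i => (knot p J (t + r + i + 1) - x₀) * (J + 1) with hκ
  set Ψ : Fin p → Polynomial ℝ := fun r =>
    ∏ i ∈ Finset.range (p - 1), (Polynomial.X - Polynomial.C (κ r i)) with hΨ
  have hΨb : ∀ r i, |(Ψ r).coeff i| ≤ (1 + p : ℝ) ^ (p - 1) := by
    intro r i
    refine abs_coeff_prod_X_sub_C_le (by positivity) _ _ (fun j hj => ?_) i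
    simp only [hκ]
    rw [abs_mul, abs_of_pos hJ, ← le_div_iff₀ hJ]
    exact abs_knot_sub_le hp ht (by omega) (by omega)
  -- Obtained by comparing coefficients of `y ^ (p-1-m)` in `∑ r, Q r (u) * Ψ r (y) = (y - u) ^
  -- (p-1)`; on the right this coefficient is `(p-1).choose m * (-u) ^ m`.
  set γ : Matrix (Fin p) (Fin p) ℝ :=
    fun r m => (-1) ^ (m : ℕ) * (Ψ r).coeff (p - 1 - m) / ((p - 1).choose m) with hγ
  set T : Matrix (Fin p) (Fin p) ℝ := fun m r => (Q r).coeff m with hT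
  have hmars : ∀ u ∈ Set.Ico (0 : ℝ) 1,
      ∑ r, Polynomial.C ((Q r).eval u) * Ψ r = (Polynomial.X - Polynomial.C u) ^ (p - 1) := by
    intro u hu
    refine Polynomial.funext fun y => ?_
    have hm := marsden hp (inCell_affine ht hu) (h * y + x₀) (p - 1) (by omega)
    rw [sum_range_bsplineRec_eq_active hp (inCell_affine ht hu)] at hm
    simp only [← hh, ← hx₀] at hm
    simp only [Polynomial.eval_finsetSum, Polynomial.eval_mul, Polynomial.eval_C, hΨ,
      Polynomial.eval_prod, Polynomial.eval_sub, Polynomial.eval_X, Polynomial.eval_pow]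
    have e1 : ∀ r : Fin p, ∏ i ∈ Finset.range (p - 1), (h * y + x₀ - knot p J (t + r + i + 1))
        = h ^ (p - 1) * ∏ i ∈ Finset.range (p - 1), (y - κ r i) := by
      intro r
      have : h ^ (p - 1) = ∏ _i ∈ Finset.range (p - 1), h := by simp
      rw [this, ← Finset.prod_mul_distrib]
      refine Finset.prod_congr rfl fun i _ => ?_
      simp only [hκ, hh]
      field_simp
      ring
    have e2 : h * y + x₀ - (h * u + x₀) = h * (y - u) := by ring
    simp only [e1, e2, mul_pow] at hm
    simp_rw [mul_assoc] at hm
    rw [← Finset.mul_sum] at hm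
    have hne : h ^ (p - 1) ≠ 0 := by positivity
    have hm' := mul_left_cancel₀ hne hm
    rw [← hm']
    refine Finset.sum_congr rfl fun r _ => ?_
    rw [hQe r u hu, mul_comm]
  have hmono : ∀ m : Fin p, (Polynomial.X : Polynomial ℝ) ^ (m : ℕ)
      = ∑ r, Polynomial.C (γ r m) * Q r := by
    intro m
    refine Polynomial.eq_of_infinite_eval_eq _ _
      ((Set.Ico_infinite (zero_lt_one' ℝ)).mono fun u hu => ?_)
    have h1 := congrArg (fun P => P.coeff (p - 1 - m)) (hmars u hu)
    simp only [Polynomial.finsetSum_coeff, Polynomial.coeff_C_mul,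
      sub_eq_add_neg (Polynomial.X : Polynomial ℝ), ← Polynomial.C_neg,
      Polynomial.coeff_X_add_C_pow] at h1
    have hm : (m : ℕ) ≤ p - 1 := by omega
    rw [Nat.choose_symm hm, Nat.sub_sub_self hm] at h1
    simp only [Set.mem_ofPred_eq, Polynomial.eval_pow, Polynomial.eval_X,
      Polynomial.eval_finsetSum, Polynomial.eval_mul, Polynomial.eval_C, hγ]
    have hch : ((p - 1).choose m : ℝ) ≠ 0 := by
      exact_mod_cast (Nat.choose_pos hm).ne'
    have h2 : u ^ (m : ℕ) = (-1) ^ (m : ℕ) * ((-u) ^ (m : ℕ) * ((p - 1).choose m))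
        / ((p - 1).choose m) := by
      rw [mul_div_assoc, mul_div_cancel_right₀ _ hch, ← mul_pow]
      simp
    rw [h2, ← h1, Finset.mul_sum, Finset.sum_div]
    refine Finset.sum_congr rfl fun r _ => ?_
    ring
  have hTγ : T * γ = 1 := by
    ext m' m
    have h1 := congrArg (fun P => P.coeff (m' : ℕ)) (hmono m)
    simp only [Polynomial.finsetSum_coeff, Polynomial.coeff_C_mul, Polynomial.coeff_X_pow] at h1
    rw [Matrix.mul_apply, Matrix.one_apply]
    simp only [hT]
    rw [show (if m' = m then (1 : ℝ) else 0) = if (m' : ℕ) = m then 1 else 0 by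
      simp [Fin.ext_iff], h1]
    exact Finset.sum_congr rfl fun r _ => mul_comm _ _
  have hγT : γ * T = 1 := mul_eq_one_comm.1 hTγ
  set c' : Fin p → ℝ := fun r => c (t + r) with hc'
  set a : Fin p → ℝ := T *ᵥ c' with ha
  have hca : c' = γ *ᵥ a := by
    rw [ha, Matrix.mulVec_mulVec, hγT, Matrix.one_mulVec]
  have hint : ∫ u in (0 : ℝ)..1, (∑ m, a m * u ^ (m : ℕ)) ^ 2 = ∫ u in (0 : ℝ)..1,
      (∑ l ∈ Finset.range (J + p), c l * bsplineRec p J (p - 1) l (h * u + x₀)) ^ 2 := by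
    -- The endpoint `u = 1` is dropped because its image may lie in the next cell.
    refine intervalIntegral.integral_congr_ae ?_
    have : ∀ᵐ u : ℝ, u ≠ 1 := Measure.ae_ne volume 1
    filter_upwards [this] with u hu1 hu
    rw [Set.uIoc_of_le zero_le_one] at hu
    have hu' : u ∈ Set.Ico (0 : ℝ) 1 := ⟨hu.1.le, lt_of_le_of_ne hu.2 hu1⟩
    rw [sum_range_bsplineRec_eq_active hp (inCell_affine ht hu')]
    congr 1
    have e : ∀ r : Fin p, (Q r).eval u = ∑ m : Fin p, (Q r).coeff m * u ^ (m : ℕ) := by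
      intro r
      rw [Polynomial.eval_eq_sum_range' (hQdeg r), Finset.sum_range]
    simp only [← hh, ← hx₀]
    simp_rw [hQe _ u hu', e]
    simp only [ha, Matrix.mulVec, dotProduct, hT, Finset.sum_mul, Finset.mul_sum]
    rw [Finset.sum_comm]
    refine Finset.sum_congr rfl fun i _ => Finset.sum_congr rfl fun m _ => ?_
    simp only [hc']
    ring
  have hb := hcoef a
  rw [hint] at hb
  have hcr : c (t + r) = ∑ m, γ r m * a m := by
    have := congrFun hca r
    simpa [Matrix.mulVec, dotProduct, hc'] using this
  have hγb : ∀ m, γ r m ^ 2 ≤ ((1 + p : ℝ) ^ (p - 1)) ^ 2 := by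
    intro m
    rw [sq_le_sq, abs_of_nonneg (by positivity : (0 : ℝ) ≤ (1 + p) ^ (p - 1))]
    simp only [hγ]
    rw [abs_div, abs_mul, abs_pow, abs_neg, abs_one, one_pow, one_mul, Nat.abs_cast]
    refine (div_le_self (abs_nonneg _) ?_).trans (hΨb r _)
    have hm : (m : ℕ) ≤ p - 1 := by omega
    exact_mod_cast Nat.choose_pos hm
  calc c (t + r) ^ 2 ≤ (∑ m, γ r m ^ 2) * ∑ m, a m ^ 2 := by
        rw [hcr]
        exact Finset.sum_mul_sq_le_sq_mul_sq _ _ _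
    _ ≤ (p * ((1 + p : ℝ) ^ (p - 1)) ^ 2) * (C * _) := by
        refine mul_le_mul ?_ hb (by positivity) (by positivity)
        refine (Finset.sum_le_sum fun m _ => hγb m).trans ?_
        simp
    _ = _ := by ring

/-- The spline with coefficients `c`. -/
noncomputable def spl (p J : ℕ) (c : Fin (J + p) → ℝ) (x : ℝ) : ℝ := bspline p J x ⬝ᵥ c

lemma measurable_spl (p J : ℕ) (c : Fin (J + p) → ℝ) : Measurable (spl p J c) := by
  unfold spl dotProduct
  exact Finset.measurable_sum _ fun l _ => (measurable_bspline p J l).mul_const _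

lemma abs_spl_le {p J : ℕ} (hp : 1 ≤ p) {c : Fin (J + p) → ℝ} {K : ℝ} (hK : 0 ≤ K)
    (hc : ∀ l, |c l| ≤ K) (x : ℝ) : |spl p J c x| ≤ K := by
  unfold spl dotProduct
  calc |∑ l, bspline p J x l * c l| ≤ ∑ l, |bspline p J x l * c l| :=
        Finset.abs_sum_le_sum_abs _ _
    _ ≤ ∑ l, bspline p J x l * K := by
        refine Finset.sum_le_sum fun l _ => ?_
        rw [abs_mul, abs_of_nonneg (bspline_nonneg J hp x l)]
        exact mul_le_mul_of_nonneg_left (hc l) (bspline_nonneg J hp x l)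
    _ ≤ K := by
        rw [← Finset.sum_mul]
        exact mul_le_of_le_one_left hK (sum_bspline_le J hp x)

lemma exists_abs_spl_le {p J : ℕ} (hp : 1 ≤ p) (c : Fin (J + p) → ℝ) :
    ∃ K : ℝ, ∀ x, |spl p J c x| ≤ K :=
  ⟨∑ l, |c l|, abs_spl_le hp (by positivity) fun l =>
    Finset.single_le_sum (f := fun l => |c l|) (fun _ _ => abs_nonneg _) (Finset.mem_univ l)⟩

lemma intervalIntegrable_of_bounded {g : ℝ → ℝ} (hg : Measurable g) {K : ℝ}
    (hK : ∀ x, |g x| ≤ K) (a b : ℝ) : IntervalIntegrable g volume a b := by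
  rw [intervalIntegrable_iff]
  exact Measure.integrableOn_of_bounded (by simp) hg.aestronglyMeasurable
    (Eventually.of_forall hK)

lemma intervalIntegrable_spl_sq {p J : ℕ} (hp : 1 ≤ p) (c : Fin (J + p) → ℝ) (a b : ℝ) :
    IntervalIntegrable (fun x => spl p J c x ^ 2) volume a b := by
  obtain ⟨K, hK⟩ := exists_abs_spl_le hp c
  refine intervalIntegrable_of_bounded ((measurable_spl p J c).pow_const 2) (K := K ^ 2)
    (fun x => ?_) a b
  rw [abs_pow]
  exact pow_le_pow_left₀ (abs_nonneg _) (hK x) 2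

/-- Stability of the B-spline basis in `L²`. -/
theorem exists_stability {p : ℕ} (hp : 1 ≤ p) : ∃ C : ℝ, 0 < C ∧ ∀ (J : ℕ) (c : Fin (J + p) → ℝ),
    ∑ l, c l ^ 2 ≤ C * (J + 1) * ∫ x in (0 : ℝ)..1, spl p J c x ^ 2 := by
  obtain ⟨C, hC, hloc⟩ := exists_local_stability hp
  refine ⟨p * C, by positivity, fun J c => ?_⟩
  have hJ : (0 : ℝ) < J + 1 := by positivity
  set c' : ℕ → ℝ := fun l => if hl : l < J + p then c ⟨l, hl⟩ else 0 with hc'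
  have hcc' : ∀ l : Fin (J + p), c' l = c l := fun l => by simp [hc']
  have hs : ∀ x, spl p J c x = ∑ l ∈ Finset.range (J + p), c' l * bsplineRec p J (p - 1) l x := by
    intro x
    rw [Finset.sum_range]
    simp only [spl, dotProduct, hcc', bspline]
    exact Finset.sum_congr rfl fun l _ => mul_comm _ _
  -- The change of variables to the unit interval has Jacobian `1 / (J+1)`, the source of the factor
  -- `J + 1`; the factor `p` counts the active splines of a cell.
  have hcell : ∀ t ∈ Finset.range (J + 1), ∑ r ∈ Finset.range p, c' (t + r) ^ 2
      ≤ p * C * (J + 1) * ∫ x in (t : ℝ) / (J + 1)..((t + 1 : ℕ) : ℝ) / (J + 1),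
        spl p J c x ^ 2 := by
    intro t ht
    have ht' : t ≤ J := by simpa [Nat.lt_succ_iff] using ht
    have e1 : ∫ x in (t : ℝ) / (J + 1)..((t + 1 : ℕ) : ℝ) / (J + 1), spl p J c x ^ 2
        = (J + 1 : ℝ)⁻¹ * ∫ u in (0 : ℝ)..1, spl p J c ((J + 1 : ℝ)⁻¹ * u + t / (J + 1)) ^ 2 := by
      have := intervalIntegral.mul_integral_comp_mul_add (a := 0) (b := 1)
        (f := fun x => spl p J c x ^ 2) (c := (J + 1 : ℝ)⁻¹) (d := (t : ℝ) / (J + 1))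
      rw [this]
      congr 1
      · ring
      · push_cast; field_simp; ring
    rw [e1, Finset.sum_range]
    calc ∑ r : Fin p, c' (t + r) ^ 2
        ≤ ∑ _r : Fin p, C * ∫ u in (0 : ℝ)..1, spl p J c ((J + 1 : ℝ)⁻¹ * u + t / (J + 1)) ^ 2 := by
          refine Finset.sum_le_sum fun r _ => ?_
          simp_rw [hs]
          exact hloc J t ht' c' r
      _ = _ := by
          simp only [Finset.sum_const, Finset.card_univ, Fintype.card_fin, nsmul_eq_mul]
          field_simp
  have hsum : ∑ t ∈ Finset.range (J + 1),
      ∫ x in (t : ℝ) / (J + 1)..((t + 1 : ℕ) : ℝ) / (J + 1), spl p J c x ^ 2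
      = ∫ x in (0 : ℝ)..1, spl p J c x ^ 2 := by
    have := intervalIntegral.sum_integral_adjacent_intervals (f := fun x => spl p J c x ^ 2)
      (μ := volume) (a := fun t : ℕ => (t : ℝ) / (J + 1)) (n := J + 1)
      (fun k _ => intervalIntegrable_spl_sq hp c _ _)
    rw [this]
    congr 1
    · simp
    · push_cast; rw [div_self hJ.ne']
  calc ∑ l, c l ^ 2 = ∑ l ∈ Finset.range (J + p), c' l ^ 2 := by
        rw [Finset.sum_range]
        simp_rw [hcc']
    -- Every index is active on some cell: `l < J` is taken as the first active index of cell `l`,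
    -- and the last `p` indices are those of cell `J`.
    _ = ∑ t ∈ Finset.range J, c' t ^ 2 + ∑ r ∈ Finset.range p, c' (J + r) ^ 2 := by
        rw [Finset.sum_range_add]
    _ ≤ ∑ t ∈ Finset.range (J + 1), ∑ r ∈ Finset.range p, c' (t + r) ^ 2 := by
        rw [Finset.sum_range_succ]
        gcongr with t
        have := Finset.single_le_sum (f := fun r => c' (t + r) ^ 2) (s := Finset.range p)
          (fun _ _ => sq_nonneg _) (Finset.mem_range.2 hp)
        simpa using this
    _ ≤ ∑ t ∈ Finset.range (J + 1), p * C * (J + 1)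
          * ∫ x in (t : ℝ) / (J + 1)..((t + 1 : ℕ) : ℝ) / (J + 1), spl p J c x ^ 2 :=
        Finset.sum_le_sum hcell
    _ = _ := by rw [← Finset.mul_sum, hsum]

/-- Cauchy–Schwarz with the B-spline values as weights, whose total mass is at most one. -/
lemma spl_sq_le {p J : ℕ} (hp : 1 ≤ p) (c : Fin (J + p) → ℝ) (x : ℝ) :
    spl p J c x ^ 2 ≤ ∑ l, c l ^ 2 * bspline p J x l := by
  have h := Finset.sum_sq_le_sum_mul_sum_of_sq_le_mul Finset.univ
    (f := fun l => bspline p J x l) (g := fun l => c l ^ 2 * bspline p J x l)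
    (r := fun l => bspline p J x l * c l) (fun l _ => bspline_nonneg J hp x l)
    (fun l _ => mul_nonneg (sq_nonneg _) (bspline_nonneg J hp x l)) (fun l _ => le_of_eq (by ring))
  refine h.trans (mul_le_of_le_one_left ?_ (sum_bspline_le J hp x))
  exact Finset.sum_nonneg fun l _ => mul_nonneg (sq_nonneg _) (bspline_nonneg J hp x l)

lemma lintegral_bspline_le {p J : ℕ} (hp : 1 ≤ p) (l : Fin (J + p)) :
    ∫⁻ x, ENNReal.ofReal (bspline p J x l) ≤ ENNReal.ofReal (p / (J + 1)) := by
  calc ∫⁻ x, ENNReal.ofReal (bspline p J x l)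
      ≤ ∫⁻ x, (Set.Icc (((l : ℝ) + 1 - p) / (J + 1)) (((l : ℝ) + 1) / (J + 1))).indicator 1 x := by
        refine lintegral_mono fun x => ?_
        by_cases h : bspline p J x l = 0
        · simp [h]
        · rw [Set.indicator_of_mem (bspline_support_Icc hp h)]
          simpa using bspline_le_one J hp x l
    _ = ENNReal.ofReal (p / (J + 1)) := by
        rw [lintegral_indicator_one measurableSet_Icc, Real.volume_Icc]
        congr 1
        ring

end FTSBreak

namespace FTSBreak

/-! ### Banded coercive matrices -/

/-- The indices within bandwidth `p` of `l`. -/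
def InBand (p : ℕ) {d : ℕ} (l l' : Fin d) : Prop := (l : ℕ) < l' + p ∧ (l' : ℕ) < l + p

open Classical in
lemma card_inBand_le (p : ℕ) {d : ℕ} (l : Fin d) :
    (Finset.univ.filter (InBand p l)).card ≤ 2 * p := by
  have : ((Finset.univ.filter (InBand p l)).map Fin.valEmbedding) ⊆
      Finset.Ico (l + 1 - p : ℕ) (l + p) := by
    intro k hk
    simp only [Finset.mem_map, Finset.mem_filter, Finset.mem_univ, true_and] at hk
    obtain ⟨l', h, rfl⟩ := hk
    have h1 := h.1
    have h2 := h.2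
    simp only [Fin.valEmbedding_apply, Finset.mem_Ico]
    omega
  have h2 := Finset.card_le_card this
  rw [Finset.card_map, Nat.card_Ico] at h2
  omega

lemma sum_le_of_inBand {p d : ℕ} (l : Fin d) {g : Fin d → ℝ} {δ : ℝ} (hδ : 0 ≤ δ)
    (hb : ∀ l', ¬ InBand p l l' → g l' = 0) (hg : ∀ l', g l' ≤ δ) :
    ∑ l', g l' ≤ 2 * p * δ := by
  classical
  rw [← Finset.sum_filter_add_sum_filter_not Finset.univ (InBand p l),
    Finset.sum_eq_zero (s := Finset.univ.filter fun l' => ¬ InBand p l l')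
      (fun l' hl' => hb l' (Finset.mem_filter.1 hl').2), add_zero]
  calc ∑ l' ∈ Finset.univ.filter (InBand p l), g l'
      ≤ ∑ _l' ∈ Finset.univ.filter (InBand p l), δ := Finset.sum_le_sum fun l' _ => hg l'
    _ = (Finset.univ.filter (InBand p l)).card * δ := by simp
    _ ≤ _ := by
        gcongr
        exact_mod_cast card_inBand_le p l

/-- Schur's test: `2|u l||u l'| ≤ u l ^ 2 + u l' ^ 2` reduces the quadratic form to row sums. -/
lemma sum_abs_mul_le_of_row {d : ℕ} {D : Matrix (Fin d) (Fin d) ℝ} {R : ℝ}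
    (hD : ∀ l l', 0 ≤ D l l') (hs : ∀ l l', D l l' = D l' l) (hrow : ∀ l, ∑ l', D l l' ≤ R)
    (u : Fin d → ℝ) : ∑ l, ∑ l', |u l| * D l l' * |u l'| ≤ R * ∑ l, u l ^ 2 := by
  have h1 : ∑ l, ∑ l', |u l| * D l l' * |u l'|
      ≤ ∑ l, ∑ l', (u l ^ 2 * D l l' / 2 + u l' ^ 2 * D l' l / 2) := by
    refine Finset.sum_le_sum fun l _ => Finset.sum_le_sum fun l' _ => ?_
    rw [← hs l l', ← sq_abs (u l), ← sq_abs (u l')]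
    nlinarith [hD l l', mul_nonneg (hD l l') (sq_nonneg (|u l| - |u l'|))]
  have h2 : ∑ l, ∑ l', u l ^ 2 * D l l' / 2 ≤ R / 2 * ∑ l, u l ^ 2 := by
    rw [Finset.mul_sum]
    refine Finset.sum_le_sum fun l _ => ?_
    rw [← Finset.sum_div, ← Finset.mul_sum]
    nlinarith [hrow l, sq_nonneg (u l)]
  simp_rw [Finset.sum_add_distrib] at h1
  rw [Finset.sum_comm (f := fun l l' => u l' ^ 2 * D l' l / 2)] at h1
  linarith

/-- Banded symmetric matrices with nonnegative entries, uniformly coercive and with bounded row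
sums at the scale `1 / (J + 1)`. -/
structure GoodGram (p J : ℕ) (c C : ℝ) (A : Matrix (Fin (J + p)) (Fin (J + p)) ℝ) : Prop where
  nonneg : ∀ l l', 0 ≤ A l l'
  symm : ∀ l l', A l l' = A l' l
  banded : ∀ l l', ¬ InBand p l l' → A l l' = 0
  coercive : ∀ u, c / (J + 1) * ∑ l, u l ^ 2 ≤ u ⬝ᵥ A *ᵥ u
  row : ∀ l, ∑ l', A l l' ≤ C / (J + 1)

lemma dotProduct_mulVec_eq_sum {d : ℕ} (A : Matrix (Fin d) (Fin d) ℝ) (u v : Fin d → ℝ) :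
    u ⬝ᵥ A *ᵥ v = ∑ l, ∑ l', u l * A l l' * v l' := by
  simp only [dotProduct, Matrix.mulVec, Finset.mul_sum, mul_assoc]

/-- Thanks to the common band a row of the difference has at most `2p` nonzero entries, so by
Schur's test an entrywise error `δ / (J+1)` moves the quadratic form and the row sums by at most `2
p δ / (J+1)` times the relevant norm. -/
lemma GoodGram.of_close {p J : ℕ} {c C δ : ℝ} {A B : Matrix (Fin (J + p)) (Fin (J + p)) ℝ}
    (hA : GoodGram p J c C A) (hδ : 0 ≤ δ) (h0 : ∀ l l', 0 ≤ B l l')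
    (hs : ∀ l l', B l l' = B l' l) (hb : ∀ l l', ¬ InBand p l l' → B l l' = 0)
    (hcl : ∀ l l', |B l l' - A l l'| ≤ δ / (J + 1)) :
    GoodGram p J (c - 2 * p * δ) (C + 2 * p * δ) B := by
  have hJ : (0 : ℝ) < J + 1 := by positivity
  have hrow : ∀ l, ∑ l', |B l l' - A l l'| ≤ 2 * p * (δ / (J + 1)) := by
    intro l
    refine sum_le_of_inBand (p := p) l (by positivity) (fun l' hl' => ?_) (hcl l)
    rw [hb l l' hl', hA.banded l l' hl', sub_zero, abs_zero]
  refine ⟨h0, hs, hb, fun u => ?_, fun l => ?_⟩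
  · have h1 := sum_abs_mul_le_of_row (D := fun l l' => |B l l' - A l l'|)
      (fun _ _ => abs_nonneg _) (fun l l' => by rw [hs l l', hA.symm l l']) hrow u
    have h2 := hA.coercive u
    have h3 : u ⬝ᵥ A *ᵥ u - u ⬝ᵥ B *ᵥ u ≤ ∑ l, ∑ l', |u l| * |B l l' - A l l'| * |u l'| := by
      rw [dotProduct_mulVec_eq_sum, dotProduct_mulVec_eq_sum, ← Finset.sum_sub_distrib]
      refine Finset.sum_le_sum fun l _ => ?_
      rw [← Finset.sum_sub_distrib]
      refine Finset.sum_le_sum fun l' _ => ?_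
      rw [← abs_mul, ← abs_mul, ← abs_neg]
      refine le_trans (le_of_eq ?_) (le_abs_self _)
      ring
    have h4 : (c - 2 * p * δ) / (J + 1) * ∑ l, u l ^ 2
        = c / (J + 1) * ∑ l, u l ^ 2 - 2 * p * (δ / (J + 1)) * ∑ l, u l ^ 2 := by ring
    linarith
  · have h1 := hA.row l
    have h2 : ∑ l', B l l' ≤ ∑ l', A l l' + ∑ l', |B l l' - A l l'| := by
      rw [← Finset.sum_add_distrib]
      refine Finset.sum_le_sum fun l' _ => ?_
      linarith [le_abs_self (B l l' - A l l')]
    have h3 := hrow l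
    have h4 : (C + 2 * p * δ) / (J + 1) = C / (J + 1) + 2 * p * (δ / (J + 1)) := by ring
    linarith

namespace GoodGram

variable {p J : ℕ} {c C : ℝ} {A : Matrix (Fin (J + p)) (Fin (J + p)) ℝ}

lemma isUnit_det (hA : GoodGram p J c C A) (hc : 0 < c) : IsUnit A.det := by
  rw [isUnit_iff_ne_zero]
  intro hdet
  obtain ⟨v, hv, hv0⟩ := Matrix.exists_mulVec_eq_zero_iff.2 hdet
  have h1 := hA.coercive v
  rw [hv0, dotProduct_zero] at h1
  have h2 : ∑ l, v l ^ 2 ≤ 0 := by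
    by_contra h
    push Not at h
    have : 0 < c / (J + 1) * ∑ l, v l ^ 2 := by positivity
    linarith
  refine hv (funext fun l => ?_)
  have h3 : v l ^ 2 ≤ ∑ l, v l ^ 2 :=
    Finset.single_le_sum (f := fun l => v l ^ 2) (fun _ _ => sq_nonneg _) (Finset.mem_univ l)
  have h4 : v l ^ 2 = 0 := le_antisymm (h3.trans h2) (sq_nonneg _)
  simpa using h4

lemma mulVec_inv (hA : GoodGram p J c C A) (hc : 0 < c) (z : Fin (J + p) → ℝ) :
    A *ᵥ (A⁻¹ *ᵥ z) = z := by
  rw [Matrix.mulVec_mulVec, Matrix.mul_nonsing_inv _ (hA.isUnit_det hc), Matrix.one_mulVec]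

/-- With `u = A⁻¹ z`, coercivity and Cauchy–Schwarz give `c / (J+1) * |u|² ≤ u · z ≤ |u| |z|`. -/
lemma sum_sq_inv_le (hA : GoodGram p J c C A) (hc : 0 < c) (z : Fin (J + p) → ℝ) :
    ∑ l, (A⁻¹ *ᵥ z) l ^ 2 ≤ ((J + 1) / c) ^ 2 * ∑ l, z l ^ 2 := by
  have hJ : (0 : ℝ) < J + 1 := by positivity
  set u := A⁻¹ *ᵥ z with hu
  have h1 := hA.coercive u
  rw [hu, hA.mulVec_inv hc, ← hu] at h1
  have h2 : (u ⬝ᵥ z) ^ 2 ≤ (∑ l, u l ^ 2) * ∑ l, z l ^ 2 := Finset.sum_mul_sq_le_sq_mul_sq _ _ _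
  set U := ∑ l, u l ^ 2 with hU
  have hU0 : 0 ≤ U := Finset.sum_nonneg fun _ _ => sq_nonneg _
  have hZ0 : 0 ≤ ∑ l, z l ^ 2 := Finset.sum_nonneg fun _ _ => sq_nonneg _
  rcases hU0.eq_or_lt with h0 | h0
  · rw [← h0]; positivity
  · have h3 : (c / (J + 1) * U) ^ 2 ≤ U * ∑ l, z l ^ 2 :=
      (pow_le_pow_left₀ (by positivity) h1 2).trans h2
    have h4 : (c / (J + 1)) ^ 2 * U ≤ ∑ l, z l ^ 2 := by
      refine le_of_mul_le_mul_left ?_ h0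
      calc U * ((c / (J + 1)) ^ 2 * U) = (c / (J + 1) * U) ^ 2 := by ring
        _ ≤ _ := h3
    calc U = ((J + 1) / c) ^ 2 * ((c / (J + 1)) ^ 2 * U) := by field_simp
      _ ≤ _ := by gcongr

/-- The weight `s` in the inequality between arithmetic and geometric means stays free; the signal
bound tunes it so that the term in `u` can be absorbed. -/
lemma dot_le (hA : GoodGram p J c C A) (u v : Fin (J + p) → ℝ) (s : ℝ) (hs : 0 < s) :
    u ⬝ᵥ A *ᵥ v ≤ C / (J + 1) * (s * ∑ l, u l ^ 2 + s⁻¹ * ∑ l, v l ^ 2) / 2 := by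
  have h1 : u ⬝ᵥ A *ᵥ v ≤ ∑ l, ∑ l', A l l' * (s * u l ^ 2 + s⁻¹ * v l' ^ 2) / 2 := by
    rw [dotProduct_mulVec_eq_sum]
    refine Finset.sum_le_sum fun l _ => Finset.sum_le_sum fun l' _ => ?_
    have h2 : 2 * (u l * v l') ≤ s * u l ^ 2 + s⁻¹ * v l' ^ 2 := by
      have : 0 ≤ s⁻¹ * (s * u l - v l') ^ 2 := by positivity
      have e : s⁻¹ * (s * u l - v l') ^ 2
          = s * u l ^ 2 - 2 * (u l * v l') + s⁻¹ * v l' ^ 2 := by field_simp; ring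
      linarith
    nlinarith [mul_le_mul_of_nonneg_left h2 (hA.nonneg l l')]
  have h2 : ∑ l, ∑ l', A l l' * (s * u l ^ 2 + s⁻¹ * v l' ^ 2) / 2
      = (s * ∑ l, u l ^ 2 * ∑ l', A l l') / 2 + (s⁻¹ * ∑ l', v l' ^ 2 * ∑ l, A l' l) / 2 := by
    simp_rw [mul_add, add_div, Finset.sum_add_distrib]
    congr 1
    · rw [Finset.mul_sum, Finset.sum_div]
      refine Finset.sum_congr rfl fun l _ => ?_
      rw [Finset.mul_sum, Finset.mul_sum, Finset.sum_div]
      exact Finset.sum_congr rfl fun l' _ => by ring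
    · rw [Finset.sum_comm, Finset.mul_sum, Finset.sum_div]
      refine Finset.sum_congr rfl fun l _ => ?_
      rw [Finset.mul_sum, Finset.mul_sum, Finset.sum_div]
      exact Finset.sum_congr rfl fun l' _ => by rw [hA.symm l' l]; ring
  have h3 : ∀ w : Fin (J + p) → ℝ, ∑ l, w l ^ 2 * ∑ l', A l l'
      ≤ C / (J + 1) * ∑ l, w l ^ 2 := by
    intro w
    rw [Finset.mul_sum]
    refine Finset.sum_le_sum fun l _ => ?_
    rw [mul_comm]
    exact mul_le_mul_of_nonneg_right (hA.row l) (sq_nonneg _)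
  have h4 := mul_le_mul_of_nonneg_left (h3 u) hs.le
  have h5 := mul_le_mul_of_nonneg_left (h3 v) (inv_pos.2 hs).le
  rw [h2] at h1
  linarith

end GoodGram

lemma exists_sum_geometric_le {ρ : ℝ} (h0 : 0 ≤ ρ) (h1 : ρ < 1) : ∃ K : ℝ, 0 < K ∧
    ∀ (d : ℕ) (l₀ : Fin d), ∑ l : Fin d, ρ ^ (((l : ℤ) - (l₀ : ℤ)).natAbs) ≤ K := by
  have hs : Summable (fun k : ℤ => ρ ^ k.natAbs) := by
    refine Summable.of_nat_of_neg ?_ ?_ <;>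
      simpa using summable_geometric_of_lt_one h0 h1
  refine ⟨∑' k : ℤ, ρ ^ k.natAbs, hs.tsum_pos (fun _ => by positivity) 0 (by simp),
    fun d l₀ => ?_⟩
  have hinj : Function.Injective (fun l : Fin d => (l : ℤ) - (l₀ : ℤ)) := by
    intro a b hab
    simp only [sub_left_inj, Nat.cast_inj] at hab
    exact Fin.ext hab
  have := hs.sum_le_tsum (Finset.univ.map ⟨_, hinj⟩) (fun _ _ => by positivity)
  rwa [Finset.sum_map] at this

/-- The inverse of a banded coercive matrix is bounded in the sup norm. -/
lemma exists_abs_inv_mulVec_le (p : ℕ) {c C : ℝ} (hc : 0 < c) (hC : 0 < C) :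
    ∃ K : ℝ, 0 < K ∧ ∀ (J : ℕ) (A : Matrix (Fin (J + p)) (Fin (J + p)) ℝ), GoodGram p J c C A →
      ∀ (z : Fin (J + p) → ℝ) (ζ : ℝ), (∀ l, |z l| ≤ ζ) →
        ∀ l, |(A⁻¹ *ᵥ z) l| ≤ K * (J + 1) * ζ := by
  -- A weighted energy estimate with weights `ρ ^ |l - l₀|`. Within the band a ratio of weights
  -- differs from `1` by at most `ρ⁻ᵖ - 1`, and `ρ` is taken so close to `1` that conjugating `A` by
  -- the weights costs at most half of its coercivity.
  obtain ⟨ρ, hρ0, hρ1, hρ⟩ : ∃ ρ : ℝ, 0 < ρ ∧ ρ < 1 ∧ (ρ ^ p)⁻¹ - 1 ≤ c / (2 * C) := by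
    have ht : Tendsto (fun ρ : ℝ => (ρ ^ p)⁻¹ - 1) (𝓝[<] 1) (𝓝 0) := by
      have : ContinuousAt (fun ρ : ℝ => (ρ ^ p)⁻¹ - 1) 1 := by
        refine ContinuousAt.sub (ContinuousAt.inv₀ (by fun_prop) (by simp)) continuousAt_const
      have h2 := this.tendsto
      simp only [one_pow, inv_one, sub_self] at h2
      exact h2.mono_left nhdsWithin_le_nhds
    have h1 : ∀ᶠ ρ : ℝ in 𝓝[<] 1, (ρ ^ p)⁻¹ - 1 < c / (2 * C) :=
      ht.eventually_lt_const (by positivity)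
    have h2 : ∀ᶠ ρ : ℝ in 𝓝[<] 1, 0 < ρ :=
      nhdsWithin_le_nhds (lt_mem_nhds one_pos)
    obtain ⟨ρ, ha, hb, hd⟩ := (h1.and (h2.and self_mem_nhdsWithin)).exists
    exact ⟨ρ, hb, hd, ha.le⟩
  obtain ⟨K, hK, hgeo⟩ := exists_sum_geometric_le (ρ := ρ ^ 2) (by positivity)
    (pow_lt_one₀ hρ0.le hρ1 two_ne_zero)
  -- `2 / c` is the inverse of the remaining half of the coercivity; `√K` is the Euclidean norm of
  -- the weights, bounded independently of the dimension and of `l₀`.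
  refine ⟨2 / c * Real.sqrt K, by positivity, fun J A hA z ζ hz l₀ => ?_⟩
  have hJ : (0 : ℝ) < J + 1 := by positivity
  have hζ : 0 ≤ ζ := (abs_nonneg _).trans (hz l₀)
  set u := A⁻¹ *ᵥ z with hu
  have hAu : A *ᵥ u = z := hA.mulVec_inv hc z
  set w : Fin (J + p) → ℝ := fun l => ρ ^ (((l : ℤ) - (l₀ : ℤ)).natAbs) with hw
  have hw0 : ∀ l, 0 < w l := fun l => by positivity
  set v : Fin (J + p) → ℝ := fun l => w l * u l with hv
  have hratio : ∀ l l', InBand p l l' → |w l / w l' - 1| ≤ c / (2 * C) := by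
    intro l l' hb
    refine le_trans ?_ hρ
    have hb1 := hb.1
    have hb2 := hb.2
    set i := ((l : ℤ) - (l₀ : ℤ)).natAbs with hi
    set j := ((l' : ℤ) - (l₀ : ℤ)).natAbs with hj
    have hij : i ≤ j + p := by omega
    have hji : j ≤ i + p := by omega
    have e1 : ρ ^ i * ρ ^ p ≤ ρ ^ j := by
      rw [← pow_add]; exact pow_le_pow_of_le_one hρ0.le hρ1.le hji
    have e2 : ρ ^ j * ρ ^ p ≤ ρ ^ i := by
      rw [← pow_add]; exact pow_le_pow_of_le_one hρ0.le hρ1.le hij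
    have hpi : 0 < ρ ^ i := by positivity
    have hpj : 0 < ρ ^ j := by positivity
    have hpp : 0 < ρ ^ p := by positivity
    have e3 : ρ ^ i / ρ ^ j ≤ (ρ ^ p)⁻¹ := by
      rw [div_le_iff₀ hpj, inv_mul_eq_div, le_div_iff₀ hpp]; exact e1
    have e4 : ρ ^ p ≤ ρ ^ i / ρ ^ j := by
      rw [le_div_iff₀ hpj, mul_comm]; exact e2
    change |ρ ^ i / ρ ^ j - 1| ≤ _
    rw [abs_le]
    refine ⟨?_, by linarith⟩
    have : 2 ≤ ρ ^ p + (ρ ^ p)⁻¹ := by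
      have h5 : 0 ≤ (ρ ^ p)⁻¹ * (1 - ρ ^ p) ^ 2 := by positivity
      have h6 : (ρ ^ p)⁻¹ * (1 - ρ ^ p) ^ 2 = (ρ ^ p)⁻¹ - 2 + ρ ^ p := by field_simp; ring
      linarith
    linarith
  have hrowv := sum_abs_mul_le_of_row hA.nonneg hA.symm hA.row v
  -- Up to sign, the left side is the commutator of `A` with the weights, paired with `v`: entrywise
  -- it is `(w l / w l' - 1) * v l * A l l' * v l'`.
  have hkey : v ⬝ᵥ A *ᵥ v - ∑ l, w l * v l * z l
      ≤ c / (2 * C) * ∑ l, ∑ l', |v l| * A l l' * |v l'| := by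
    rw [dotProduct_mulVec_eq_sum, ← Finset.sum_sub_distrib, Finset.mul_sum]
    refine Finset.sum_le_sum fun l _ => ?_
    have e1 : w l * v l * z l = ∑ l', w l * v l * (A l l' * u l') := by
      rw [← Finset.mul_sum, ← hAu]
      rfl
    rw [e1, ← Finset.sum_sub_distrib, Finset.mul_sum]
    refine Finset.sum_le_sum fun l' _ => ?_
    by_cases hb : InBand p l l'
    · have hne := (hw0 l').ne'
      have e2 : v l * A l l' * v l' - w l * v l * (A l l' * u l')
          = -((w l / w l' - 1) * (v l * A l l' * v l')) := by
        simp only [hv]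
        field_simp
        ring
      rw [e2]
      refine (neg_le_abs _).trans ?_
      rw [abs_mul, abs_mul, abs_mul, abs_of_nonneg (hA.nonneg l l')]
      refine mul_le_mul_of_nonneg_right (hratio l l' hb) ?_
      have := hA.nonneg l l'
      positivity
    · rw [hA.banded l l' hb]
      simp
  have hcoe := hA.coercive v
  set S := ∑ l, v l ^ 2 with hS
  have hS0 : 0 ≤ S := Finset.sum_nonneg fun _ _ => sq_nonneg _
  have h1 : c / (2 * (J + 1)) * S ≤ ∑ l, w l * v l * z l := by
    have : c / (2 * C) * ∑ l, ∑ l', |v l| * A l l' * |v l'|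
        ≤ c / (2 * C) * (C / (J + 1) * S) := by gcongr
    have e : c / (2 * C) * (C / (J + 1) * S) = c / (2 * (J + 1)) * S := by field_simp
    have e' : c / (J + 1) * S = 2 * (c / (2 * (J + 1)) * S) := by field_simp
    linarith
  have h2 : ∑ l, w l * v l * z l ≤ ζ * (Real.sqrt K * Real.sqrt S) := by
    have hb : ∑ l, w l * v l * z l ≤ ζ * ∑ l, w l * |v l| := by
      rw [Finset.mul_sum]
      refine Finset.sum_le_sum fun l _ => ?_
      refine (le_abs_self _).trans ?_
      rw [abs_mul, abs_mul, abs_of_pos (hw0 l), mul_comm]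
      have := hw0 l
      exact mul_le_mul_of_nonneg_right (hz l) (by positivity)
    refine hb.trans (mul_le_mul_of_nonneg_left ?_ hζ)
    rw [← Real.sqrt_mul hK.le]
    refine Real.le_sqrt_of_sq_le ?_
    refine (Finset.sum_mul_sq_le_sq_mul_sq _ _ _).trans ?_
    simp_rw [sq_abs]
    refine mul_le_mul_of_nonneg_right ?_ hS0
    refine le_trans (le_of_eq ?_) (hgeo _ l₀)
    refine Finset.sum_congr rfl fun l _ => ?_
    simp only [hw]
    rw [← pow_mul, ← pow_mul, mul_comm]
  have h3 : Real.sqrt S ≤ 2 / c * Real.sqrt K * (J + 1) * ζ := by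
    rcases (Real.sqrt_nonneg S).eq_or_lt with h0 | h0
    · rw [← h0]; positivity
    · have h4 : c / (2 * (J + 1)) * Real.sqrt S * Real.sqrt S ≤ ζ * Real.sqrt K * Real.sqrt S := by
        rw [mul_assoc, Real.mul_self_sqrt hS0]
        linarith
      have h5 := le_of_mul_le_mul_right h4 h0
      calc Real.sqrt S = 2 / c * (J + 1) * (c / (2 * (J + 1)) * Real.sqrt S) := by field_simp
        _ ≤ 2 / c * (J + 1) * (ζ * Real.sqrt K) := by gcongr
        _ = _ := by ring
  refine le_trans ?_ h3
  -- The weight equals one at `l₀`, so the weighted energy controls this one coordinate.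
  have h6 : v l₀ = u l₀ := by simp [hv, hw]
  rw [← h6]
  refine Real.abs_le_sqrt ?_
  exact Finset.single_le_sum (f := fun l => v l ^ 2) (fun _ _ => sq_nonneg _) (Finset.mem_univ l₀)

/-! ### The `L²` and sup norms of splines -/

lemma spl_add {p J : ℕ} (a b : Fin (J + p) → ℝ) (x : ℝ) :
    spl p J (a + b) x = spl p J a x + spl p J b x := by simp [spl]

lemma spl_smul {p J : ℕ} (r : ℝ) (a : Fin (J + p) → ℝ) (x : ℝ) :
    spl p J (r • a) x = r * spl p J a x := by simp [spl]

lemma memLp_spl {p J : ℕ} (hp : 1 ≤ p) (a : Fin (J + p) → ℝ) :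
    MemLp (spl p J a) 2 (volume.restrict (Set.Ioc (0 : ℝ) 1)) := by
  obtain ⟨K, hK⟩ := exists_abs_spl_le hp a
  exact MemLp.of_bound (measurable_spl p J a).aestronglyMeasurable K (Eventually.of_forall hK)

/-- Identifies the integral formula with the norm of `L²(0,1]`, from which the triangle inequality
and homogeneity of `l2Semi` are inherited. -/
lemma l2Norm_eq_norm {p J : ℕ} (hp : 1 ≤ p) (a : Fin (J + p) → ℝ) :
    l2Norm (spl p J a) = ‖(memLp_spl hp a).toLp (spl p J a)‖ := by
  have h1 := real_inner_self_eq_norm_sq ((memLp_spl hp a).toLp (spl p J a))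
  rw [L2.inner_def] at h1
  rw [l2Norm, ← Real.sqrt_sq (norm_nonneg _), ← h1, intervalIntegral.integral_of_le zero_le_one]
  congr 1
  refine integral_congr_ae ?_
  filter_upwards [(memLp_spl hp a).coeFn_toLp] with x hx
  rw [hx]
  simp [pow_two]

/-- The `L²` seminorm on spline coefficients. -/
noncomputable def l2Semi {p : ℕ} (hp : 1 ≤ p) (J : ℕ) : Seminorm ℝ (Fin (J + p) → ℝ) :=
  Seminorm.of (fun a => l2Norm (spl p J a))
    (fun a b => by
      rw [l2Norm_eq_norm hp, l2Norm_eq_norm hp, l2Norm_eq_norm hp]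
      refine le_trans (le_of_eq ?_) (norm_add_le _ _)
      rw [← MemLp.toLp_add]
      congr 2
      ext x
      exact spl_add a b x)
    (fun r a => by
      rw [l2Norm_eq_norm hp, l2Norm_eq_norm hp, ← norm_smul, ← MemLp.toLp_const_smul]
      congr 2
      ext x
      exact spl_smul r a x)

lemma l2Semi_apply {p : ℕ} (hp : 1 ≤ p) (J : ℕ) (a : Fin (J + p) → ℝ) :
    l2Semi hp J a = l2Norm (spl p J a) := rfl

lemma bddAbove_abs_spl {p J : ℕ} (hp : 1 ≤ p) (a : Fin (J + p) → ℝ) :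
    BddAbove (Set.range fun x : Set.Icc (0 : ℝ) 1 => |spl p J a x|) := by
  obtain ⟨K, hK⟩ := exists_abs_spl_le hp a
  exact ⟨K, by rintro _ ⟨x, rfl⟩; exact hK x⟩

/-- The sup seminorm on spline coefficients. -/
noncomputable def supSemi {p : ℕ} (hp : 1 ≤ p) (J : ℕ) : Seminorm ℝ (Fin (J + p) → ℝ) :=
  haveI : Nonempty (Set.Icc (0 : ℝ) 1) := ⟨⟨0, by simp⟩⟩
  Seminorm.of (fun a => supNorm (spl p J a))
    (fun a b => by
      refine ciSup_le fun x => ?_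
      rw [spl_add]
      exact (abs_add_le _ _).trans (add_le_add (le_ciSup (bddAbove_abs_spl hp a) x)
        (le_ciSup (bddAbove_abs_spl hp b) x)))
    (fun r a => by
      simp only [supNorm, spl_smul, abs_mul, Real.norm_eq_abs]
      rw [Real.mul_iSup_of_nonneg (abs_nonneg r)])

lemma supSemi_le {p J : ℕ} (hp : 1 ≤ p) {a : Fin (J + p) → ℝ} {K : ℝ} (hK : 0 ≤ K)
    (ha : ∀ l, |a l| ≤ K) : supSemi hp J a ≤ K :=
  haveI : Nonempty (Set.Icc (0 : ℝ) 1) := ⟨⟨0, by simp⟩⟩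
  ciSup_le fun x => abs_spl_le hp hK ha x

lemma l2Semi_le_supSemi {p : ℕ} (hp : 1 ≤ p) (J : ℕ) (a : Fin (J + p) → ℝ) :
    l2Semi hp J a ≤ supSemi hp J a := by
  rw [l2Semi_apply, l2Norm]
  have h0 : 0 ≤ supSemi hp J a := apply_nonneg _ _
  refine Real.sqrt_le_iff.2 ⟨h0, ?_⟩
  calc ∫ x in (0 : ℝ)..1, spl p J a x ^ 2 ≤ ∫ _x in (0 : ℝ)..1, supSemi hp J a ^ 2 := by
        refine intervalIntegral.integral_mono_on zero_le_one (intervalIntegrable_spl_sq hp a 0 1)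
          (by simp) fun x hx => ?_
        rw [← sq_abs]
        exact pow_le_pow_left₀ (abs_nonneg _) (le_ciSup (bddAbove_abs_spl hp a) ⟨x, hx⟩) 2
    _ = _ := by simp

lemma integral_bspline_le {p J : ℕ} (hp : 1 ≤ p) (l : Fin (J + p)) :
    ∫ x in (0 : ℝ)..1, bspline p J x l ≤ p / (J + 1) := by
  rw [intervalIntegral.integral_of_le zero_le_one, integral_eq_lintegral_of_nonneg_ae
    (Eventually.of_forall fun x => bspline_nonneg J hp x l)
    (measurable_bspline p J l).aestronglyMeasurable]
  refine ENNReal.toReal_le_of_le_ofReal (by positivity) ?_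
  exact (setLIntegral_le_lintegral _ _).trans (lintegral_bspline_le hp l)

lemma l2Semi_le {p : ℕ} (hp : 1 ≤ p) (J : ℕ) (a : Fin (J + p) → ℝ) :
    l2Semi hp J a ≤ Real.sqrt (p / (J + 1) * ∑ l, a l ^ 2) := by
  rw [l2Semi_apply, l2Norm]
  refine Real.sqrt_le_sqrt ?_
  have hi : ∀ l, IntervalIntegrable (fun x => a l ^ 2 * bspline p J x l) volume 0 1 := fun l =>
    (intervalIntegrable_of_bounded (measurable_bspline p J l) (K := 1) (fun x => by
      rw [abs_of_nonneg (bspline_nonneg J hp x l)]; exact bspline_le_one J hp x l) 0 1).const_mul _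
  calc ∫ x in (0 : ℝ)..1, spl p J a x ^ 2
      ≤ ∫ x in (0 : ℝ)..1, ∑ l, a l ^ 2 * bspline p J x l := by
        refine intervalIntegral.integral_mono_on zero_le_one (intervalIntegrable_spl_sq hp a 0 1)
          ?_ fun x _ => spl_sq_le hp a x
        simpa only [Finset.sum_fn] using IntervalIntegrable.sum Finset.univ fun l _ => hi l
    _ = ∑ l, a l ^ 2 * ∫ x in (0 : ℝ)..1, bspline p J x l := by
        rw [intervalIntegral.integral_finsetSum fun l _ => hi l]
        simp_rw [intervalIntegral.integral_const_mul]
    _ ≤ _ := by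
        rw [Finset.mul_sum]
        refine Finset.sum_le_sum fun l _ => ?_
        rw [mul_comm]
        exact mul_le_mul_of_nonneg_right (integral_bspline_le hp l) (sq_nonneg _)

/-! ### Maximizers of a noisy tent function -/

/-- The tent function `k ↦ min (k (n - k₀)) (k₀ (n - k)) / n`. -/
noncomputable def tent (n k₀ k : ℕ) : ℝ :=
  if k ≤ k₀ then (k : ℝ) * (n - k₀) / n else (k₀ : ℝ) * (n - k) / n

/-- For a sequence with a single jump, the level common to all terms cancels in the centered partial
sums and only the jump survives, with a piecewise linear factor. Applied to the projected means,
this is the signal. -/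
lemma cusum_const_eq {E : Type*} [AddCommGroup E] [Module ℝ E] (a b : E) {n k₀ k : ℕ}
    (hn : 0 < n) (hk₀ : k₀ ≤ n) :
    (∑ i ∈ Finset.Icc 1 k, if i ≤ k₀ then a else b)
      - ((k : ℝ) / n) • ∑ i ∈ Finset.Icc 1 n, (if i ≤ k₀ then a else b)
      = -(tent n k₀ k • (b - a)) := by
  have hn' : (n : ℝ) ≠ 0 := by exact_mod_cast hn.ne'
  have hsum : ∀ m : ℕ, (∑ i ∈ Finset.Icc 1 m, if i ≤ k₀ then a else b)
      = ((min m k₀ : ℕ) : ℝ) • a + ((m : ℝ) - (min m k₀ : ℕ)) • b := by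
    intro m
    induction m with
    | zero => simp
    | succ m ih =>
      rw [Finset.sum_Icc_succ_top (by omega), ih]
      by_cases h : m + 1 ≤ k₀
      · rw [if_pos h, min_eq_left h, min_eq_left (by omega)]
        push_cast
        module
      · rw [if_neg h, min_eq_right (by omega : k₀ ≤ m), min_eq_right (by omega)]
        push_cast
        module
  rw [hsum, hsum, min_eq_right hk₀, tent]
  split_ifs with h
  · rw [min_eq_left h]
    match_scalars <;> field_simp <;> ring
  · rw [min_eq_right (by omega)]
    match_scalars <;> field_simp <;> ring

section Tent

variable {ε : ℝ} {n k₀ k : ℕ}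

lemma tent_self_ge (hε : 0 < ε) (hn : 0 < n) (h1 : ε * n ≤ k₀) (h2 : (k₀ : ℝ) ≤ (1 - ε) * n) :
    ε ^ 2 * n ≤ tent n k₀ k₀ := by
  have hn' : (0 : ℝ) < n := by exact_mod_cast hn
  rw [tent, if_pos le_rfl, le_div_iff₀ hn']
  have h3 : ε * n ≤ n - k₀ := by linarith
  calc ε ^ 2 * n * n = (ε * n) * (ε * n) := by ring
    _ ≤ _ := mul_le_mul h1 h3 (by positivity) (by positivity)

lemma tent_nonneg (hk₀ : k₀ ≤ n) (hk : k ≤ n) : 0 ≤ tent n k₀ k := by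
  have h1 : (k₀ : ℝ) ≤ n := by exact_mod_cast hk₀
  have h2 : (k : ℝ) ≤ n := by exact_mod_cast hk
  unfold tent
  split_ifs
  · exact div_nonneg (mul_nonneg (by positivity) (by linarith)) (by positivity)
  · exact div_nonneg (mul_nonneg (by positivity) (by linarith)) (by positivity)

/-- The two slopes of the tent are `(n - k₀) / n` and `k₀ / n` in absolute value, and both are at
least `ε`. -/
lemma tent_gap (hn : 0 < n) (h1 : ε * n ≤ k₀) (h2 : (k₀ : ℝ) ≤ (1 - ε) * n) :
    ε * |(k : ℝ) - k₀| ≤ tent n k₀ k₀ - tent n k₀ k := by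
  have hn' : (0 : ℝ) < n := by exact_mod_cast hn
  rw [tent, if_pos le_rfl, tent]
  split_ifs with h
  · have hk : (k : ℝ) ≤ k₀ := by exact_mod_cast h
    rw [abs_of_nonpos (by linarith), ← sub_div, le_div_iff₀ hn']
    nlinarith
  · have hk : (k₀ : ℝ) ≤ k := by exact_mod_cast (by omega : k₀ ≤ k)
    rw [abs_of_nonneg (by linarith), ← sub_div, le_div_iff₀ hn']
    nlinarith

/-- Relative to its height the tent drops by `|k - k₀| / k₀` on the left and `|k - k₀| / (n - k₀)`
on the right, hence by at least `|k - k₀| / n`. -/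
lemma tent_rel_gap (hn : 0 < n) (hk₀ : k₀ ≤ n) :
    |(k : ℝ) - k₀| * tent n k₀ k₀ ≤ n * (tent n k₀ k₀ - tent n k₀ k) := by
  have hn' : (0 : ℝ) < n := by exact_mod_cast hn
  have hk₀' : (k₀ : ℝ) ≤ n := by exact_mod_cast hk₀
  have h0 : (0 : ℝ) ≤ k₀ := by positivity
  rw [tent, if_pos le_rfl, tent]
  split_ifs with h
  · have hk : (k : ℝ) ≤ k₀ := by exact_mod_cast h
    rw [abs_of_nonpos (by linarith), ← sub_div, mul_div_cancel₀ _ hn'.ne', mul_div_assoc',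
      div_le_iff₀ hn']
    nlinarith [mul_nonneg (mul_nonneg (sub_nonneg.2 hk) (sub_nonneg.2 hk₀')) (sub_nonneg.2 hk₀')]
  · have hk : (k₀ : ℝ) ≤ k := by exact_mod_cast (by omega : k₀ ≤ k)
    rw [abs_of_nonneg (by linarith), ← sub_div, mul_div_cancel₀ _ hn'.ne', mul_div_assoc',
      div_le_iff₀ hn']
    nlinarith [mul_nonneg (mul_nonneg (sub_nonneg.2 hk) h0) h0]

variable {E : Type*} [AddCommGroup E] [Module ℝ E] (N : Seminorm ℝ E) {P : E} {Z : ℕ → E}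

/-- A maximizer of `k ↦ N (Z k - tent k • P)` cannot be at a distance from the mode of the tent
at which the increments of the noise are small. -/
lemma tent_argmax_of_increment {c η : ℝ} (hε : 0 < ε) (hη : 0 < η) (hn : 0 < n) (hk₀ : k₀ ≤ n)
    (hk : k ≤ n)
    (h1 : ε * n ≤ k₀) (h2 : (k₀ : ℝ) ≤ (1 - ε) * n) (hP : c ≤ N P) (hc : 3 * η < ε ^ 2 * c)
    (hZ₀ : N (Z k₀) ≤ η * n) (hZ : N (Z k - Z k₀) ≤ η * |(k : ℝ) - k₀|)
    (hmax : N (Z k₀ - tent n k₀ k₀ • P) ≤ N (Z k - tent n k₀ k • P)) : k = k₀ := by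
  by_contra hne
  have hn' : (0 : ℝ) < n := by exact_mod_cast hn
  have hd : 0 < |(k : ℝ) - k₀| := by
    rw [abs_pos, sub_ne_zero]
    exact_mod_cast hne
  set h₀ := tent n k₀ k₀ with hh₀
  set hk' := tent n k₀ k with hhk
  have hh0 : ε ^ 2 * n ≤ h₀ := tent_self_ge hε hn h1 h2
  have hh0pos : 0 < h₀ := lt_of_lt_of_le (by positivity) hh0
  have hgap := tent_rel_gap (k := k) hn hk₀
  rw [← hh₀, ← hhk] at hgap
  have hk0 : 0 ≤ hk' := tent_nonneg hk₀ hk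
  -- The relative drop of the tent between its mode and `k`.
  set τ := (h₀ - hk') / h₀ with hτ
  have hτ1 : |(k : ℝ) - k₀| ≤ n * τ := by
    rw [hτ, mul_div_assoc', le_div_iff₀ hh0pos]
    exact hgap
  have hτpos : 0 < τ := by
    by_contra hcon
    push Not at hcon
    nlinarith
  have hτle : τ ≤ 1 := by rw [hτ, div_le_one hh0pos]; linarith
  -- The value at `k` is the value at `k₀` shrunk by `1 - τ`, plus an increment of the noise and a
  -- fraction `τ` of the noise at `k₀`. Maximality at `k` then forces `τ * (N (Z k₀ - h₀ • P) - N (Z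
  -- k₀)) ≤ N (Z k - Z k₀)`, and `τ` cancels against the bound on the increment.
  have hdec : Z k - hk' • P = (1 - τ) • (Z k₀ - h₀ • P) + ((Z k - Z k₀) + τ • Z k₀) := by
    have e : hk' = (1 - τ) * h₀ := by rw [hτ]; field_simp; ring
    rw [e]
    module
  have hb : N (Z k - hk' • P) ≤ (1 - τ) * N (Z k₀ - h₀ • P) + (N (Z k - Z k₀) + τ * N (Z k₀)) := by
    rw [hdec]
    refine (map_add_le_add N _ _).trans (add_le_add ?_ ((map_add_le_add N _ _).trans ?_))
    · rw [map_smul_eq_mul, Real.norm_of_nonneg (by linarith)]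
    · rw [map_smul_eq_mul, Real.norm_of_nonneg hτpos.le]
  have hlow : h₀ * c - η * n ≤ N (Z k₀ - h₀ • P) := by
    have e : h₀ • P = Z k₀ - (Z k₀ - h₀ • P) := by abel
    have h3 : N (h₀ • P) ≤ N (Z k₀) + N (Z k₀ - h₀ • P) := by
      conv_lhs => rw [e]
      exact map_sub_le_add N _ _
    rw [map_smul_eq_mul, Real.norm_of_nonneg hh0pos.le] at h3
    have : h₀ * c ≤ h₀ * N P := by gcongr
    linarith
  have h5 : τ * (h₀ * c - 2 * η * n) ≤ η * (n * τ) := by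
    have h6 : τ * (N (Z k₀ - h₀ • P) - N (Z k₀)) ≤ N (Z k - Z k₀) := by linarith
    have h7 : τ * (h₀ * c - 2 * η * n) ≤ τ * (N (Z k₀ - h₀ • P) - N (Z k₀)) := by
      exact mul_le_mul_of_nonneg_left (by linarith) hτpos.le
    have h8 : η * |(k : ℝ) - k₀| ≤ η * (n * τ) := by gcongr
    linarith
  have hcpos : 0 < c := by
    by_contra hcon
    push Not at hcon
    nlinarith [sq_nonneg ε]
  have h9 : h₀ * c - 2 * η * n ≤ η * n := by
    refine le_of_mul_le_mul_left ?_ hτpos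
    linarith
  have h10 : ε ^ 2 * n * c ≤ h₀ * c := by gcongr
  -- The three copies of `η` in `hc` pay for the noise at `k₀` in the lower bound `hlow`, for its
  -- fraction `τ` in the decomposition, and for the increment.
  nlinarith

/-- The distance from a maximizer of `k ↦ N (Z k - tent k • P)` to the mode of the tent. -/
lemma tent_argmax_of_bound {c ζ : ℝ} (hε : 0 < ε) (hn : 0 < n) (hk₀ : k₀ ≤ n)
    (hk : k ≤ n) (h1 : ε * n ≤ k₀) (h2 : (k₀ : ℝ) ≤ (1 - ε) * n) (hc : 0 < c) (hP : c ≤ N P)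
    (hZ₀ : N (Z k₀) ≤ ζ) (hZ : N (Z k) ≤ ζ)
    (hmax : N (Z k₀ - tent n k₀ k₀ • P) ≤ N (Z k - tent n k₀ k • P)) :
    |(k : ℝ) - k₀| ≤ 2 * ζ / (ε * c) := by
  have hgap := tent_gap (k := k) hn h1 h2
  set h₀ := tent n k₀ k₀ with hh₀
  set hk' := tent n k₀ k with hhk
  have hh0 : 0 ≤ h₀ := tent_nonneg hk₀ hk₀
  have hk0 : 0 ≤ hk' := tent_nonneg hk₀ hk
  have hb : N (Z k - hk' • P) ≤ N (Z k) + hk' * N P := by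
    refine (map_sub_le_add N _ _).trans ?_
    rw [map_smul_eq_mul, Real.norm_of_nonneg hk0]
  have hlow : h₀ * N P ≤ N (Z k₀) + N (Z k₀ - h₀ • P) := by
    have e : h₀ • P = Z k₀ - (Z k₀ - h₀ • P) := by abel
    have h3 : N (h₀ • P) ≤ N (Z k₀) + N (Z k₀ - h₀ • P) := by
      conv_lhs => rw [e]
      exact map_sub_le_add N _ _
    rwa [map_smul_eq_mul, Real.norm_of_nonneg hh0] at h3
  have h5 : (h₀ - hk') * N P ≤ 2 * ζ := by linarith
  have h6 : ε * |(k : ℝ) - k₀| * c ≤ (h₀ - hk') * N P :=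
    mul_le_mul hgap hP hc.le (le_trans (by positivity) hgap)
  rw [le_div_iff₀ (by positivity)]
  linarith

end Tent

end FTSBreak

namespace FTSBreak

/-! ### Maximal and exponential inequalities for independent sequences -/

section Independent

variable {Ω : Type*} [MeasurableSpace Ω] {P : Measure Ω}

/-- Induction on the finite index set: the new block is independent of the join of the previous ones
because its sources are disjoint from theirs. -/
lemma iIndep_iSup_of_pairwise_disjoint {κ ι : Type*} {m : κ → MeasurableSpace Ω}
    (hle : ∀ a, m a ≤ ‹MeasurableSpace Ω›) (hm : iIndep m P) (K : ι → Set κ)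
    (hK : Pairwise fun i j => Disjoint (K i) (K j)) :
    iIndep (fun i => ⨆ a ∈ K i, m a) P := by
  classical
  have := hm.isProbabilityMeasure
  rw [iIndep_iff]
  intro s
  induction s using Finset.induction_on with
  | empty => simp
  | insert i s hi ih =>
    intro f hf
    rw [Finset.set_biInter_insert, Finset.prod_insert hi,
      ← ih fun j hj => hf j (Finset.mem_insert_of_mem hj)]
    have hdis : Disjoint (K i) (⋃ j ∈ s, K j) := by
      rw [Set.disjoint_iUnion₂_right]
      intro j hj
      exact hK fun h => hi (h ▸ hj)
    have hind := indep_iSup_of_disjoint hle hm hdis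
    refine (Indep_iff _ _ _).1 hind _ _ (hf i (Finset.mem_insert_self _ _)) ?_
    refine Finset.measurableSet_biInter _ fun j hj => ?_
    refine (iSup₂_le fun a ha => ?_ : (⨆ a ∈ K j, m a) ≤ ⨆ a ∈ ⋃ j ∈ s, K j, m a) _
      (hf j (Finset.mem_insert_of_mem hj))
    exact le_iSup₂_of_le a (Set.mem_biUnion hj ha) le_rfl

variable {ι : Type*} [Fintype ι] {Z : ℕ → Ω → ι → ℝ}

/-- Orthogonality of martingale increments: the partial sum restricted to `A` is a function of the
first `k + 1` vectors, and the next vector is centered and independent of them. -/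
lemma setIntegral_sum_mul_eq_zero (hind : iIndepFun Z P) (hm : ∀ i, Measurable (Z i))
    (h0 : ∀ i l, ∫ ω, Z i ω l ∂P = 0) (k : ℕ) (l : ι) {A : Set Ω}
    (hA : MeasurableSet[Filtration.natural Z (fun i => (hm i).stronglyMeasurable) k] A) :
    ∫ ω in A, (∑ i ∈ Finset.range (k + 1), Z i ω l) * Z (k + 1) ω l ∂P = 0 := by
  set ℱ := Filtration.natural Z (fun i => (hm i).stronglyMeasurable) with hℱ
  have hAm : MeasurableSet A := ℱ.le k A hA
  have hI : Indep (MeasurableSpace.comap (Z (k + 1)) inferInstance) (ℱ k) P :=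
    hind.indep_comap_natural_of_lt (fun i => (hm i).stronglyMeasurable) (Nat.lt_succ_self k)
  have hS : Measurable[ℱ k] (fun ω => ∑ i ∈ Finset.range (k + 1), Z i ω l) := by
    refine Finset.measurable_sum _ fun i hi => ?_
    have h1 : Measurable[ℱ k] (Z i) := by
      have h2 := (Filtration.stronglyAdapted_natural (fun i => (hm i).stronglyMeasurable) i)
      exact h2.measurable.mono (ℱ.mono (by simpa [Nat.lt_succ_iff] using hi)) le_rfl
    exact (measurable_pi_apply l).comp h1
  have hSA : Measurable[ℱ k] (A.indicator fun ω => ∑ i ∈ Finset.range (k + 1), Z i ω l) :=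
    hS.indicator hA
  have hIF : IndepFun (A.indicator fun ω => ∑ i ∈ Finset.range (k + 1), Z i ω l)
      (fun ω => Z (k + 1) ω l) P := by
    rw [IndepFun_iff_Indep]
    refine indep_of_indep_of_le (m₁ := ℱ k) hI.symm hSA.comap_le ?_
    exact ((measurable_pi_apply l).comp (comap_measurable (Z (k + 1)))).comap_le
  have e : ∫ ω in A, (∑ i ∈ Finset.range (k + 1), Z i ω l) * Z (k + 1) ω l ∂P
      = ∫ ω, (A.indicator fun ω => ∑ i ∈ Finset.range (k + 1), Z i ω l) ω * Z (k + 1) ω l ∂P := by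
    rw [← integral_indicator hAm]
    congr 1
    ext ω
    by_cases h : ω ∈ A <;> simp [h]
  rw [e, hIF.integral_fun_mul_eq_mul_integral (hSA.mono (ℱ.le k) le_rfl).aestronglyMeasurable
    ((measurable_pi_apply l).comp (hm (k + 1))).aestronglyMeasurable, h0, mul_zero]

/-- Kolmogorov's maximal inequality for independent random vectors. -/
theorem kolmogorov_maximal (hind : iIndepFun Z P) (hm : ∀ i, Measurable (Z i))
    (h2 : ∀ i l, MemLp (fun ω => Z i ω l) 2 P) (h0 : ∀ i l, ∫ ω, Z i ω l ∂P = 0)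
    (M : ℕ) {x : ℝ} (hx : 0 < x) :
    P {ω | ∃ k ≤ M, x ^ 2 < ∑ l, (∑ i ∈ Finset.range k, Z i ω l) ^ 2}
      ≤ ENNReal.ofReal ((∑ i ∈ Finset.range M, ∑ l, ∫ ω, Z i ω l ^ 2 ∂P) / x ^ 2) := by
  have := hind.isProbabilityMeasure
  rcases M.eq_zero_or_pos with rfl | hM
  · have : {ω | ∃ k ≤ 0, x ^ 2 < ∑ l, (∑ i ∈ Finset.range k, Z i ω l) ^ 2} = ∅ := by
      ext ω
      simp only [Set.mem_ofPred_eq, Set.mem_empty_iff_false, iff_false, not_exists, not_and]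
      intro k hk
      rw [Nat.le_zero.1 hk]
      simp
      positivity
    rw [this]
    simp
  -- Index `k` of the process below stands for `k + 1` summands, so that it is adapted to the
  -- natural filtration; the empty sum never exceeds the level.
  obtain ⟨M, rfl⟩ : ∃ M', M = M' + 1 := ⟨M - 1, by omega⟩
  set ℱ := Filtration.natural Z (fun i => (hm i).stronglyMeasurable) with hℱ
  set S : ℕ → ι → Ω → ℝ := fun k l ω => ∑ i ∈ Finset.range (k + 1), Z i ω l with hS
  have hSL : ∀ k l, MemLp (S k l) 2 P := fun k l => memLp_finsetSum _ fun i _ => h2 i l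
  set f : ℕ → Ω → ℝ := fun k ω => ∑ l, S k l ω ^ 2 with hf
  have hint : ∀ k, Integrable (f k) P := fun k =>
    integrable_finsetSum _ fun l _ => (hSL k l).integrable_sq
  have hSmeas : ∀ k l, Measurable[ℱ k] (S k l) := by
    intro k l
    refine Finset.measurable_sum _ fun i hi => ?_
    have h1 : Measurable[ℱ k] (Z i) := by
      have h2 := (Filtration.stronglyAdapted_natural (fun i => (hm i).stronglyMeasurable) i)
      exact h2.measurable.mono (ℱ.mono (by simpa [Nat.lt_succ_iff] using hi)) le_rfl
    exact (measurable_pi_apply l).comp h1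
  have hexp : ∀ k ω, f (k + 1) ω = f k ω
      + (∑ l, 2 * (S k l ω * Z (k + 1) ω l) + ∑ l, Z (k + 1) ω l ^ 2) := by
    intro k ω
    simp only [hf, ← Finset.sum_add_distrib]
    refine Finset.sum_congr rfl fun l _ => ?_
    have : S (k + 1) l ω = S k l ω + Z (k + 1) ω l := Finset.sum_range_succ _ _
    rw [this]
    ring
  have hcrossint : ∀ k l, Integrable (fun ω => 2 * (S k l ω * Z (k + 1) ω l)) P := fun k l =>
    ((hSL k l).integrable_mul (h2 (k + 1) l)).const_mul 2
  have hstep : ∀ k (A : Set Ω), MeasurableSet[ℱ k] A → ∫ ω in A, f (k + 1) ω ∂P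
      = ∫ ω in A, f k ω ∂P + ∫ ω in A, ∑ l, Z (k + 1) ω l ^ 2 ∂P := by
    intro k A hA
    have hi1 : Integrable (fun ω => ∑ l, 2 * (S k l ω * Z (k + 1) ω l)) P :=
      integrable_finsetSum _ fun l _ => hcrossint k l
    have hi2 : Integrable (fun ω => ∑ l, Z (k + 1) ω l ^ 2) P :=
      integrable_finsetSum _ fun l _ => (h2 (k + 1) l).integrable_sq
    have e1 : ∫ ω in A, ∑ l, 2 * (S k l ω * Z (k + 1) ω l) ∂P = 0 := by
      rw [integral_finsetSum _ fun l _ => (hcrossint k l).integrableOn]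
      refine Finset.sum_eq_zero fun l _ => ?_
      rw [integral_const_mul, setIntegral_sum_mul_eq_zero hind hm h0 k l hA, mul_zero]
    simp_rw [hexp]
    have e2 := integral_add (μ := P.restrict A) (hint k).integrableOn (hi1.add hi2).integrableOn
    have e3 := integral_add (μ := P.restrict A) hi1.integrableOn hi2.integrableOn
    simp only [Pi.add_apply] at e2
    rw [e2, e3, e1, zero_add]
  -- The squared Euclidean norm of the partial sums grows in mean by the second moment of the new
  -- vector, so Doob's maximal inequality applies to it.
  have hsub : Submartingale f ℱ P := by
    refine submartingale_of_setIntegral_le_succ ?_ hint fun k A hA => ?_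
    · intro k
      exact (Finset.measurable_sum _ fun l _ => (hSmeas k l).pow_const 2).stronglyMeasurable
    · rw [hstep k A hA]
      have : 0 ≤ ∫ ω in A, ∑ l, Z (k + 1) ω l ^ 2 ∂P :=
        integral_nonneg fun ω => Finset.sum_nonneg fun l _ => sq_nonneg _
      linarith
  have hval : ∀ k, ∫ ω, f k ω ∂P = ∑ i ∈ Finset.range (k + 1), ∑ l, ∫ ω, Z i ω l ^ 2 ∂P := by
    intro k
    induction k with
    | zero =>
      simp only [hf, hS, zero_add, Finset.range_one, Finset.sum_singleton]
      exact integral_finsetSum _ fun l _ => (h2 0 l).integrable_sq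
    | succ k ih =>
      have := hstep k Set.univ MeasurableSet.univ
      simp only [Measure.restrict_univ] at this
      rw [this, ih, Finset.sum_range_succ _ (k + 1),
        integral_finsetSum _ fun l _ => (h2 (k + 1) l).integrable_sq]
  have hnn : 0 ≤ f := fun k ω => Finset.sum_nonneg fun l _ => sq_nonneg _
  have hmax := maximal_ineq hsub hnn (ε := (x ^ 2).toNNReal) M
  set E := {ω | ((x ^ 2).toNNReal : ℝ)
    ≤ (Finset.range (M + 1)).sup' Finset.nonempty_range_add_one fun k => f k ω} with hE
  have hsubset : {ω | ∃ k ≤ M + 1, x ^ 2 < ∑ l, (∑ i ∈ Finset.range k, Z i ω l) ^ 2} ⊆ E := by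
    rintro ω ⟨k, hk, hlt⟩
    rcases k.eq_zero_or_pos with rfl | hkpos
    · simp at hlt
      nlinarith
    · obtain ⟨k, rfl⟩ : ∃ k', k = k' + 1 := ⟨k - 1, by omega⟩
      rw [hE, Set.mem_ofPred_eq, Real.coe_toNNReal _ (sq_nonneg x)]
      refine hlt.le.trans ?_
      exact Finset.le_sup' (fun k => f k ω) (Finset.mem_range.2 (by omega))
  have hle : ∫ ω in E, f M ω ∂P ≤ ∑ i ∈ Finset.range (M + 1), ∑ l, ∫ ω, Z i ω l ^ 2 ∂P := by
    rw [← hval M]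
    exact setIntegral_le_integral (hint M) (Eventually.of_forall (hnn M))
  have hx2 : 0 < x ^ 2 := by positivity
  refine (measure_mono hsubset).trans ?_
  rw [ENNReal.ofReal_div_of_pos hx2, ENNReal.le_div_iff_mul_le (Or.inl (by simpa using hx.ne'))
    (Or.inl (by simp)), mul_comm]
  exact hmax.trans (ENNReal.ofReal_le_ofReal hle)

variable {X : ℕ → Ω → ℝ}

/-- Chernoff's bound at the fixed parameter `1/T` for the truncated variables, where the exponent is
at most one in absolute value. -/
lemma measureReal_truncated_sum_ge_le (hind : iIndepFun X P) (hm : ∀ i, Measurable (X i))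
    (h2 : ∀ i, MemLp (X i) 2 P) (h0 : ∀ i, ∫ ω, X i ω ∂P = 0) {T x : ℝ}
    (hT : 0 < T) (k : ℕ) {v : ℝ} (hv : ∑ i ∈ Finset.range k, ∫ ω, X i ω ^ 2 ∂P ≤ v) :
    P.real {ω | x ≤ ∑ i ∈ Finset.range k, X i ω ∧ ∀ i < k, |X i ω| ≤ T}
      ≤ Real.exp (-(x / T) + 2 * v / T ^ 2) := by
  have := hind.isProbabilityMeasure
  set φ : ℝ → ℝ := fun y => if |y| ≤ T then y else 0 with hφ
  have hφm : Measurable φ :=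
    Measurable.ite (measurableSet_le measurable_id.abs measurable_const) measurable_id
      measurable_const
  have hφb : ∀ y, |φ y| ≤ T := by
    intro y
    simp only [hφ]
    split_ifs with h
    · exact h
    · simpa using hT.le
  set Y : ℕ → Ω → ℝ := fun i ω => φ (X i ω) with hY
  have hYm : ∀ i, Measurable (Y i) := fun i => hφm.comp (hm i)
  have hYind : iIndepFun Y P := hind.comp (fun _ => φ) fun _ => hφm
  have hYint : ∀ i, Integrable (Y i) P := fun i =>
    Integrable.of_bound (hYm i).aestronglyMeasurable T (Eventually.of_forall fun ω => hφb _)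
  have hmgf : ∀ i, mgf (Y i) P T⁻¹ ≤ Real.exp (2 * (∫ ω, X i ω ^ 2 ∂P) / T ^ 2) := by
    intro i
    have hXi := (h2 i).integrable one_le_two
    have hXsq := (h2 i).integrable_sq
    -- Uses `exp u ≤ 1 + u + u²` for `|u| ≤ 1`. Truncation destroys the centering, but `Y ≤ X + X² /
    -- T`, so comparison with the centered `X` costs a second term `X² / T²`; hence the factor `2`.
    have hpt : ∀ ω, Real.exp (T⁻¹ * Y i ω) ≤ 1 + T⁻¹ * X i ω + 2 * X i ω ^ 2 / T ^ 2 := by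
      intro ω
      have hb : |T⁻¹ * Y i ω| ≤ 1 := by
        rw [abs_mul, abs_of_pos (inv_pos.2 hT), inv_mul_le_one₀ hT]
        exact hφb _
      have h1 := (abs_le.1 (Real.abs_exp_sub_one_sub_id_le hb)).2
      have hYX : (Y i ω) ^ 2 ≤ X i ω ^ 2 := by
        simp only [hY, hφ]
        split_ifs
        · exact le_rfl
        · simp; positivity
      have hYd : Y i ω - X i ω ≤ X i ω ^ 2 / T := by
        simp only [hY, hφ]
        split_ifs with h
        · simp; positivity
        · push Not at h
          rw [le_div_iff₀ hT, zero_sub, ← sq_abs]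
          have := neg_le_abs (X i ω)
          nlinarith [abs_nonneg (X i ω)]
      have h3 : T⁻¹ * (Y i ω - X i ω) ≤ X i ω ^ 2 / T ^ 2 := by
        calc T⁻¹ * (Y i ω - X i ω) ≤ T⁻¹ * (X i ω ^ 2 / T) := by gcongr
          _ = _ := by field_simp
      have h4 : (T⁻¹ * Y i ω) ^ 2 ≤ X i ω ^ 2 / T ^ 2 := by
        rw [mul_pow, inv_pow, inv_mul_eq_div]
        gcongr
      have h5 : 2 * X i ω ^ 2 / T ^ 2 = X i ω ^ 2 / T ^ 2 + X i ω ^ 2 / T ^ 2 := by ring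
      linarith
    calc mgf (Y i) P T⁻¹ ≤ ∫ ω, (1 + T⁻¹ * X i ω + 2 * X i ω ^ 2 / T ^ 2) ∂P := by
          refine integral_mono_of_nonneg (Eventually.of_forall fun ω => (Real.exp_pos _).le)
            ?_ (Eventually.of_forall hpt)
          exact ((integrable_const _).add (hXi.const_mul _)).add ((hXsq.const_mul 2).div_const _)
      _ = 2 * (∫ ω, X i ω ^ 2 ∂P) / T ^ 2 + 1 := by
          have hi1 : Integrable (fun ω => 1 + T⁻¹ * X i ω) P :=
            (integrable_const _).add (hXi.const_mul _)
          rw [integral_add hi1 ((hXsq.const_mul 2).div_const _),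
            integral_add (integrable_const _) (hXi.const_mul _),
            integral_const_mul, h0, integral_div, integral_const_mul]
          simp
          ring
      _ ≤ _ := Real.add_one_le_exp _
  have hSint : Integrable (fun ω => Real.exp (T⁻¹ * (∑ i ∈ Finset.range k, Y i) ω)) P := by
    refine Integrable.of_bound (by fun_prop) (Real.exp k) (Eventually.of_forall fun ω => ?_)
    rw [Real.norm_of_nonneg (Real.exp_pos _).le, Real.exp_le_exp, Finset.sum_apply]
    have : ∑ i ∈ Finset.range k, Y i ω ≤ ∑ _i ∈ Finset.range k, T :=
      Finset.sum_le_sum fun i _ => (le_abs_self _).trans (hφb _)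
    simp only [Finset.sum_const, Finset.card_range, nsmul_eq_mul] at this
    rw [inv_mul_le_iff₀ hT]
    linarith
  have hch := measure_ge_le_exp_mul_mgf x (inv_pos.2 hT).le hSint
  have hsubset : {ω | x ≤ ∑ i ∈ Finset.range k, X i ω ∧ ∀ i < k, |X i ω| ≤ T}
      ⊆ {ω | x ≤ (∑ i ∈ Finset.range k, Y i) ω} := by
    rintro ω ⟨h1, h3⟩
    rw [Set.mem_ofPred_eq, Finset.sum_apply]
    refine h1.trans (le_of_eq (Finset.sum_congr rfl fun i hi => ?_))
    simp only [hY, hφ, if_pos (h3 i (Finset.mem_range.1 hi))]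
  refine (measureReal_mono hsubset).trans (hch.trans ?_)
  rw [hYind.mgf_sum hYm, Real.exp_add]
  refine mul_le_mul (le_of_eq ?_) ?_ (Finset.prod_nonneg fun i _ => mgf_nonneg)
    (Real.exp_pos _).le
  · congr 1
    ring
  · calc ∏ i ∈ Finset.range k, mgf (Y i) P T⁻¹
        ≤ ∏ i ∈ Finset.range k, Real.exp (2 * (∫ ω, X i ω ^ 2 ∂P) / T ^ 2) :=
          Finset.prod_le_prod (fun _ _ => mgf_nonneg) fun i _ => hmgf i
      _ = Real.exp (2 * (∑ i ∈ Finset.range k, ∫ ω, X i ω ^ 2 ∂P) / T ^ 2) := by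
          rw [← Real.exp_sum]
          congr 1
          rw [Finset.mul_sum, Finset.sum_div]
      _ ≤ _ := by
          rw [Real.exp_le_exp]
          gcongr

/-- A Bernstein-type inequality on the event that all summands are at most `T`. -/
theorem measureReal_truncated_abs_sum_gt_le (hind : iIndepFun X P) (hm : ∀ i, Measurable (X i))
    (h2 : ∀ i, MemLp (X i) 2 P) (h0 : ∀ i, ∫ ω, X i ω ∂P = 0) {T x : ℝ}
    (hT : 0 < T) (k : ℕ) {v : ℝ} (hv : ∑ i ∈ Finset.range k, ∫ ω, X i ω ^ 2 ∂P ≤ v) :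
    P.real {ω | x < |∑ i ∈ Finset.range k, X i ω| ∧ ∀ i < k, |X i ω| ≤ T}
      ≤ 2 * Real.exp (-(x / T) + 2 * v / T ^ 2) := by
  have := hind.isProbabilityMeasure
  have h1 := measureReal_truncated_sum_ge_le hind hm h2 h0 (x := x) hT k hv
  have hind' : iIndepFun (fun i ω => -X i ω) P := hind.comp (fun _ y => -y) fun _ => measurable_neg
  have h3 := measureReal_truncated_sum_ge_le hind' (fun i => (hm i).neg) (fun i => (h2 i).neg)
    (fun i => by rw [integral_neg, h0, neg_zero]) (x := x) hT k (v := v)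
    (by simpa using hv)
  calc P.real {ω | x < |∑ i ∈ Finset.range k, X i ω| ∧ ∀ i < k, |X i ω| ≤ T}
      ≤ P.real ({ω | x ≤ ∑ i ∈ Finset.range k, X i ω ∧ ∀ i < k, |X i ω| ≤ T}
        ∪ {ω | x ≤ ∑ i ∈ Finset.range k, -X i ω ∧ ∀ i < k, |-X i ω| ≤ T}) := by
        refine measureReal_mono ?_
        rintro ω ⟨ha, hb⟩
        rcases lt_abs.1 ha with h | h
        · exact Or.inl ⟨h.le, hb⟩
        · refine Or.inr ⟨?_, fun i hi => by rw [abs_neg]; exact hb i hi⟩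
          rw [Finset.sum_neg_distrib]
          exact h.le
    _ ≤ _ := measureReal_union_le _ _
    _ ≤ _ := by linarith

end Independent

end FTSBreak

namespace FTSBreak

/-! ### Sums of layers of finitely dependent variables -/

section Layered

/-- The sum of the weights `(m + 1) ^ (-5/4)`. -/
noncomputable def layerSum : ℝ := ∑' m : ℕ, ((m : ℝ) + 1) ^ (-(5 / 4) : ℝ)

lemma summable_layerSum : Summable fun m : ℕ => ((m : ℝ) + 1) ^ (-(5 / 4) : ℝ) := by
  have h := (summable_nat_add_iff 1).2
    (Real.summable_nat_rpow.2 (by norm_num : (-(5 / 4) : ℝ) < -1))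
  simpa using h

lemma layerSum_pos : 0 < layerSum :=
  summable_layerSum.tsum_pos (fun _ => by positivity) 0 (by simp)

/-- The share of the `m`-th layer in a deviation. -/
noncomputable def layerShare (m : ℕ) : ℝ := (2 * layerSum)⁻¹ * ((m : ℝ) + 1) ^ (-(9 / 4) : ℝ)

lemma layerShare_pos (m : ℕ) : 0 < layerShare m := by
  have := layerSum_pos
  unfold layerShare
  positivity

/-- Layer `m` has `m + 1` residue classes, each allowed one share; together they use half of the
deviation and leave half to the remainder. The exponent `9/4` is steep enough for this sum and flat
enough that `(m+1)⁻³ / layerShare m = O((m+1)^(-3/4))` has summable `r`-th powers for `r ≥ 2`. -/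
lemma sum_layerShare_le (n : ℕ) :
    ∑ m ∈ Finset.range n, ((m : ℝ) + 1) * layerShare m ≤ 1 / 2 := by
  have hS := layerSum_pos
  have h1 : ∀ m : ℕ, ((m : ℝ) + 1) * layerShare m
      = (2 * layerSum)⁻¹ * ((m : ℝ) + 1) ^ (-(5 / 4) : ℝ) := by
    intro m
    have : ((m : ℝ) + 1) ^ (-(5 / 4) : ℝ) = ((m : ℝ) + 1) * ((m : ℝ) + 1) ^ (-(9 / 4) : ℝ) := by
      conv_rhs => rw [← Real.rpow_one_add' (by positivity) (by norm_num)]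
      norm_num
    rw [this, layerShare]
    ring
  simp_rw [h1]
  rw [← Finset.mul_sum]
  have h2 := summable_layerSum.sum_le_tsum (Finset.range n) (fun _ _ => by positivity)
  calc (2 * layerSum)⁻¹ * ∑ m ∈ Finset.range n, ((m : ℝ) + 1) ^ (-(5 / 4) : ℝ)
      ≤ (2 * layerSum)⁻¹ * layerSum := by
        gcongr
        exact h2
    _ = 1 / 2 := by field_simp

lemma inv_cube_div_layerShare (m : ℕ) : (((m : ℝ) + 1) ^ 3)⁻¹ / layerShare m
    = 2 * layerSum * ((m : ℝ) + 1) ^ (-(3 / 4) : ℝ) := by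
  have hS := layerSum_pos
  have hm : (0 : ℝ) < (m : ℝ) + 1 := by positivity
  have h1 : (((m : ℝ) + 1) ^ 3)⁻¹ = ((m : ℝ) + 1) ^ (-(3 / 4) : ℝ) * ((m : ℝ) + 1) ^ (-(9 / 4) : ℝ) := by
    rw [← Real.rpow_add hm, ← Real.rpow_natCast, ← Real.rpow_neg hm.le]
    norm_num
  rw [h1, layerShare]
  field_simp

lemma inv_cube_div_layerShare_le (m : ℕ) :
    (((m : ℝ) + 1) ^ 3)⁻¹ / layerShare m ≤ 2 * layerSum := by
  have hS := layerSum_pos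
  rw [inv_cube_div_layerShare]
  refine mul_le_of_le_one_right (by positivity) ?_
  exact Real.rpow_le_one_of_one_le_of_nonpos (by linarith [Nat.cast_nonneg (α := ℝ) m])
    (by norm_num)

lemma sum_inv_cube_div_layerShare_le (n : ℕ) {r : ℕ} (hr : 2 ≤ r) :
    ∑ m ∈ Finset.range n, ((((m : ℝ) + 1) ^ 3)⁻¹ / layerShare m) ^ r
      ≤ (2 * layerSum) ^ r * layerSum := by
  have hS := layerSum_pos
  simp_rw [inv_cube_div_layerShare, mul_pow]
  rw [← Finset.mul_sum, ← mul_pow]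
  gcongr
  refine le_trans (Finset.sum_le_sum fun m _ => ?_)
    (summable_layerSum.sum_le_tsum (Finset.range n) (fun _ _ => by positivity))
  have hm : (1 : ℝ) ≤ (m : ℝ) + 1 := by linarith [Nat.cast_nonneg (α := ℝ) m]
  rw [← Real.rpow_natCast, ← Real.rpow_mul (by positivity)]
  refine Real.rpow_le_rpow_of_exponent_le hm ?_
  have : (2 : ℝ) ≤ r := by exact_mod_cast hr
  linarith

variable {Ω : Type*} [MeasurableSpace Ω] {P : Measure Ω} {ι : Type*}

/-- The part of a sequence with index in one residue class. -/
noncomputable def residuePart (m ρ : ℕ) (Z : ℕ → Ω → ι → ℝ) (i : ℕ) (ω : Ω) : ι → ℝ :=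
  if i % (m + 1) = ρ then Z i ω else 0

/-- A decomposition of a noise sequence into `n` layers and a remainder. The `m`-th layer has size
`(m + 1) ^ (-3)` and is independent along residue classes modulo `m + 1`. -/
structure Layered (P : Measure Ω) (n : ℕ) (v : ℝ) (W : ℕ → Ω → ι → ℝ) where
  /-- the layers -/
  Z : ℕ → ℕ → Ω → ι → ℝ
  /-- the remainder -/
  R : ℕ → Ω → ι → ℝ
  decomp : ∀ i ω l, W i ω l = ∑ m ∈ Finset.range n, Z m i ω l + R i ω l
  meas : ∀ m i, Measurable (Z m i)
  indep : ∀ m ρ, iIndepFun (residuePart m ρ (Z m)) P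
  memLp : ∀ m i l, MemLp (fun ω => Z m i ω l) 2 P
  mean : ∀ m i l, ∫ ω, Z m i ω l ∂P = 0
  var : ∀ m i l, ∫ ω, Z m i ω l ^ 2 ∂P ≤ v * ((((m : ℝ) + 1) ^ 3)⁻¹) ^ 2
  R_memLp : ∀ i l, MemLp (fun ω => R i ω l) 2 P
  R_var : ∀ i l, ∫ ω, R i ω l ^ 2 ∂P ≤ v * ((n : ℝ) ^ 4)⁻¹

lemma measurable_residuePart {m ρ : ℕ} {Z : ℕ → Ω → ι → ℝ} (h : ∀ i, Measurable (Z i)) (i : ℕ) :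
    Measurable (residuePart m ρ Z i) := by
  unfold residuePart
  split_ifs
  · exact h i
  · exact measurable_const

lemma sum_residuePart (m : ℕ) (Z : ℕ → Ω → ι → ℝ) (i : ℕ) (ω : Ω) (l : ι) :
    ∑ ρ ∈ Finset.range (m + 1), residuePart m ρ Z i ω l = Z i ω l := by
  rw [Finset.sum_eq_single (i % (m + 1))]
  · simp [residuePart]
  · intro ρ _ hρ
    simp [residuePart, Ne.symm hρ]
  · intro h
    exact absurd (Finset.mem_range.2 (Nat.mod_lt _ (Nat.succ_pos m))) h

namespace Layered

variable {n : ℕ} {v : ℝ} {W : ℕ → Ω → ι → ℝ}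

lemma v_nonneg (D : Layered P n v W) [Nonempty ι] : 0 ≤ v := by
  obtain ⟨l⟩ := ‹Nonempty ι›
  have h1 := D.var 0 0 l
  have h2 : 0 ≤ ∫ ω, D.Z 0 0 ω l ^ 2 ∂P := integral_nonneg fun _ => sq_nonneg _
  simp at h1
  linarith

lemma residue_memLp (D : Layered P n v W) (m ρ i : ℕ) (l : ι) :
    MemLp (fun ω => residuePart m ρ (D.Z m) i ω l) 2 P := by
  by_cases h : i % (m + 1) = ρ
  · simpa [residuePart, h] using D.memLp m i l
  · simp [residuePart, h]

lemma residue_mean (D : Layered P n v W) (m ρ i : ℕ) (l : ι) : ∫ ω, residuePart m ρ (D.Z m) i ω l ∂P = 0 := by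
  by_cases h : i % (m + 1) = ρ
  · simpa [residuePart, h] using D.mean m i l
  · simp [residuePart, h]

lemma residue_sq (D : Layered P n v W) (m ρ i : ℕ) (l : ι) : ∫ ω, residuePart m ρ (D.Z m) i ω l ^ 2 ∂P
    = if i % (m + 1) = ρ then ∫ ω, D.Z m i ω l ^ 2 ∂P else 0 := by
  by_cases h : i % (m + 1) = ρ <;> simp [residuePart, h]

/-- By Cauchy–Schwarz the integrand dominates the squares of all partial sums of at most `M`
remainders. No independence is needed, because the second moments are of order `n⁻⁴`. -/
lemma integral_remainder_le (D : Layered P n v W) (s : ℕ) (l : ι) {M : ℕ} (hM : M ≤ n) (hv : 0 ≤ v) :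
    ∫ ω, M * ∑ i ∈ Finset.range M, D.R (s + i) ω l ^ 2 ∂P ≤ M * v * ((n : ℝ) ^ 3)⁻¹ := by
  rcases Nat.eq_zero_or_pos M with rfl | hMpos
  · simp
  have hn : (0 : ℝ) < n := by exact_mod_cast lt_of_lt_of_le hMpos hM
  have hMn : (M : ℝ) ≤ n := by exact_mod_cast hM
  rw [integral_const_mul, integral_finsetSum _ fun i _ => (D.R_memLp (s + i) l).integrable_sq]
  calc (M : ℝ) * ∑ i ∈ Finset.range M, ∫ ω, D.R (s + i) ω l ^ 2 ∂P
      ≤ M * ∑ _i ∈ Finset.range M, v * ((n : ℝ) ^ 4)⁻¹ := by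
        gcongr
        exact D.R_var _ _
    _ = M * v * (M * ((n : ℝ) ^ 4)⁻¹) := by
        simp only [Finset.sum_const, Finset.card_range, nsmul_eq_mul]
        ring
    _ ≤ M * v * (n * ((n : ℝ) ^ 4)⁻¹) := by gcongr
    _ = _ := by field_simp

/-- Second-moment maximal inequality for layered noise. -/
theorem maximal [IsProbabilityMeasure P] [Fintype ι] [Nonempty ι] (D : Layered P n v W) (s : ℕ) {M : ℕ} (hM : M ≤ n) {x : ℝ} (hx : 0 < x) :
    P {ω | ∃ k ≤ M, x ^ 2 < ∑ l, (∑ i ∈ Finset.range k, W (s + i) ω l) ^ 2}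
      ≤ ENNReal.ofReal ((4 + (2 * layerSum) ^ 2 * layerSum)
          * (M * Fintype.card ι * v) / x ^ 2) := by
  have hv := D.v_nonneg
  have hS := layerSum_pos
  set Z' : ℕ → ℕ → ℕ → Ω → ι → ℝ := fun m ρ i => residuePart m ρ (D.Z m) (s + i) with hZ'
  set E : ℕ → ℕ → Set Ω := fun m ρ => {ω | ∃ k ≤ M, (layerShare m * x) ^ 2
    < ∑ l, (∑ i ∈ Finset.range k, Z' m ρ i ω l) ^ 2} with hE
  set F : Set Ω := {ω | (x / 2) ^ 2 ≤ ∑ l, M * ∑ i ∈ Finset.range M, D.R (s + i) ω l ^ 2} with hF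
  -- If every class stays within its share and the remainder within `x/2`, the triangle inequality
  -- keeps the whole sum below `x`.
  have hcover : {ω | ∃ k ≤ M, x ^ 2 < ∑ l, (∑ i ∈ Finset.range k, W (s + i) ω l) ^ 2}
      ⊆ (⋃ m ∈ Finset.range n, ⋃ ρ ∈ Finset.range (m + 1), E m ρ) ∪ F := by
    rintro ω ⟨k, hk, hlt⟩
    by_contra hcon
    simp only [Set.mem_union, Set.mem_iUnion, not_or, not_exists] at hcon
    obtain ⟨hc1, hc2⟩ := hcon
    set en : (ι → ℝ) → ℝ := fun y => ‖(WithLp.toLp 2 y : EuclideanSpace ℝ ι)‖ with hen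
    have ensq : ∀ y, en y ^ 2 = ∑ l, y l ^ 2 := by
      intro y
      simp [hen, EuclideanSpace.norm_sq_eq]
    have en0 : ∀ y, 0 ≤ en y := fun y => norm_nonneg _
    have hb1 : ∀ m ∈ Finset.range n, ∀ ρ ∈ Finset.range (m + 1),
        en (fun l => ∑ i ∈ Finset.range k, Z' m ρ i ω l) ≤ layerShare m * x := by
      intro m hm ρ hρ
      have h1 := hc1 m hm ρ hρ
      simp only [hE, Set.mem_ofPred_eq, not_exists, not_and, not_lt] at h1
      have h2 := h1 k hk
      rw [← ensq (fun l => ∑ i ∈ Finset.range k, Z' m ρ i ω l)] at h2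
      exact (sq_le_sq₀ (en0 _) (mul_pos (layerShare_pos m) hx).le).1 h2
    have hb2 : en (fun l => ∑ i ∈ Finset.range k, D.R (s + i) ω l) ≤ x / 2 := by
      refine (sq_le_sq₀ (en0 _) (by positivity)).1 ?_
      rw [ensq]
      simp only [hF, Set.mem_ofPred_eq, not_le] at hc2
      refine le_trans (Finset.sum_le_sum fun l _ => ?_) hc2.le
      have h1 := sq_sum_le_card_mul_sum_sq (s := Finset.range k) (f := fun i => D.R (s + i) ω l)
      rw [Finset.card_range] at h1
      refine h1.trans ?_
      refine mul_le_mul (by exact_mod_cast hk) ?_ (Finset.sum_nonneg fun _ _ => sq_nonneg _)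
        (by positivity)
      exact Finset.sum_le_sum_of_subset_of_nonneg (Finset.range_mono hk) fun _ _ _ => sq_nonneg _
    have hdec : (fun l => ∑ i ∈ Finset.range k, W (s + i) ω l)
        = (∑ m ∈ Finset.range n, ∑ ρ ∈ Finset.range (m + 1),
            fun l => ∑ i ∈ Finset.range k, Z' m ρ i ω l)
          + fun l => ∑ i ∈ Finset.range k, D.R (s + i) ω l := by
      ext l
      simp only [Pi.add_apply, Finset.sum_apply, D.decomp, Finset.sum_add_distrib]
      congr 1
      rw [Finset.sum_comm]
      refine Finset.sum_congr rfl fun m _ => ?_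
      rw [Finset.sum_comm]
      refine Finset.sum_congr rfl fun i _ => ?_
      exact (sum_residuePart m (D.Z m) (s + i) ω l).symm
    have hle : en (fun l => ∑ i ∈ Finset.range k, W (s + i) ω l) ≤ x := by
      rw [hdec]
      simp only [hen, WithLp.toLp_add, WithLp.toLp_sum]
      refine (norm_add_le _ _).trans ?_
      refine (add_le_add ((norm_sum_le _ _).trans (Finset.sum_le_sum fun m hm =>
        (norm_sum_le _ _).trans (Finset.sum_le_sum fun ρ hρ => hb1 m hm ρ hρ))) hb2).trans ?_
      simp only [Finset.sum_const, Finset.card_range, nsmul_eq_mul]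
      have h1 := mul_le_mul_of_nonneg_right (sum_layerShare_le n) hx.le
      rw [Finset.sum_mul] at h1
      have h2 : ∑ m ∈ Finset.range n, ((m + 1 : ℕ) : ℝ) * (layerShare m * x)
          = ∑ m ∈ Finset.range n, ((m : ℝ) + 1) * layerShare m * x :=
        Finset.sum_congr rfl fun m _ => by push_cast; ring
      linarith
    have h3 := pow_le_pow_left₀ (en0 _) hle 2
    rw [ensq] at h3
    linarith
  have hEm : ∀ m ρ, P (E m ρ) ≤ ENNReal.ofReal ((∑ i ∈ Finset.range M, ∑ l,
      ∫ ω, Z' m ρ i ω l ^ 2 ∂P) / (layerShare m * x) ^ 2) := by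
    intro m ρ
    refine kolmogorov_maximal ((D.indep m ρ).precomp (add_right_injective s))
      (fun i => measurable_residuePart (D.meas m) _) (fun i l => D.residue_memLp m ρ _ l)
      (fun i l => D.residue_mean m ρ _ l) M (mul_pos (layerShare_pos m) hx)
  have hFm : P F ≤ ENNReal.ofReal (4 * (M * Fintype.card ι * v) / x ^ 2) := by
    have hint : Integrable (fun ω => ∑ l, M * ∑ i ∈ Finset.range M, D.R (s + i) ω l ^ 2) P :=
      integrable_finsetSum _ fun l _ => (integrable_finsetSum _ fun i _ =>
        (D.R_memLp (s + i) l).integrable_sq).const_mul _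
    have h1 := mul_meas_ge_le_integral_of_nonneg (Eventually.of_forall fun ω =>
      Finset.sum_nonneg fun l _ => mul_nonneg (Nat.cast_nonneg M)
        (Finset.sum_nonneg fun i _ => sq_nonneg (D.R (s + i) ω l))) hint ((x / 2) ^ 2)
    have h2 : ∫ ω, ∑ l, M * ∑ i ∈ Finset.range M, D.R (s + i) ω l ^ 2 ∂P
        ≤ M * Fintype.card ι * v := by
      rw [integral_finsetSum _ fun l _ => (integrable_finsetSum _ fun i _ =>
        (D.R_memLp (s + i) l).integrable_sq).const_mul _]
      refine (Finset.sum_le_sum fun l _ => D.integral_remainder_le s l hM hv).trans ?_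
      simp only [Finset.sum_const, Finset.card_univ, nsmul_eq_mul]
      have : ((n : ℝ) ^ 3)⁻¹ ≤ 1 := by
        rcases Nat.eq_zero_or_pos n with rfl | hn
        · simp
        · exact inv_le_one_of_one_le₀ (one_le_pow₀ (by exact_mod_cast hn))
      calc (Fintype.card ι : ℝ) * (M * v * ((n : ℝ) ^ 3)⁻¹) ≤ Fintype.card ι * (M * v * 1) := by
            gcongr
        _ = _ := by ring
    rw [← ofReal_measureReal]
    refine ENNReal.ofReal_le_ofReal ?_
    rw [le_div_iff₀ (by positivity)]
    have h3 := h1.trans h2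
    rw [← hF] at h3
    nlinarith
  refine (measure_mono hcover).trans ((measure_union_le _ _).trans ?_)
  have hsum : P (⋃ m ∈ Finset.range n, ⋃ ρ ∈ Finset.range (m + 1), E m ρ)
      ≤ ENNReal.ofReal ((2 * layerSum) ^ 2 * layerSum * (M * Fintype.card ι * v) / x ^ 2) := by
    refine (measure_biUnion_finset_le _ _).trans ?_
    refine (Finset.sum_le_sum fun m _ => (measure_biUnion_finset_le _ _).trans
      (Finset.sum_le_sum fun ρ _ => hEm m ρ)).trans ?_
    have hnn : ∀ m ρ, 0 ≤ (∑ i ∈ Finset.range M, ∑ l,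
        ∫ ω, Z' m ρ i ω l ^ 2 ∂P) / (layerShare m * x) ^ 2 := fun m ρ =>
      div_nonneg (Finset.sum_nonneg fun _ _ => Finset.sum_nonneg fun _ _ =>
        integral_nonneg fun _ => sq_nonneg _) (sq_nonneg _)
    have e1 : ∀ m, ∑ ρ ∈ Finset.range (m + 1), ENNReal.ofReal ((∑ i ∈ Finset.range M, ∑ l,
        ∫ ω, Z' m ρ i ω l ^ 2 ∂P) / (layerShare m * x) ^ 2)
        ≤ ENNReal.ofReal (((((m : ℝ) + 1) ^ 3)⁻¹ / layerShare m) ^ 2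
          * ((M * Fintype.card ι * v) / x ^ 2)) := by
      intro m
      rw [← ENNReal.ofReal_sum_of_nonneg fun ρ _ => hnn m ρ]
      refine ENNReal.ofReal_le_ofReal ?_
      rw [← Finset.sum_div, Finset.sum_comm]
      -- Each index lies in exactly one residue class, so summing over the classes of a layer costs
      -- no factor `m + 1`.
      have h1 : ∀ i, ∑ ρ ∈ Finset.range (m + 1), ∑ l, ∫ ω, Z' m ρ i ω l ^ 2 ∂P
          ≤ Fintype.card ι * (v * ((((m : ℝ) + 1) ^ 3)⁻¹) ^ 2) := by
        intro i
        rw [Finset.sum_comm]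
        calc ∑ l, ∑ ρ ∈ Finset.range (m + 1), ∫ ω, Z' m ρ i ω l ^ 2 ∂P
            = ∑ l, ∫ ω, D.Z m (s + i) ω l ^ 2 ∂P := by
              refine Finset.sum_congr rfl fun l _ => ?_
              simp_rw [hZ', D.residue_sq]
              rw [Finset.sum_ite_eq, if_pos (Finset.mem_range.2 (Nat.mod_lt _ (Nat.succ_pos m)))]
          _ ≤ ∑ _l : ι, v * ((((m : ℝ) + 1) ^ 3)⁻¹) ^ 2 :=
              Finset.sum_le_sum fun l _ => D.var m (s + i) l
          _ = _ := by simp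
      have h2 := Finset.sum_le_sum fun i (_ : i ∈ Finset.range M) => h1 i
      rw [Finset.sum_const, Finset.card_range, nsmul_eq_mul] at h2
      have hpos := layerShare_pos m
      calc _ ≤ (M * (Fintype.card ι * (v * ((((m : ℝ) + 1) ^ 3)⁻¹) ^ 2)))
            / (layerShare m * x) ^ 2 := by gcongr
        _ = _ := by field_simp
    refine (Finset.sum_le_sum fun m _ => e1 m).trans ?_
    rw [← ENNReal.ofReal_sum_of_nonneg fun m _ => by positivity, ← Finset.sum_mul]
    refine ENNReal.ofReal_le_ofReal ?_
    rw [mul_div_assoc ((2 * layerSum) ^ 2 * layerSum)]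
    exact mul_le_mul_of_nonneg_right (sum_inv_cube_div_layerShare_le n le_rfl) (by positivity)
  refine (add_le_add hsum hFm).trans ?_
  rw [← ENNReal.ofReal_add (by positivity) (by positivity)]
  refine ENNReal.ofReal_le_ofReal (le_of_eq ?_)
  ring

/-- Within one class the quotient by `m + 1` determines the index, and at most `(n + 2m + 1) / (m +
1)` quotients occur; `m < n` turns the numerator into `3n`. -/
lemma card_residue_le {m ρ s k : ℕ} (hk : k ≤ n) (hm : m < n) :
    (((Finset.range k).filter fun i => (s + i) % (m + 1) = ρ).card : ℝ)
      ≤ 3 * n / ((m : ℝ) + 1) := by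
  have h1 : ((Finset.range k).filter fun i => (s + i) % (m + 1) = ρ).card
      ≤ (Finset.Icc (s / (m + 1)) ((s + n) / (m + 1))).card := by
    refine Finset.card_le_card_of_injOn (fun i => (s + i) / (m + 1)) ?_ ?_
    · intro i hi
      simp only [Finset.coe_filter, Finset.mem_range, Set.mem_ofPred_eq] at hi
      simp only [Finset.coe_Icc, Set.mem_Icc]
      exact ⟨Nat.div_le_div_right (by omega), Nat.div_le_div_right (by omega)⟩
    · intro i hi j hj hij
      simp only [Finset.coe_filter, Finset.mem_range, Set.mem_ofPred_eq] at hi hj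
      simp only at hij
      have a1 := Nat.div_add_mod (s + i) (m + 1)
      have a2 := Nat.div_add_mod (s + j) (m + 1)
      rw [hi.2, hij] at a1
      rw [hj.2] at a2
      omega
  have h2 : (Finset.Icc (s / (m + 1)) ((s + n) / (m + 1))).card * (m + 1) ≤ n + 2 * m + 1 := by
    rw [Nat.card_Icc]
    have b1 := Nat.div_mul_le_self (s + n) (m + 1)
    have b2 := Nat.div_add_mod s (m + 1)
    have b3 := Nat.mod_lt s (by omega : 0 < m + 1)
    have b4 : s / (m + 1) ≤ (s + n) / (m + 1) := Nat.div_le_div_right (by omega)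
    set u := s / (m + 1)
    set w := (s + n) / (m + 1)
    have b5 : (w + 1 - u) * (m + 1) + u * (m + 1) = w * (m + 1) + (m + 1) := by
      rw [← Nat.add_mul, Nat.sub_add_cancel (by omega)]
      ring
    have b6 : (m + 1) * u = u * (m + 1) := mul_comm _ _
    omega
  have h3 : ((Finset.range k).filter fun i => (s + i) % (m + 1) = ρ).card * (m + 1) ≤ 3 * n :=
    (Nat.mul_le_mul_right _ h1).trans (by omega)
  rw [le_div_iff₀ (by positivity)]
  exact_mod_cast h3

lemma residue_var_le (D : Layered P n v W) (hv : 0 ≤ v) {m ρ s k : ℕ} (hk : k ≤ n) (hm : m < n)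
    (l : ι) : ∑ i ∈ Finset.range k, ∫ ω, residuePart m ρ (D.Z m) (s + i) ω l ^ 2 ∂P
      ≤ 3 * n * v * ((((m : ℝ) + 1) ^ 3)⁻¹) ^ 2 := by
  simp_rw [D.residue_sq]
  rw [← Finset.sum_filter]
  refine (Finset.sum_le_sum fun i _ => D.var m (s + i) l).trans ?_
  rw [Finset.sum_const, nsmul_eq_mul]
  have h1 : (((Finset.range k).filter fun i => (s + i) % (m + 1) = ρ).card : ℝ) ≤ 3 * n :=
    (card_residue_le hk hm).trans
      (div_le_self (by positivity) (by linarith [Nat.cast_nonneg (α := ℝ) m]))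
  calc _ ≤ 3 * n * (v * ((((m : ℝ) + 1) ^ 3)⁻¹) ^ 2) := by gcongr
    _ = _ := by ring

/-- Exponential deviation inequality for layered noise whose layers have `r`-th order tails. -/
theorem deviation [IsProbabilityMeasure P] [Fintype ι] [Nonempty ι] (D : Layered P n v W) (s : ℕ)
    {r : ℕ} (hr : 2 ≤ r) {κ : ℝ} (hκ : 0 ≤ κ)
    (htail : ∀ m i l T, 0 < T →
      P {ω | T < |D.Z m i ω l|} ≤ ENNReal.ofReal (κ * ((((m : ℝ) + 1) ^ 3)⁻¹ / T) ^ r))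
    {A x : ℝ} (hA : 0 < A) (hx : 0 < x) :
    P {ω | ∃ k ≤ n, ∃ l, x < |∑ i ∈ Finset.range k, W (s + i) ω l|}
      ≤ ENNReal.ofReal (Fintype.card ι * (2 * n ^ 2 * (n + 1)
          * Real.exp (-A + 6 * n * v * (2 * layerSum) ^ 2 * (A / x) ^ 2)
          + n * κ * ((2 * layerSum) ^ r * layerSum) * (A / x) ^ r
          + 4 * v / x ^ 2)) := by
  have hv := D.v_nonneg
  have hS := layerSum_pos
  -- Truncating each layer at its share of `x/A` makes the Chernoff exponent equal to `-A` in every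
  -- layer.
  set T : ℕ → ℝ := fun m => layerShare m * x / A with hT
  have hTpos : ∀ m, 0 < T m := fun m => div_pos (mul_pos (layerShare_pos m) hx) hA
  set Z' : ℕ → ℕ → ℕ → Ω → ι → ℝ := fun m ρ i => residuePart m ρ (D.Z m) (s + i) with hZ'
  set E : ℕ → ℕ → ι → ℕ → Set Ω := fun m ρ l k => {ω | layerShare m * x
    < |∑ i ∈ Finset.range k, Z' m ρ i ω l| ∧ ∀ i < k, |Z' m ρ i ω l| ≤ T m} with hE
  set G : ℕ → ι → ℕ → Set Ω := fun m l i => {ω | T m < |D.Z m (s + i) ω l|} with hG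
  set F : ι → Set Ω := fun l => {ω | (x / 2) ^ 2
    ≤ n * ∑ i ∈ Finset.range n, D.R (s + i) ω l ^ 2} with hF
  -- Three ways to fail: a class exceeds its share although its terms are truncated, some single
  -- term exceeds the truncation level, or the remainder is large.
  have hcover : {ω | ∃ k ≤ n, ∃ l, x < |∑ i ∈ Finset.range k, W (s + i) ω l|}
      ⊆ ⋃ l ∈ (Finset.univ : Finset ι), ((⋃ m ∈ Finset.range n, ⋃ ρ ∈ Finset.range (m + 1),
          ⋃ k ∈ Finset.range (n + 1), E m ρ l k)
        ∪ (⋃ m ∈ Finset.range n, ⋃ i ∈ Finset.range n, G m l i)) ∪ F l := by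
    rintro ω ⟨k, hk, l, hlt⟩
    refine Set.mem_iUnion₂.2 ⟨l, Finset.mem_univ l, ?_⟩
    by_contra hcon
    simp only [Set.mem_union, Set.mem_iUnion, not_or, not_exists] at hcon
    obtain ⟨⟨hc1, hc3⟩, hc2⟩ := hcon
    have hsmall : ∀ m ∈ Finset.range n, ∀ ρ, ∀ i < k, |Z' m ρ i ω l| ≤ T m := by
      intro m hm ρ i hi
      have h1 := hc3 m hm i (Finset.mem_range.2 (by omega))
      simp only [hG, Set.mem_ofPred_eq, not_lt] at h1
      simp only [hZ', residuePart]
      split_ifs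
      · exact h1
      · simpa using (hTpos m).le
    have hb1 : ∀ m ∈ Finset.range n, ∀ ρ ∈ Finset.range (m + 1),
        |∑ i ∈ Finset.range k, Z' m ρ i ω l| ≤ layerShare m * x := by
      intro m hm ρ hρ
      have h1 := hc1 m hm ρ hρ k (Finset.mem_range.2 (by omega))
      simp only [hE, Set.mem_ofPred_eq, not_and] at h1
      by_contra h2
      exact h1 (not_le.1 h2) (hsmall m hm ρ)
    have hb2 : |∑ i ∈ Finset.range k, D.R (s + i) ω l| ≤ x / 2 := by
      refine abs_le_of_sq_le_sq ?_ (by positivity)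
      simp only [hF, Set.mem_ofPred_eq, not_le] at hc2
      refine le_trans ?_ hc2.le
      have h1 := sq_sum_le_card_mul_sum_sq (s := Finset.range k) (f := fun i => D.R (s + i) ω l)
      rw [Finset.card_range] at h1
      refine h1.trans ?_
      refine mul_le_mul (by exact_mod_cast hk) ?_ (Finset.sum_nonneg fun _ _ => sq_nonneg _)
        (by positivity)
      exact Finset.sum_le_sum_of_subset_of_nonneg (Finset.range_mono hk) fun _ _ _ => sq_nonneg _
    have hdec : ∑ i ∈ Finset.range k, W (s + i) ω l
        = (∑ m ∈ Finset.range n, ∑ ρ ∈ Finset.range (m + 1),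
            ∑ i ∈ Finset.range k, Z' m ρ i ω l) + ∑ i ∈ Finset.range k, D.R (s + i) ω l := by
      simp only [D.decomp, Finset.sum_add_distrib]
      congr 1
      rw [Finset.sum_comm]
      refine Finset.sum_congr rfl fun m _ => ?_
      rw [Finset.sum_comm]
      refine Finset.sum_congr rfl fun i _ => ?_
      exact (sum_residuePart m (D.Z m) (s + i) ω l).symm
    have hle : |∑ i ∈ Finset.range k, W (s + i) ω l| ≤ x := by
      rw [hdec]
      refine (abs_add_le _ _).trans ?_
      refine (add_le_add ((Finset.abs_sum_le_sum_abs _ _).trans (Finset.sum_le_sum fun m hm =>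
        (Finset.abs_sum_le_sum_abs _ _).trans
          (Finset.sum_le_sum fun ρ hρ => hb1 m hm ρ hρ))) hb2).trans ?_
      simp only [Finset.sum_const, Finset.card_range, nsmul_eq_mul]
      have h1 := mul_le_mul_of_nonneg_right (sum_layerShare_le n) hx.le
      rw [Finset.sum_mul] at h1
      have h2 : ∑ m ∈ Finset.range n, ((m + 1 : ℕ) : ℝ) * (layerShare m * x)
          = ∑ m ∈ Finset.range n, ((m : ℝ) + 1) * layerShare m * x :=
        Finset.sum_congr rfl fun m _ => by push_cast; ring
      linarith
    linarith
  set b : ℝ := 2 * Real.exp (-A + 6 * n * v * (2 * layerSum) ^ 2 * (A / x) ^ 2) with hb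
  have hEm : ∀ m < n, ∀ ρ l, ∀ k ≤ n, P (E m ρ l k) ≤ ENNReal.ofReal b := by
    intro m hm ρ l k hk
    have hind : iIndepFun (fun i ω => Z' m ρ i ω l) P :=
      ((D.indep m ρ).precomp (add_right_injective s)).comp (fun _ y => y l)
        fun _ => measurable_pi_apply l
    have h1 := measureReal_truncated_abs_sum_gt_le hind
      (fun i => (measurable_pi_apply l).comp (measurable_residuePart (D.meas m) _))
      (fun i => D.residue_memLp m ρ _ l) (fun i => D.residue_mean m ρ _ l)
      (x := layerShare m * x) (hTpos m) k (D.residue_var_le hv hk hm l)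
    rw [← ofReal_measureReal]
    refine ENNReal.ofReal_le_ofReal (h1.trans ?_)
    rw [hb]
    gcongr 2 * Real.exp ?_
    have hp := layerShare_pos m
    refine add_le_add (le_of_eq ?_) ?_
    · simp only [hT]
      field_simp
    · calc 2 * (3 * n * v * ((((m : ℝ) + 1) ^ 3)⁻¹) ^ 2) / T m ^ 2
          = 6 * n * v * ((((m : ℝ) + 1) ^ 3)⁻¹ / layerShare m) ^ 2 * (A / x) ^ 2 := by
            simp only [hT]
            field_simp
            ring
        _ ≤ _ := by
            gcongr
            exact inv_cube_div_layerShare_le m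
  have hGm : ∀ m l i, P (G m l i) ≤ ENNReal.ofReal
      (κ * ((((m : ℝ) + 1) ^ 3)⁻¹ / layerShare m) ^ r * (A / x) ^ r) := by
    intro m l i
    refine (htail m (s + i) l (T m) (hTpos m)).trans (ENNReal.ofReal_le_ofReal (le_of_eq ?_))
    have hp := layerShare_pos m
    rw [mul_assoc, ← mul_pow]
    congr 2
    simp only [hT]
    field_simp
  have hFm : ∀ l, P (F l) ≤ ENNReal.ofReal (4 * v / x ^ 2) := by
    intro l
    have hint : Integrable (fun ω => n * ∑ i ∈ Finset.range n, D.R (s + i) ω l ^ 2) P :=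
      (integrable_finsetSum _ fun i _ => (D.R_memLp (s + i) l).integrable_sq).const_mul _
    have h1 := mul_meas_ge_le_integral_of_nonneg (Eventually.of_forall fun ω =>
      mul_nonneg (Nat.cast_nonneg n)
        (Finset.sum_nonneg fun i _ => sq_nonneg (D.R (s + i) ω l))) hint ((x / 2) ^ 2)
    have h2 := D.integral_remainder_le s l le_rfl hv
    have h4 : n * v * ((n : ℝ) ^ 3)⁻¹ ≤ v := by
      rcases Nat.eq_zero_or_pos n with rfl | hn
      · simpa using hv
      · have hn' : (1 : ℝ) ≤ n := by exact_mod_cast hn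
        rw [← div_eq_mul_inv, div_le_iff₀ (by positivity), mul_comm]
        gcongr
        exact le_self_pow₀ hn' (by norm_num)
    rw [← ofReal_measureReal]
    refine ENNReal.ofReal_le_ofReal ?_
    rw [le_div_iff₀ (by positivity)]
    have h3 := (h1.trans h2).trans h4
    change (x / 2) ^ 2 * P.real (F l) ≤ v at h3
    nlinarith
  have hb0 : 0 ≤ b := by positivity
  have hl : ∀ l, P (((⋃ m ∈ Finset.range n, ⋃ ρ ∈ Finset.range (m + 1),
          ⋃ k ∈ Finset.range (n + 1), E m ρ l k)
        ∪ (⋃ m ∈ Finset.range n, ⋃ i ∈ Finset.range n, G m l i)) ∪ F l)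
      ≤ ENNReal.ofReal (n ^ 2 * (n + 1) * b
          + n * κ * ((2 * layerSum) ^ r * layerSum) * (A / x) ^ r + 4 * v / x ^ 2) := by
    intro l
    have g1 : P (⋃ m ∈ Finset.range n, ⋃ ρ ∈ Finset.range (m + 1),
        ⋃ k ∈ Finset.range (n + 1), E m ρ l k) ≤ ENNReal.ofReal (n ^ 2 * (n + 1) * b) := by
      refine (measure_biUnion_finset_le _ _).trans ?_
      have : ∀ m ∈ Finset.range n, P (⋃ ρ ∈ Finset.range (m + 1),
          ⋃ k ∈ Finset.range (n + 1), E m ρ l k) ≤ ENNReal.ofReal (n * ((n + 1) * b)) := by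
        intro m hm
        refine (measure_biUnion_finset_le _ _).trans ?_
        have h1 : ∀ ρ ∈ Finset.range (m + 1), P (⋃ k ∈ Finset.range (n + 1), E m ρ l k)
            ≤ ENNReal.ofReal ((n + 1) * b) := by
          intro ρ _
          refine (measure_biUnion_finset_le _ _).trans ?_
          refine (Finset.sum_le_sum fun k hk => hEm m (Finset.mem_range.1 hm) ρ l k
            (Nat.lt_succ_iff.1 (Finset.mem_range.1 hk))).trans ?_
          rw [← ENNReal.ofReal_sum_of_nonneg fun _ _ => hb0]
          refine ENNReal.ofReal_le_ofReal (le_of_eq ?_)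
          simp
        refine (Finset.sum_le_sum h1).trans ?_
        rw [← ENNReal.ofReal_sum_of_nonneg fun _ _ => by positivity]
        refine ENNReal.ofReal_le_ofReal ?_
        rw [Finset.sum_const, Finset.card_range, nsmul_eq_mul]
        have : ((m + 1 : ℕ) : ℝ) ≤ n := by exact_mod_cast Finset.mem_range.1 hm
        gcongr
      refine (Finset.sum_le_sum this).trans ?_
      rw [← ENNReal.ofReal_sum_of_nonneg fun _ _ => by positivity]
      refine ENNReal.ofReal_le_ofReal (le_of_eq ?_)
      simp only [Finset.sum_const, Finset.card_range, nsmul_eq_mul]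
      ring
    have g2 : P (⋃ m ∈ Finset.range n, ⋃ i ∈ Finset.range n, G m l i)
        ≤ ENNReal.ofReal (n * κ * ((2 * layerSum) ^ r * layerSum) * (A / x) ^ r) := by
      have hnn : ∀ m : ℕ, 0 ≤ κ * ((((m : ℝ) + 1) ^ 3)⁻¹ / layerShare m) ^ r * (A / x) ^ r := by
        intro m
        have hp := layerShare_pos m
        positivity
      refine (measure_biUnion_finset_le _ _).trans ?_
      refine (Finset.sum_le_sum fun m _ => (measure_biUnion_finset_le _ _).trans
        (Finset.sum_le_sum fun i _ => hGm m l i)).trans ?_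
      simp_rw [Finset.sum_const, Finset.card_range]
      rw [← Finset.smul_sum, ← ENNReal.ofReal_sum_of_nonneg fun m _ => hnn m, nsmul_eq_mul,
        ← ENNReal.ofReal_natCast, ← ENNReal.ofReal_mul (Nat.cast_nonneg n)]
      refine ENNReal.ofReal_le_ofReal ?_
      rw [← Finset.sum_mul, ← Finset.mul_sum, mul_assoc (n : ℝ) κ, mul_assoc (n : ℝ)]
      gcongr
      exact sum_inv_cube_div_layerShare_le n hr
    refine (measure_union_le _ _).trans ?_
    refine (add_le_add ((measure_union_le _ _).trans (add_le_add g1 g2)) (hFm l)).trans ?_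
    rw [← ENNReal.ofReal_add (by positivity) (by positivity),
      ← ENNReal.ofReal_add (by positivity) (by positivity)]
  refine (measure_mono hcover).trans ((measure_biUnion_finset_le _ _).trans ?_)
  refine (Finset.sum_le_sum fun l _ => hl l).trans ?_
  rw [← ENNReal.ofReal_sum_of_nonneg fun _ _ => by positivity]
  refine ENNReal.ofReal_le_ofReal (le_of_eq ?_)
  rw [Finset.sum_const, Finset.card_univ, nsmul_eq_mul, hb]
  ring

end Layered

end Layered

end FTSBreak

namespace FTSBreak

set_option linter.unusedSectionVars false

/-! ### Decoupling independent arguments -/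

section Decouple

variable {Ω α β : Type*} [MeasurableSpace Ω] [MeasurableSpace α] [MeasurableSpace β]
  {P : Measure Ω} [IsProbabilityMeasure P] {A : Ω → α} {B : Ω → β}

/-- Independence makes the joint law a product, so by Tonelli's theorem `B` may be evaluated at a
second sample point, which acts as an independent copy. -/
lemma lintegral_decouple (hA : Measurable A) (hB : Measurable B) (h : IndepFun A B P)
    {F : α → β → ℝ≥0∞} (hF : Measurable (Function.uncurry F)) :
    ∫⁻ ω, F (A ω) (B ω) ∂P = ∫⁻ ω, ∫⁻ ω', F (A ω) (B ω') ∂P ∂P := by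
  have h1 := (indepFun_iff_map_prod_eq_prod_map_map hA.aemeasurable hB.aemeasurable).1 h
  have : IsProbabilityMeasure (P.map B) := Measure.isProbabilityMeasure_map hB.aemeasurable
  calc ∫⁻ ω, F (A ω) (B ω) ∂P = ∫⁻ q, Function.uncurry F q ∂(P.map fun ω => (A ω, B ω)) := by
        rw [lintegral_map hF (hA.prodMk hB)]
        rfl
    _ = ∫⁻ a, ∫⁻ b, F a b ∂(P.map B) ∂(P.map A) := by
        rw [h1, lintegral_prod _ hF.aemeasurable]
        rfl
    _ = _ := by
        have hm : Measurable fun a => ∫⁻ b, F a b ∂(P.map B) := hF.lintegral_prod_right'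
        rw [lintegral_map hm hA]
        refine lintegral_congr fun ω => ?_
        exact lintegral_map (hF.comp measurable_prodMk_left) hB

lemma integral_decouple (hA : Measurable A) (hB : Measurable B) (h : IndepFun A B P)
    {F : α → β → ℝ} (hF : Measurable (Function.uncurry F))
    (hint : Integrable (fun ω => F (A ω) (B ω)) P) :
    ∫ ω, F (A ω) (B ω) ∂P = ∫ ω, ∫ ω', F (A ω) (B ω') ∂P ∂P := by
  have h1 := (indepFun_iff_map_prod_eq_prod_map_map hA.aemeasurable hB.aemeasurable).1 h
  have : IsProbabilityMeasure (P.map B) := Measure.isProbabilityMeasure_map hB.aemeasurable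
  have : IsProbabilityMeasure (P.map A) := Measure.isProbabilityMeasure_map hA.aemeasurable
  have hi : Integrable (Function.uncurry F) ((P.map A).prod (P.map B)) := by
    rw [← h1, integrable_map_measure hF.aestronglyMeasurable (hA.prodMk hB).aemeasurable]
    exact hint
  calc ∫ ω, F (A ω) (B ω) ∂P = ∫ q, Function.uncurry F q ∂(P.map fun ω => (A ω, B ω)) := by
        rw [integral_map (hA.prodMk hB).aemeasurable hF.aestronglyMeasurable]
        rfl
    _ = ∫ a, ∫ b, F a b ∂(P.map B) ∂(P.map A) := by
        rw [h1, integral_prod _ hi]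
        rfl
    _ = _ := by
        rw [integral_map hA.aemeasurable
          (hF.stronglyMeasurable.integral_prod_right).aestronglyMeasurable]
        refine integral_congr_ae (Eventually.of_forall fun ω => ?_)
        exact integral_map hB.aemeasurable (hF.comp measurable_prodMk_left).aestronglyMeasurable

lemma ae_integrable_decouple (hA : Measurable A) (hB : Measurable B) (h : IndepFun A B P)
    {F : α → β → ℝ} (hF : Measurable (Function.uncurry F))
    (hint : Integrable (fun ω => F (A ω) (B ω)) P) :
    ∀ᵐ ω ∂P, Integrable (fun ω' => F (A ω) (B ω')) P := by
  have h1 := lintegral_decouple hA hB h (F := fun a b => ‖F a b‖ₑ) hF.enorm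
  have h2 : ∫⁻ ω, ∫⁻ ω', ‖F (A ω) (B ω')‖ₑ ∂P ∂P ≠ ∞ := by
    rw [← h1]
    exact hint.2.ne
  have hm : Measurable fun ω => ∫⁻ ω', ‖F (A ω) (B ω')‖ₑ ∂P := by
    refine Measurable.lintegral_prod_right' (f := fun q : Ω × Ω => ‖F (A q.1) (B q.2)‖ₑ) ?_
    exact (hF.comp ((hA.comp measurable_fst).prodMk (hB.comp measurable_snd))).enorm
  filter_upwards [ae_lt_top hm h2] with ω hω
  exact ⟨(hF.comp (measurable_prodMk_left.comp hB)).aestronglyMeasurable, hω⟩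

/-- Jensen's inequality for a probability measure, in extended nonnegative form. -/
lemma lintegral_pow_le {f : Ω → ℝ≥0∞} (hf : AEMeasurable f P) {r : ℕ} (hr : 1 ≤ r) :
    (∫⁻ ω, f ω ∂P) ^ r ≤ ∫⁻ ω, f ω ^ r ∂P := by
  have hr' : (1 : ℝ) ≤ r := by exact_mod_cast hr
  have h := eLpNorm'_le_eLpNorm'_of_exponent_le (f := f) (μ := P) one_pos hr'
    hf.aestronglyMeasurable
  have hr0 : (r : ℝ) ≠ 0 := by positivity
  simp only [eLpNorm', enorm_eq_self, ENNReal.rpow_one, div_one, ENNReal.rpow_natCast] at h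
  calc (∫⁻ ω, f ω ∂P) ^ r ≤ ((∫⁻ ω, f ω ^ r ∂P) ^ (1 / (r : ℝ))) ^ r := by gcongr
    _ = _ := by
        rw [← ENNReal.rpow_natCast, ← ENNReal.rpow_mul, one_div, inv_mul_cancel₀ hr0,
          ENNReal.rpow_one]

lemma enorm_integral_pow_le {f : Ω → ℝ} (hf : AEMeasurable f P) {r : ℕ} (hr : 1 ≤ r) :
    ‖∫ ω, f ω ∂P‖ₑ ^ r ≤ ∫⁻ ω, ‖f ω‖ₑ ^ r ∂P :=
  (pow_le_pow_left₀ zero_le (enorm_integral_le_lintegral_enorm f) r).trans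
    (lintegral_pow_le hf.enorm hr)

end Decouple

section Groups

variable {Ω κ α : Type*} [MeasurableSpace Ω] {P : Measure Ω} {m : κ → MeasurableSpace Ω}

lemma measure_biInter_of_iIndep_comp {I : Type*} {g : I → κ} (hg : Function.Injective g)
    (h : iIndep (fun i => m (g i)) P) {s : Finset κ} (hs : ∀ x ∈ s, x ∈ Set.range g)
    {f : κ → Set Ω} (hf : ∀ x ∈ s, MeasurableSet[m x] (f x)) :
    P (⋂ x ∈ s, f x) = ∏ x ∈ s, P (f x) := by
  classical
  obtain ⟨t, rfl⟩ : ∃ t : Finset I, s = t.image g := by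
    refine ⟨s.preimage g hg.injOn, ?_⟩
    rw [Finset.image_preimage]
    exact (Finset.filter_true_of_mem hs).symm
  rw [Finset.set_biInter_finset_image, Finset.prod_image fun a _ b _ hab => hg hab]
  exact (iIndep_iff _ _).1 h t fun i hi => hf _ (Finset.mem_image_of_mem g hi)

/-- A family of σ-algebras is independent if it consists of groups that are mutually independent
and independent inside. -/
lemma iIndep_of_groups [Fintype α] {τ : κ → α} {G : α → MeasurableSpace Ω} (hG : iIndep G P)
    (hle : ∀ x, m x ≤ G (τ x))
    (hin : ∀ a, ∀ s : Finset κ, (∀ x ∈ s, τ x = a) → ∀ f : κ → Set Ω,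
      (∀ x ∈ s, MeasurableSet[m x] (f x)) → P (⋂ x ∈ s, f x) = ∏ x ∈ s, P (f x)) :
    iIndep m P := by
  classical
  rw [iIndep_iff]
  intro s f hf
  have e1 : ⋂ x ∈ s, f x = ⋂ a ∈ (Finset.univ : Finset α), ⋂ x ∈ s.filter (τ · = a), f x := by
    ext ω
    simp only [Set.mem_iInter, Finset.mem_univ, Finset.mem_filter, true_implies]
    exact ⟨fun h a x hx => h x hx.1, fun h x hx => h (τ x) x ⟨hx, rfl⟩⟩
  rw [e1, (iIndep_iff _ _).1 hG Finset.univ (f := fun a => ⋂ x ∈ s.filter (τ · = a), f x),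
    ← Finset.prod_fiberwise s τ]
  · refine Finset.prod_congr rfl fun a _ => ?_
    exact hin a _ (fun x hx => (Finset.mem_filter.1 hx).2) f
      fun x hx => hf x (Finset.mem_filter.1 hx).1
  · intro a _
    refine Finset.measurableSet_biInter _ fun x hx => ?_
    rw [Finset.mem_filter] at hx
    have := hle x _ (hf x hx.1)
    rwa [hx.2] at this

end Groups

/-! ### Independence in the model -/

/-- The sources of randomness of the model. -/
inductive Src where
  | e (k : ℤ)
  | X (i j : ℕ)
  | err (i j : ℕ)
  | N (i : ℕ)

namespace Model

variable {Ω S : Type*} [MeasurableSpace Ω] [MeasurableSpace S]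

/-- The σ-algebra of one source of randomness. -/
@[reducible]
def srcAlg (M : Model Ω S) (n : ℕ) : Src → MeasurableSpace Ω
  | .e k => MeasurableSpace.comap (M.e k) inferInstance
  | .X i j => MeasurableSpace.comap (M.X i j) inferInstance
  | .err i j => MeasurableSpace.comap (M.err i j) inferInstance
  | .N i => MeasurableSpace.comap (M.N n i) inferInstance

/-- The σ-algebra of a set of sources of randomness. -/
@[reducible]
def srcSup (M : Model Ω S) (n : ℕ) (A : Set Src) : MeasurableSpace Ω := ⨆ a ∈ A, M.srcAlg n a

variable {P : Measure Ω} {M : Model Ω S} {ε : ℝ}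

lemma srcAlg_le (hM : M.Standing P ε) (n : ℕ) (a : Src) :
    M.srcAlg n a ≤ ‹MeasurableSpace Ω› := by
  cases a with
  | e k => exact (hM.e_meas k).comap_le
  | X i j => exact (hM.X_meas i j).comap_le
  | err i j => exact (hM.err_meas i j).comap_le
  | N i => exact (hM.N_meas n i).comap_le

lemma srcSup_le (hM : M.Standing P ε) (n : ℕ) (A : Set Src) :
    M.srcSup n A ≤ ‹MeasurableSpace Ω› := iSup₂_le fun a _ => srcAlg_le hM n a

lemma measurable_e_src {n : ℕ} {A : Set Src} {k : ℤ} (h : Src.e k ∈ A) :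
    Measurable[M.srcSup n A] (M.e k) :=
  (comap_measurable (M.e k)).mono (le_iSup₂_of_le (f := fun a (_ : a ∈ A) => M.srcAlg n a)
    _ h le_rfl) le_rfl

lemma measurable_X_src {n : ℕ} {A : Set Src} {i j : ℕ} (h : Src.X i j ∈ A) :
    Measurable[M.srcSup n A] (M.X i j) :=
  (comap_measurable (M.X i j)).mono (le_iSup₂_of_le (f := fun a (_ : a ∈ A) => M.srcAlg n a)
    _ h le_rfl) le_rfl

lemma measurable_err_src {n : ℕ} {A : Set Src} {i j : ℕ} (h : Src.err i j ∈ A) :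
    Measurable[M.srcSup n A] (M.err i j) :=
  (comap_measurable (M.err i j)).mono (le_iSup₂_of_le (f := fun a (_ : a ∈ A) => M.srcAlg n a)
    _ h le_rfl) le_rfl

lemma measurable_N_src {n : ℕ} {A : Set Src} {i : ℕ} (h : Src.N i ∈ A) :
    Measurable[M.srcSup n A] (M.N n i) :=
  (comap_measurable (M.N n i)).mono (le_iSup₂_of_le (f := fun a (_ : a ∈ A) => M.srcAlg n a)
    _ h le_rfl) le_rfl

/-- The four families are independent of each other and internally, hence all single sources are
mutually independent. Later independence claims about observed data then reduce to disjointness of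
sets of sources. -/
lemma iIndep_srcAlg (hM : M.Standing P ε) (n : ℕ) : iIndep (M.srcAlg n) P := by
  set τ : Src → Fin 4 := fun a => match a with
    | .e _ => 0
    | .X _ _ => 1
    | .err _ _ => 2
    | .N _ => 3 with hτ
  refine iIndep_of_groups (τ := τ) (hM.indep n) ?_ ?_
  · intro a
    cases a with
    | e k => exact le_iSup (fun k => MeasurableSpace.comap (M.e k) inferInstance) k
    | X i j =>
      exact le_iSup₂ (f := fun i j => MeasurableSpace.comap (M.X i j) inferInstance) i j
    | err i j =>
      exact le_iSup₂ (f := fun i j => MeasurableSpace.comap (M.err i j) inferInstance) i j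
    | N i => exact le_iSup (fun i => MeasurableSpace.comap (M.N n i) inferInstance) i
  · intro a s hs f hf
    have hcase : a = 0 ∨ a = 1 ∨ a = 2 ∨ a = 3 := by omega
    rcases hcase with rfl | rfl | rfl | rfl
    · refine measure_biInter_of_iIndep_comp (m := M.srcAlg n) (g := Src.e) (fun _ _ h => by simpa using h) ((iIndepFun_iff_iIndep _ _ _).1 hM.e_indep)
        (fun x hx => ?_) hf
      have := hs x hx
      cases x <;> simp_all
    · refine measure_biInter_of_iIndep_comp (m := M.srcAlg n) (g := fun ij : ℕ × ℕ => Src.X ij.1 ij.2)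
        (fun _ _ h => by simpa [Prod.ext_iff] using h) ((iIndepFun_iff_iIndep _ _ _).1 hM.X_indep) (fun x hx => ?_) hf
      have := hs x hx
      cases x <;> simp_all
    · refine measure_biInter_of_iIndep_comp (m := M.srcAlg n) (g := fun ij : ℕ × ℕ => Src.err ij.1 ij.2)
        (fun _ _ h => by simpa [Prod.ext_iff] using h) ((iIndepFun_iff_iIndep _ _ _).1 hM.err_indep) (fun x hx => ?_) hf
      have := hs x hx
      cases x <;> simp_all
    · refine measure_biInter_of_iIndep_comp (m := M.srcAlg n) (g := Src.N) (fun _ _ h => by simpa using h)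
        ((iIndepFun_iff_iIndep _ _ _).1 (hM.N_indep n)) (fun x hx => ?_) hf
      have := hs x hx
      cases x <;> simp_all

lemma indepFun_of_src (hM : M.Standing P ε) {n : ℕ} {A B : Set Src} (hAB : Disjoint A B)
    {β γ : Type*} [MeasurableSpace β] [MeasurableSpace γ] {f : Ω → β} {g : Ω → γ}
    (hf : Measurable[M.srcSup n A] f) (hg : Measurable[M.srcSup n B] g) : IndepFun f g P := by
  rw [IndepFun_iff_Indep]
  exact indep_of_indep_of_le (indep_iSup_of_disjoint (srcAlg_le hM n) (iIndep_srcAlg hM n) hAB)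
    hf.comap_le hg.comap_le

end Model

end FTSBreak

namespace FTSBreak

set_option linter.unusedSectionVars false

/-! ### Finite-dependence approximation of the error process -/

/-- The first `m + 1` terms of `s` followed by the terms of `y`. -/
def splice {S : Type*} (m : ℕ) (s y : ℕ → S) : ℕ → S := fun k => if k ≤ m then s k else y k

/-- The sequence `s` frozen after time `m`. -/
def freeze {S : Type*} (m : ℕ) (s : ℕ → S) : ℕ → S := fun k => s (min k m)

lemma splice_freeze {S : Type*} (m : ℕ) (s y : ℕ → S) :
    splice m (freeze m s) y = splice m s y := by
  funext k
  by_cases h : k ≤ m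
  · simp [splice, freeze, h]
  · simp [splice, h]

lemma freeze_splice {S : Type*} (m : ℕ) (s y : ℕ → S) :
    freeze m (splice m s y) = freeze m s := by
  funext k
  simp [splice, freeze]

lemma measurable_splice {S : Type*} [MeasurableSpace S] (m : ℕ) :
    Measurable fun q : (ℕ → S) × (ℕ → S) => splice m q.1 q.2 := by
  refine measurable_pi_iff.2 fun k => ?_
  by_cases h : k ≤ m
  · simp only [splice, h, if_true]
    exact (measurable_pi_apply k).comp measurable_fst
  · simp only [splice, h, if_false]
    exact (measurable_pi_apply k).comp measurable_snd

lemma measurable_freeze {S : Type*} [MeasurableSpace S] (m : ℕ) :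
    Measurable (freeze (S := S) m) :=
  measurable_pi_iff.2 fun _ => measurable_pi_apply _

lemma lintegral_enorm_pow_eq {Ω : Type*} [MeasurableSpace Ω] {P : Measure Ω} (f : Ω → ℝ) {r : ℕ}
    (hr : 1 ≤ r) : ∫⁻ ω, ‖f ω‖ₑ ^ r ∂P = eLpNorm f r P ^ r := by
  have hr0 : (r : ℝ) ≠ 0 := by positivity
  rw [eLpNorm_eq_lintegral_rpow_enorm_toReal (by positivity) (by simp)]
  simp only [ENNReal.toReal_natCast, ENNReal.rpow_natCast]
  rw [← ENNReal.rpow_natCast, ← ENNReal.rpow_mul, one_div, inv_mul_cancel₀ hr0, ENNReal.rpow_one]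

namespace Model

variable {Ω S : Type*} [MeasurableSpace Ω] [MeasurableSpace S] {P : Measure Ω}
  [IsProbabilityMeasure P] {M : Model Ω S} {ε : ℝ}

/-- Future innovations, used as independent copies of past ones. -/
def fut (M : Model Ω S) (ω : Ω) : ℕ → S := fun k => M.e (k + 1) ω

/-- The filter `H`, averaged over all but the last `m + 1` innovations. -/
noncomputable def Hm (M : Model Ω S) (P : Measure Ω) (m : ℕ) (x : ℝ) (s : ℕ → S) : ℝ :=
  ∫ ω, M.H x (splice m s (M.fut ω)) ∂P

/-- The time indices of `splice m (past 0) fut`. -/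
def spliceIdx (m k : ℕ) : ℤ := if k ≤ m then 0 - (k : ℤ) else (k : ℤ) + 1

lemma spliceIdx_injective (m : ℕ) : Function.Injective (spliceIdx m) := by
  intro a b h
  unfold spliceIdx at h
  split_ifs at h <;> omega

lemma spliceIdx_ne (m k : ℕ) : spliceIdx m k ≠ (m : ℤ) + 1 := by
  unfold spliceIdx
  split_ifs <;> omega

lemma splice_past_fut (m : ℕ) (ω : Ω) :
    splice m (M.past 0 ω) (M.fut ω) = fun k => M.e (spliceIdx m k) ω := by
  funext k
  by_cases h : k ≤ m <;> simp [splice, spliceIdx, past, fut, h]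

lemma measurable_seq (hM : M.Standing P ε) (τ : ℕ → ℤ) :
    Measurable fun ω k => M.e (τ k) ω := measurable_pi_iff.2 fun k => hM.e_meas (τ k)

lemma measurable_past (hM : M.Standing P ε) (i : ℤ) : Measurable (M.past i) :=
  measurable_seq hM fun k => i - k

lemma measurable_fut (hM : M.Standing P ε) : Measurable M.fut :=
  measurable_seq hM fun k => (k : ℤ) + 1

lemma map_seq (hM : M.Standing P ε) {τ : ℕ → ℤ} (hτ : Function.Injective τ) :
    P.map (fun ω k => M.e (τ k) ω) = Measure.infinitePi fun _ : ℕ => P.map (M.e 0) := by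
  rw [(hM.e_indep.precomp hτ).map_fun_eq_infinitePi_map fun k => hM.e_meas (τ k)]
  congr 1
  funext k
  exact (hM.e_ident (τ k)).map_eq

lemma identDistrib_seq (hM : M.Standing P ε) {τ τ' : ℕ → ℤ} (hτ : Function.Injective τ)
    (hτ' : Function.Injective τ') :
    IdentDistrib (fun ω k => M.e (τ k) ω) (fun ω k => M.e (τ' k) ω) P P :=
  ⟨(measurable_seq hM τ).aemeasurable, (measurable_seq hM τ').aemeasurable,
    (map_seq hM hτ).trans (map_seq hM hτ').symm⟩

lemma past_injective (i : ℤ) : Function.Injective fun k : ℕ => i - (k : ℤ) := by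
  intro a b h
  simpa using h

lemma identDistrib_past (hM : M.Standing P ε) (i : ℤ) :
    IdentDistrib (M.past i) (M.past 0) P P :=
  identDistrib_seq hM (past_injective i) (past_injective 0)

lemma identDistrib_splice (hM : M.Standing P ε) (m : ℕ) :
    IdentDistrib (fun ω => splice m (M.past 0 ω) (M.fut ω)) (M.past 0) P P := by
  simp only [splice_past_fut]
  exact identDistrib_seq hM (spliceIdx_injective m) (past_injective 0)

lemma indepFun_past_fut (hM : M.Standing P ε) (i : ℤ) (hi : i ≤ 0) :
    IndepFun (M.past i) M.fut P := by
  refine indepFun_of_src hM (n := 0) (A := {a | ∃ k ≤ 0, a = Src.e k})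
    (B := {a | ∃ k > 0, a = Src.e k}) ?_ ?_ ?_
  · rw [Set.disjoint_left]
    rintro a ⟨k, hk, rfl⟩ ⟨l, hl, h⟩
    cases h
    omega
  · exact @measurable_pi_iff _ _ _ (_) _ _ |>.2
      fun k => measurable_e_src ⟨i - k, by omega, rfl⟩
  · exact @measurable_pi_iff _ _ _ (_) _ _ |>.2
      fun k => measurable_e_src ⟨(k : ℤ) + 1, by omega, rfl⟩

/-- Position `k > m` of the splice carries `e (k+1)`, so `e (m+1)`, which is `fut m`, never occurs
in it and can play the role of `eStar`. Both pairs then have the product of the law of an i.i.d.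
sequence with the law of one innovation. -/
lemma identDistrib_splice_star (hM : M.Standing P ε) (m : ℕ) :
    IdentDistrib (fun ω => (splice m (M.past 0 ω) (M.fut ω), M.fut ω m))
      (fun ω => (M.past m ω, M.eStar ω)) P P := by
  have h1 : IndepFun (fun ω => splice m (M.past 0 ω) (M.fut ω)) (fun ω => M.fut ω m) P := by
    simp only [splice_past_fut]
    refine indepFun_of_src hM (n := 0) (A := {a | ∃ k ≠ (m : ℤ) + 1, a = Src.e k})
      (B := {Src.e (m + 1)}) ?_ ?_ ?_
    · rw [Set.disjoint_left]
      rintro a ⟨k, hk, rfl⟩ h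
      exact hk (by simpa using h)
    · exact @measurable_pi_iff _ _ _ (_) _ _ |>.2
        fun k => measurable_e_src ⟨_, spliceIdx_ne m k, rfl⟩
    · exact measurable_e_src rfl
  have h2 : IndepFun (M.past m) M.eStar P :=
    (hM.eStar_indep.comp measurable_id
      (measurable_pi_iff.2 fun k : ℕ => measurable_pi_apply ((m : ℤ) - k))).symm
  have hs : AEMeasurable M.eStar P := hM.eStar_ident.aemeasurable_fst
  have hspl : Measurable fun ω => splice m (M.past 0 ω) (M.fut ω) :=
    (measurable_splice m).comp ((measurable_past hM 0).prodMk (measurable_fut hM))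
  have hf : Measurable fun ω => M.fut ω m := hM.e_meas _
  refine ⟨(hspl.prodMk hf).aemeasurable,
    (measurable_past hM m).aemeasurable.prodMk hs, ?_⟩
  rw [(indepFun_iff_map_prod_eq_prod_map_map hspl.aemeasurable hf.aemeasurable).1 h1,
    (indepFun_iff_map_prod_eq_prod_map_map (measurable_past hM m).aemeasurable hs).1 h2,
    (identDistrib_splice hM m).map_eq, (identDistrib_past hM m).map_eq,
    hM.eStar_ident.map_eq]
  congr 1
  exact (hM.e_ident _).map_eq

lemma pastStar_eq (m : ℕ) (ω : Ω) :
    M.pastStar m ω = Function.update (M.past m ω) m (M.eStar ω) := by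
  funext k
  by_cases h : k = m
  · subst h
    simp [pastStar]
  · have : (m : ℤ) - k ≠ 0 := by omega
    simp [pastStar, past, h, this]

lemma splice_pred_eq (m : ℕ) (ω : Ω) :
    splice m (M.past 0 ω) (M.fut ω)
      = Function.update (splice (m + 1) (M.past 0 ω) (M.fut ω)) (m + 1) (M.fut ω (m + 1)) := by
  funext k
  by_cases h : k = m + 1
  · subst h
    simp [splice]
  · by_cases h' : k ≤ m
    · simp [splice, h, h', h'.trans (Nat.le_succ m)]
    · have : ¬ k ≤ m + 1 := by omega
      simp [splice, h, h', this]

/-- Passing from `splice (m+1)` to `splice m` exchanges one coordinate for a fresh innovation. In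
law this is the replacement of `e 0` by `eStar` in the past of time `m + 1`, which is what the
dependence measure records. -/
lemma eLpNorm_splice_sub_eq (hM : M.Standing P ε) (x : ℝ) (m : ℕ) (r : ℝ≥0∞) :
    eLpNorm (fun ω => M.H x (splice (m + 1) (M.past 0 ω) (M.fut ω))
      - M.H x (splice m (M.past 0 ω) (M.fut ω))) r P
    = eLpNorm (fun ω => M.H x (M.past ((m + 1 : ℕ) : ℤ) ω)
      - M.H x (M.pastStar ((m + 1 : ℕ) : ℤ) ω)) r P := by
  have hH : Measurable (M.H x) := hM.H_meas.comp measurable_prodMk_left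
  have hu : Measurable fun q : (ℕ → S) × S => M.H x q.1 - M.H x (Function.update q.1 (m + 1) q.2) :=
    (hH.comp measurable_fst).sub (hH.comp measurable_update')
  have h := ((identDistrib_splice_star hM (m + 1)).comp hu).eLpNorm_eq r
  simp only [Function.comp_def, ← splice_pred_eq, ← pastStar_eq] at h
  exact h

lemma eLpNorm_splice_sub_le (hM : M.Standing P ε) {x : ℝ} (hx : x ∈ Set.Icc (0 : ℝ) 1) (m : ℕ)
    (r : ℝ≥0∞) :
    eLpNorm (fun ω => M.H x (splice (m + 1) (M.past 0 ω) (M.fut ω))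
      - M.H x (splice m (M.past 0 ω) (M.fut ω))) r P ≤ M.depMeasure P (m + 1) r := by
  rw [eLpNorm_splice_sub_eq hM]
  exact le_iSup₂ (f := fun x (_ : x ∈ Set.Icc (0 : ℝ) 1) =>
    eLpNorm (fun ω => M.H x (M.past ((m + 1 : ℕ) : ℤ) ω)
      - M.H x (M.pastStar ((m + 1 : ℕ) : ℤ) ω)) r P) x hx

/-- A crude bound by twice the moment of `ξ`, for the finitely many lags at which the polynomial
decay need not hold yet. -/
lemma depMeasure_le (hM : M.Standing P ε) {r : ℕ} (hr : 1 ≤ r) {C : ℝ≥0∞}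
    (hC : ∀ x ∈ Set.Icc (0 : ℝ) 1, eLpNorm (M.ξ 0 x) r P ≤ C) (m : ℕ) :
    M.depMeasure P (m + 1) r ≤ C + C := by
  refine iSup₂_le fun x hx => ?_
  have hH : Measurable (M.H x) := hM.H_meas.comp measurable_prodMk_left
  have hmeas : ∀ m, AEStronglyMeasurable
      (fun ω => M.H x (splice m (M.past 0 ω) (M.fut ω))) P := fun m =>
    (hH.comp ((measurable_splice m).comp
      ((measurable_past hM 0).prodMk (measurable_fut hM)))).aestronglyMeasurable
  have hle : ∀ m, eLpNorm (fun ω => M.H x (splice m (M.past 0 ω) (M.fut ω))) r P ≤ C := fun m =>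
    (((identDistrib_splice hM m).comp hH).eLpNorm_eq r).trans_le (hC x hx)
  refine (eLpNorm_splice_sub_eq hM x m r).symm.trans_le ?_
  exact (eLpNorm_sub_le (hmeas _) (hmeas _) (by exact_mod_cast hr)).trans
    (add_le_add (hle _) (hle _))

lemma measurable_Hm (hM : M.Standing P ε) (m : ℕ) :
    Measurable fun q : ℝ × (ℕ → S) => M.Hm P m q.1 q.2 := by
  have h : StronglyMeasurable fun q : (ℝ × (ℕ → S)) × Ω =>
      M.H q.1.1 (splice m q.1.2 (M.fut q.2)) := by
    have h1 : Measurable fun q : (ℝ × (ℕ → S)) × Ω => (q.1.1, splice m q.1.2 (M.fut q.2)) :=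
      (measurable_fst.comp measurable_fst).prodMk ((measurable_splice m).comp
      ((measurable_snd.comp measurable_fst).prodMk ((measurable_fut hM).comp measurable_snd)))
    exact (hM.H_meas.comp h1).stronglyMeasurable
  exact h.integral_prod_right.measurable

lemma Hm_freeze (m : ℕ) (x : ℝ) (s : ℕ → S) : M.Hm P m x (freeze m s) = M.Hm P m x s := by
  simp only [Hm, splice_freeze]

lemma measurable_H_splice (hM : M.Standing P ε) (m : ℕ) (x : ℝ) :
    Measurable (Function.uncurry fun (s y : ℕ → S) => M.H x (splice m s y)) :=
  (hM.H_meas.comp measurable_prodMk_left).comp (measurable_splice m)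

lemma integrable_H_splice (hM : M.Standing P ε) {x : ℝ} (hx : x ∈ Set.Icc (0 : ℝ) 1) (m : ℕ) :
    Integrable (fun ω => M.H x (splice m (M.past 0 ω) (M.fut ω))) P :=
  ((identDistrib_splice hM m).comp (hM.H_meas.comp measurable_prodMk_left)).integrable_iff.2
    (hM.ξ_integrable x hx)

lemma ae_integrable_H_splice (hM : M.Standing P ε) {x : ℝ} (hx : x ∈ Set.Icc (0 : ℝ) 1) (m : ℕ) :
    ∀ᵐ ω ∂P, Integrable (fun ω' => M.H x (splice m (M.past 0 ω) (M.fut ω'))) P :=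
  ae_integrable_decouple (measurable_past hM 0) (measurable_fut hM)
    (indepFun_past_fut hM 0 le_rfl) (measurable_H_splice hM m x) (integrable_H_splice hM hx m)

/-- Averaging out the older innovations contracts `L^r` norms: Jensen's inequality inside, then
decoupling and equality in law of the splice with the past. -/
lemma lintegral_Hm_pow_le (hM : M.Standing P ε) (m : ℕ) (x : ℝ) {r : ℕ} (hr : 1 ≤ r) :
    ∫⁻ ω, ‖M.Hm P m x (M.past 0 ω)‖ₑ ^ r ∂P ≤ ∫⁻ ω, ‖M.ξ 0 x ω‖ₑ ^ r ∂P := by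
  have hH : Measurable (M.H x) := hM.H_meas.comp measurable_prodMk_left
  have hmeas := measurable_H_splice (S := S) hM m x
  calc ∫⁻ ω, ‖M.Hm P m x (M.past 0 ω)‖ₑ ^ r ∂P
      ≤ ∫⁻ ω, ∫⁻ ω', ‖M.H x (splice m (M.past 0 ω) (M.fut ω'))‖ₑ ^ r ∂P ∂P := by
        refine lintegral_mono fun ω => enorm_integral_pow_le ?_ hr
        exact (hmeas.comp (measurable_prodMk_left.comp (measurable_fut hM))).aemeasurable
    _ = ∫⁻ ω, ‖M.H x (splice m (M.past 0 ω) (M.fut ω))‖ₑ ^ r ∂P :=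
        (lintegral_decouple (measurable_past hM 0) (measurable_fut hM)
          (indepFun_past_fut hM 0 le_rfl)
          (F := fun s y => ‖M.H x (splice m s y)‖ₑ ^ r) (hmeas.enorm.pow_const r)).symm
    _ = ∫⁻ ω, ‖M.ξ 0 x ω‖ₑ ^ r ∂P :=
        ((identDistrib_splice hM m).comp (hH.enorm.pow_const r)).lintegral_eq

lemma lintegral_Hm_sub_pow_le (hM : M.Standing P ε) {x : ℝ} (hx : x ∈ Set.Icc (0 : ℝ) 1) (m : ℕ)
    {r : ℕ} (hr : 1 ≤ r) :
    ∫⁻ ω, ‖M.Hm P (m + 1) x (M.past 0 ω) - M.Hm P m x (M.past 0 ω)‖ₑ ^ r ∂P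
      ≤ M.depMeasure P (m + 1) r ^ r := by
  have hm1 := measurable_H_splice (S := S) hM (m + 1) x
  have hm0 := measurable_H_splice (S := S) hM m x
  calc ∫⁻ ω, ‖M.Hm P (m + 1) x (M.past 0 ω) - M.Hm P m x (M.past 0 ω)‖ₑ ^ r ∂P
      ≤ ∫⁻ ω, ∫⁻ ω', ‖M.H x (splice (m + 1) (M.past 0 ω) (M.fut ω'))
          - M.H x (splice m (M.past 0 ω) (M.fut ω'))‖ₑ ^ r ∂P ∂P := by
        refine lintegral_mono_ae ?_
        filter_upwards [ae_integrable_H_splice hM hx (m + 1), ae_integrable_H_splice hM hx m]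
          with ω h1 h2
        rw [Hm, Hm, ← integral_sub h1 h2]
        exact enorm_integral_pow_le (h1.sub h2).1.aemeasurable hr
    _ = ∫⁻ ω, ‖M.H x (splice (m + 1) (M.past 0 ω) (M.fut ω))
          - M.H x (splice m (M.past 0 ω) (M.fut ω))‖ₑ ^ r ∂P :=
        (lintegral_decouple (measurable_past hM 0) (measurable_fut hM)
          (indepFun_past_fut hM 0 le_rfl)
          (F := fun s y => ‖M.H x (splice (m + 1) s y) - M.H x (splice m s y)‖ₑ ^ r)
          ((hm1.sub hm0).enorm.pow_const r)).symm
    _ ≤ _ := by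
        rw [lintegral_enorm_pow_eq _ hr]
        gcongr
        exact eLpNorm_splice_sub_le hM hx m r

lemma integrable_Hm (hM : M.Standing P ε) {x : ℝ} (hx : x ∈ Set.Icc (0 : ℝ) 1) (m : ℕ) :
    Integrable (fun ω => M.Hm P m x (M.past 0 ω)) P := by
  refine ⟨((measurable_Hm hM m).comp
    (measurable_prodMk_left.comp (measurable_past hM 0))).aestronglyMeasurable, ?_⟩
  have h := lintegral_Hm_pow_le hM m x le_rfl
  simp only [pow_one] at h
  exact h.trans_lt (hM.ξ_integrable x hx).2

lemma integral_Hm_past (hM : M.Standing P ε) {x : ℝ} (hx : x ∈ Set.Icc (0 : ℝ) 1) (m : ℕ) :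
    ∫ ω, M.Hm P m x (M.past 0 ω) ∂P = 0 := by
  unfold Hm
  rw [← integral_decouple (measurable_past hM 0) (measurable_fut hM)
    (indepFun_past_fut hM 0 le_rfl) (measurable_H_splice hM m x) (integrable_H_splice hM hx m)]
  rw [← hM.ξ_mean x hx]
  exact ((identDistrib_splice hM m).comp (hM.H_meas.comp measurable_prodMk_left)).integral_eq

lemma freeze_mono {m m' : ℕ} (h : m ≤ m') (s : ℕ → S) : freeze m (freeze m' s) = freeze m s := by
  funext k
  simp [freeze, h]

/-- The filtration of the last `m + 1` innovations before time `0`. -/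
def pastFiltration (hM : M.Standing P ε) : Filtration ℕ ‹MeasurableSpace Ω› where
  seq m := MeasurableSpace.comap (fun ω => freeze m (M.past 0 ω)) inferInstance
  mono' := by
    intro m m' h
    refine Measurable.comap_le ?_
    have : (fun ω => freeze m (M.past 0 ω)) = freeze m ∘ fun ω => freeze m' (M.past 0 ω) := by
      funext ω
      exact (freeze_mono h _).symm
    rw [this]
    exact (measurable_freeze m).comp (comap_measurable _)
  le' m := ((measurable_freeze m).comp (measurable_past hM 0)).comap_le

/-- Splicing leaves the last `m + 1` innovations unchanged, so indicators of events in them pass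
through the average. The identification gives access to Lévy's upward theorem. -/
lemma Hm_ae_eq_condExp (hM : M.Standing P ε) {x : ℝ} (hx : x ∈ Set.Icc (0 : ℝ) 1) (m : ℕ) :
    (fun ω => M.Hm P m x (M.past 0 ω)) =ᵐ[P] P[M.ξ 0 x | pastFiltration hM m] := by
  have hH : Measurable (M.H x) := hM.H_meas.comp measurable_prodMk_left
  refine ae_eq_condExp_of_forall_setIntegral_eq ((pastFiltration hM).le m) (hM.ξ_integrable x hx)
    (fun s _ _ => (integrable_Hm hM hx m).integrableOn) ?_ ?_
  · rintro s ⟨T, hT, rfl⟩ _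
    have hms : MeasurableSet ((fun ω => freeze m (M.past 0 ω)) ⁻¹' T) :=
      ((measurable_freeze m).comp (measurable_past hM 0)) hT
    have hF : Measurable ((freeze m ⁻¹' T).indicator (M.H x)) :=
      hH.indicator (measurable_freeze m hT)
    have hFs : ∀ s y : ℕ → S, (freeze m ⁻¹' T).indicator (M.H x) (splice m s y)
        = (freeze m ⁻¹' T).indicator (fun s => M.H x (splice m s y)) s := by
      intro s y
      by_cases h : freeze m s ∈ T
      · rw [Set.indicator_of_mem, Set.indicator_of_mem]
        · exact h
        · rwa [Set.mem_preimage, freeze_splice]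
      · rw [Set.indicator_of_notMem, Set.indicator_of_notMem]
        · exact h
        · rwa [Set.mem_preimage, freeze_splice]
    have hFm : Measurable (Function.uncurry fun s y : ℕ → S =>
        (freeze m ⁻¹' T).indicator (M.H x) (splice m s y)) := hF.comp (measurable_splice m)
    have hint : Integrable (fun ω => (freeze m ⁻¹' T).indicator (M.H x)
        (splice m (M.past 0 ω) (M.fut ω))) P := by
      refine (integrable_H_splice hM hx m).mono
        (hF.comp ((measurable_splice m).comp
          ((measurable_past hM 0).prodMk (measurable_fut hM)))).aestronglyMeasurable
        (Eventually.of_forall fun ω => norm_indicator_le_norm_self _ _)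
    calc ∫ ω in (fun ω => freeze m (M.past 0 ω)) ⁻¹' T, M.Hm P m x (M.past 0 ω) ∂P
        = ∫ ω, ∫ ω', (freeze m ⁻¹' T).indicator (M.H x) (splice m (M.past 0 ω) (M.fut ω')) ∂P ∂P := by
          rw [← integral_indicator hms]
          refine integral_congr_ae (Eventually.of_forall fun ω => ?_)
          simp only [hFs]
          by_cases h : freeze m (M.past 0 ω) ∈ T
          · rw [Set.indicator_of_mem (show ω ∈ _ from h)]
            refine integral_congr_ae (Eventually.of_forall fun ω' => ?_)
            simp only
            rw [Set.indicator_of_mem (show M.past 0 ω ∈ freeze m ⁻¹' T from h)]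
          · rw [Set.indicator_of_notMem (show ω ∉ _ from h)]
            simp only [Set.indicator_of_notMem (show M.past 0 ω ∉ freeze m ⁻¹' T from h),
              integral_zero]
      _ = ∫ ω, (freeze m ⁻¹' T).indicator (M.H x) (splice m (M.past 0 ω) (M.fut ω)) ∂P :=
          (integral_decouple (measurable_past hM 0) (measurable_fut hM)
            (indepFun_past_fut hM 0 le_rfl) hFm hint).symm
      _ = ∫ ω, (freeze m ⁻¹' T).indicator (M.H x) (M.past 0 ω) ∂P :=
          ((identDistrib_splice hM m).comp hF).integral_eq
      _ = _ := by
          rw [← integral_indicator hms]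
          rfl
  · have : (fun ω => M.Hm P m x (M.past 0 ω))
        = (fun s => M.Hm P m x s) ∘ fun ω => freeze m (M.past 0 ω) := by
      funext ω
      exact (Hm_freeze m x _).symm
    rw [this]
    exact (((measurable_Hm hM m).comp measurable_prodMk_left).comp
      (comap_measurable _)).stronglyMeasurable.aestronglyMeasurable

/-- Lévy's upward theorem: every coordinate of the past is measurable for some member of the
filtration, so `ξ 0 x` is measurable for the limit. -/
lemma tendsto_Hm (hM : M.Standing P ε) {x : ℝ} (hx : x ∈ Set.Icc (0 : ℝ) 1) :
    ∀ᵐ ω ∂P, Tendsto (fun m => M.Hm P m x (M.past 0 ω)) atTop (𝓝 (M.ξ 0 x ω)) := by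
  have hmeas : Measurable[⨆ m, pastFiltration hM m] (M.ξ 0 x) := by
    have hp : Measurable[⨆ m, pastFiltration hM m] (M.past 0) := by
      refine @measurable_pi_iff _ _ _ (_) _ _ |>.2 fun k => ?_
      have h1 : Measurable[pastFiltration hM k] fun ω => freeze k (M.past 0 ω) :=
        comap_measurable _
      have h2 : Measurable[pastFiltration hM k] fun ω => freeze k (M.past 0 ω) k :=
        (measurable_pi_apply k).comp h1
      simp only [freeze, min_self] at h2
      exact h2.mono (le_iSup (fun m => (pastFiltration hM m : MeasurableSpace Ω)) k) le_rfl
    exact (hM.H_meas.comp measurable_prodMk_left).comp hp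
  have h1 := (hM.ξ_integrable x hx).tendsto_ae_condExp hmeas.stronglyMeasurable
  have h2 := ae_all_iff.2 fun m => Hm_ae_eq_condExp hM hx m
  filter_upwards [h1, h2] with ω h1 h2
  simpa only [← h2] using h1

/-- Telescoping from level `m` upwards bounds `Hm (m + K) - Hm m`, and Fatou's lemma for the `L^r`
norm passes to the almost sure limit. -/
lemma eLpNorm_ξ_sub_Hm_le (hM : M.Standing P ε) {x : ℝ} (hx : x ∈ Set.Icc (0 : ℝ) 1) (m : ℕ)
    {r : ℕ} (hr : 1 ≤ r) :
    eLpNorm (fun ω => M.ξ 0 x ω - M.Hm P m x (M.past 0 ω)) r P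
      ≤ ∑' k, M.depMeasure P (m + k + 1) r := by
  have hmm : ∀ k, AEStronglyMeasurable (fun ω => M.Hm P k x (M.past 0 ω)) P :=
    fun k => (integrable_Hm hM hx k).1
  have hr1 : (1 : ℝ≥0∞) ≤ r := by exact_mod_cast hr
  have hstep : ∀ k, eLpNorm (fun ω => M.Hm P (k + 1) x (M.past 0 ω) - M.Hm P k x (M.past 0 ω)) r P
      ≤ M.depMeasure P (k + 1) r := by
    intro k
    have h := lintegral_Hm_sub_pow_le hM hx k hr
    rw [lintegral_enorm_pow_eq _ hr] at h
    exact (ENNReal.pow_le_pow_left_iff (by omega)).1 h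
  have hfin : ∀ K, eLpNorm (fun ω => M.Hm P (m + K) x (M.past 0 ω) - M.Hm P m x (M.past 0 ω)) r P
      ≤ ∑ k ∈ Finset.range K, M.depMeasure P (m + k + 1) r := by
    intro K
    induction K with
    | zero => simp
    | succ K ih =>
      rw [Finset.sum_range_succ]
      have e : (fun ω => M.Hm P (m + (K + 1)) x (M.past 0 ω) - M.Hm P m x (M.past 0 ω))
          = (fun ω => M.Hm P (m + K) x (M.past 0 ω) - M.Hm P m x (M.past 0 ω))
          + fun ω => M.Hm P (m + K + 1) x (M.past 0 ω) - M.Hm P (m + K) x (M.past 0 ω) := by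
        funext ω
        simp only [Pi.add_apply, ← add_assoc]
        ring
      rw [e]
      exact (eLpNorm_add_le ((hmm _).sub (hmm _)) ((hmm _).sub (hmm _)) hr1).trans
        (add_le_add ih (hstep _))
  have hlim : ∀ᵐ ω ∂P, Tendsto (fun K => M.Hm P (m + K) x (M.past 0 ω) - M.Hm P m x (M.past 0 ω))
      atTop (𝓝 (M.ξ 0 x ω - M.Hm P m x (M.past 0 ω))) := by
    filter_upwards [tendsto_Hm hM hx] with ω h
    refine Tendsto.sub_const ?_ _
    have := (tendsto_add_atTop_iff_nat m).2 h
    simpa only [add_comm] using this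
  refine (Lp.eLpNorm_lim_le_liminf_eLpNorm (fun K => (hmm _).sub (hmm _)) _ hlim).trans ?_
  refine liminf_le_of_le (by isBoundedDefault) fun b hb => ?_
  obtain ⟨K, hK⟩ := hb.exists
  exact hK.trans ((hfin K).trans (ENNReal.sum_le_tsum _))

end Model

end FTSBreak

namespace FTSBreak

set_option linter.unusedSectionVars false

/-! ### Moments of sums of independent variables with values in the unit interval -/

lemma one_add_pow_le (r : ℕ) (a : ℝ≥0∞) : (1 + a) ^ r ≤ 2 ^ r * (1 + a ^ r) := by
  rcases le_total a 1 with h | h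
  · calc (1 + a) ^ r ≤ (1 + 1) ^ r := by gcongr
      _ = 2 ^ r * 1 := by rw [one_add_one_eq_two, mul_one]
      _ ≤ _ := by gcongr; exact le_self_add
  · calc (1 + a) ^ r ≤ (a + a) ^ r := by gcongr
      _ = 2 ^ r * a ^ r := by rw [← two_mul, mul_pow]
      _ ≤ _ := by gcongr; exact le_add_self

/-- The constant in the moment bound for sums of independent variables in the unit interval. -/
noncomputable def sumMomentConst (r : ℕ) : ℝ≥0∞ := ∏ s ∈ Finset.range r, 2 ^ s

lemma one_le_sumMomentConst (r : ℕ) : 1 ≤ sumMomentConst r :=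
  Finset.one_le_prod' fun _ _ => one_le_pow₀ one_le_two

lemma sumMomentConst_ne_top (r : ℕ) : sumMomentConst r ≠ ∞ :=
  (ENNReal.prod_lt_top fun _ _ => ENNReal.pow_lt_top (by simp)).ne

/-- A Rosenthal-type bound by induction on `r`. Write `S ^ (r+1) = ∑ j, b j * S ^ r` and bound `S`
by one plus the sum without `b j`; that sum is independent of `b j`, so the induction hypothesis
applies. -/
lemma lintegral_sum_pow_le {Ω ι : Type*} [MeasurableSpace Ω] {P : Measure Ω}
    [IsProbabilityMeasure P] {b : ι → Ω → ℝ≥0∞} (hb : ∀ j, Measurable (b j))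
    (hind : iIndepFun b P) (hle : ∀ j ω, b j ω ≤ 1) {π : ℝ≥0∞}
    (hπ : ∀ j, ∫⁻ ω, b j ω ∂P ≤ π) {r : ℕ} (hr : 1 ≤ r) (F : Finset ι) :
    ∫⁻ ω, (∑ j ∈ F, b j ω) ^ r ∂P
      ≤ sumMomentConst r * ∑ t ∈ Finset.Icc 1 r, ((F.card : ℝ≥0∞) * π) ^ t := by
  classical
  induction r, hr using Nat.le_induction generalizing F with
  | base =>
    simp only [pow_one, Finset.Icc_self, Finset.sum_singleton]
    rw [lintegral_finsetSum _ fun j _ => hb j]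
    refine le_trans ?_ (le_mul_of_one_le_left' (one_le_sumMomentConst 1))
    refine (Finset.sum_le_sum fun j _ => hπ j).trans ?_
    simp
  | succ r hr ih =>
    set Q : ℝ≥0∞ := (F.card : ℝ≥0∞) * π with hQ
    have hterm : ∀ j ∈ F, ∫⁻ ω, b j ω * (∑ k ∈ F, b k ω) ^ r ∂P
        ≤ π * (2 ^ r * (sumMomentConst r * (1 + ∑ t ∈ Finset.Icc 1 r, Q ^ t))) := by
      intro j hj
      have hS : Measurable fun ω => ∑ k ∈ F.erase j, b k ω :=
        Finset.measurable_sum _ fun k _ => hb k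
      have hi : IndepFun (b j) (fun ω => (1 + ∑ k ∈ F.erase j, b k ω) ^ r) P := by
        have h0 := (hind.indepFun_finsetSum_of_notMem hb (Finset.notMem_erase j F)).symm
        have h1 := h0.comp measurable_id
          (by fun_prop : Measurable fun y : ℝ≥0∞ => (1 + y) ^ r)
        have e : (fun y : ℝ≥0∞ => (1 + y) ^ r) ∘ (∑ k ∈ F.erase j, b k)
            = fun ω => (1 + ∑ k ∈ F.erase j, b k ω) ^ r := by
          funext ω
          simp
        rw [e] at h1
        exact h1
      calc ∫⁻ ω, b j ω * (∑ k ∈ F, b k ω) ^ r ∂P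
          ≤ ∫⁻ ω, (b j * fun ω => (1 + ∑ k ∈ F.erase j, b k ω) ^ r) ω ∂P := by
            refine lintegral_mono fun ω => ?_
            simp only [Pi.mul_apply]
            gcongr
            rw [← Finset.add_sum_erase F _ hj]
            gcongr
            exact hle j ω
        _ = (∫⁻ ω, b j ω ∂P) * ∫⁻ ω, (1 + ∑ k ∈ F.erase j, b k ω) ^ r ∂P :=
            lintegral_mul_eq_lintegral_mul_lintegral_of_indepFun (hb j)
              ((measurable_const.add hS).pow_const r) hi
        _ ≤ π * ∫⁻ ω, 2 ^ r * (1 + (∑ k ∈ F.erase j, b k ω) ^ r) ∂P := by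
            gcongr
            · exact hπ j
            · exact one_add_pow_le r _
        _ = π * (2 ^ r * (1 + ∫⁻ ω, (∑ k ∈ F.erase j, b k ω) ^ r ∂P)) := by
            rw [lintegral_const_mul _ (by fun_prop), lintegral_add_left measurable_const]
            simp
        _ ≤ _ := by
            gcongr
            rw [mul_add, mul_one]
            gcongr
            · exact one_le_sumMomentConst r
            · refine (ih (F.erase j)).trans ?_
              rw [hQ]
              gcongr
              exact Finset.erase_subset j F
    calc ∫⁻ ω, (∑ j ∈ F, b j ω) ^ (r + 1) ∂P
        = ∑ j ∈ F, ∫⁻ ω, b j ω * (∑ k ∈ F, b k ω) ^ r ∂P := by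
          rw [← lintegral_finsetSum]
          · refine lintegral_congr fun ω => ?_
            rw [pow_succ', Finset.sum_mul]
          · intro j _
            exact (hb j).mul ((Finset.measurable_sum _ fun k _ => hb k).pow_const r)
      _ ≤ ∑ j ∈ F, π * (2 ^ r * (sumMomentConst r * (1 + ∑ t ∈ Finset.Icc 1 r, Q ^ t))) :=
          Finset.sum_le_sum hterm
      _ = sumMomentConst (r + 1) * (Q * (1 + ∑ t ∈ Finset.Icc 1 r, Q ^ t)) := by
          rw [Finset.sum_const, nsmul_eq_mul, sumMomentConst, sumMomentConst,
            Finset.prod_range_succ, hQ]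
          ring
      _ = _ := by
          congr 1
          rw [mul_add, mul_one, Finset.mul_sum, ← Finset.sum_Ioc_add_eq_sum_Icc (by omega : 1 ≤ r + 1),
            pow_one, add_comm]
          congr 1
          have : Finset.Ioc 1 (r + 1) = (Finset.Icc 1 r).map (addRightEmbedding 1) := by
            rw [Finset.map_add_right_Icc]
            ext
            simp
            omega
          rw [this, Finset.sum_map]
          refine Finset.sum_congr rfl fun t _ => ?_
          rw [addRightEmbedding_apply, pow_succ']

lemma sum_mul_pow_le {ι : Type*} (s : Finset ι) (w f : ι → ℝ≥0∞) {r : ℕ} (hr : 1 ≤ r) :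
    (∑ j ∈ s, w j * f j) ^ r ≤ (∑ j ∈ s, w j) ^ (r - 1) * ∑ j ∈ s, w j * f j ^ r := by
  have hr' : (1 : ℝ) ≤ r := by exact_mod_cast hr
  have hr0 : (r : ℝ) ≠ 0 := by positivity
  have h := ENNReal.inner_le_weight_mul_Lp_of_nonneg s hr' w f
  calc (∑ j ∈ s, w j * f j) ^ r
      ≤ ((∑ j ∈ s, w j) ^ (1 - (r : ℝ)⁻¹) * (∑ j ∈ s, w j * f j ^ (r : ℝ)) ^ (r : ℝ)⁻¹) ^ r := by
        gcongr
    _ = _ := by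
        rw [mul_pow, ← ENNReal.rpow_natCast, ← ENNReal.rpow_mul, ← ENNReal.rpow_natCast,
          ← ENNReal.rpow_mul, inv_mul_cancel₀ hr0, ENNReal.rpow_one, sub_mul,
          inv_mul_cancel₀ hr0, one_mul, ← ENNReal.rpow_natCast, Nat.cast_sub hr, Nat.cast_one]
        simp only [ENNReal.rpow_natCast]

namespace Model

variable {Ω S : Type*} [MeasurableSpace Ω] [MeasurableSpace S] {P : Measure Ω}
  [IsProbabilityMeasure P] {M : Model Ω S} {ε : ℝ}

lemma exists_mean_bound {q : ℕ} {ν : ℝ} (hS : M.SmoothMeans q ν) :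
    ∃ D : ℝ, 0 < D ∧ ∀ x ∈ Set.Icc (0 : ℝ) 1, |M.mPre x| ≤ D ∧ |M.mPost x| ≤ D := by
  obtain ⟨-, -, -, h1, h2⟩ := hS
  obtain ⟨D1, hD1⟩ := isCompact_Icc.exists_bound_of_continuousOn h1.1.continuousOn
  obtain ⟨D2, hD2⟩ := isCompact_Icc.exists_bound_of_continuousOn h2.1.continuousOn
  refine ⟨max (max D1 D2) 1, lt_max_of_lt_right one_pos, fun x hx => ⟨?_, ?_⟩⟩
  · exact (hD1 x hx).trans ((le_max_left _ _).trans (le_max_left _ _))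
  · exact (hD2 x hx).trans ((le_max_right _ _).trans (le_max_left _ _))

lemma exists_ξ_bound (hM : M.Standing P ε) {q : ℕ} {ν : ℝ} (hS : M.SmoothMeans q ν) {r₂ : ℕ}
    (hT : M.TrajectoryMoments P r₂) :
    ∃ D : ℝ, 0 < D ∧ ∀ x ∈ Set.Icc (0 : ℝ) 1, eLpNorm (M.ξ 0 x) r₂ P ≤ ENNReal.ofReal D := by
  obtain ⟨D, hD0, hD⟩ := exists_mean_bound hS
  obtain ⟨-, -, hr, C, hC⟩ := hT
  refine ⟨C + D, by positivity, fun x hx => ?_⟩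
  have hH : Measurable (M.H x) := hM.H_meas.comp measurable_prodMk_left
  have hξ : Measurable (M.ξ 0 x) := hH.comp (measurable_past hM 0)
  have e : M.ξ 0 x = (fun ω => M.mPre x + M.ξ 0 x ω) - fun _ => M.mPre x := by
    funext ω
    simp
  have hr1 : (1 : ℝ≥0∞) ≤ r₂ := by exact_mod_cast (by omega : 1 ≤ r₂)
  rw [e]
  refine (eLpNorm_sub_le (measurable_const.add hξ).aestronglyMeasurable
    aestronglyMeasurable_const hr1).trans ?_
  rw [ENNReal.ofReal_add C.coe_nonneg hD0.le]
  refine add_le_add ((hC x hx).1.trans (by simp)) ?_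
  rw [eLpNorm_const _ (by positivity) (IsProbabilityMeasure.ne_zero P)]
  simp only [measure_univ, ENNReal.one_rpow, mul_one]
  rw [Real.enorm_eq_ofReal_abs]
  exact ENNReal.ofReal_le_ofReal (hD x hx).1

/-- Beyond some lag `β ≥ 3` gives cubic decay; the earlier lags are absorbed into the constant. The
shift to `m + 2` makes the bound at lag `m + 1` the size of layer `m + 1`. -/
lemma exists_depMeasure_bound (hM : M.Standing P ε) {q : ℕ} {ν : ℝ} (hS : M.SmoothMeans q ν)
    {r₂ : ℕ} (hT : M.TrajectoryMoments P r₂) (hD : M.DependenceDecay P r₂) :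
    ∃ D : ℝ, 0 < D ∧ ∀ m : ℕ,
      M.depMeasure P (m + 1) r₂ ≤ ENNReal.ofReal (D * (((m : ℝ) + 2) ^ 3)⁻¹) := by
  obtain ⟨D, hD0, hξ⟩ := exists_ξ_bound hM hS hT
  obtain ⟨β, hβ, C, hC⟩ := hD
  obtain ⟨i₀, hi₀⟩ := eventually_atTop.1 hC
  -- `8` comes from `m + 2 ≤ 2 (m + 1)`; the second summand covers the lags below `i₀`.
  refine ⟨8 * |C| + 2 * D * ((i₀ : ℝ) + 2) ^ 3, by positivity, fun m => ?_⟩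
  by_cases hm : i₀ ≤ m + 1
  · refine (hi₀ (m + 1) hm).trans (ENNReal.ofReal_le_ofReal ?_)
    have h1 : (((m + 1 : ℕ) : ℝ)) ^ (-β) ≤ ((((m : ℝ) + 1)) ^ 3)⁻¹ := by
      rw [← Real.rpow_natCast, ← Real.rpow_neg (by positivity)]
      push_cast
      exact Real.rpow_le_rpow_of_exponent_le (by linarith [(Nat.cast_nonneg m : (0 : ℝ) ≤ m)])
        (by linarith)
    have h2 : ((((m : ℝ) + 1)) ^ 3)⁻¹ ≤ 8 * ((((m : ℝ) + 2)) ^ 3)⁻¹ := by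
      rw [← div_eq_mul_inv, inv_eq_one_div, div_le_div_iff₀ (by positivity) (by positivity)]
      nlinarith [(Nat.cast_nonneg m : (0 : ℝ) ≤ m), sq_nonneg (m : ℝ),
        pow_nonneg (Nat.cast_nonneg m : (0 : ℝ) ≤ m) 3]
    calc C * ((m + 1 : ℕ) : ℝ) ^ (-β) ≤ |C| * (8 * ((((m : ℝ) + 2)) ^ 3)⁻¹) := by
          refine mul_le_mul (le_abs_self C) (h1.trans h2) (by positivity) (abs_nonneg C)
      _ = 8 * |C| * ((((m : ℝ) + 2)) ^ 3)⁻¹ := by ring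
      _ ≤ _ := by
          gcongr
          exact le_add_of_nonneg_right (by positivity)
  · push Not at hm
    refine (depMeasure_le hM (by have := hT.2.2.1; omega) hξ m).trans ?_
    rw [← ENNReal.ofReal_add hD0.le hD0.le]
    refine ENNReal.ofReal_le_ofReal ?_
    have h1 : ((m : ℝ) + 2) ^ 3 ≤ ((i₀ : ℝ) + 2) ^ 3 := by
      gcongr
      omega
    rw [← div_eq_mul_inv, le_div_iff₀ (by positivity)]
    nlinarith [abs_nonneg C, mul_le_mul_of_nonneg_left h1 hD0.le]

lemma sum_inv_cube_le (m K : ℕ) :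
    ∑ k ∈ Finset.range K, (((m : ℝ) + k + 2) ^ 3)⁻¹
      ≤ (((m : ℝ) + 1) ^ 2)⁻¹ - (((m : ℝ) + K + 1) ^ 2)⁻¹ := by
  induction K with
  | zero => simp
  | succ K ih =>
    rw [Finset.sum_range_succ]
    have h : (((m : ℝ) + K + 2) ^ 3)⁻¹
        ≤ (((m : ℝ) + K + 1) ^ 2)⁻¹ - (((m : ℝ) + (K + 1 : ℕ) + 1) ^ 2)⁻¹ := by
      push_cast
      set t : ℝ := (m : ℝ) + K with ht
      have ht0 : 0 ≤ t := by positivity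
      rw [show (m : ℝ) + (K + 1) + 1 = t + 2 by rw [ht]; ring, le_sub_iff_add_le,
        ← one_div, ← one_div, ← one_div, div_add_div _ _ (by positivity) (by positivity),
        div_le_div_iff₀ (by positivity) (by positivity)]
      have h2 : 0 ≤ (t + 2) ^ 2 * (t ^ 2 + 4 * t + 3) := by positivity
      nlinarith [h2, mul_nonneg ht0 (sq_nonneg (t + 2))]
    linarith

/-- Uniform moment bounds for the layers of the error process. -/
lemma exists_layer_moments (hM : M.Standing P ε) {q : ℕ} {ν : ℝ} (hS : M.SmoothMeans q ν)
    {r₂ : ℕ} (hT : M.TrajectoryMoments P r₂) (hD : M.DependenceDecay P r₂) :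
    ∃ D : ℝ, 0 < D ∧ ∀ s : ℕ, 1 ≤ s → s ≤ r₂ → ∀ x ∈ Set.Icc (0 : ℝ) 1, ∀ i : ℤ,
      (∀ m, eLpNorm (fun ω => M.Hm P m x (M.past i ω)) s P ≤ ENNReal.ofReal D) ∧
      (∀ m : ℕ, eLpNorm (fun ω => M.Hm P (m + 1) x (M.past i ω) - M.Hm P m x (M.past i ω)) s P
        ≤ ENNReal.ofReal (D * (((m : ℝ) + 2) ^ 3)⁻¹)) ∧
      (∀ m : ℕ, eLpNorm (fun ω => M.ξ i x ω - M.Hm P m x (M.past i ω)) s P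
        ≤ ENNReal.ofReal (D * (((m : ℝ) + 1) ^ 2)⁻¹)) := by
  obtain ⟨D1, hD1, hξ⟩ := exists_ξ_bound hM hS hT
  obtain ⟨D2, hD2, hdep⟩ := exists_depMeasure_bound hM hS hT hD
  have hr : 1 ≤ r₂ := by have := hT.2.2.1; omega
  refine ⟨D1 + D2, by positivity, fun s hs hsr x hx i => ?_⟩
  have hsr' : (s : ℝ≥0∞) ≤ r₂ := by exact_mod_cast hsr
  have hH : Measurable (M.H x) := hM.H_meas.comp measurable_prodMk_left
  have hHm : ∀ m, Measurable (M.Hm P m x) := fun m =>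
    (measurable_Hm hM m).comp measurable_prodMk_left
  have key : ∀ (u : (ℕ → S) → ℝ), Measurable u →
      eLpNorm (fun ω => u (M.past i ω)) s P ≤ eLpNorm (fun ω => u (M.past 0 ω)) r₂ P := by
    intro u hu
    refine ((((identDistrib_past hM i).comp hu).eLpNorm_eq s).trans_le ?_)
    exact eLpNorm_le_eLpNorm_of_exponent_le hsr'
      (hu.comp (measurable_past hM 0)).aestronglyMeasurable
  refine ⟨fun m => ?_, fun m => ?_, fun m => ?_⟩
  · refine (key _ (hHm m)).trans ?_
    have h := lintegral_Hm_pow_le hM m x hr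
    rw [lintegral_enorm_pow_eq _ hr, lintegral_enorm_pow_eq _ hr] at h
    refine ((ENNReal.pow_le_pow_left_iff (by omega)).1 h).trans ((hξ x hx).trans ?_)
    exact ENNReal.ofReal_le_ofReal (by linarith)
  · refine (key _ ((hHm (m + 1)).sub (hHm m))).trans ?_
    have h := lintegral_Hm_sub_pow_le hM hx m hr
    rw [lintegral_enorm_pow_eq _ hr] at h
    refine ((ENNReal.pow_le_pow_left_iff (by omega)).1 h).trans ((hdep m).trans ?_)
    exact ENNReal.ofReal_le_ofReal (by gcongr; linarith)
  · refine (key _ (hH.sub (hHm m))).trans ?_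
    refine (eLpNorm_ξ_sub_Hm_le hM hx m hr).trans ?_
    refine ENNReal.tsum_le_of_sum_range_le fun K => ?_
    calc ∑ k ∈ Finset.range K, M.depMeasure P (m + k + 1) r₂
        ≤ ∑ k ∈ Finset.range K, ENNReal.ofReal (D2 * (((m : ℝ) + k + 2) ^ 3)⁻¹) := by
          refine Finset.sum_le_sum fun k _ => ?_
          have := hdep (m + k)
          push_cast at this
          exact this
      _ = ENNReal.ofReal (D2 * ∑ k ∈ Finset.range K, (((m : ℝ) + k + 2) ^ 3)⁻¹) := by
          rw [← ENNReal.ofReal_sum_of_nonneg fun k _ => by positivity, Finset.mul_sum]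
      _ ≤ _ := by
          refine ENNReal.ofReal_le_ofReal ?_
          have h1 := sum_inv_cube_le m K
          have h2 : (0 : ℝ) ≤ (((m : ℝ) + K + 1) ^ 2)⁻¹ := by positivity
          have h3 : (0 : ℝ) ≤ (((m : ℝ) + 1) ^ 2)⁻¹ := by positivity
          calc _ ≤ D2 * (((m : ℝ) + 1) ^ 2)⁻¹ := by gcongr; linarith
            _ ≤ _ := by gcongr; linarith

end Model

end FTSBreak

namespace FTSBreak

set_option linter.unusedSectionVars false

/-! ### Averages over the observations of one curve -/

/-- Measurable weights in the unit interval that vanish off the unit interval. -/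
structure IsWeight (g : ℝ → ℝ) : Prop where
  meas : Measurable g
  nonneg : ∀ x, 0 ≤ g x
  le_one : ∀ x, g x ≤ 1
  support : ∀ x ∉ Set.Icc (0 : ℝ) 1, g x = 0

/-- The average over the observations of one curve, as a function of the number of observations,
the design points, the innovations and the errors. -/
noncomputable def curveAvg {S : Type*} (g : ℝ → ℝ) (φ : ℝ → (ℕ → S) → ℝ → ℝ) (a : ℕ × (ℕ → ℝ))
    (b : (ℕ → S) × (ℕ → ℝ)) : ℝ :=
  (a.1 : ℝ)⁻¹ * ∑ j ∈ Finset.Icc 1 a.1, g (a.2 j) * φ (a.2 j) b.1 (b.2 j)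

lemma measurable_of_nat_index {T β : Type*} [MeasurableSpace T] [MeasurableSpace β]
    {h : ℕ → T → β} (hh : ∀ K, Measurable (h K)) {κ : T → ℕ} (hκ : Measurable κ) :
    Measurable fun t => h (κ t) t :=
  (measurable_from_prod_countable_right (f := Function.uncurry h) hh).comp
    (hκ.prodMk measurable_id)

lemma measurable_curveAvg {S : Type*} [MeasurableSpace S] {g : ℝ → ℝ} (hg : Measurable g)
    {φ : ℝ → (ℕ → S) → ℝ → ℝ} (hφ : Measurable fun q : ℝ × (ℕ → S) × ℝ => φ q.1 q.2.1 q.2.2) :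
    Measurable (Function.uncurry (curveAvg g φ)) := by
  refine measurable_of_nat_index (h := fun K (q : (ℕ × (ℕ → ℝ)) × (ℕ → S) × (ℕ → ℝ)) =>
    (K : ℝ)⁻¹ * ∑ j ∈ Finset.Icc 1 K, g (q.1.2 j) * φ (q.1.2 j) q.2.1 (q.2.2 j)) (fun K => ?_) (measurable_fst.comp measurable_fst)
  refine Measurable.const_mul (Finset.measurable_sum _ fun j _ => ?_) _
  have hx : Measurable fun q : (ℕ × (ℕ → ℝ)) × (ℕ → S) × (ℕ → ℝ) => q.1.2 j :=
    (measurable_pi_apply j).comp (measurable_snd.comp measurable_fst)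
  refine (hg.comp hx).mul ?_
  have hb : Measurable fun q : (ℕ × (ℕ → ℝ)) × (ℕ → S) × (ℕ → ℝ) => (q.1.2 j, q.2.1, q.2.2 j) :=
    hx.prodMk ((measurable_fst.comp measurable_snd).prodMk
      ((measurable_pi_apply j).comp (measurable_snd.comp measurable_snd)))
  exact hφ.comp hb

namespace Model

variable {Ω S : Type*} [MeasurableSpace Ω] [MeasurableSpace S] {P : Measure Ω}
  [IsProbabilityMeasure P] {M : Model Ω S} {ε : ℝ}

/-- The number of observations and the design points of curve `i`. -/
def design (M : Model Ω S) (n i : ℕ) (ω : Ω) : ℕ × (ℕ → ℝ) := (M.N n i ω, fun j => M.X i j ω)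

/-- The innovations and the errors that enter curve `i`. -/
def noise (M : Model Ω S) (i : ℕ) (ω : Ω) : (ℕ → S) × (ℕ → ℝ) :=
  (M.past i ω, fun j => M.err i j ω)

/-- The average of `g X_ij * φ X_ij` over the observations of curve `i`. -/
noncomputable def zeta (M : Model Ω S) (n i : ℕ) (g : ℝ → ℝ) (φ : ℝ → (ℕ → S) → ℝ → ℝ) (ω : Ω) :
    ℝ := curveAvg g φ (M.design n i ω) (M.noise i ω)

lemma measurable_design (hM : M.Standing P ε) (n i : ℕ) : Measurable (M.design n i) :=
  (hM.N_meas n i).prodMk (measurable_pi_iff.2 fun j => hM.X_meas i j)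

lemma measurable_noise (hM : M.Standing P ε) (i : ℕ) : Measurable (M.noise i) :=
  (measurable_past hM i).prodMk (measurable_pi_iff.2 fun j => hM.err_meas i j)

lemma indepFun_design_noise (hM : M.Standing P ε) (n i : ℕ) :
    IndepFun (M.design n i) (M.noise i) P := by
  refine indepFun_of_src hM (n := n)
    (A := {a | (∃ k, a = Src.N k) ∨ ∃ k l, a = Src.X k l})
    (B := {a | (∃ k, a = Src.e k) ∨ ∃ k l, a = Src.err k l}) ?_ ?_ ?_
  · rw [Set.disjoint_left]
    rintro a (⟨k, rfl⟩ | ⟨k, l, rfl⟩) (⟨k', h⟩ | ⟨k', l', h⟩) <;> cases h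
  · exact (measurable_N_src (.inl ⟨i, rfl⟩)).prodMk
      (@measurable_pi_iff _ _ _ (_) _ _ |>.2 fun j => measurable_X_src (.inr ⟨i, j, rfl⟩))
  · exact (@measurable_pi_iff _ _ _ (_) _ _ |>.2 fun k => measurable_e_src (.inl ⟨i - k, rfl⟩)).prodMk
      (@measurable_pi_iff _ _ _ (_) _ _ |>.2 fun j => measurable_err_src (.inr ⟨i, j, rfl⟩))

lemma indepFun_N_X (hM : M.Standing P ε) (n i : ℕ) :
    IndepFun (M.N n i) (fun ω j => M.X i j ω) P := by
  refine indepFun_of_src hM (n := n) (A := {a | ∃ k, a = Src.N k})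
    (B := {a | ∃ k l, a = Src.X k l}) ?_ ?_ ?_
  · rw [Set.disjoint_left]
    rintro a ⟨k, rfl⟩ ⟨k', l', h⟩
    cases h
  · exact measurable_N_src ⟨i, rfl⟩
  · exact @measurable_pi_iff _ _ _ (_) _ _ |>.2 fun j => measurable_X_src ⟨i, j, rfl⟩

lemma measurable_zeta (hM : M.Standing P ε) (n i : ℕ) {g : ℝ → ℝ} (hg : Measurable g)
    {φ : ℝ → (ℕ → S) → ℝ → ℝ} (hφ : Measurable fun q : ℝ × (ℕ → S) × ℝ => φ q.1 q.2.1 q.2.2) :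
    Measurable (M.zeta n i g φ) :=
  (measurable_curveAvg hg hφ).comp ((measurable_design hM n i).prodMk (measurable_noise hM i))

/-- The points of one curve share the same `ξ_i`, so the summands are dependent through the noise.
With the design frozen, the weighted Hölder inequality separates a noise moment uniform in `x` from
the `r`-th power of the averaged weights. -/
lemma lintegral_zeta_pow_le (hM : M.Standing P ε) (n i : ℕ) {g : ℝ → ℝ} (hg : IsWeight g)
    {φ : ℝ → (ℕ → S) → ℝ → ℝ} (hφ : Measurable fun q : ℝ × (ℕ → S) × ℝ => φ q.1 q.2.1 q.2.2)
    {r : ℕ} (hr : 1 ≤ r) {D : ℝ≥0∞}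
    (hD : ∀ x ∈ Set.Icc (0 : ℝ) 1, ∀ j,
      ∫⁻ ω, ‖φ x (M.past i ω) (M.err i j ω)‖ₑ ^ r ∂P ≤ D) :
    ∫⁻ ω, ‖M.zeta n i g φ ω‖ₑ ^ r ∂P
      ≤ D * ∫⁻ ω, ((M.N n i ω : ℝ≥0∞)⁻¹
        * ∑ j ∈ Finset.Icc 1 (M.N n i ω), ENNReal.ofReal (g (M.X i j ω))) ^ r ∂P := by
  have hF := (measurable_curveAvg hg.meas hφ).enorm.pow_const r
  have hφm : ∀ x j, Measurable fun ω => φ x (M.past i ω) (M.err i j ω) := fun x j =>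
    hφ.comp (measurable_const.prodMk ((measurable_past hM i).prodMk (hM.err_meas i j)))
  rw [mul_comm, ← lintegral_mul_const]
  swap
  · refine Measurable.pow_const ?_ r
    refine measurable_of_nat_index (h := fun K ω => (K : ℝ≥0∞)⁻¹ * ∑ j ∈ Finset.Icc 1 K,
      ENNReal.ofReal (g (M.X i j ω))) (fun K => ?_) (hM.N_meas n i)
    exact (Finset.measurable_sum _ fun j _ =>
      (hg.meas.comp (hM.X_meas i j)).ennreal_ofReal).const_mul _
  rw [show (fun ω => ‖M.zeta n i g φ ω‖ₑ ^ r)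
    = fun ω => ‖curveAvg g φ (M.design n i ω) (M.noise i ω)‖ₑ ^ r from rfl,
    lintegral_decouple (measurable_design hM n i) (measurable_noise hM i)
      (indepFun_design_noise hM n i) (F := fun a b => ‖curveAvg g φ a b‖ₑ ^ r) hF]
  refine lintegral_mono fun ω => ?_
  set K := M.N n i ω with hK
  have hK1 : 1 ≤ K := hM.N_pos n i ω
  set w : ℕ → ℝ≥0∞ := fun j => ENNReal.ofReal (g (M.X i j ω)) with hw
  set W : ℝ≥0∞ := ∑ j ∈ Finset.Icc 1 K, w j with hW
  have hpt : ∀ ω', ‖curveAvg g φ (M.design n i ω) (M.noise i ω')‖ₑ ^ r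
      ≤ ((K : ℝ≥0∞)⁻¹) ^ r * (W ^ (r - 1) * ∑ j ∈ Finset.Icc 1 K,
        w j * ‖φ (M.X i j ω) (M.past i ω') (M.err i j ω')‖ₑ ^ r) := by
    intro ω'
    have h1 : ‖curveAvg g φ (M.design n i ω) (M.noise i ω')‖ₑ
        ≤ (K : ℝ≥0∞)⁻¹ * ∑ j ∈ Finset.Icc 1 K,
          w j * ‖φ (M.X i j ω) (M.past i ω') (M.err i j ω')‖ₑ := by
      unfold curveAvg design noise
      rw [enorm_mul]
      refine mul_le_mul' (le_of_eq ?_) ?_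
      · rw [enorm_inv (by positivity), Real.enorm_natCast]
      · refine (enorm_sum_le _ _).trans (Finset.sum_le_sum fun j _ => ?_)
        rw [enorm_mul, hw, Real.enorm_of_nonneg (hg.nonneg _)]
    calc _ ≤ ((K : ℝ≥0∞)⁻¹ * ∑ j ∈ Finset.Icc 1 K,
          w j * ‖φ (M.X i j ω) (M.past i ω') (M.err i j ω')‖ₑ) ^ r := by gcongr
      _ ≤ _ := by
          rw [mul_pow]
          gcongr
          exact sum_mul_pow_le _ _ _ hr
  refine (lintegral_mono hpt).trans ?_
  have hmj : ∀ j ∈ Finset.Icc 1 K, Measurable fun ω' =>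
      w j * ‖φ (M.X i j ω) (M.past i ω') (M.err i j ω')‖ₑ ^ r := fun j _ =>
    ((hφm _ j).enorm.pow_const r).const_mul _
  rw [lintegral_const_mul _ ((Finset.measurable_sum _ hmj).const_mul _),
    lintegral_const_mul _ (Finset.measurable_sum _ hmj), lintegral_finsetSum _ hmj]
  calc ((K : ℝ≥0∞)⁻¹) ^ r * (W ^ (r - 1) * ∑ j ∈ Finset.Icc 1 K,
        ∫⁻ ω', w j * ‖φ (M.X i j ω) (M.past i ω') (M.err i j ω')‖ₑ ^ r ∂P)
      ≤ ((K : ℝ≥0∞)⁻¹) ^ r * (W ^ (r - 1) * ∑ j ∈ Finset.Icc 1 K, w j * D) := by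
        gcongr with j hj
        rw [lintegral_const_mul _ ((hφm _ j).enorm.pow_const r)]
        by_cases hx : M.X i j ω ∈ Set.Icc (0 : ℝ) 1
        · gcongr
          exact hD _ hx j
        · simp [hw, hg.support _ hx]
    _ = (K : ℝ≥0∞)⁻¹ ^ r * (W ^ (r - 1) * W) * D := by
        rw [← Finset.sum_mul]
        ring
    _ = _ := by
        rw [← pow_succ, Nat.sub_add_cancel hr, mul_pow]

/-- Given `N = K`, the `r`-th moment of a sum of `K` independent weights is at most a constant times
`∑ t, (K π) ^ t`. Dividing by `K ^ r` yields the terms `E(N^(t-r)) π^t`, which is where `momentSum`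
comes from. -/
lemma lintegral_weight_pow_le (hM : M.Standing P ε) (n i : ℕ) {g : ℝ → ℝ} (hg : IsWeight g)
    {r : ℕ} (hr : 1 ≤ r) {π : ℝ≥0∞}
    (hπ : ∀ j, ∫⁻ ω, ENNReal.ofReal (g (M.X i j ω)) ∂P ≤ π) :
    ∫⁻ ω, ((M.N n i ω : ℝ≥0∞)⁻¹
        * ∑ j ∈ Finset.Icc 1 (M.N n i ω), ENNReal.ofReal (g (M.X i j ω))) ^ r ∂P
      ≤ sumMomentConst r * ∑ t ∈ Finset.Icc 1 r,
        (∫⁻ ω, ENNReal.ofReal ((M.N n 1 ω : ℝ) ^ ((t : ℤ) - (r : ℤ))) ∂P) * π ^ t := by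
  have hgm : ∀ j, Measurable fun x : ℕ → ℝ => ENNReal.ofReal (g (x j)) := fun j =>
    (hg.meas.comp (measurable_pi_apply j)).ennreal_ofReal
  have hF : Measurable (Function.uncurry fun (K : ℕ) (x : ℕ → ℝ) =>
      ((K : ℝ≥0∞)⁻¹ * ∑ j ∈ Finset.Icc 1 K, ENNReal.ofReal (g (x j))) ^ r) :=
    measurable_from_prod_countable_right fun K =>
      ((Finset.measurable_sum (Finset.Icc 1 K) fun j _ => hgm j).const_mul (K : ℝ≥0∞)⁻¹).pow_const r
  rw [lintegral_decouple (hM.N_meas n i) (measurable_pi_iff.2 fun j => hM.X_meas i j)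
    (indepFun_N_X hM n i) hF]
  have hind : iIndepFun (fun j ω => ENNReal.ofReal (g (M.X i j ω))) P := by
    have h := hM.X_indep.precomp (g := fun j : ℕ => (i, j)) fun a b h => by simpa using h
    exact h.comp (fun _ x => ENNReal.ofReal (g x)) fun _ => hg.meas.ennreal_ofReal
  have hN : ∀ t : ℕ, ∫⁻ ω, ENNReal.ofReal ((M.N n 1 ω : ℝ) ^ ((t : ℤ) - (r : ℤ))) ∂P
      = ∫⁻ ω, ENNReal.ofReal ((M.N n i ω : ℝ) ^ ((t : ℤ) - (r : ℤ))) ∂P := fun t =>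
    (((hM.N_ident n i).comp (measurable_from_top (f := fun K : ℕ =>
      ENNReal.ofReal ((K : ℝ) ^ ((t : ℤ) - (r : ℤ)))))).lintegral_eq).symm
  have hmN : ∀ t : ℕ, Measurable fun ω => ENNReal.ofReal ((M.N n i ω : ℝ) ^ ((t : ℤ) - (r : ℤ))) :=
    fun t => (measurable_from_top (f := fun K : ℕ =>
      ENNReal.ofReal ((K : ℝ) ^ ((t : ℤ) - (r : ℤ))))).comp (hM.N_meas n i)
  simp only [hN]
  simp_rw [← lintegral_mul_const _ (hmN _)]
  rw [← lintegral_finsetSum _ fun t _ => (hmN t).mul_const _,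
    ← lintegral_const_mul _ (Finset.measurable_sum _ fun t _ => (hmN t).mul_const _)]
  refine lintegral_mono fun ω => ?_
  set K := M.N n i ω with hK
  have hK1 : 1 ≤ K := hM.N_pos n i ω
  simp only [mul_pow]
  have hXj : ∀ j, Measurable fun ω => ENNReal.ofReal (g (M.X i j ω)) := fun j =>
    (hg.meas.comp (hM.X_meas i j)).ennreal_ofReal
  rw [lintegral_const_mul _ ((Finset.measurable_sum _ fun j _ => hXj j).pow_const r)]
  refine (mul_le_mul_right (lintegral_sum_pow_le
    hXj hind
    (fun j ω => ENNReal.ofReal_le_one.2 (hg.le_one _)) hπ hr (Finset.Icc 1 K)) _).trans ?_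
  rw [mul_left_comm, Finset.mul_sum]
  refine mul_le_mul_right (Finset.sum_le_sum fun t ht => ?_) _
  rw [Nat.card_Icc, Nat.add_sub_cancel, mul_pow, ← mul_assoc]
  gcongr
  have hK0 : (0 : ℝ) < K := by exact_mod_cast hK1
  rw [zpow_sub₀ hK0.ne', zpow_natCast, zpow_natCast, ENNReal.ofReal_div_of_pos (by positivity),
    ENNReal.ofReal_pow hK0.le, ENNReal.ofReal_pow hK0.le, ENNReal.ofReal_natCast,
    div_eq_mul_inv, mul_comm, ENNReal.inv_pow]

lemma integrable_N_zpow (hM : M.Standing P ε) (n i : ℕ) {t r : ℕ} (h : t ≤ r) :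
    Integrable (fun ω => (M.N n i ω : ℝ) ^ ((t : ℤ) - (r : ℤ))) P := by
  refine Integrable.of_bound (((measurable_from_top (f := fun K : ℕ =>
    (K : ℝ) ^ ((t : ℤ) - (r : ℤ)))).comp (hM.N_meas n i)).aestronglyMeasurable) 1
    (Eventually.of_forall fun ω => ?_)
  have h1 : (1 : ℝ) ≤ M.N n i ω := by exact_mod_cast hM.N_pos n i ω
  rw [Real.norm_of_nonneg (by positivity)]
  exact zpow_le_one_of_nonpos₀ h1 (by omega)

lemma lintegral_N_zpow (hM : M.Standing P ε) (n : ℕ) {t r : ℕ} (h : t ≤ r) :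
    ∫⁻ ω, ENNReal.ofReal ((M.N n 1 ω : ℝ) ^ ((t : ℤ) - (r : ℤ))) ∂P
      = ENNReal.ofReal (∫ ω, (M.N n 1 ω : ℝ) ^ ((t : ℤ) - (r : ℤ)) ∂P) :=
  (ofReal_integral_eq_lintegral_ofReal (integrable_N_zpow hM n 1 h)
    (Eventually.of_forall fun ω => by positivity)).symm

lemma momentSum_nonneg (r n J : ℕ) : 0 ≤ M.momentSum P r n J :=
  Finset.sum_nonneg fun s _ => mul_nonneg (integral_nonneg fun ω => by positivity) (by positivity)

/-- Moments of curve averages with weights of total mass `O(1 / J)`. -/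
lemma lintegral_zeta_pow_le_momentSum (hM : M.Standing P ε) (n i : ℕ) {g : ℝ → ℝ}
    (hg : IsWeight g) {φ : ℝ → (ℕ → S) → ℝ → ℝ}
    (hφ : Measurable fun q : ℝ × (ℕ → S) × ℝ => φ q.1 q.2.1 q.2.2)
    {r : ℕ} (hr : 1 ≤ r) {D : ℝ} (hD0 : 0 ≤ D)
    (hD : ∀ x ∈ Set.Icc (0 : ℝ) 1, ∀ j,
      eLpNorm (fun ω => φ x (M.past i ω) (M.err i j ω)) r P ≤ ENNReal.ofReal D)
    {J : ℕ} {C : ℝ} (hC : 1 ≤ C)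
    (hπ : ∀ j, ∫⁻ ω, ENNReal.ofReal (g (M.X i j ω)) ∂P ≤ ENNReal.ofReal (C / J)) :
    ∫⁻ ω, ‖M.zeta n i g φ ω‖ₑ ^ r ∂P
      ≤ ENNReal.ofReal ((sumMomentConst r).toReal * C ^ r * D ^ r * M.momentSum P r n J) := by
  have hD' : ∀ x ∈ Set.Icc (0 : ℝ) 1, ∀ j,
      ∫⁻ ω, ‖φ x (M.past i ω) (M.err i j ω)‖ₑ ^ r ∂P ≤ ENNReal.ofReal D ^ r := by
    intro x hx j
    rw [lintegral_enorm_pow_eq _ hr]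
    gcongr
    exact hD x hx j
  refine (lintegral_zeta_pow_le hM n i hg hφ hr hD').trans ?_
  have hC0 : (0 : ℝ) ≤ C := by linarith
  have hterm : ∀ t ∈ Finset.Icc 1 r,
      (∫⁻ ω, ENNReal.ofReal ((M.N n 1 ω : ℝ) ^ ((t : ℤ) - (r : ℤ))) ∂P)
        * ENNReal.ofReal (C / J) ^ t
      ≤ ENNReal.ofReal (C ^ r * ((∫ ω, (M.N n 1 ω : ℝ) ^ ((t : ℤ) - (r : ℤ)) ∂P)
        * (J : ℝ) ^ (-(t : ℤ)))) := by
    intro t ht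
    rw [Finset.mem_Icc] at ht
    have hI : 0 ≤ ∫ ω, (M.N n 1 ω : ℝ) ^ ((t : ℤ) - (r : ℤ)) ∂P :=
      integral_nonneg fun ω => by positivity
    rw [lintegral_N_zpow hM n ht.2, ← ENNReal.ofReal_pow (by positivity),
      ← ENNReal.ofReal_mul hI]
    refine ENNReal.ofReal_le_ofReal ?_
    rw [mul_left_comm, div_pow, div_eq_mul_inv, zpow_neg, zpow_natCast]
    gcongr
    exact ht.2
  calc _ ≤ ENNReal.ofReal D ^ r * (sumMomentConst r * ∑ t ∈ Finset.Icc 1 r,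
        (∫⁻ ω, ENNReal.ofReal ((M.N n 1 ω : ℝ) ^ ((t : ℤ) - (r : ℤ))) ∂P)
          * ENNReal.ofReal (C / J) ^ t) := by
        gcongr
        exact lintegral_weight_pow_le hM n i hg hr hπ
    _ ≤ ENNReal.ofReal D ^ r * (sumMomentConst r * ∑ t ∈ Finset.Icc 1 r,
        ENNReal.ofReal (C ^ r * ((∫ ω, (M.N n 1 ω : ℝ) ^ ((t : ℤ) - (r : ℤ)) ∂P)
          * (J : ℝ) ^ (-(t : ℤ))))) := by
        gcongr with t ht
        exact hterm t ht
    _ = _ := by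
        rw [← ENNReal.ofReal_sum_of_nonneg, ← Finset.mul_sum,
          ← ENNReal.ofReal_toReal (sumMomentConst_ne_top r), ← ENNReal.ofReal_pow hD0,
          ← ENNReal.ofReal_mul ENNReal.toReal_nonneg, ← ENNReal.ofReal_mul (by positivity),
          ENNReal.toReal_ofReal ENNReal.toReal_nonneg]
        · congr 1
          unfold momentSum
          ring
        · intro t _
          have hI : 0 ≤ ∫ ω, (M.N n 1 ω : ℝ) ^ ((t : ℤ) - (r : ℤ)) ∂P :=
            integral_nonneg fun ω => by positivity
          positivity

lemma integral_comp_X (hM : M.Standing P ε) (i j : ℕ) {h : ℝ → ℝ} (hh : Measurable h) :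
    ∫ ω, h (M.X i j ω) ∂P = ∫ ω, h (M.X 0 0 ω) ∂P := by
  have hid : IdentDistrib (M.X i j) (M.X 0 0) P P :=
    ⟨(hM.X_meas i j).aemeasurable, (hM.X_meas 0 0).aemeasurable,
      (hM.X_law i j).trans (hM.X_law 0 0).symm⟩
  exact (hid.comp hh).integral_eq

/-- The mean of a curve average. -/
lemma integral_zeta (hM : M.Standing P ε) (n i : ℕ) {g : ℝ → ℝ} (hg : IsWeight g)
    {φ : ℝ → (ℕ → S) → ℝ → ℝ} (hφ : Measurable fun q : ℝ × (ℕ → S) × ℝ => φ q.1 q.2.1 q.2.2)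
    (hint : Integrable (M.zeta n i g φ) P) {ψ : ℝ → ℝ}
    (hφi : ∀ x ∈ Set.Icc (0 : ℝ) 1, ∀ j, Integrable (fun ω => φ x (M.past i ω) (M.err i j ω)) P)
    (hψ : ∀ x ∈ Set.Icc (0 : ℝ) 1, ∀ j, ∫ ω, φ x (M.past i ω) (M.err i j ω) ∂P = ψ x)
    (hψm : Measurable fun x => g x * ψ x) {C : ℝ} (hC : ∀ x, |g x * ψ x| ≤ C) :
    ∫ ω, M.zeta n i g φ ω ∂P = ∫ ω, g (M.X 0 0 ω) * ψ (M.X 0 0 ω) ∂P := by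
  have hC0 : 0 ≤ C := (abs_nonneg _).trans (hC 0)
  have h1 : ∫ ω, M.zeta n i g φ ω ∂P
      = ∫ ω, (M.N n i ω : ℝ)⁻¹ * ∑ j ∈ Finset.Icc 1 (M.N n i ω),
        g (M.X i j ω) * ψ (M.X i j ω) ∂P := by
    unfold zeta at hint ⊢
    rw [integral_decouple (measurable_design hM n i) (measurable_noise hM i)
      (indepFun_design_noise hM n i) (measurable_curveAvg hg.meas hφ) hint]
    refine integral_congr_ae (Eventually.of_forall fun ω => ?_)
    simp only [curveAvg, design, noise]
    rw [integral_const_mul, integral_finsetSum]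
    · congr 1
      refine Finset.sum_congr rfl fun j _ => ?_
      rw [integral_const_mul]
      by_cases hx : M.X i j ω ∈ Set.Icc (0 : ℝ) 1
      · rw [hψ _ hx]
      · simp [hg.support _ hx]
    · intro j _
      by_cases hx : M.X i j ω ∈ Set.Icc (0 : ℝ) 1
      · exact (hφi _ hx j).const_mul _
      · simp [hg.support _ hx]
  rw [h1]
  have hF : Measurable (Function.uncurry fun (K : ℕ) (x : ℕ → ℝ) =>
      (K : ℝ)⁻¹ * ∑ j ∈ Finset.Icc 1 K, g (x j) * ψ (x j)) :=
    measurable_from_prod_countable_right fun K =>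
      (Finset.measurable_sum (Finset.Icc 1 K)
        fun j _ => hψm.comp (measurable_pi_apply j)).const_mul (K : ℝ)⁻¹
  have hXm : Measurable fun ω j => M.X i j ω := measurable_pi_iff.2 fun j => hM.X_meas i j
  have hint2 : Integrable (fun ω => (M.N n i ω : ℝ)⁻¹ * ∑ j ∈ Finset.Icc 1 (M.N n i ω),
      g (M.X i j ω) * ψ (M.X i j ω)) P := by
    refine Integrable.of_bound (hF.comp ((hM.N_meas n i).prodMk hXm)).aestronglyMeasurable C
      (Eventually.of_forall fun ω => ?_)
    have hK : (0 : ℝ) < M.N n i ω := by exact_mod_cast hM.N_pos n i ω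
    rw [norm_mul, norm_inv, Real.norm_natCast, inv_mul_le_iff₀ hK]
    refine (norm_sum_le _ _).trans ((Finset.sum_le_sum fun j _ => hC _).trans ?_)
    simp
  rw [integral_decouple (hM.N_meas n i) hXm (indepFun_N_X hM n i) hF hint2]
  have hi : ∀ j, Integrable (fun ω => g (M.X i j ω) * ψ (M.X i j ω)) P := fun j =>
    Integrable.of_bound (hψm.comp (hM.X_meas i j)).aestronglyMeasurable C
      (Eventually.of_forall fun ω => hC _)
  -- All design points have the same law, so an average over any number of them has the same mean
  -- and the random number of observations cancels.
  have hc : ∀ ω, ∫ ω', (M.N n i ω : ℝ)⁻¹ * ∑ j ∈ Finset.Icc 1 (M.N n i ω),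
      g (M.X i j ω') * ψ (M.X i j ω') ∂P = ∫ ω, g (M.X 0 0 ω) * ψ (M.X 0 0 ω) ∂P := by
    intro ω
    have hK : (0 : ℝ) < M.N n i ω := by exact_mod_cast hM.N_pos n i ω
    rw [integral_const_mul, integral_finsetSum _ fun j _ => hi j,
      Finset.sum_congr rfl fun j _ => integral_comp_X hM i j hψm]
    simp [inv_mul_cancel_left₀ hK.ne']
  simp only [hc]
  simp

end Model

end FTSBreak

namespace FTSBreak

set_option linter.unusedSectionVars false

/-! ### The layers of the centered scores -/

lemma curveAvg_sum {S κ : Type*} (g : ℝ → ℝ) (φ : κ → ℝ → (ℕ → S) → ℝ → ℝ) (F : Finset κ)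
    (a : ℕ × (ℕ → ℝ)) (b : (ℕ → S) × (ℕ → ℝ)) :
    curveAvg g (fun x s e => ∑ m ∈ F, φ m x s e) a b = ∑ m ∈ F, curveAvg g (φ m) a b := by
  simp only [curveAvg, Finset.mul_sum]
  rw [Finset.sum_comm]

lemma curveAvg_add {S : Type*} (g : ℝ → ℝ) (φ φ' : ℝ → (ℕ → S) → ℝ → ℝ)
    (a : ℕ × (ℕ → ℝ)) (b : (ℕ → S) × (ℕ → ℝ)) :
    curveAvg g (fun x s e => φ x s e + φ' x s e) a b = curveAvg g φ a b + curveAvg g φ' a b := by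
  simp only [curveAvg, mul_add, Finset.sum_add_distrib]

lemma isWeight_bspline {p : ℕ} (hp : 1 ≤ p) (J : ℕ) (l : Fin (J + p)) :
    IsWeight fun x => bspline p J x l :=
  ⟨measurable_bspline p J l, fun x => bspline_nonneg J hp x l, fun x => bspline_le_one J hp x l,
    fun _ hx => bspline_of_notMem hx l⟩

lemma measure_abs_gt_le {Ω : Type*} [MeasurableSpace Ω] {P : Measure Ω} {f : Ω → ℝ}
    (hf : Measurable f) {r : ℕ} {b T : ℝ} (hT : 0 < T)
    (h : ∫⁻ ω, ‖f ω‖ₑ ^ r ∂P ≤ ENNReal.ofReal b) :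
    P {ω | T < |f ω|} ≤ ENNReal.ofReal (b / T ^ r) := by
  have h1 : P {ω | T < |f ω|} ≤ P {ω | ENNReal.ofReal (T ^ r) ≤ ‖f ω‖ₑ ^ r} := by
    refine measure_mono fun ω hω => ?_
    change T < |f ω| at hω
    change ENNReal.ofReal (T ^ r) ≤ ‖f ω‖ₑ ^ r
    rw [ENNReal.ofReal_pow hT.le, Real.enorm_eq_ofReal_abs]
    gcongr
  refine h1.trans ((meas_ge_le_lintegral_div (hf.enorm.pow_const r).aemeasurable
    (by simpa using pow_pos hT r) ENNReal.ofReal_ne_top).trans ?_)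
  rw [ENNReal.ofReal_div_of_pos (by positivity)]
  gcongr

lemma integral_sq_le_of_lintegral {Ω : Type*} [MeasurableSpace Ω] {P : Measure Ω} {f : Ω → ℝ}
    {b : ℝ} (hb : 0 ≤ b) (h : ∫⁻ ω, ‖f ω‖ₑ ^ 2 ∂P ≤ ENNReal.ofReal b) :
    ∫ ω, f ω ^ 2 ∂P ≤ b := by
  by_cases hi : Integrable (fun ω => f ω ^ 2) P
  · refine (ENNReal.ofReal_le_ofReal_iff hb).1 ?_
    rw [ofReal_integral_eq_lintegral_ofReal hi (Eventually.of_forall fun ω => sq_nonneg _)]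
    refine le_trans (le_of_eq (lintegral_congr fun ω => ?_)) h
    rw [Real.enorm_eq_ofReal_abs, ← ENNReal.ofReal_pow (abs_nonneg _), sq_abs]
  · rw [integral_undef hi]
    exact hb

lemma memLp_of_lintegral {Ω : Type*} [MeasurableSpace Ω] {P : Measure Ω} {f : Ω → ℝ}
    (hf : Measurable f) {r : ℕ} (hr : 1 ≤ r) {b : ℝ}
    (h : ∫⁻ ω, ‖f ω‖ₑ ^ r ∂P ≤ ENNReal.ofReal b) : MemLp f r P := by
  refine ⟨hf.aestronglyMeasurable, ?_⟩
  rw [lintegral_enorm_pow_eq _ hr] at h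
  by_contra hc
  rw [not_lt, top_le_iff] at hc
  rw [hc, ENNReal.top_pow (by omega), top_le_iff] at h
  exact ENNReal.ofReal_ne_top h

lemma lintegral_enorm_sub_pow_le {Ω : Type*} [MeasurableSpace Ω] {P : Measure Ω}
    [IsProbabilityMeasure P] {f : Ω → ℝ} (hf : Measurable f) {r : ℕ} (hr : 1 ≤ r) :
    ∫⁻ ω, ‖f ω - ∫ ω', f ω' ∂P‖ₑ ^ r ∂P ≤ 2 ^ r * ∫⁻ ω, ‖f ω‖ₑ ^ r ∂P := by
  rw [lintegral_enorm_pow_eq _ hr, lintegral_enorm_pow_eq _ hr, ← mul_pow]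
  gcongr
  have hr1 : (1 : ℝ≥0∞) ≤ r := by exact_mod_cast hr
  refine (eLpNorm_sub_le hf.aestronglyMeasurable aestronglyMeasurable_const hr1).trans ?_
  rw [two_mul]
  gcongr
  rw [eLpNorm_const _ (by positivity) (IsProbabilityMeasure.ne_zero P)]
  simp only [measure_univ, ENNReal.one_rpow, mul_one]
  have h := enorm_integral_pow_le (P := P) hf.aemeasurable hr
  rw [lintegral_enorm_pow_eq _ hr] at h
  exact (ENNReal.pow_le_pow_left_iff (by omega)).1 h

namespace Model

variable {Ω S : Type*} [MeasurableSpace Ω] [MeasurableSpace S] {P : Measure Ω}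
  [IsProbabilityMeasure P] {M : Model Ω S} {ε : ℝ}

/-- The mean function of curve `i`, set to zero off the unit interval. -/
noncomputable def meanI (M : Model Ω S) (n i : ℕ) : ℝ → ℝ :=
  (Set.Icc (0 : ℝ) 1).indicator (M.mean n i)

/-- The contribution of the `m`-th layer to an observation. -/
noncomputable def layerφ (M : Model Ω S) (P : Measure Ω) (n i : ℕ) :
    ℕ → ℝ → (ℕ → S) → ℝ → ℝ
  | 0, x, s, e => M.meanI n i x + M.Hm P 0 x s + M.σ x * e
  | m + 1, x, s, _ => M.Hm P (m + 1) x s - M.Hm P m x s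

/-- The vector `E (B(X) h(X))`. -/
noncomputable def proj (M : Model Ω S) (P : Measure Ω) (p J : ℕ) (h : ℝ → ℝ) (l : Fin (J + p)) :
    ℝ := ∫ ω, bspline p J (M.X 0 0 ω) l * h (M.X 0 0 ω) ∂P

lemma continuousOn_mean {q : ℕ} {ν : ℝ} (hS : M.SmoothMeans q ν) (n i : ℕ) :
    ContinuousOn (M.mean n i) (Set.Icc 0 1) := by
  unfold mean
  split_ifs
  · exact hS.2.2.2.1.1.continuousOn
  · exact hS.2.2.2.2.1.continuousOn

lemma measurable_indicator_Icc {h : ℝ → ℝ} (hh : ContinuousOn h (Set.Icc 0 1)) :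
    Measurable ((Set.Icc (0 : ℝ) 1).indicator h) := by
  classical
  rw [← Set.piecewise_eq_indicator]
  exact hh.measurable_piecewise continuousOn_const measurableSet_Icc

/-- The mean functions are regular only on `[0,1]`. Cutting them off makes them measurable on the
line and is invisible to the scores, since B-splines vanish elsewhere. -/
lemma bspline_mul_indicator {p J : ℕ} (l : Fin (J + p)) (h : ℝ → ℝ) (x : ℝ) :
    bspline p J x l * (Set.Icc (0 : ℝ) 1).indicator h x = bspline p J x l * h x := by
  by_cases hx : x ∈ Set.Icc (0 : ℝ) 1
  · rw [Set.indicator_of_mem hx]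
  · rw [bspline_of_notMem hx, zero_mul, zero_mul]

lemma measurable_layerφ (hM : M.Standing P ε) {q : ℕ} {ν : ℝ} (hS : M.SmoothMeans q ν)
    (n i m : ℕ) : Measurable fun q : ℝ × (ℕ → S) × ℝ => M.layerφ P n i m q.1 q.2.1 q.2.2 := by
  have hp : Measurable fun q : ℝ × (ℕ → S) × ℝ => (q.1, q.2.1) :=
    measurable_fst.prodMk (measurable_fst.comp measurable_snd)
  cases m with
  | zero =>
    exact (((measurable_indicator_Icc (continuousOn_mean hS n i)).comp measurable_fst).add
      ((measurable_Hm hM 0).comp hp)).add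
      ((hM.σ_meas.comp measurable_fst).mul (measurable_snd.comp measurable_snd))
  | succ m => exact ((measurable_Hm hM (m + 1)).comp hp).sub ((measurable_Hm hM m).comp hp)

/-- Layer `m` sees only the last `m + 1` innovations; this finite dependence is what yields
independence along residue classes. -/
lemma layerφ_freeze (n i m : ℕ) (x : ℝ) (s : ℕ → S) (e : ℝ) :
    M.layerφ P n i m x (freeze m s) e = M.layerφ P n i m x s e := by
  cases m with
  | zero => simp only [layerφ, Hm_freeze]
  | succ m =>
    simp only [layerφ, Hm_freeze]
    rw [← Hm_freeze m x (freeze (m + 1) s), freeze_mono (Nat.le_succ m), Hm_freeze]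

lemma sum_layerφ (n i m : ℕ) (x : ℝ) (s : ℕ → S) (e : ℝ) :
    ∑ k ∈ Finset.range (m + 1), M.layerφ P n i k x s e
      = M.meanI n i x + M.Hm P m x s + M.σ x * e := by
  induction m with
  | zero => simp [layerφ]
  | succ m ih =>
    rw [Finset.sum_range_succ, ih]
    simp only [layerφ]
    ring

lemma score_eq_zeta {p : ℕ} (J n i : ℕ) (ω : Ω) (l : Fin (J + p)) :
    M.score p J n i ω l
      = M.zeta n i (fun x => bspline p J x l)
        (fun x s e => M.meanI n i x + M.H x s + M.σ x * e) ω := by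
  simp only [score, zeta, curveAvg, design, noise, Pi.smul_apply, Finset.sum_apply, smul_eq_mul]
  congr 1
  refine Finset.sum_congr rfl fun j _ => ?_
  rw [mul_comm, add_assoc, mul_add, meanI, bspline_mul_indicator, ← mul_add, ← add_assoc]
  rfl

lemma score_eq_sum (n : ℕ) {p : ℕ} (J m i : ℕ) (ω : Ω) (l : Fin (J + p)) :
    M.score p J n i ω l
      = ∑ k ∈ Finset.range (m + 1), M.zeta n i (fun x => bspline p J x l) (M.layerφ P n i k) ω
        + M.zeta n i (fun x => bspline p J x l) (fun x s _ => M.H x s - M.Hm P m x s) ω := by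
  rw [score_eq_zeta]
  unfold zeta
  rw [← curveAvg_sum, ← curveAvg_add]
  congr 1
  funext x s e
  rw [sum_layerφ]
  ring

lemma eLpNorm_err_le (hM : M.Standing P ε) {r₁ s : ℕ} (hs : s ≤ r₁) (i j : ℕ) :
    eLpNorm (M.err i j) s P ≤ eLpNorm (M.err 0 0) r₁ P :=
  ((hM.err_ident i j).eLpNorm_eq s).trans_le (eLpNorm_le_eLpNorm_of_exponent_le
    (by exact_mod_cast hs) (hM.err_meas 0 0).aestronglyMeasurable)

lemma exists_layerφ_moments (hM : M.Standing P ε) {q : ℕ} {ν : ℝ} (hS : M.SmoothMeans q ν)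
    {r₁ r₂ : ℕ} (hE : M.ErrorMoments P r₁) (hT : M.TrajectoryMoments P r₂)
    (hD : M.DependenceDecay P r₂) :
    ∃ D : ℝ, 0 < D ∧ ∀ s : ℕ, 1 ≤ s → s ≤ min r₁ r₂ → ∀ n i : ℕ, ∀ x ∈ Set.Icc (0 : ℝ) 1,
      ∀ j : ℕ,
      (∀ m : ℕ, eLpNorm (fun ω => M.layerφ P n i m x (M.past i ω) (M.err i j ω)) s P
        ≤ ENNReal.ofReal (D * (((m : ℝ) + 1) ^ 3)⁻¹)) ∧
      (∀ m : ℕ, eLpNorm (fun ω => M.H x (M.past i ω) - M.Hm P m x (M.past i ω)) s P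
        ≤ ENNReal.ofReal (D * (((m : ℝ) + 1) ^ 2)⁻¹)) := by
  obtain ⟨D1, hD1, hm⟩ := exists_mean_bound hS
  obtain ⟨D2, hD2, hL⟩ := exists_layer_moments hM hS hT hD
  obtain ⟨⟨Cσ, hσ⟩, hr₁, hE⟩ := hE
  set D3 : ℝ := Real.sqrt Cσ * (eLpNorm (M.err 0 0) r₁ P).toReal with hD3
  have hD3' : 0 ≤ D3 := by positivity
  refine ⟨D1 + D2 + D3, by positivity, fun s hs hsr n i x hx j => ⟨fun m => ?_, fun m => ?_⟩⟩
  · obtain ⟨h0, h1, -⟩ := hL s hs (hsr.trans (min_le_right _ _)) x hx i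
    cases m with
    | zero =>
      have hs1 : (1 : ℝ≥0∞) ≤ s := by exact_mod_cast hs
      have hmH : AEStronglyMeasurable (fun ω => M.Hm P 0 x (M.past i ω)) P :=
        (((measurable_Hm hM 0).comp measurable_prodMk_left).comp
          (measurable_past hM i)).aestronglyMeasurable
      have hmE : AEStronglyMeasurable (fun ω => M.σ x * M.err i j ω) P :=
        ((hM.err_meas i j).const_mul _).aestronglyMeasurable
      have e1 : eLpNorm (fun _ : Ω => M.meanI n i x) s P ≤ ENNReal.ofReal D1 := by
        rw [eLpNorm_const _ (by positivity) (IsProbabilityMeasure.ne_zero P)]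
        simp only [measure_univ, ENNReal.one_rpow, mul_one]
        rw [Real.enorm_eq_ofReal_abs, meanI, Set.indicator_of_mem hx]
        refine ENNReal.ofReal_le_ofReal ?_
        unfold mean
        split_ifs
        · exact (hm x hx).1
        · exact (hm x hx).2
      have e3 : eLpNorm (fun ω => M.σ x * M.err i j ω) s P ≤ ENNReal.ofReal D3 := by
        have := eLpNorm_const_smul (M.σ x) (M.err i j) (s : ℝ≥0∞) P
        rw [show (fun ω => M.σ x * M.err i j ω) = M.σ x • M.err i j from rfl, this, hD3,
          ENNReal.ofReal_mul (Real.sqrt_nonneg _), ENNReal.ofReal_toReal hE.2.ne,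
          Real.enorm_eq_ofReal_abs]
        refine mul_le_mul' (ENNReal.ofReal_le_ofReal ?_)
          (eLpNorm_err_le hM (hsr.trans (min_le_left _ _)) i j)
        exact Real.abs_le_sqrt (hσ x hx)
      have e : (fun ω => M.layerφ P n i 0 x (M.past i ω) (M.err i j ω))
          = ((fun _ => M.meanI n i x) + fun ω => M.Hm P 0 x (M.past i ω))
            + fun ω => M.σ x * M.err i j ω := rfl
      rw [e]
      refine (eLpNorm_add_le (aestronglyMeasurable_const.add hmH) hmE hs1).trans ?_
      refine (add_le_add (eLpNorm_add_le aestronglyMeasurable_const hmH hs1) le_rfl).trans ?_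
      refine (add_le_add (add_le_add e1 (h0 0)) e3).trans ?_
      rw [← ENNReal.ofReal_add hD1.le hD2.le, ← ENNReal.ofReal_add (by positivity) hD3']
      simp
    | succ m =>
      refine (h1 m).trans (ENNReal.ofReal_le_ofReal ?_)
      push_cast
      rw [add_assoc (m : ℝ), one_add_one_eq_two]
      gcongr
      linarith
  · obtain ⟨-, -, h2⟩ := hL s hs (hsr.trans (min_le_right _ _)) x hx i
    refine (h2 m).trans (ENNReal.ofReal_le_ofReal ?_)
    gcongr
    linarith

lemma exists_design_mass (hM : M.Standing P ε) (hf : M.DesignDensity) {p : ℕ} (hp : 1 ≤ p) :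
    ∃ C : ℝ, 1 ≤ C ∧ ∀ J : ℕ, 1 ≤ J → ∀ i j : ℕ, ∀ l : Fin (J + p),
      ∫⁻ ω, ENNReal.ofReal (bspline p J (M.X i j ω) l) ∂P ≤ ENNReal.ofReal (C / J) := by
  obtain ⟨c, C, hc, hfb⟩ := hf
  have hC : 0 < C := hc.trans_le ((hfb 0 (by simp)).1.trans (hfb 0 (by simp)).2)
  refine ⟨max 1 (C * p), le_max_left _ _, fun J hJ i j l => ?_⟩
  have hJ0 : (0 : ℝ) < J := by exact_mod_cast hJ
  have hB : Measurable fun x => ENNReal.ofReal (bspline p J x l) :=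
    (measurable_bspline p J l).ennreal_ofReal
  rw [← lintegral_map (f := fun x => ENNReal.ofReal (bspline p J x l)) hB (hM.X_meas i j),
    hM.X_law i j, lintegral_withDensity_eq_lintegral_mul _ hM.f_meas.ennreal_ofReal hB]
  calc ∫⁻ x in Set.Icc (0 : ℝ) 1, ((fun x => ENNReal.ofReal (M.f x)) *
        fun x => ENNReal.ofReal (bspline p J x l)) x
      ≤ ∫⁻ x in Set.Icc (0 : ℝ) 1, ENNReal.ofReal C * ENNReal.ofReal (bspline p J x l) := by
        refine setLIntegral_mono' measurableSet_Icc fun x hx => ?_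
        simp only [Pi.mul_apply]
        gcongr
        exact (hfb x hx).2
    _ ≤ ∫⁻ x, ENNReal.ofReal C * ENNReal.ofReal (bspline p J x l) := setLIntegral_le_lintegral _ _
    _ ≤ ENNReal.ofReal C * ENNReal.ofReal (p / (J + 1)) := by
        rw [lintegral_const_mul _ hB]
        gcongr
        exact lintegral_bspline_le hp l
    _ ≤ _ := by
        rw [← ENNReal.ofReal_mul hC.le]
        refine ENNReal.ofReal_le_ofReal ?_
        rw [← mul_div_assoc]
        gcongr
        · exact le_max_right _ _
        · linarith

/-- The sources of randomness of the `m`-th layer of curve `i`. -/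
def layerSrc (m i : ℕ) : Set Src :=
  {a | (∃ k : ℤ, (i : ℤ) - m ≤ k ∧ k ≤ i ∧ a = Src.e k) ∨ (∃ j, a = Src.X i j) ∨
    (∃ j, a = Src.err i j) ∨ a = Src.N i}

/-- Distinct indices congruent modulo `m + 1` are at least `m + 1` apart, so their windows of `m +
1` innovations do not overlap; the other sources belong to one curve each. -/
lemma disjoint_layerSrc {m i i' : ℕ} (h : i % (m + 1) = i' % (m + 1)) (hne : i ≠ i') :
    Disjoint (layerSrc m i) (layerSrc m i') := by
  rw [Set.disjoint_left]
  rintro a (⟨k, hk1, hk2, rfl⟩ | ⟨j, rfl⟩ | ⟨j, rfl⟩ | rfl)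
    (⟨k', hk1', hk2', h'⟩ | ⟨j', h'⟩ | ⟨j', h'⟩ | h') <;> cases h'
  · have h1 : (m + 1 : ℤ) ∣ (i : ℤ) - i' := by
      have := (Nat.modEq_iff_dvd.1 (show i' ≡ i [MOD (m + 1)] from h.symm))
      exact_mod_cast this
    have h2 : |(i : ℤ) - i'| < m + 1 := by
      rw [abs_lt]
      constructor <;> omega
    have h3 := Int.eq_zero_of_abs_lt_dvd h1 h2
    omega
  all_goals exact hne rfl

lemma measurable_zeta_layer (hM : M.Standing P ε) {q : ℕ} {ν : ℝ} (hS : M.SmoothMeans q ν)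
    (n i m : ℕ) {g : ℝ → ℝ} (hg : Measurable g) :
    Measurable[M.srcSup n (layerSrc m i)] (M.zeta n i g (M.layerφ P n i m)) := by
  have e : M.zeta n i g (M.layerφ P n i m) = fun ω => Function.uncurry
      (curveAvg g (M.layerφ P n i m)) (M.design n i ω,
        (freeze m (M.past i ω), fun j => M.err i j ω)) := by
    funext ω
    simp only [zeta, curveAvg, noise, Function.uncurry, layerφ_freeze]
  rw [e]
  refine (measurable_curveAvg hg (measurable_layerφ hM hS n i m)).comp ?_
  refine Measurable.prodMk (Measurable.prodMk ?_ ?_) (Measurable.prodMk ?_ ?_)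
  · exact measurable_N_src (.inr (.inr (.inr rfl)))
  · exact @measurable_pi_iff _ _ _ (_) _ _ |>.2 fun j => measurable_X_src (.inr (.inl ⟨j, rfl⟩))
  · refine @measurable_pi_iff _ _ _ (_) _ _ |>.2 fun k => measurable_e_src (.inl ⟨_, ?_, ?_, rfl⟩)
    · omega
    · omega
  · exact @measurable_pi_iff _ _ _ (_) _ _ |>.2
      fun j => measurable_err_src (.inr (.inr (.inl ⟨j, rfl⟩)))

lemma iIndepFun_residuePart (hM : M.Standing P ε) {n m : ℕ} {ι : Type*} {Z : ℕ → Ω → ι → ℝ}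
    (hZ : ∀ i, Measurable[M.srcSup n (layerSrc m i)] (Z i)) (ρ : ℕ) :
    iIndepFun (residuePart m ρ Z) P := by
  classical
  set K : ℕ → Set Src := fun i => if i % (m + 1) = ρ then layerSrc m i else ∅ with hK
  have h := iIndep_iSup_of_pairwise_disjoint (srcAlg_le hM n) (iIndep_srcAlg hM n) K (by
    intro i i' hne
    simp only [hK]
    split_ifs with h1 h2
    · exact disjoint_layerSrc (h1.trans h2.symm) hne
    all_goals simp)
  rw [iIndepFun_iff_iIndep]
  refine iIndep_of_iIndep_of_le h fun i => Measurable.comap_le ?_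
  by_cases hi : i % (m + 1) = ρ
  · have e1 : K i = layerSrc m i := by simp only [hK, hi, if_true]
    have e2 : residuePart m ρ Z i = Z i := by
      funext ω
      simp only [residuePart, hi, if_true]
    rw [e1, e2]
    exact hZ i
  · have e2 : residuePart m ρ Z i = fun _ => 0 := by
      funext ω
      simp only [residuePart, hi, if_false]
    rw [e2]
    exact measurable_const

lemma integral_comp_past (hM : M.Standing P ε) (i : ℤ) {u : (ℕ → S) → ℝ} (hu : Measurable u) :
    ∫ ω, u (M.past i ω) ∂P = ∫ ω, u (M.past 0 ω) ∂P :=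
  ((identDistrib_past hM i).comp hu).integral_eq

lemma integrable_Hm_past (hM : M.Standing P ε) {x : ℝ} (hx : x ∈ Set.Icc (0 : ℝ) 1) (i : ℤ)
    (m : ℕ) : Integrable (fun ω => M.Hm P m x (M.past i ω)) P :=
  ((identDistrib_past hM i).comp ((measurable_Hm hM m).comp
    measurable_prodMk_left)).integrable_iff.2 (integrable_Hm hM hx m)

lemma integral_Hm (hM : M.Standing P ε) {x : ℝ} (hx : x ∈ Set.Icc (0 : ℝ) 1) (i : ℤ) (m : ℕ) :
    ∫ ω, M.Hm P m x (M.past i ω) ∂P = 0 :=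
  (integral_comp_past hM i ((measurable_Hm hM m).comp measurable_prodMk_left)).trans
    (integral_Hm_past hM hx m)

lemma integrable_err (hM : M.Standing P ε) (i j : ℕ) : Integrable (M.err i j) P :=
  (hM.err_ident i j).integrable_iff.2 (hM.err_memLp.integrable one_le_two)

/-- The mean of the `m`-th layer of an observation. -/
noncomputable def layerMean (M : Model Ω S) (n i m : ℕ) : ℝ → ℝ :=
  if m = 0 then M.meanI n i else 0

lemma integrable_layerφ (hM : M.Standing P ε) {x : ℝ} (hx : x ∈ Set.Icc (0 : ℝ) 1)
    (n i m j : ℕ) : Integrable (fun ω => M.layerφ P n i m x (M.past i ω) (M.err i j ω)) P := by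
  cases m with
  | zero =>
    exact ((integrable_const _).add (integrable_Hm_past hM hx i 0)).add
      ((integrable_err hM i j).const_mul _)
  | succ m => exact (integrable_Hm_past hM hx i (m + 1)).sub (integrable_Hm_past hM hx i m)

lemma integral_layerφ (hM : M.Standing P ε) {x : ℝ} (hx : x ∈ Set.Icc (0 : ℝ) 1)
    (n i m j : ℕ) :
    ∫ ω, M.layerφ P n i m x (M.past i ω) (M.err i j ω) ∂P = M.layerMean n i m x := by
  cases m with
  | zero =>
    simp only [layerφ, layerMean, if_true]
    have hi : Integrable (fun ω => M.meanI n i x + M.Hm P 0 x (M.past i ω)) P :=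
      (integrable_const _).add (integrable_Hm_past hM hx i 0)
    rw [integral_add hi ((integrable_err hM i j).const_mul _), integral_add (integrable_const _)
      (integrable_Hm_past hM hx i 0), integral_Hm hM hx, integral_const_mul,
      (hM.err_ident i j).integral_eq, hM.err_mean]
    simp
  | succ m =>
    simp only [layerφ, layerMean]
    rw [integral_sub (integrable_Hm_past hM hx i (m + 1)) (integrable_Hm_past hM hx i m),
      integral_Hm hM hx, integral_Hm hM hx]
    simp

end Model

end FTSBreak

/-! ### Layered decomposition of the centered scores -/

namespace FTSBreak

set_option linter.unusedSectionVars false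

namespace Model

variable {Ω S : Type*} [MeasurableSpace Ω] [MeasurableSpace S] {P : Measure Ω}
  [IsProbabilityMeasure P] {M : Model Ω S} {ε : ℝ}

/-- The layers of the centered scores. -/
noncomputable def layer (M : Model Ω S) (P : Measure Ω) (p J n m i : ℕ) (ω : Ω)
    (l : Fin (J + p)) : ℝ :=
  M.zeta n i (fun x => bspline p J x l) (M.layerφ P n i m) ω
    - M.proj P p J (M.layerMean n i m) l

lemma proj_layerMean (p J n i m : ℕ) (l : Fin (J + p)) :
    M.proj P p J (M.layerMean n i m) l = if m = 0 then M.proj P p J (M.mean n i) l else 0 := by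
  unfold proj layerMean
  split_ifs
  · simp only [meanI, bspline_mul_indicator]
  · simp

lemma sum_layer_add (p J n m i : ℕ) (ω : Ω) (l : Fin (J + p)) :
    M.score p J n i ω l - M.proj P p J (M.mean n i) l
      = ∑ k ∈ Finset.range (m + 1), M.layer P p J n k i ω l
        + M.zeta n i (fun x => bspline p J x l) (fun x s _ => M.H x s - M.Hm P m x s) ω := by
  rw [score_eq_sum (P := P) n J m i ω l]
  simp only [layer, proj_layerMean, Finset.sum_sub_distrib]
  rw [Finset.sum_ite_eq' (Finset.range (m + 1)) 0, if_pos (by simp)]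
  ring

lemma momentSum_le_of_eLpNorm (hM : M.Standing P ε) {p : ℕ} (hp : 1 ≤ p) (n i J : ℕ)
    (l : Fin (J + p)) {φ : ℝ → (ℕ → S) → ℝ → ℝ}
    (hφ : Measurable fun q : ℝ × (ℕ → S) × ℝ => φ q.1 q.2.1 q.2.2)
    {r : ℕ} (hr : 1 ≤ r) {D w : ℝ} (hD0 : 0 ≤ D) (hw : 0 ≤ w)
    (hD : ∀ x ∈ Set.Icc (0 : ℝ) 1, ∀ j,
      eLpNorm (fun ω => φ x (M.past i ω) (M.err i j ω)) r P ≤ ENNReal.ofReal (D * w))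
    {C : ℝ} (hC : 1 ≤ C)
    (hπ : ∀ j, ∫⁻ ω, ENNReal.ofReal (bspline p J (M.X i j ω) l) ∂P ≤ ENNReal.ofReal (C / J)) :
    ∫⁻ ω, ‖M.zeta n i (fun x => bspline p J x l) φ ω‖ₑ ^ r ∂P
      ≤ ENNReal.ofReal ((sumMomentConst r).toReal * C ^ r * D ^ r * M.momentSum P r n J
        * w ^ r) := by
  refine (lintegral_zeta_pow_le_momentSum hM n i (isWeight_bspline hp J l) hφ hr
    (mul_nonneg hD0 hw) hD hC hπ).trans (le_of_eq ?_)
  congr 1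
  rw [mul_pow]
  ring

/-- The centered scores have a layered decomposition. -/
theorem exists_layered (hM : M.Standing P ε) {q : ℕ} {ν : ℝ} (hS : M.SmoothMeans q ν)
    (hf : M.DesignDensity) {r₁ r₂ : ℕ} (hE : M.ErrorMoments P r₁)
    (hT : M.TrajectoryMoments P r₂) (hD : M.DependenceDecay P r₂) {p : ℕ} (hp : 1 ≤ p) :
    ∃ K : ℝ, 0 < K ∧ ∀ n J : ℕ, 1 ≤ n → 1 ≤ J →
      ∃ L : Layered P n (K * M.momentSum P 2 n J)
        (fun i ω (l : Fin (J + p)) => M.score p J n i ω l - M.proj P p J (M.mean n i) l),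
      ∀ m i l (T : ℝ), 0 < T → P {ω | T < |L.Z m i ω l|}
        ≤ ENNReal.ofReal (K * M.momentSum P (min r₁ r₂) n J
          * ((((m : ℝ) + 1) ^ 3)⁻¹ / T) ^ (min r₁ r₂)) := by
  obtain ⟨C, hC, hmass⟩ := exists_design_mass hM hf hp
  obtain ⟨D, hD0, hmom⟩ := exists_layerφ_moments hM hS hE hT hD
  obtain ⟨Dm, hDm0, hDm⟩ := exists_mean_bound hS
  set r := min r₁ r₂ with hr
  have hr3 : 3 ≤ r := le_min hE.2.1 hT.2.2.1
  set A : ℕ → ℝ := fun s => (sumMomentConst s).toReal * C ^ s * D ^ s with hA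
  have hA0 : ∀ s, 0 ≤ A s := fun s => by positivity
  -- `A 2` serves the variances and `2 ^ r * A r` the tails of the centered layers, centering
  -- costing at most `2 ^ r`; the last summand gives positivity.
  refine ⟨A 2 + 2 ^ r * A r + 1, by have := hA0 2; have := hA0 r; positivity,
    fun n J hn hJ => ?_⟩
  -- The `n` layers are numbered `0, …, n'`, and the remainder comes from `ξ - Hm n'`, of size `(n'
  -- + 1)⁻² = n⁻²`; its second moment carries the factor `n⁻⁴`.
  obtain ⟨n', hn'⟩ : ∃ n', n = n' + 1 := ⟨n - 1, by omega⟩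
  set K : ℝ := A 2 + 2 ^ r * A r + 1 with hK
  have hK2 : A 2 ≤ K := by have := mul_nonneg (pow_nonneg zero_le_two r : (0 : ℝ) ≤ 2 ^ r) (hA0 r); linarith
  have hKr : 2 ^ r * A r ≤ K := by have := hA0 2; linarith
  have hmz : ∀ m i l, Measurable (M.zeta n i (fun x => bspline p J x l) (M.layerφ P n i m)) :=
    fun m i l => measurable_zeta hM n i (measurable_bspline p J l) (measurable_layerφ hM hS n i m)
  have hmR : Measurable fun q : ℝ × (ℕ → S) × ℝ => M.H q.1 q.2.1 - M.Hm P n' q.1 q.2.1 := by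
    have hpr : Measurable fun q : ℝ × (ℕ → S) × ℝ => (q.1, q.2.1) :=
      measurable_fst.prodMk (measurable_fst.comp measurable_snd)
    exact (hM.H_meas.comp hpr).sub ((measurable_Hm hM n').comp hpr)
  have hz : ∀ s, 1 ≤ s → s ≤ r → ∀ m i l,
      ∫⁻ ω, ‖M.zeta n i (fun x => bspline p J x l) (M.layerφ P n i m) ω‖ₑ ^ s ∂P
        ≤ ENNReal.ofReal (A s * M.momentSum P s n J * ((((m : ℝ) + 1) ^ 3)⁻¹) ^ s) :=
    fun s hs hsr m i l => momentSum_le_of_eLpNorm hM hp n i J l (measurable_layerφ hM hS n i m) hs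
      hD0.le (by positivity) (fun x hx j => (hmom s hs hsr n i x hx j).1 m) hC
      (fun j => hmass J hJ i j l)
  have hR : ∀ s, 1 ≤ s → s ≤ r → ∀ i l, ∫⁻ ω, ‖M.zeta n i (fun x => bspline p J x l)
      (fun x s _ => M.H x s - M.Hm P n' x s) ω‖ₑ ^ s ∂P
        ≤ ENNReal.ofReal (A s * M.momentSum P s n J * ((((n' : ℝ) + 1) ^ 2)⁻¹) ^ s) :=
    fun s hs hsr i l => momentSum_le_of_eLpNorm hM hp n i J l
      (φ := fun x s _ => M.H x s - M.Hm P n' x s) hmR hs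
      hD0.le (by positivity) (fun x hx j => (hmom s hs hsr n i x hx j).2 n') hC
      (fun j => hmass J hJ i j l)
  have hmem : ∀ m i l, MemLp (M.zeta n i (fun x => bspline p J x l) (M.layerφ P n i m)) 2 P :=
    fun m i l => memLp_of_lintegral (hmz m i l) one_le_two (hz 2 one_le_two (by omega) m i l)
  have hmean : ∀ m i l, ∫ ω, M.zeta n i (fun x => bspline p J x l) (M.layerφ P n i m) ω ∂P
      = M.proj P p J (M.layerMean n i m) l := by
    intro m i l
    refine integral_zeta hM n i (isWeight_bspline hp J l) (measurable_layerφ hM hS n i m)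
      ((hmem m i l).integrable one_le_two) (fun x hx j => integrable_layerφ hM hx n i m j)
      (fun x hx j => integral_layerφ hM hx n i m j) ?_ (C := Dm) fun x => ?_
    · refine (measurable_bspline p J l).mul ?_
      unfold layerMean
      split_ifs
      · exact measurable_indicator_Icc (continuousOn_mean hS n i)
      · exact measurable_const
    · by_cases hx : x ∈ Set.Icc (0 : ℝ) 1
      · have h1 : |M.layerMean n i m x| ≤ Dm := by
          unfold layerMean
          split_ifs
          · rw [meanI, Set.indicator_of_mem hx]
            unfold mean
            split_ifs
            · exact (hDm x hx).1
            · exact (hDm x hx).2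
          · simpa using hDm0.le
        rw [abs_mul, abs_of_nonneg (bspline_nonneg J hp x l)]
        calc _ ≤ 1 * Dm := mul_le_mul (bspline_le_one J hp x l) h1 (abs_nonneg _) zero_le_one
          _ = Dm := one_mul _
      · rw [bspline_of_notMem hx, zero_mul, abs_zero]
        exact hDm0.le
  have hlayer : ∀ m i l, (fun ω => M.layer P p J n m i ω l) = fun ω =>
      M.zeta n i (fun x => bspline p J x l) (M.layerφ P n i m) ω
        - ∫ ω', M.zeta n i (fun x => bspline p J x l) (M.layerφ P n i m) ω' ∂P := by
    intro m i l
    funext ω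
    rw [hmean, layer]
  have hms : ∀ s, 0 ≤ M.momentSum P s n J := fun s => momentSum_nonneg s n J
  have hmeasL : ∀ m i, Measurable[M.srcSup n (layerSrc m i)] (M.layer P p J n m i) := by
    intro m i
    refine @measurable_pi_iff _ _ _ (_) _ _ |>.2 fun l => ?_
    exact (measurable_zeta_layer hM hS n i m (measurable_bspline p J l)).sub_const _
  refine ⟨⟨M.layer P p J n, fun i ω l => M.zeta n i (fun x => bspline p J x l)
    (fun x s _ => M.H x s - M.Hm P n' x s) ω, ?_, ?_, ?_, ?_, ?_, ?_, ?_, ?_⟩, ?_⟩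
  · intro i ω l
    have h := sum_layer_add (M := M) (P := P) p J n n' i ω l
    rw [← hn'] at h
    exact h
  · intro m i
    exact (hmeasL m i).mono (srcSup_le hM n _) le_rfl
  · intro m ρ
    exact iIndepFun_residuePart hM (hmeasL m) ρ
  · intro m i l
    exact (hmem m i l).sub (memLp_const _)
  · intro m i l
    rw [hlayer, integral_sub ((hmem m i l).integrable one_le_two) (integrable_const _)]
    simp
  · intro m i l
    have h1 : ∫ ω, M.layer P p J n m i ω l ^ 2 ∂P
        = Var[M.zeta n i (fun x => bspline p J x l) (M.layerφ P n i m); P] := by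
      rw [variance_eq_integral (hmz m i l).aemeasurable]
      simp only [hmean]
      rfl
    rw [h1]
    refine (variance_le_expectation_sq (hmz m i l).aestronglyMeasurable).trans ?_
    refine (integral_sq_le_of_lintegral ?_ (hz 2 one_le_two (by omega) m i l)).trans ?_
    · have := hA0 2
      have := hms 2
      positivity
    · have := hms 2
      gcongr
  · intro i l
    exact memLp_of_lintegral (measurable_zeta hM n i (measurable_bspline p J l)
      (φ := fun x s _ => M.H x s - M.Hm P n' x s) hmR) one_le_two
      (hR 2 one_le_two (by omega) i l)
  · intro i l
    refine (integral_sq_le_of_lintegral ?_ (hR 2 one_le_two (by omega) i l)).trans ?_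
    · have := hA0 2
      have := hms 2
      positivity
    · have := hms 2
      have e : (n : ℝ) = (n' : ℝ) + 1 := by
        rw [hn']
        push_cast
        rfl
      rw [e, inv_pow, ← pow_mul]
      gcongr
  · intro m i l T hT0
    change P {ω | T < |M.layer P p J n m i ω l|} ≤ _
    have hb : ∫⁻ ω, ‖M.layer P p J n m i ω l‖ₑ ^ r ∂P
        ≤ ENNReal.ofReal (K * M.momentSum P r n J * ((((m : ℝ) + 1) ^ 3)⁻¹) ^ r) := by
      have e : (fun ω => ‖M.layer P p J n m i ω l‖ₑ ^ r) = fun ω =>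
        ‖M.zeta n i (fun x => bspline p J x l) (M.layerφ P n i m) ω
        - ∫ ω', M.zeta n i (fun x => bspline p J x l) (M.layerφ P n i m) ω' ∂P‖ₑ ^ r := by
        funext ω
        rw [← congrFun (hlayer m i l) ω]
      rw [e]
      refine (lintegral_enorm_sub_pow_le (hmz m i l) (by omega)).trans ?_
      refine (mul_le_mul_right (hz r (by omega) le_rfl m i l) _).trans ?_
      rw [show (2 : ℝ≥0∞) ^ r = ENNReal.ofReal (2 ^ r) by
        rw [ENNReal.ofReal_pow zero_le_two, ENNReal.ofReal_ofNat],
        ← ENNReal.ofReal_mul (by positivity)]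
      refine ENNReal.ofReal_le_ofReal ?_
      have := hms r
      rw [← mul_assoc, ← mul_assoc]
      gcongr
    refine (measure_abs_gt_le ((measurable_pi_iff.1 ((hmeasL m i).mono (srcSup_le hM n _) le_rfl)) l)
      hT0 hb).trans (le_of_eq ?_)
    rw [div_pow, mul_div_assoc]

end Model

end FTSBreak

namespace FTSBreak

set_option linter.unusedSectionVars false

/-! ### The empirical Gram matrix -/

namespace Model

variable {Ω S : Type*} [MeasurableSpace Ω] [MeasurableSpace S] {P : Measure Ω}
  [IsProbabilityMeasure P] {M : Model Ω S} {ε : ℝ}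

lemma integral_design (hM : M.Standing P ε) {h : ℝ → ℝ} (hm : Measurable h) :
    ∫ ω, h (M.X 0 0 ω) ∂P
      = ∫ x in Set.Icc (0 : ℝ) 1, (ENNReal.ofReal (M.f x)).toReal * h x := by
  rw [← integral_map (hM.X_meas 0 0).aemeasurable hm.aestronglyMeasurable, hM.X_law 0 0,
    integral_withDensity_eq_integral_toReal_smul hM.f_meas.ennreal_ofReal
      (Eventually.of_forall fun x => ENNReal.ofReal_lt_top)]
  rfl

lemma integral_design_bounds (hM : M.Standing P ε) {c C : ℝ} (hc : 0 < c)
    (hf : ∀ x ∈ Set.Icc (0 : ℝ) 1, c ≤ M.f x ∧ M.f x ≤ C) {h : ℝ → ℝ} (hm : Measurable h)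
    (h0 : ∀ x, 0 ≤ h x) {K : ℝ} (hK : ∀ x, h x ≤ K) :
    c * ∫ x in (0 : ℝ)..1, h x ≤ ∫ ω, h (M.X 0 0 ω) ∂P ∧
      ∫ ω, h (M.X 0 0 ω) ∂P ≤ C * ∫ x in (0 : ℝ)..1, h x := by
  rw [integral_design hM hm, intervalIntegral.integral_of_le zero_le_one,
    ← integral_Icc_eq_integral_Ioc, ← integral_const_mul, ← integral_const_mul]
  have hi : IntegrableOn h (Set.Icc (0 : ℝ) 1) :=
    Measure.integrableOn_of_bounded (by simp) hm.aestronglyMeasurable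
      (Eventually.of_forall fun x => (by rw [Real.norm_of_nonneg (h0 x)]; exact hK x : ‖h x‖ ≤ K))
  have hfe : ∀ x ∈ Set.Icc (0 : ℝ) 1, (ENNReal.ofReal (M.f x)).toReal = M.f x := fun x hx =>
    ENNReal.toReal_ofReal (hc.le.trans (hf x hx).1)
  have hC0 : 0 ≤ C := (hc.le.trans (hf 0 (by simp)).1).trans (hf 0 (by simp)).2
  have hi2 : IntegrableOn (fun x => (ENNReal.ofReal (M.f x)).toReal * h x) (Set.Icc (0 : ℝ) 1) := by
    refine (hi.const_mul C).mono'
      (hM.f_meas.ennreal_ofReal.ennreal_toReal.mul hm).aestronglyMeasurable ?_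
    refine (ae_restrict_iff' measurableSet_Icc).2 (Eventually.of_forall fun x hx => ?_)
    rw [hfe x hx, norm_mul, Real.norm_of_nonneg (h0 x),
      Real.norm_of_nonneg (hc.le.trans (hf x hx).1)]
    exact mul_le_mul_of_nonneg_right (hf x hx).2 (h0 x)
  constructor
  · refine setIntegral_mono_on (hi.const_mul c) hi2 measurableSet_Icc fun x hx => ?_
    rw [hfe x hx]
    exact mul_le_mul_of_nonneg_right (hf x hx).1 (h0 x)
  · refine setIntegral_mono_on hi2 (hi.const_mul C) measurableSet_Icc fun x hx => ?_
    rw [hfe x hx]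
    exact mul_le_mul_of_nonneg_right (hf x hx).2 (h0 x)

lemma ae_X_mem (hM : M.Standing P ε) : ∀ᵐ ω ∂P, M.X 0 0 ω ∈ Set.Icc (0 : ℝ) 1 := by
  have h : ∀ᵐ x ∂(P.map (M.X 0 0)), x ∈ Set.Icc (0 : ℝ) 1 := by
    rw [hM.X_law 0 0]
    exact (withDensity_absolutelyContinuous _ _).ae_le (ae_restrict_mem measurableSet_Icc)
  exact ae_of_ae_map (hM.X_meas 0 0).aemeasurable h

/-- The population Gram matrix. -/
noncomputable def Vpop (M : Model Ω S) (P : Measure Ω) (p J : ℕ) :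
    Matrix (Fin (J + p)) (Fin (J + p)) ℝ :=
  fun l l' => ∫ ω, bspline p J (M.X 0 0 ω) l * bspline p J (M.X 0 0 ω) l' ∂P

lemma isWeight_mul {p : ℕ} (hp : 1 ≤ p) (J : ℕ) (l l' : Fin (J + p)) :
    IsWeight fun x => bspline p J x l * bspline p J x l' :=
  ⟨(measurable_bspline p J l).mul (measurable_bspline p J l'),
    fun x => mul_nonneg (bspline_nonneg J hp x l) (bspline_nonneg J hp x l'),
    fun x => mul_le_one₀ (bspline_le_one J hp x l) (bspline_nonneg J hp x l')
      (bspline_le_one J hp x l'),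
    fun _ hx => by rw [bspline_of_notMem hx, zero_mul]⟩

lemma IsWeight.integrable_comp (hM : M.Standing P ε) {g : ℝ → ℝ} (hg : IsWeight g) :
    Integrable (fun ω => g (M.X 0 0 ω)) P :=
  Integrable.of_bound (hg.meas.comp (hM.X_meas 0 0)).aestronglyMeasurable 1
    (Eventually.of_forall fun ω => by
      rw [Real.norm_of_nonneg (hg.nonneg _)]
      exact hg.le_one _)

/-- The quadratic form is `E s(X)²` for the spline `s` with coefficients `u`, so coercivity follows
from the lower bound on the density and the stability of the basis. Row sums are at most `E B_l(X)`
by the partition of unity, hence `O(1/J)` by the upper bound on the density. -/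
lemma goodGram_Vpop (hM : M.Standing P ε) (hf : M.DesignDensity) {p : ℕ} (hp : 1 ≤ p) :
    ∃ c C : ℝ, 0 < c ∧ 0 < C ∧ ∀ J, GoodGram p J c C (M.Vpop P p J) := by
  obtain ⟨c, C, hc, hfb⟩ := hf
  have hC0 : 0 < C := (hc.trans_le (hfb 0 (by simp)).1).trans_le (hfb 0 (by simp)).2
  obtain ⟨Cs, hCs, hstab⟩ := exists_stability hp
  have hp0 : (0 : ℝ) < p := by exact_mod_cast hp
  refine ⟨c / Cs, C * p, by positivity, by positivity, fun J => ⟨?_, ?_, ?_, ?_, ?_⟩⟩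
  · exact fun l l' => integral_nonneg fun ω => (isWeight_mul hp J l l').nonneg _
  · intro l l'
    simp only [Vpop, mul_comm]
  · intro l l' hb
    unfold Vpop
    refine integral_eq_zero_of_ae (Eventually.of_forall fun ω => ?_)
    by_contra h
    exact hb (bspline_banded hp h)
  · intro u
    have e : u ⬝ᵥ M.Vpop P p J *ᵥ u = ∫ ω, spl p J u (M.X 0 0 ω) ^ 2 ∂P := by
      rw [dotProduct_mulVec_eq_sum]
      have hi : ∀ l l', Integrable (fun ω => u l * (bspline p J (M.X 0 0 ω) l
          * bspline p J (M.X 0 0 ω) l') * u l') P := fun l l' =>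
        ((IsWeight.integrable_comp hM (isWeight_mul hp J l l')).const_mul _).mul_const _
      have e2 : (fun ω => spl p J u (M.X 0 0 ω) ^ 2) = fun ω => ∑ l, ∑ l', u l *
          (bspline p J (M.X 0 0 ω) l * bspline p J (M.X 0 0 ω) l') * u l' := by
        funext ω
        simp only [spl, dotProduct, sq, Finset.sum_mul_sum]
        refine Finset.sum_congr rfl fun l _ => Finset.sum_congr rfl fun l' _ => ?_
        ring
      rw [e2, integral_finsetSum _ fun l _ => integrable_finsetSum _ fun l' _ => hi l l']
      refine Finset.sum_congr rfl fun l _ => ?_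
      rw [integral_finsetSum _ fun l' _ => hi l l']
      refine Finset.sum_congr rfl fun l' _ => ?_
      rw [integral_mul_const, integral_const_mul]
      rfl
    rw [e]
    obtain ⟨K, hK⟩ := exists_abs_spl_le hp u
    have h1 := (integral_design_bounds hM hc hfb ((measurable_spl p J u).pow_const 2)
      (fun x => sq_nonneg _) (K := K ^ 2) fun x => by
        rw [← sq_abs]
        exact pow_le_pow_left₀ (abs_nonneg _) (hK x) 2).1
    refine le_trans ?_ h1
    have h2 := hstab J u
    calc c / Cs / (J + 1) * ∑ l, u l ^ 2
        ≤ c / Cs / (J + 1) * (Cs * (J + 1) * ∫ x in (0 : ℝ)..1, spl p J u x ^ 2) := by gcongr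
      _ = _ := by field_simp
  · intro l
    have e : ∑ l', M.Vpop P p J l l' ≤ ∫ ω, bspline p J (M.X 0 0 ω) l ∂P := by
      unfold Vpop
      rw [← integral_finsetSum _ fun l' _ =>
        IsWeight.integrable_comp hM (isWeight_mul hp J l l')]
      refine integral_mono (integrable_finsetSum _ fun l' _ =>
        IsWeight.integrable_comp hM (isWeight_mul hp J l l'))
        (IsWeight.integrable_comp hM (isWeight_bspline hp J l)) fun ω => ?_
      simp only [← Finset.mul_sum]
      exact mul_le_of_le_one_right (bspline_nonneg J hp _ l) (sum_bspline_le J hp _)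
    refine e.trans ((integral_design_bounds hM hc hfb (measurable_bspline p J l)
      (fun x => bspline_nonneg J hp x l) fun x => bspline_le_one J hp x l).2.trans ?_)
    rw [mul_div_assoc]
    gcongr
    exact integral_bspline_le hp l

lemma Vhat_apply (p J n : ℕ) (ω : Ω) (l l' : Fin (J + p)) :
    M.Vhat p J n ω l l' = (n : ℝ)⁻¹ * ∑ i ∈ Finset.Icc 1 n,
      M.zeta n i (fun x => bspline p J x l * bspline p J x l') (fun _ _ _ => 1) ω := by
  simp only [Vhat, zeta, curveAvg, design, Matrix.smul_apply, Matrix.sum_apply, smul_eq_mul,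
    Matrix.vecMulVec_apply, mul_one]

lemma EInvN_le_one (hM : M.Standing P ε) (n : ℕ) : M.EInvN P n ≤ 1 := by
  have h := integrable_N_zpow hM n 1 (t := 0) (r := 1) (by norm_num)
  have e : (fun ω => (M.N n 1 ω : ℝ) ^ (((0 : ℕ) : ℤ) - ((1 : ℕ) : ℤ)))
      = fun ω => (M.N n 1 ω : ℝ)⁻¹ := by
    funext ω
    simp
  rw [e] at h
  calc M.EInvN P n ≤ ∫ _ω, (1 : ℝ) ∂P := by
        refine integral_mono h (integrable_const _) fun ω => ?_
        have h1 : (1 : ℝ) ≤ M.N n 1 ω := by exact_mod_cast hM.N_pos n 1 ω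
        exact inv_le_one_of_one_le₀ h1
    _ = 1 := by simp

lemma EInvN_pos (hM : M.Standing P ε) (n : ℕ) : 0 < M.EInvN P n := by
  have h := integrable_N_zpow hM n 1 (t := 0) (r := 1) (by norm_num)
  have e : (fun ω => (M.N n 1 ω : ℝ) ^ (((0 : ℕ) : ℤ) - ((1 : ℕ) : ℤ)))
      = fun ω => (M.N n 1 ω : ℝ)⁻¹ := by
    funext ω
    simp
  rw [e] at h
  unfold EInvN
  rw [integral_pos_iff_support_of_nonneg (fun ω => by positivity) h]
  have : Function.support (fun ω => (M.N n 1 ω : ℝ)⁻¹) = Set.univ := by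
    ext ω
    have := hM.N_pos n 1 ω
    simp
    omega
  rw [this]
  simp

lemma momentSum_two (n J : ℕ) :
    M.momentSum P 2 n J = M.EInvN P n * (J : ℝ)⁻¹ + ((J : ℝ) ^ 2)⁻¹ := by
  have e : Finset.Icc 1 2 = {1, 2} := rfl
  rw [momentSum, e, Finset.sum_pair (by norm_num)]
  have e1 : ((1 : ℕ) : ℤ) - ((2 : ℕ) : ℤ) = -1 := by norm_num
  have e2 : ((2 : ℕ) : ℤ) - ((2 : ℕ) : ℤ) = 0 := by norm_num
  rw [e1, e2]
  simp only [zpow_zero, zpow_neg, zpow_natCast, pow_one, EInvN]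
  simp

lemma measurable_zeta_one {n i : ℕ} {g : ℝ → ℝ} (hg : Measurable g) :
    Measurable[M.srcSup n {a | a = Src.N i ∨ ∃ j, a = Src.X i j}]
      (M.zeta n i g fun _ _ _ => 1) := by
  have e : M.zeta n i g (fun _ _ _ => 1) = fun ω => Function.uncurry
      (curveAvg (S := Unit) g fun _ _ _ => 1) (M.design n i ω, (fun _ => (), fun _ => 0)) := by
    funext ω
    simp only [zeta, curveAvg, Function.uncurry]
  rw [e]
  refine (measurable_curveAvg hg measurable_const).comp ?_
  refine Measurable.prodMk (Measurable.prodMk ?_ ?_) measurable_const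
  · exact measurable_N_src (.inl rfl)
  · exact @measurable_pi_iff _ _ _ (_) _ _ |>.2 fun j => measurable_X_src (.inr ⟨j, rfl⟩)

/-- Chebyshev's inequality: an entry of `V̂` is an average over independent curves, and the second
moment of one term is of the order of `momentSum 2`. -/
lemma Vhat_entry_deviation (hM : M.Standing P ε) {p : ℕ} (hp : 1 ≤ p) {C : ℝ} (hC : 1 ≤ C)
    {n J : ℕ} (hn : 1 ≤ n)
    (hmass : ∀ i j : ℕ, ∀ l : Fin (J + p),
      ∫⁻ ω, ENNReal.ofReal (bspline p J (M.X i j ω) l) ∂P ≤ ENNReal.ofReal (C / J))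
    (l l' : Fin (J + p)) {t : ℝ} (ht : 0 < t) :
    P {ω | t ≤ |M.Vhat p J n ω l l' - M.Vpop P p J l l'|}
      ≤ ENNReal.ofReal ((sumMomentConst 2).toReal * C ^ 2 * M.momentSum P 2 n J / (n * t ^ 2)) := by
  set g : ℝ → ℝ := fun x => bspline p J x l * bspline p J x l' with hg
  have hgw : IsWeight g := isWeight_mul hp J l l'
  set T : ℕ → Ω → ℝ := fun i => M.zeta n i g fun _ _ _ => 1 with hT
  have hTs : ∀ i, Measurable[M.srcSup n {a | a = Src.N i ∨ ∃ j, a = Src.X i j}] (T i) :=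
    fun i => measurable_zeta_one hgw.meas
  have hTm : ∀ i, Measurable (T i) := fun i => (hTs i).mono (srcSup_le hM n _) le_rfl
  have hmom : ∀ s, 1 ≤ s → ∀ i, ∫⁻ ω, ‖T i ω‖ₑ ^ s ∂P
      ≤ ENNReal.ofReal ((sumMomentConst s).toReal * C ^ s * 1 ^ s * M.momentSum P s n J) := by
    intro s hs i
    refine lintegral_zeta_pow_le_momentSum hM n i hgw (φ := fun _ _ _ => 1) measurable_const
      hs zero_le_one (fun x _ j => ?_) hC fun j => ?_
    · rw [eLpNorm_const _ (by positivity) (IsProbabilityMeasure.ne_zero P)]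
      simp
    · refine le_trans (lintegral_mono fun ω => ENNReal.ofReal_le_ofReal ?_) (hmass i j l)
      exact mul_le_of_le_one_right (bspline_nonneg J hp _ l) (bspline_le_one J hp _ l')
  have hmem : ∀ i, MemLp (T i) 2 P := fun i =>
    memLp_of_lintegral (hTm i) one_le_two (hmom 2 one_le_two i)
  have hmean : ∀ i, ∫ ω, T i ω ∂P = M.Vpop P p J l l' := by
    intro i
    have h := integral_zeta hM n i hgw (φ := fun _ _ _ => 1) measurable_const
      ((hmem i).integrable one_le_two) (ψ := fun _ => 1) (fun x _ j => integrable_const _)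
      (fun x _ j => by simp) (hgw.meas.mul measurable_const) (C := 1) fun x => by
        rw [mul_one, abs_of_nonneg (hgw.nonneg x)]
        exact hgw.le_one x
    simp only [mul_one] at h
    exact h
  have hind : Set.Pairwise (↑(Finset.Icc 1 n)) fun i i' => IndepFun (T i) (T i') P := by
    intro i _ i' _ hne
    refine indepFun_of_src hM (n := n) ?_ (hTs i) (hTs i')
    rw [Set.disjoint_left]
    rintro a (rfl | ⟨j, rfl⟩) (h | ⟨j', h⟩) <;> cases h <;> exact hne rfl
  have hn0 : (0 : ℝ) < n := by exact_mod_cast hn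
  set Sm : Ω → ℝ := ∑ i ∈ Finset.Icc 1 n, T i with hSm
  have hSmem : MemLp Sm 2 P := memLp_finsetSum' _ fun i _ => hmem i
  have hSmean : ∫ ω, Sm ω ∂P = n * M.Vpop P p J l l' := by
    simp only [hSm, Finset.sum_apply]
    rw [integral_finsetSum _ fun i _ => (hmem i).integrable one_le_two]
    simp [hmean]
  have hvar : Var[Sm; P] ≤ n * ((sumMomentConst 2).toReal * C ^ 2 * M.momentSum P 2 n J) := by
    rw [hSm, IndepFun.variance_sum (fun i _ => hmem i) hind]
    refine (Finset.sum_le_sum fun i _ =>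
      (variance_le_expectation_sq (hTm i).aestronglyMeasurable).trans
        (integral_sq_le_of_lintegral ?_ (hmom 2 one_le_two i))).trans ?_
    · have := momentSum_nonneg (M := M) (P := P) 2 n J
      positivity
    · simp
  have hset : {ω | t ≤ |M.Vhat p J n ω l l' - M.Vpop P p J l l'|}
      ⊆ {ω | n * t ≤ |Sm ω - ∫ ω', Sm ω' ∂P|} := by
    intro ω hω
    change t ≤ |M.Vhat p J n ω l l' - M.Vpop P p J l l'| at hω
    change n * t ≤ |Sm ω - ∫ ω', Sm ω' ∂P|
    have e : Sm ω - ∫ ω', Sm ω' ∂P = n * (M.Vhat p J n ω l l' - M.Vpop P p J l l') := by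
      rw [hSmean, Vhat_apply, mul_sub, mul_inv_cancel_left₀ hn0.ne', hSm, Finset.sum_apply]
    rw [e, abs_mul, abs_of_pos hn0]
    exact mul_le_mul_of_nonneg_left hω hn0.le
  refine (measure_mono hset).trans ((meas_ge_le_variance_div_sq hSmem (by positivity)).trans ?_)
  refine ENNReal.ofReal_le_ofReal ?_
  calc Var[Sm; P] / (n * t) ^ 2
      ≤ n * ((sumMomentConst 2).toReal * C ^ 2 * M.momentSum P 2 n J) / (n * t) ^ 2 := by gcongr
    _ = _ := by field_simp

/-- Only the `O(J)` entries inside the band can deviate. Each exceeds the tolerance `δ / (J+1)` with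
probability `O(J/n)`, and the union bound gives `J²/n`. -/
theorem exists_goodGram_Vhat (hM : M.Standing P ε) (hf : M.DesignDensity) {p : ℕ} (hp : 1 ≤ p) :
    ∃ c C K : ℝ, 0 < c ∧ 0 < C ∧ 0 < K ∧ ∀ n J : ℕ, 1 ≤ n → 1 ≤ J →
      P {ω | ¬ GoodGram p J c C (M.Vhat p J n ω)} ≤ ENNReal.ofReal (K * ((J : ℝ) ^ 2 / n)) := by
  classical
  obtain ⟨c, C, hc, hC, hpop⟩ := goodGram_Vpop hM hf hp
  obtain ⟨Cm, hCm, hmass⟩ := exists_design_mass hM hf hp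
  have hp0 : (0 : ℝ) < p := by exact_mod_cast hp
  -- The tolerance that costs exactly half of the coercivity, `2 p δ = c / 2`.
  set δ : ℝ := c / (4 * p) with hδ
  have hδ0 : 0 < δ := by positivity
  set B : ℝ := (sumMomentConst 2).toReal * Cm ^ 2 with hB
  have hB0 : 0 ≤ B := by positivity
  refine ⟨c - 2 * p * δ, C + 2 * p * δ, (1 + p) * (2 * p) * (B * 8 / δ ^ 2) + 1, ?_, by positivity,
    by positivity, fun n J hn hJ => ?_⟩
  · rw [hδ]
    have e : c - 2 * p * (c / (4 * p)) = c / 2 := by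
      field_simp
      norm_num
    rw [e]
    positivity
  have hn0 : (0 : ℝ) < n := by exact_mod_cast hn
  have hJ1 : (1 : ℝ) ≤ J := by exact_mod_cast hJ
  have hJ0 : (0 : ℝ) < J := by linarith
  set F : Finset (Fin (J + p) × Fin (J + p)) :=
    Finset.univ.filter fun q => InBand p q.1 q.2 with hF
  have hVb : ∀ ω l l', ¬ InBand p l l' → M.Vhat p J n ω l l' = 0 := by
    intro ω l l' hb
    rw [Vhat_apply, Finset.sum_eq_zero, mul_zero]
    intro i _
    simp only [zeta, curveAvg]
    rw [Finset.sum_eq_zero, mul_zero]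
    intro j _
    rw [mul_one]
    by_contra h
    exact hb (bspline_banded hp h)
  have hsub : {ω | ¬ GoodGram p J (c - 2 * p * δ) (C + 2 * p * δ) (M.Vhat p J n ω)}
      ⊆ ⋃ q ∈ F, {ω | δ / (J + 1) ≤ |M.Vhat p J n ω q.1 q.2 - M.Vpop P p J q.1 q.2|} := by
    intro ω hω
    by_contra hcon
    simp only [Set.mem_iUnion, not_exists] at hcon
    refine hω ((hpop J).of_close hδ0.le ?_ ?_ (hVb ω) ?_)
    · intro l l'
      rw [Vhat_apply]
      refine mul_nonneg (by positivity) (Finset.sum_nonneg fun i _ => ?_)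
      simp only [zeta, curveAvg]
      exact mul_nonneg (by positivity) (Finset.sum_nonneg fun j _ => mul_nonneg
        ((isWeight_mul hp J l l').nonneg _) zero_le_one)
    · intro l l'
      rw [Vhat_apply, Vhat_apply]
      simp only [mul_comm (bspline p J _ l)]
    · intro l l'
      by_cases hb : InBand p l l'
      · have := hcon (l, l') (by simpa [hF] using hb)
        exact (not_le.1 this).le
      · rw [hVb ω l l' hb, (hpop J).banded l l' hb, sub_zero, abs_zero]
        positivity
  have hcard : (F.card : ℝ) ≤ (1 + p) * (2 * p) * J := by
    have h1 : F.card ≤ (J + p) * (2 * p) := by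
      have : F.card = ∑ l : Fin (J + p), (Finset.univ.filter (InBand p l)).card := by
        rw [hF, ← Finset.univ_product_univ, Finset.card_filter, Finset.sum_product]
        simp only [Finset.card_filter]
      rw [this]
      refine (Finset.sum_le_sum fun l _ => card_inBand_le p l).trans ?_
      simp
    have h2 : (F.card : ℝ) ≤ ((J : ℝ) + p) * (2 * p) := by exact_mod_cast h1
    nlinarith [mul_nonneg hp0.le (sub_nonneg.2 hJ1), mul_nonneg hp0.le hp0.le,
      mul_nonneg (mul_nonneg hp0.le hp0.le) (sub_nonneg.2 hJ1)]
  have hms : M.momentSum P 2 n J ≤ 2 / J := by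
    rw [momentSum_two]
    have h1 := EInvN_le_one hM n
    have h2 : ((J : ℝ) ^ 2)⁻¹ ≤ (J : ℝ)⁻¹ := inv_anti₀ hJ0 (by nlinarith)
    have h3 : M.EInvN P n * (J : ℝ)⁻¹ ≤ 1 * (J : ℝ)⁻¹ := by gcongr
    rw [div_eq_mul_inv]
    linarith
  have hent : ∀ q ∈ F, P {ω | δ / (J + 1) ≤ |M.Vhat p J n ω q.1 q.2 - M.Vpop P p J q.1 q.2|}
      ≤ ENNReal.ofReal (B * 8 / δ ^ 2 * (J / n)) := by
    intro q _
    refine (Vhat_entry_deviation hM hp hCm hn (hmass J hJ) q.1 q.2 (by positivity)).trans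
      (ENNReal.ofReal_le_ofReal ?_)
    have hJJ : ((J : ℝ) + 1) ^ 2 ≤ 4 * J ^ 2 := by nlinarith
    calc B * M.momentSum P 2 n J / (n * (δ / (J + 1)) ^ 2)
        ≤ B * (2 / J) / (n * (δ / (J + 1)) ^ 2) := by gcongr
      _ = B * 2 / δ ^ 2 * (((J : ℝ) + 1) ^ 2 / (J * n)) := by field_simp
      _ ≤ B * 2 / δ ^ 2 * (4 * J ^ 2 / (J * n)) := by gcongr
      _ = _ := by field_simp; ring
  calc P {ω | ¬ GoodGram p J (c - 2 * p * δ) (C + 2 * p * δ) (M.Vhat p J n ω)}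
      ≤ ∑ q ∈ F, P {ω | δ / (J + 1) ≤ |M.Vhat p J n ω q.1 q.2 - M.Vpop P p J q.1 q.2|} :=
        (measure_mono hsub).trans (measure_biUnion_finset_le _ _)
    _ ≤ ∑ _q ∈ F, ENNReal.ofReal (B * 8 / δ ^ 2 * (J / n)) := Finset.sum_le_sum hent
    _ = ENNReal.ofReal (F.card * (B * 8 / δ ^ 2 * (J / n))) := by
        rw [Finset.sum_const, nsmul_eq_mul, ENNReal.ofReal_mul (Nat.cast_nonneg F.card),
          ENNReal.ofReal_natCast]
    _ ≤ _ := by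
        refine ENNReal.ofReal_le_ofReal ?_
        have h0 : 0 ≤ B * 8 / δ ^ 2 := by positivity
        calc F.card * (B * 8 / δ ^ 2 * (J / n))
            ≤ (1 + p) * (2 * p) * J * (B * 8 / δ ^ 2 * (J / n)) := by gcongr
          _ = (1 + p) * (2 * p) * (B * 8 / δ ^ 2) * ((J : ℝ) ^ 2 / n) := by ring
          _ ≤ _ := by
              gcongr
              linarith

end Model

end FTSBreak

namespace FTSBreak

set_option linter.unusedSectionVars false

/-! ### The signal -/

namespace Model

variable {Ω S : Type*} [MeasurableSpace Ω] [MeasurableSpace S] {P : Measure Ω}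
  [IsProbabilityMeasure P] {M : Model Ω S} {ε : ℝ}

lemma integrable_bspline_mul (hM : M.Standing P ε) {p : ℕ} (hp : 1 ≤ p) {J : ℕ}
    (l : Fin (J + p)) {h : ℝ → ℝ} (hh : ContinuousOn h (Set.Icc 0 1)) :
    Integrable (fun ω => bspline p J (M.X 0 0 ω) l * h (M.X 0 0 ω)) P := by
  obtain ⟨K, hK⟩ := isCompact_Icc.exists_bound_of_continuousOn hh
  have hK0 : 0 ≤ K := (norm_nonneg _).trans (hK 0 (by simp))
  simp only [← bspline_mul_indicator l h]
  refine Integrable.of_bound (((measurable_bspline p J l).mul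
    (measurable_indicator_Icc hh)).comp (hM.X_meas 0 0)).aestronglyMeasurable K
    (Eventually.of_forall fun ω => ?_)
  rw [norm_mul, Real.norm_of_nonneg (bspline_nonneg J hp _ l)]
  refine (mul_le_of_le_one_left (norm_nonneg _) (bspline_le_one J hp _ l)).trans ?_
  by_cases hx : M.X 0 0 ω ∈ Set.Icc (0 : ℝ) 1
  · rw [Set.indicator_of_mem hx]
    exact hK _ hx
  · rw [Set.indicator_of_notMem hx, norm_zero]
    exact hK0

lemma continuousOn_Δ {q : ℕ} {ν : ℝ} (hS : M.SmoothMeans q ν) :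
    ContinuousOn M.Δ (Set.Icc 0 1) :=
  hS.2.2.2.2.1.continuousOn.sub hS.2.2.2.1.1.continuousOn

lemma proj_Δ (hM : M.Standing P ε) {q : ℕ} {ν : ℝ} (hS : M.SmoothMeans q ν) {p : ℕ} (hp : 1 ≤ p)
    (J : ℕ) : M.proj P p J M.Δ = M.proj P p J M.mPost - M.proj P p J M.mPre := by
  funext l
  simp only [proj, Δ, Pi.sub_apply, mul_sub]
  exact integral_sub (integrable_bspline_mul hM hp l hS.2.2.2.2.1.continuousOn)
    (integrable_bspline_mul hM hp l hS.2.2.2.1.1.continuousOn)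

/-- The centered scores. -/
noncomputable def cscore (M : Model Ω S) (P : Measure Ω) (p J n i : ℕ) (ω : Ω) :
    Fin (J + p) → ℝ := fun l => M.score p J n i ω l - M.proj P p J (M.mean n i) l

/-- The noise part of the CUSUM process. -/
noncomputable def noiseCusum (M : Model Ω S) (P : Measure Ω) (p J n k : ℕ) (ω : Ω) :
    Fin (J + p) → ℝ :=
  ∑ i ∈ Finset.Icc 1 k, M.cscore P p J n i ω
    - ((k : ℝ) / n) • ∑ i ∈ Finset.Icc 1 n, M.cscore P p J n i ω

/-- The scores are centered at their exact means, so the break enters only through `proj Δ`,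
multiplied by the tent, and no spline approximation error appears. -/
lemma cusum_eq (hM : M.Standing P ε) {q : ℕ} {ν : ℝ} (hS : M.SmoothMeans q ν) {p : ℕ}
    (hp : 1 ≤ p) {J n : ℕ} (hn : 0 < n) (hk₀ : M.k₀ n ≤ n) (k : ℕ) (ω : Ω) :
    M.cusum p J n k ω = spl p J ((M.Vhat p J n ω)⁻¹ *ᵥ M.noiseCusum P p J n k ω
      - tent n (M.k₀ n) k • ((M.Vhat p J n ω)⁻¹ *ᵥ M.proj P p J M.Δ)) := by
  have hsc : ∀ i, M.score p J n i ω = M.cscore P p J n i ω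
      + if i ≤ M.k₀ n then M.proj P p J M.mPre else M.proj P p J M.mPost := by
    intro i
    funext l
    simp only [cscore, Pi.add_apply, mean]
    split_ifs <;> ring
  have h := cusum_const_eq (M.proj P p J M.mPre) (M.proj P p J M.mPost) (k := k) hn hk₀
  rw [← proj_Δ hM hS hp] at h
  have e : ∑ i ∈ Finset.Icc 1 k, M.score p J n i ω
      - ((k : ℝ) / n) • ∑ i ∈ Finset.Icc 1 n, M.score p J n i ω
      = M.noiseCusum P p J n k ω - tent n (M.k₀ n) k • M.proj P p J M.Δ := by
    simp only [hsc, Finset.sum_add_distrib, smul_add, noiseCusum]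
    rw [add_sub_add_comm, h, sub_eq_add_neg _ (tent n (M.k₀ n) k • M.proj P p J M.Δ)]
  funext x
  unfold cusum spl
  rw [e, Matrix.mulVec_sub, Matrix.mulVec_smul]

/-- Duality. Let `d` sample `h` at nodes. The spline with coefficients `d` is uniformly close to
`h`, so `d · proj h` is bounded below in terms of `∫ h²`. On the other hand `d · proj h = d · A u`
with `u = A⁻¹ proj h`; a weighted bound on this pairing and the stability of the basis force the
`L²` norm of the spline of `u` to stay away from zero. -/
lemma exists_signal_lower_bound (hM : M.Standing P ε) (hf : M.DesignDensity) {p : ℕ} (hp : 1 ≤ p)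
    {h : ℝ → ℝ} (hh : ContinuousOn h (Set.Icc 0 1)) (hpos : 0 < l2Norm h) {c C : ℝ} (hc : 0 < c)
    (hC : 0 < C) :
    ∃ b : ℝ, 0 < b ∧ ∃ J₀ : ℕ, ∀ J, J₀ ≤ J → ∀ A : Matrix (Fin (J + p)) (Fin (J + p)) ℝ,
      GoodGram p J c C A → b ≤ l2Semi hp J (A⁻¹ *ᵥ M.proj P p J h) := by
  obtain ⟨cf, Cf, hcf, hfb⟩ := hf
  obtain ⟨K, hK⟩ := isCompact_Icc.exists_bound_of_continuousOn hh
  obtain ⟨Cs, hCs, hstab⟩ := exists_stability hp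
  have hp0 : (0 : ℝ) < p := by exact_mod_cast hp
  have hp1 : (1 : ℝ) ≤ p := by exact_mod_cast hp
  set B : ℝ := max K 1 with hB
  have hB0 : 0 < B := lt_max_of_lt_right one_pos
  have hKB : ∀ x ∈ Set.Icc (0 : ℝ) 1, |h x| ≤ B := fun x hx => (hK x hx).trans (le_max_left _ _)
  set I : ℝ := ∫ x in (0 : ℝ)..1, h x ^ 2 with hI
  have hI0 : 0 < I := Real.sqrt_pos.1 hpos
  set c₂ : ℝ := cf * I / 2 with hc₂
  have hc₂0 : 0 < c₂ := by positivity
  have huc := isCompact_Icc.uniformContinuousOn_of_continuous hh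
  rw [Metric.uniformContinuousOn_iff] at huc
  -- Approximation within `c₂ / B`, tested against `|h| ≤ B`, loses at most `c₂`, half of the lower
  -- bound `cf * I = 2 c₂`.
  obtain ⟨δ, hδ0, hδ⟩ := huc (c₂ / B) (by positivity)
  obtain ⟨J₀, hJ₀⟩ := exists_nat_gt ((p : ℝ) / δ)
  -- Chosen so that the term in `d` takes up exactly `c₂ / 2`; the term in `u` must supply the rest.
  set s : ℝ := c₂ / (C * p * B ^ 2) with hs
  have hs0 : 0 < s := by positivity
  refine ⟨Real.sqrt (c₂ * s / (C * Cs)), Real.sqrt_pos.2 (by positivity), J₀,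
    fun J hJ A hA => ?_⟩
  have hJp : (0 : ℝ) < (J : ℝ) + 1 := by positivity
  have hpJ : (p : ℝ) / (J + 1) < δ := by
    rw [div_lt_iff₀ hJp]
    rw [div_lt_iff₀ hδ0] at hJ₀
    have : (J₀ : ℝ) ≤ J := by exact_mod_cast hJ
    nlinarith
  set t : Fin (J + p) → ℝ := fun l => min 1 ((l : ℝ) / (J + 1)) with ht
  have htm : ∀ l, t l ∈ Set.Icc (0 : ℝ) 1 := fun l =>
    ⟨le_min zero_le_one (by positivity), min_le_left _ _⟩
  set d : Fin (J + p) → ℝ := fun l => h (t l) with hd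
  have hnear : ∀ x ∈ Set.Icc (0 : ℝ) 1, ∀ l, bspline p J x l ≠ 0 → |h (t l) - h x| ≤ c₂ / B := by
    intro x hx l hl
    have hsup := bspline_support_Icc hp hl
    rw [Set.mem_Icc, div_le_iff₀ hJp, le_div_iff₀ hJp] at hsup
    have hpe : (p : ℝ) / (J + 1) * (J + 1) = p := div_mul_cancel₀ _ hJp.ne'
    have hle : (l : ℝ) / (J + 1) * (J + 1) = l := div_mul_cancel₀ _ hJp.ne'
    have h1 : |t l - x| ≤ (p : ℝ) / (J + 1) := by
      rw [abs_le]
      constructor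
      · have h2 : x - (p : ℝ) / (J + 1) ≤ t l := by
          refine le_min ?_ ?_
          · have : 0 ≤ (p : ℝ) / (J + 1) := by positivity
            linarith [hx.2]
          · rw [le_div_iff₀ hJp, sub_mul, hpe]
            linarith [hsup.2]
        linarith
      · have h2 : t l ≤ x + (p : ℝ) / (J + 1) := by
          refine (min_le_right _ _).trans ?_
          rw [div_le_iff₀ hJp, add_mul, hpe]
          linarith [hsup.1]
        linarith
    have := hδ (t l) (htm l) x hx (by rw [Real.dist_eq]; linarith)
    rw [Real.dist_eq] at this
    exact this.le
  have happrox : ∀ x ∈ Set.Icc (0 : ℝ) 1, |spl p J d x - h x| ≤ c₂ / B := by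
    intro x hx
    have e : spl p J d x - h x = ∑ l, bspline p J x l * (d l - h x) := by
      simp only [mul_sub, Finset.sum_sub_distrib, ← Finset.sum_mul, sum_bspline J hp hx, one_mul]
      rfl
    rw [e]
    calc |∑ l, bspline p J x l * (d l - h x)| ≤ ∑ l, |bspline p J x l * (d l - h x)| :=
          Finset.abs_sum_le_sum_abs _ _
      _ ≤ ∑ l, bspline p J x l * (c₂ / B) := by
          refine Finset.sum_le_sum fun l _ => ?_
          rw [abs_mul, abs_of_nonneg (bspline_nonneg J hp x l)]
          by_cases hl : bspline p J x l = 0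
          · rw [hl, zero_mul, zero_mul]
          · exact mul_le_mul_of_nonneg_left (hnear x hx l hl) (bspline_nonneg J hp x l)
      _ = c₂ / B := by rw [← Finset.sum_mul, sum_bspline J hp hx, one_mul]
  set hI' : ℝ → ℝ := (Set.Icc (0 : ℝ) 1).indicator h with hhI
  have hIm : Measurable hI' := measurable_indicator_Icc hh
  have hIB : ∀ x, |hI' x| ≤ B := by
    intro x
    by_cases hx : x ∈ Set.Icc (0 : ℝ) 1
    · rw [hhI, Set.indicator_of_mem hx]
      exact hKB x hx
    · rw [hhI, Set.indicator_of_notMem hx, abs_zero]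
      exact hB0.le
  have hdot : c₂ ≤ d ⬝ᵥ M.proj P p J h := by
    have e : d ⬝ᵥ M.proj P p J h = ∫ ω, spl p J d (M.X 0 0 ω) * h (M.X 0 0 ω) ∂P := by
      simp only [dotProduct, proj, ← integral_const_mul]
      rw [← integral_finsetSum _ fun l _ => (integrable_bspline_mul hM hp l hh).const_mul _]
      refine integral_congr_ae (Eventually.of_forall fun ω => ?_)
      simp only [spl, dotProduct, Finset.sum_mul]
      refine Finset.sum_congr rfl fun l _ => ?_
      ring
    have hint1 : Integrable (fun ω => spl p J d (M.X 0 0 ω) * h (M.X 0 0 ω)) P := by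
      simp only [spl, dotProduct, Finset.sum_mul]
      refine integrable_finsetSum _ fun l _ => ?_
      refine ((integrable_bspline_mul hM hp l hh).const_mul (d l)).congr
        (Eventually.of_forall fun ω => ?_)
      simp only
      ring
    have hint2 : Integrable (fun ω => hI' (M.X 0 0 ω) ^ 2) P := by
      refine Integrable.of_bound ((hIm.comp (hM.X_meas 0 0)).pow_const 2).aestronglyMeasurable
        (B ^ 2) (Eventually.of_forall fun ω => ?_)
      rw [norm_pow]
      exact pow_le_pow_left₀ (norm_nonneg _) (hIB _) 2
    have h2 := (integral_design_bounds hM hcf hfb (hIm.pow_const 2) (fun x => sq_nonneg _)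
      (K := B ^ 2) fun x => by
        rw [← sq_abs]
        exact pow_le_pow_left₀ (abs_nonneg _) (hIB x) 2).1
    have h3 : ∫ x in (0 : ℝ)..1, hI' x ^ 2 = I := by
      refine intervalIntegral.integral_congr fun x hx => ?_
      rw [Set.uIcc_of_le zero_le_one] at hx
      simp only [hhI, Set.indicator_of_mem hx]
    rw [h3] at h2
    have h4 : ∫ ω, hI' (M.X 0 0 ω) ^ 2 ∂P - c₂
        ≤ ∫ ω, spl p J d (M.X 0 0 ω) * h (M.X 0 0 ω) ∂P := by
      have e0 : ∫ ω, hI' (M.X 0 0 ω) ^ 2 ∂P - c₂ = ∫ ω, (hI' (M.X 0 0 ω) ^ 2 - c₂) ∂P := by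
        rw [integral_sub hint2 (integrable_const _)]
        simp
      rw [e0]
      refine integral_mono_ae (hint2.sub (integrable_const _)) hint1 ?_
      filter_upwards [ae_X_mem hM] with ω hω
      simp only [hhI, Set.indicator_of_mem hω]
      set x := M.X 0 0 ω
      have h5 := happrox x hω
      have h6 := hKB x hω
      have h7 : |(spl p J d x - h x) * h x| ≤ c₂ / B * B := by
        rw [abs_mul]
        exact mul_le_mul h5 h6 (abs_nonneg _) (by positivity)
      rw [div_mul_cancel₀ _ hB0.ne'] at h7
      have h8 := (abs_le.1 h7).1
      have h9 : (spl p J d x - h x) * h x = spl p J d x * h x - h x ^ 2 := by ring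
      linarith
    rw [e]
    have : c₂ + c₂ = cf * I := by rw [hc₂]; ring
    linarith
  set u := A⁻¹ *ᵥ M.proj P p J h with hu
  have hAu : A *ᵥ u = M.proj P p J h := hA.mulVec_inv hc _
  have hdl := hA.dot_le d u s hs0
  rw [hAu] at hdl
  have hdsq : ∑ l, d l ^ 2 ≤ p * (J + 1) * B ^ 2 := by
    calc ∑ l, d l ^ 2 ≤ ∑ _l : Fin (J + p), B ^ 2 := by
          refine Finset.sum_le_sum fun l _ => ?_
          rw [← sq_abs]
          exact pow_le_pow_left₀ (abs_nonneg _) (hKB _ (htm l)) 2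
      _ = ((J : ℝ) + p) * B ^ 2 := by simp
      _ ≤ _ := by
          gcongr
          nlinarith [mul_nonneg (sub_nonneg.2 hp1) (Nat.cast_nonneg J : (0 : ℝ) ≤ J)]
  have hst := hstab J u
  set Q : ℝ := ∫ x in (0 : ℝ)..1, spl p J u x ^ 2 with hQ
  have hbound : c₂ ≤ C / (J + 1) * (s * (p * (J + 1) * B ^ 2) + s⁻¹ * (Cs * (J + 1) * Q)) / 2 := by
    refine (hdot.trans hdl).trans ?_
    gcongr
  have e1 : C / (J + 1) * (s * (p * (J + 1) * B ^ 2) + s⁻¹ * (Cs * (J + 1) * Q)) / 2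
      = s * (C * p * B ^ 2) / 2 + C * Cs * Q / (2 * s) := by
    field_simp
  have e2 : s * (C * p * B ^ 2) = c₂ := div_mul_cancel₀ _ (by positivity)
  rw [e1, e2] at hbound
  have h3 : c₂ / 2 ≤ C * Cs * Q / (2 * s) := by linarith
  rw [le_div_iff₀ (by positivity)] at h3
  have h4 : c₂ * s / (C * Cs) ≤ Q := by
    rw [div_le_iff₀ (by positivity)]
    linarith
  rw [l2Semi_apply, l2Norm]
  exact Real.sqrt_le_sqrt h4

lemma l2Norm_pos_of_supNorm_pos {h : ℝ → ℝ} (hh : ContinuousOn h (Set.Icc 0 1))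
    (hpos : 0 < supNorm h) : 0 < l2Norm h := by
  obtain ⟨x, hx⟩ : ∃ x : Set.Icc (0 : ℝ) 1, h x ≠ 0 := by
    by_contra hcon
    push Not at hcon
    refine hpos.ne' ?_
    unfold supNorm
    simp [hcon]
  refine Real.sqrt_pos.2 ?_
  refine intervalIntegral.integral_pos zero_lt_one (hh.pow 2) (fun y _ => sq_nonneg _)
    ⟨x, x.2, ?_⟩
  positivity

end Model

end FTSBreak

namespace FTSBreak

set_option linter.unusedSectionVars false

/-! ### Increments over all scales -/

namespace Layered

variable {Ω : Type*} [MeasurableSpace Ω] {P : Measure Ω} [IsProbabilityMeasure P] {ι : Type*}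
  [Fintype ι] [Nonempty ι] {n : ℕ} {v : ℝ} {W : ℕ → Ω → ι → ℝ}

/-- The constant of the maximal inequality. -/
noncomputable def maxConst : ℝ := 4 + (2 * layerSum) ^ 2 * layerSum

lemma maxConst_pos : 0 < maxConst := by
  have := layerSum_pos
  unfold maxConst
  positivity

lemma exists_dyadic {t d : ℝ} (ht : 0 < t) (htd : t ≤ d) :
    ∃ s : ℕ, t * 2 ^ s ≤ d ∧ d < t * 2 ^ (s + 1) := by
  obtain ⟨s, h1, h2⟩ := exists_nat_pow_near ((one_le_div ht).2 htd) one_lt_two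
  rw [le_div_iff₀ ht] at h1
  rw [div_lt_iff₀ ht] at h2
  exact ⟨s, by linarith, by linarith⟩

/-- Peeling: at scale `s` the length is at most `t 2^(s+1)` and the level is `x t 2^s`, so the
maximal inequality gives a bound proportional to `2^(-s)`, which is summable. -/
lemma dyadic_measure_le (D : Layered P n v W) {t x : ℝ} (ht : 0 < t) (hx : 0 < x)
    (start M : ℕ → ℕ) (hM : ∀ s, M s ≤ n) (hMt : ∀ s, (M s : ℝ) ≤ t * 2 ^ (s + 1)) :
    P (⋃ s : ℕ, {ω | ∃ k ≤ M s, (x * (t * 2 ^ s)) ^ 2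
      < ∑ l, (∑ i ∈ Finset.range k, W (start s + i) ω l) ^ 2})
      ≤ ENNReal.ofReal (maxConst * (4 * (Fintype.card ι * v) / (t * x ^ 2))) := by
  have hv := D.v_nonneg
  have hC := maxConst_pos
  set B : ℝ := maxConst * (2 * (Fintype.card ι * v) / (t * x ^ 2)) with hB
  have hB0 : 0 ≤ B := by positivity
  have hterm : ∀ s, P {ω | ∃ k ≤ M s, (x * (t * 2 ^ s)) ^ 2
      < ∑ l, (∑ i ∈ Finset.range k, W (start s + i) ω l) ^ 2}
      ≤ ENNReal.ofReal (B * (1 / 2) ^ s) := by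
    intro s
    refine (D.maximal (start s) (hM s) (by positivity : 0 < x * (t * 2 ^ s))).trans
      (ENNReal.ofReal_le_ofReal ?_)
    calc (4 + (2 * layerSum) ^ 2 * layerSum) * (M s * Fintype.card ι * v) / (x * (t * 2 ^ s)) ^ 2
        = maxConst * (M s * Fintype.card ι * v) / (x * (t * 2 ^ s)) ^ 2 := rfl
      _ ≤ maxConst * (t * 2 ^ (s + 1) * Fintype.card ι * v) / (x * (t * 2 ^ s)) ^ 2 := by
          gcongr
          exact hMt s
      _ = B * (1 / 2) ^ s := by
          rw [hB, one_div, inv_pow, pow_succ]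
          field_simp
  refine (measure_iUnion_le _).trans ((ENNReal.tsum_le_tsum hterm).trans (le_of_eq ?_))
  rw [← ENNReal.ofReal_tsum_of_nonneg (fun s => by positivity)
    (summable_geometric_two.mul_left B), tsum_mul_left, tsum_geometric_two, hB]
  congr 1
  ring

lemma increments_right (D : Layered P n v W) (s₀ : ℕ) {t y : ℝ} (ht : 0 < t) (hy : 0 < y) :
    P {ω | ∃ d ≤ n, t ≤ d ∧ (y * d) ^ 2 < ∑ l, (∑ i ∈ Finset.range d, W (s₀ + i) ω l) ^ 2}
      ≤ ENNReal.ofReal (maxConst * (4 * (Fintype.card ι * v) / (t * y ^ 2))) := by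
  refine le_trans (measure_mono ?_) (D.dyadic_measure_le ht hy (fun _ => s₀)
    (fun s => min n ⌊t * 2 ^ (s + 1)⌋₊) (fun s => min_le_left _ _) fun s => ?_)
  · rintro ω ⟨d, hdn, htd, hlt⟩
    obtain ⟨s, h1, h2⟩ := exists_dyadic ht htd
    refine Set.mem_iUnion.2 ⟨s, d, le_min hdn (Nat.le_floor h2.le), lt_of_le_of_lt ?_ hlt⟩
    gcongr
  · exact (Nat.cast_le.2 (min_le_right _ _)).trans (Nat.floor_le (by positivity))

/-- Sums ending at `k₀` are differences of two partial sums started at the far end of a dyadic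
block, to which the forward maximal inequality applies; this costs half of `y`. -/
lemma increments_left (D : Layered P n v W) {k₀ : ℕ} (hk₀ : k₀ ≤ n) {t y : ℝ} (ht : 0 < t)
    (hy : 0 < y) :
    P {ω | ∃ d ≤ k₀, t ≤ d ∧
      (y * d) ^ 2 < ∑ l, (∑ i ∈ Finset.range d, W (k₀ + 1 - d + i) ω l) ^ 2}
      ≤ ENNReal.ofReal (maxConst * (4 * (Fintype.card ι * v) / (t * (y / 2) ^ 2))) := by
  refine le_trans (measure_mono ?_) (D.dyadic_measure_le ht (half_pos hy)
    (fun s => k₀ + 1 - min k₀ ⌊t * 2 ^ (s + 1)⌋₊)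
    (fun s => min k₀ ⌊t * 2 ^ (s + 1)⌋₊) (fun s => (min_le_left _ _).trans hk₀) fun s => ?_)
  · rintro ω ⟨d, hdk, htd, hlt⟩
    obtain ⟨s, h1, h2⟩ := exists_dyadic ht htd
    set m := min k₀ ⌊t * 2 ^ (s + 1)⌋₊ with hm
    have hdm : d ≤ m := le_min hdk (Nat.le_floor h2.le)
    have hmk : m ≤ k₀ := min_le_left _ _
    by_contra hcon
    simp only [Set.mem_iUnion, not_exists] at hcon
    have hc := hcon s
    simp only [Set.mem_ofPred_eq, not_exists, not_and, not_lt] at hc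
    have ha := hc m le_rfl
    have hb := hc (m - d) (Nat.sub_le _ _)
    have hsplit : ∀ l, ∑ i ∈ Finset.range d, W (k₀ + 1 - d + i) ω l
        = ∑ i ∈ Finset.range m, W (k₀ + 1 - m + i) ω l
          - ∑ i ∈ Finset.range (m - d), W (k₀ + 1 - m + i) ω l := by
      intro l
      have h := Finset.sum_range_add (fun i => W (k₀ + 1 - m + i) ω l) (m - d) d
      rw [Nat.sub_add_cancel hdm] at h
      rw [h, add_sub_cancel_left]
      refine Finset.sum_congr rfl fun i _ => ?_
      congr 1
      omega
    have hle : ∑ l, (∑ i ∈ Finset.range d, W (k₀ + 1 - d + i) ω l) ^ 2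
        ≤ 4 * (y / 2 * (t * 2 ^ s)) ^ 2 := by
      calc ∑ l, (∑ i ∈ Finset.range d, W (k₀ + 1 - d + i) ω l) ^ 2
          ≤ ∑ l, (2 * (∑ i ∈ Finset.range m, W (k₀ + 1 - m + i) ω l) ^ 2
            + 2 * (∑ i ∈ Finset.range (m - d), W (k₀ + 1 - m + i) ω l) ^ 2) := by
            refine Finset.sum_le_sum fun l _ => ?_
            rw [hsplit]
            nlinarith [sq_nonneg (∑ i ∈ Finset.range m, W (k₀ + 1 - m + i) ω l
              + ∑ i ∈ Finset.range (m - d), W (k₀ + 1 - m + i) ω l)]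
        _ ≤ _ := by
            rw [Finset.sum_add_distrib, ← Finset.mul_sum, ← Finset.mul_sum]
            linarith
    have h3 : 4 * (y / 2 * (t * 2 ^ s)) ^ 2 ≤ (y * d) ^ 2 := by
      calc 4 * (y / 2 * (t * 2 ^ s)) ^ 2 = (y * (t * 2 ^ s)) ^ 2 := by ring
        _ ≤ _ := by gcongr
    linarith
  · exact (Nat.cast_le.2 (min_le_right _ _)).trans (Nat.floor_le (by positivity))

end Layered

/-! ### The `L²` estimator -/

lemma l2Semi_inv_le {p J : ℕ} (hp : 1 ≤ p) {c C : ℝ} (hc : 0 < c)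
    {A : Matrix (Fin (J + p)) (Fin (J + p)) ℝ} (hA : GoodGram p J c C A) {z : Fin (J + p) → ℝ}
    {y : ℝ} (hy : 0 ≤ y) (hz : ∑ l, z l ^ 2 ≤ y ^ 2 * c ^ 2 / (p * (J + 1))) :
    l2Semi hp J (A⁻¹ *ᵥ z) ≤ y := by
  have hp0 : (0 : ℝ) < p := by exact_mod_cast hp
  refine (l2Semi_le hp J _).trans (Real.sqrt_le_iff.2 ⟨hy, ?_⟩)
  calc (p : ℝ) / (J + 1) * ∑ l, (A⁻¹ *ᵥ z) l ^ 2
      ≤ p / (J + 1) * (((J + 1) / c) ^ 2 * ∑ l, z l ^ 2) := by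
        gcongr
        exact hA.sum_sq_inv_le hc z
    _ ≤ p / (J + 1) * (((J + 1) / c) ^ 2 * (y ^ 2 * c ^ 2 / (p * (J + 1)))) := by gcongr
    _ = y ^ 2 := by field_simp

lemma sum_Icc_eq_sum_range {E : Type*} [AddCommMonoid E] (g : ℕ → E) (k : ℕ) :
    ∑ i ∈ Finset.Icc 1 k, g i = ∑ i ∈ Finset.range k, g (1 + i) := by
  rw [← Finset.Ico_add_one_right_eq_Icc, Finset.sum_Ico_eq_sum_range]
  simp

lemma sum_Icc_sub_of_le {E : Type*} [AddCommGroup E] (g : ℕ → E) {a b : ℕ} (h : a ≤ b) :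
    ∑ i ∈ Finset.Icc 1 b, g i - ∑ i ∈ Finset.Icc 1 a, g i
      = ∑ i ∈ Finset.range (b - a), g (a + 1 + i) := by
  obtain ⟨d, rfl⟩ := Nat.exists_eq_add_of_le h
  rw [sum_Icc_eq_sum_range, sum_Icc_eq_sum_range, Finset.sum_range_add, add_sub_cancel_left,
    Nat.add_sub_cancel_left]
  refine Finset.sum_congr rfl fun i _ => ?_
  congr 1
  omega

namespace Model

variable {Ω S : Type*} [MeasurableSpace Ω] [MeasurableSpace S] {P : Measure Ω}
  [IsProbabilityMeasure P] {M : Model Ω S} {ε : ℝ}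

/-- Deterministic localization of the `L²` estimator. -/
lemma l2_localization (hε : 0 < ε) (hM : M.Standing P ε) {q : ℕ} {ν : ℝ}
    (hS : M.SmoothMeans q ν) {p : ℕ} (hp : 1 ≤ p) {J n : ℕ} (hn : 0 < n)
    (hk : ε < (M.k₀ n : ℝ) / n ∧ (M.k₀ n : ℝ) / n < 1 - ε) {ω : Ω} {c C b y t : ℝ} (hc : 0 < c)
    (hA : GoodGram p J c C (M.Vhat p J n ω))
    (hsig : b ≤ l2Semi hp J ((M.Vhat p J n ω)⁻¹ *ᵥ M.proj P p J M.Δ))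
    (hy : 0 < y) (hyb : 6 * y < ε ^ 2 * b)
    (hglob : ∀ k ≤ n, ∑ l, (∑ i ∈ Finset.range k, M.cscore P p J n (1 + i) ω l) ^ 2
      ≤ (y * n) ^ 2 * c ^ 2 / (p * (J + 1)))
    (hright : ∀ d ≤ n, t ≤ (d : ℝ) →
      ∑ l, (∑ i ∈ Finset.range d, M.cscore P p J n (M.k₀ n + 1 + i) ω l) ^ 2
        ≤ (y * d) ^ 2 * c ^ 2 / (p * (J + 1)))
    (hleft : ∀ d ≤ M.k₀ n, t ≤ (d : ℝ) →
      ∑ l, (∑ i ∈ Finset.range d, M.cscore P p J n (M.k₀ n + 1 - d + i) ω l) ^ 2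
        ≤ (y * d) ^ 2 * c ^ 2 / (p * (J + 1)))
    (ht : 0 < t) {k : ℕ} (hmax : IsArgmax ε n (fun k => l2Norm (M.cusum p J n k ω) ^ 2) k) :
    |(k : ℝ) - M.k₀ n| ≤ t := by
  have hn0 : (0 : ℝ) < n := by exact_mod_cast hn
  have hk1 : ε * n < M.k₀ n := (lt_div_iff₀ hn0).1 hk.1
  have hk2 : (M.k₀ n : ℝ) < (1 - ε) * n := (div_lt_iff₀ hn0).1 hk.2
  have hk₀n : M.k₀ n ≤ n := by
    have : (M.k₀ n : ℝ) ≤ n := by nlinarith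
    exact_mod_cast this
  have hkn : k ≤ n := by
    have := hmax.1.2
    have : (k : ℝ) ≤ n := by nlinarith
    exact_mod_cast this
  by_contra hcon
  push Not at hcon
  set V := M.Vhat p J n ω with hV
  set Z : ℕ → Fin (J + p) → ℝ := fun k => V⁻¹ *ᵥ M.noiseCusum P p J n k ω with hZ
  set w : ℕ → Fin (J + p) → ℝ := fun i => M.cscore P p J n i ω with hw
  have hS1 : ∀ k ≤ n, l2Semi hp J (V⁻¹ *ᵥ ∑ i ∈ Finset.Icc 1 k, w i) ≤ y * n := by
    intro k hk
    refine l2Semi_inv_le hp hc hA (by positivity) ?_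
    rw [sum_Icc_eq_sum_range]
    simp only [Finset.sum_apply]
    exact hglob k hk
  -- The partial sum and the centering term of the CUSUM contribute `y * n` each, hence the factor
  -- `2`. The increment below doubles in the same way, so the tent lemma is used with `η = 2 y` and
  -- needs `3 η = 6 y`.
  have hZ0 : l2Semi hp J (Z (M.k₀ n)) ≤ 2 * y * n := by
    simp only [hZ, noiseCusum, Matrix.mulVec_sub, Matrix.mulVec_smul]
    refine (map_sub_le_add _ _ _).trans ?_
    rw [map_smul_eq_mul, Real.norm_of_nonneg (by positivity)]
    have h1 := hS1 _ hk₀n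
    have h2 := hS1 n le_rfl
    have h3 : (M.k₀ n : ℝ) / n ≤ 1 := (div_le_one hn0).2 (by exact_mod_cast hk₀n)
    have h4 := mul_le_mul h3 h2 (apply_nonneg _ _) zero_le_one
    linarith
  have hincr : l2Semi hp J (V⁻¹ *ᵥ (∑ i ∈ Finset.Icc 1 k, w i
      - ∑ i ∈ Finset.Icc 1 (M.k₀ n), w i)) ≤ y * |(k : ℝ) - M.k₀ n| := by
    refine l2Semi_inv_le hp hc hA (by positivity) ?_
    rcases le_total (M.k₀ n) k with h | h
    · have e : |(k : ℝ) - M.k₀ n| = ((k - M.k₀ n : ℕ) : ℝ) := by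
        rw [Nat.cast_sub h, abs_of_nonneg (sub_nonneg.2 (by exact_mod_cast h))]
      rw [e] at hcon ⊢
      rw [sum_Icc_sub_of_le _ h]
      simp only [Finset.sum_apply]
      exact hright _ ((Nat.sub_le _ _).trans hkn) hcon.le
    · have e : |(k : ℝ) - M.k₀ n| = ((M.k₀ n - k : ℕ) : ℝ) := by
        rw [Nat.cast_sub h, abs_of_nonpos (sub_nonpos.2 (by exact_mod_cast h)), neg_sub]
      rw [e] at hcon ⊢
      rw [← neg_sub, sum_Icc_sub_of_le _ h]
      simp only [Finset.sum_apply, Pi.neg_apply, neg_sq]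
      have := hleft _ (Nat.sub_le _ _) hcon.le
      rwa [show M.k₀ n + 1 - (M.k₀ n - k) = k + 1 by omega] at this
  have hZk : l2Semi hp J (Z k - Z (M.k₀ n)) ≤ 2 * y * |(k : ℝ) - M.k₀ n| := by
    have e : Z k - Z (M.k₀ n) = V⁻¹ *ᵥ (∑ i ∈ Finset.Icc 1 k, w i
        - ∑ i ∈ Finset.Icc 1 (M.k₀ n), w i)
        - (((k : ℝ) - M.k₀ n) / n) • (V⁻¹ *ᵥ ∑ i ∈ Finset.Icc 1 n, w i) := by
      simp only [hZ, noiseCusum, Matrix.mulVec_sub, Matrix.mulVec_smul]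
      rw [sub_div, sub_smul]
      abel
    rw [e]
    refine (map_sub_le_add _ _ _).trans ?_
    rw [map_smul_eq_mul, norm_div, Real.norm_natCast, Real.norm_eq_abs]
    have h2 := hS1 n le_rfl
    have h3 : |(k : ℝ) - M.k₀ n| / n * l2Semi hp J (V⁻¹ *ᵥ ∑ i ∈ Finset.Icc 1 n, w i)
        ≤ |(k : ℝ) - M.k₀ n| / n * (y * n) := by gcongr
    have h4 : |(k : ℝ) - M.k₀ n| / n * (y * n) = y * |(k : ℝ) - M.k₀ n| := by field_simp
    linarith
  have hm : l2Semi hp J (Z (M.k₀ n) - tent n (M.k₀ n) (M.k₀ n) • (V⁻¹ *ᵥ M.proj P p J M.Δ))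
      ≤ l2Semi hp J (Z k - tent n (M.k₀ n) k • (V⁻¹ *ᵥ M.proj P p J M.Δ)) := by
    have h := hmax.2 (M.k₀ n) hk1.le hk2.le
    simp only [cusum_eq (P := P) hM hS hp hn hk₀n] at h
    exact (sq_le_sq₀ (apply_nonneg (l2Semi hp J) _) (apply_nonneg (l2Semi hp J) _)).1 h
  have hfin := tent_argmax_of_increment (l2Semi hp J) hε (by positivity : 0 < 2 * y) hn hk₀n hkn
    hk1.le hk2.le hsig (by linarith) hZ0 hZk hm
  rw [hfin, sub_self, abs_zero] at hcon
  linarith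

end Model

end FTSBreak

/-! ### Probability bounds and the rate in `L²` -/

namespace FTSBreak

set_option linter.unusedSectionVars false

namespace Model

variable {Ω S : Type*} [MeasurableSpace Ω] [MeasurableSpace S] {P : Measure Ω}
  [IsProbabilityMeasure P] {M : Model Ω S} {ε : ℝ}

lemma momentSum_two_le (n : ℕ) {J : ℕ} (hJ : 1 ≤ J) :
    M.momentSum P 2 n J ≤ 2 * max 1 (J * M.EInvN P n) / (J : ℝ) ^ 2 := by
  have hJ0 : (0 : ℝ) < J := by exact_mod_cast hJ
  have e : M.momentSum P 2 n J = (J * M.EInvN P n + 1) / (J : ℝ) ^ 2 := by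
    rw [momentSum_two]
    field_simp
  rw [e]
  gcongr
  linarith [le_max_left (1 : ℝ) (J * M.EInvN P n), le_max_right (1 : ℝ) (J * M.EInvN P n)]

lemma max_le_sq (hM : M.Standing P ε) (n : ℕ) {J : ℕ} (hJ : 1 ≤ J) :
    max 1 (J * M.EInvN P n) ≤ (J : ℝ) ^ 2 := by
  have hJ1 : (1 : ℝ) ≤ J := by exact_mod_cast hJ
  have h1 := EInvN_le_one hM n
  have h2 : (J : ℝ) * M.EInvN P n ≤ J * 1 := by gcongr
  exact max_le (by nlinarith) (by nlinarith)

/-- The rate of the `L²` estimator. -/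
theorem l2_rate (hε : 0 < ε) (hM : M.Standing P ε) {q : ℕ} {ν : ℝ} (hS : M.SmoothMeans q ν)
    (hf : M.DesignDensity) {r₁ r₂ : ℕ} (hE : M.ErrorMoments P r₁)
    (hT : M.TrajectoryMoments P r₂) (hD : M.DependenceDecay P r₂) {p : ℕ} (hp : 1 ≤ p)
    {J : ℕ → ℕ} (hJ : Tendsto J atTop atTop)
    (hJn : Tendsto (fun n : ℕ => (J n : ℝ) ^ 2 / n) atTop (𝓝 0)) (hΔ : 0 < l2Norm M.Δ)
    {khat : ℕ → Ω → ℕ} (hk : M.IsL2Estimator ε p J khat) :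
    IsBigOP P (fun n ω => (khat n ω : ℝ) - (M.k₀ n : ℝ))
      (fun n => max 1 ((J n : ℝ) * M.EInvN P n)) := by
  obtain ⟨c, C, Kg, hc, hC, hKg, hgram⟩ := exists_goodGram_Vhat hM hf hp
  obtain ⟨b, hb, J₀, hsig⟩ := exists_signal_lower_bound hM hf hp (continuousOn_Δ hS) hΔ hc hC
  obtain ⟨K0, hK0, hlay⟩ := exists_layered hM hS hf hE hT hD hp
  have hp0 : (0 : ℝ) < p := by exact_mod_cast hp
  set y : ℝ := ε ^ 2 * b / 12 with hy
  have hy0 : 0 < y := by positivity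
  have hyb : 6 * y < ε ^ 2 * b := by
    have : 0 < ε ^ 2 * b := by positivity
    rw [hy]
    linarith
  set Q : ℝ := 4 * p * (1 + p) * K0 / (y ^ 2 * c ^ 2) with hQ
  have hQ0 : 0 < Q := by positivity
  have hm0 := Layered.maxConst_pos
  set m := Layered.maxConst with hm
  intro δ hδ
  -- Makes the probability bound for large increments to the left equal to `δ / 4`, the worse of the
  -- two sides.
  set K : ℝ := 64 * m * Q / δ with hK
  have hK' : 0 < K := by positivity
  refine ⟨K, hK', ?_⟩
  have hev1 : ∀ᶠ n : ℕ in atTop, Kg * ((J n : ℝ) ^ 2 / n) < δ / 4 := by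
    have h := hJn.const_mul Kg
    rw [mul_zero] at h
    exact h.eventually_lt_const (by positivity)
  have hev2 : ∀ᶠ n : ℕ in atTop, m * Q * ((J n : ℝ) ^ 2 / n) < δ / 4 := by
    have h := hJn.const_mul (m * Q)
    rw [mul_zero] at h
    exact h.eventually_lt_const (by positivity)
  filter_upwards [hev1, hev2, eventually_ge_atTop 1, hJ.eventually_ge_atTop 1,
    hJ.eventually_ge_atTop J₀, hk, hM.break_mem] with n h1 h2 hn hJ1 hJ2 hkn hbr
  set j := J n with hj
  have hjr : (1 : ℝ) ≤ j := by exact_mod_cast hJ1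
  have hj0 : (0 : ℝ) < j := by linarith
  have hn0 : (0 : ℝ) < n := by exact_mod_cast hn
  set a : ℝ := max 1 ((j : ℝ) * M.EInvN P n) with ha
  have ha1 : 1 ≤ a := le_max_left _ _
  have ha0 : 0 < a := by linarith
  obtain ⟨L, -⟩ := hlay n j hn hJ1
  have : Nonempty (Fin (j + p)) := ⟨⟨0, by omega⟩⟩
  have hv0 := L.v_nonneg
  set v : ℝ := K0 * M.momentSum P 2 n j with hv
  -- The level for coefficient vectors that corresponds, by `l2Semi_inv_le`, to an `L²` norm of at
  -- most `y` after inversion of the Gram matrix.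
  set Y : ℝ := y * c / Real.sqrt (p * (j + 1)) with hY
  have hsq : 0 < Real.sqrt (p * (j + 1)) := Real.sqrt_pos.2 (by positivity)
  have hY0 : 0 < Y := by positivity
  have hY2 : Y ^ 2 = y ^ 2 * c ^ 2 / (p * (j + 1)) := by
    rw [hY, div_pow, mul_pow, Real.sq_sqrt (by positivity)]
  have hYd : ∀ d : ℝ, (Y * d) ^ 2 = (y * d) ^ 2 * c ^ 2 / (p * (j + 1)) := by
    intro d
    rw [mul_pow, hY2]
    ring
  have hcv : Fintype.card (Fin (j + p)) * v / Y ^ 2 ≤ Q * a := by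
    have hvb : v ≤ K0 * (2 * a / (j : ℝ) ^ 2) := by
      rw [hv]
      gcongr
      exact momentSum_two_le n hJ1
    have hcard : ((Fintype.card (Fin (j + p)) : ℕ) : ℝ) ≤ (1 + p) * j := by
      rw [Fintype.card_fin]
      push_cast
      nlinarith
    calc Fintype.card (Fin (j + p)) * v / Y ^ 2
        ≤ (1 + p) * j * (K0 * (2 * a / (j : ℝ) ^ 2)) / Y ^ 2 := by gcongr
      _ = 2 * p * (1 + p) * K0 / (y ^ 2 * c ^ 2) * a * (((j : ℝ) + 1) / j) := by
          rw [hY2]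
          field_simp
      _ ≤ 2 * p * (1 + p) * K0 / (y ^ 2 * c ^ 2) * a * 2 := by
          gcongr
          rw [div_le_iff₀ hj0]
          linarith
      _ = Q * a := by
          rw [hQ]
          ring
  set E0 : Set Ω := {ω | ¬ GoodGram p j c C (M.Vhat p j n ω)} with hE0
  set E1 : Set Ω := {ω | ∃ k ≤ n, (Y * n) ^ 2
    < ∑ l, (∑ i ∈ Finset.range k, M.cscore P p j n (1 + i) ω l) ^ 2} with hE1
  set E2 : Set Ω := {ω | ∃ d ≤ n, K * a ≤ d ∧ (Y * d) ^ 2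
    < ∑ l, (∑ i ∈ Finset.range d, M.cscore P p j n (M.k₀ n + 1 + i) ω l) ^ 2} with hE2
  set E3 : Set Ω := {ω | ∃ d ≤ M.k₀ n, K * a ≤ d ∧ (Y * d) ^ 2
    < ∑ l, (∑ i ∈ Finset.range d, M.cscore P p j n (M.k₀ n + 1 - d + i) ω l) ^ 2} with hE3
  have hk₀n : M.k₀ n ≤ n := by
    have h3 := (div_lt_iff₀ hn0).1 hbr.2
    have : (M.k₀ n : ℝ) ≤ n := by nlinarith
    exact_mod_cast this
  have hP0 : P E0 ≤ ENNReal.ofReal (δ / 4) :=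
    (hgram n j hn hJ1).trans (ENNReal.ofReal_le_ofReal h1.le)
  have hP1 : P E1 ≤ ENNReal.ofReal (δ / 4) := by
    refine (L.maximal 1 le_rfl (by positivity : 0 < Y * n)).trans (ENNReal.ofReal_le_ofReal ?_)
    calc m * (n * Fintype.card (Fin (j + p)) * v) / (Y * n) ^ 2
        = m * (Fintype.card (Fin (j + p)) * v / Y ^ 2) / n := by field_simp
      _ ≤ m * (Q * a) / n := by gcongr
      _ ≤ m * (Q * (j : ℝ) ^ 2) / n := by
          gcongr
          exact max_le_sq hM n hJ1
      _ = m * Q * ((j : ℝ) ^ 2 / n) := by ring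
      _ ≤ δ / 4 := h2.le
  have hP2 : P E2 ≤ ENNReal.ofReal (δ / 4) := by
    refine (L.increments_right (M.k₀ n + 1) (by positivity : 0 < K * a) hY0).trans
      (ENNReal.ofReal_le_ofReal ?_)
    calc m * (4 * (Fintype.card (Fin (j + p)) * v) / (K * a * Y ^ 2))
        = 4 * m * (Fintype.card (Fin (j + p)) * v / Y ^ 2) / (K * a) := by field_simp
      _ ≤ 4 * m * (Q * a) / (K * a) := by gcongr
      _ = δ / 16 := by
          rw [hK]
          field_simp
          norm_num
      _ ≤ δ / 4 := by linarith
  have hP3 : P E3 ≤ ENNReal.ofReal (δ / 4) := by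
    refine (L.increments_left hk₀n (by positivity : 0 < K * a) hY0).trans
      (ENNReal.ofReal_le_ofReal ?_)
    calc m * (4 * (Fintype.card (Fin (j + p)) * v) / (K * a * (Y / 2) ^ 2))
        = 16 * m * (Fintype.card (Fin (j + p)) * v / Y ^ 2) / (K * a) := by
          field_simp
          ring
      _ ≤ 16 * m * (Q * a) / (K * a) := by gcongr
      _ = δ / 4 := by
          rw [hK]
          field_simp
          norm_num
      _ ≤ δ / 4 := le_rfl
  have hsub : {ω | K * a < |(khat n ω : ℝ) - (M.k₀ n : ℝ)|} ⊆ ((E0 ∪ E1) ∪ E2) ∪ E3 := by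
    intro ω hω
    by_contra hcon
    simp only [Set.mem_union, not_or] at hcon
    obtain ⟨⟨⟨g0, g1⟩, g2⟩, g3⟩ := hcon
    simp only [hE0, hE1, hE2, hE3, Set.mem_ofPred_eq, not_not, not_exists, not_and,
      not_lt] at g0 g1 g2 g3
    have hloc := l2_localization (P := P) hε hM hS hp hn hbr hc g0 (hsig j hJ2 _ g0) hy0 hyb
      (fun k hk => (g1 k hk).trans_eq (hYd n)) (fun d hd ht => (g2 d hd ht).trans_eq (hYd d))
      (fun d hd ht => (g3 d hd ht).trans_eq (hYd d)) (by positivity : 0 < K * a) (hkn ω)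
    change K * a < |(khat n ω : ℝ) - (M.k₀ n : ℝ)| at hω
    linarith
  calc P {ω | K * a < |(khat n ω : ℝ) - (M.k₀ n : ℝ)|} ≤ P (((E0 ∪ E1) ∪ E2) ∪ E3) :=
        measure_mono hsub
    _ ≤ P E0 + P E1 + P E2 + P E3 := by
        refine (measure_union_le _ _).trans (add_le_add ?_ le_rfl)
        refine (measure_union_le _ _).trans (add_le_add ?_ le_rfl)
        exact measure_union_le _ _
    _ ≤ ENNReal.ofReal (δ / 4) + ENNReal.ofReal (δ / 4) + ENNReal.ofReal (δ / 4)
        + ENNReal.ofReal (δ / 4) := add_le_add (add_le_add (add_le_add hP0 hP1) hP2) hP3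
    _ = ENNReal.ofReal δ := by
        rw [← ENNReal.ofReal_add (by positivity) (by positivity),
          ← ENNReal.ofReal_add (by positivity) (by positivity),
          ← ENNReal.ofReal_add (by positivity) (by positivity)]
        congr 1
        ring

end Model

end FTSBreak

namespace FTSBreak

set_option linter.unusedSectionVars false

/-! ### The sup-norm estimator -/

namespace Model

variable {Ω S : Type*} [MeasurableSpace Ω] [MeasurableSpace S] {P : Measure Ω}
  [IsProbabilityMeasure P] {M : Model Ω S} {ε : ℝ}

/-- Deterministic localization of the sup-norm estimator. -/
lemma sup_localization (hε : 0 < ε) (hM : M.Standing P ε) {q : ℕ} {ν : ℝ}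
    (hS : M.SmoothMeans q ν) {p : ℕ} (hp : 1 ≤ p) {J n : ℕ} (hn : 0 < n)
    (hk : ε < (M.k₀ n : ℝ) / n ∧ (M.k₀ n : ℝ) / n < 1 - ε) {ω : Ω} {K b x : ℝ} (hK : 0 < K)
    (hinv : ∀ z : Fin (J + p) → ℝ, ∀ ζ : ℝ, (∀ l, |z l| ≤ ζ) →
      ∀ l, |((M.Vhat p J n ω)⁻¹ *ᵥ z) l| ≤ K * (J + 1) * ζ)
    (hb : 0 < b) (hsig : b ≤ l2Semi hp J ((M.Vhat p J n ω)⁻¹ *ᵥ M.proj P p J M.Δ))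
    (hx : 0 < x) (hglob : ∀ k ≤ n, ∀ l,
      |∑ i ∈ Finset.range k, M.cscore P p J n (1 + i) ω l| ≤ x)
    {k : ℕ} (hmax : IsArgmax ε n (fun k => supNorm (M.cusum p J n k ω)) k) :
    |(k : ℝ) - M.k₀ n| ≤ 2 * (K * (J + 1) * (2 * x)) / (ε * b) := by
  have hn0 : (0 : ℝ) < n := by exact_mod_cast hn
  have hk1 : ε * n < M.k₀ n := (lt_div_iff₀ hn0).1 hk.1
  have hk2 : (M.k₀ n : ℝ) < (1 - ε) * n := (div_lt_iff₀ hn0).1 hk.2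
  have hk₀n : M.k₀ n ≤ n := by
    have : (M.k₀ n : ℝ) ≤ n := by nlinarith
    exact_mod_cast this
  have hkn : k ≤ n := by
    have := hmax.1.2
    have : (k : ℝ) ≤ n := by nlinarith
    exact_mod_cast this
  set V := M.Vhat p J n ω with hV
  set Z : ℕ → Fin (J + p) → ℝ := fun k => V⁻¹ *ᵥ M.noiseCusum P p J n k ω with hZ
  have hZb : ∀ k ≤ n, supSemi hp J (Z k) ≤ K * (J + 1) * (2 * x) := by
    intro k hk
    refine supSemi_le hp (by positivity) (hinv _ _ fun l => ?_)
    simp only [noiseCusum, Pi.sub_apply, Pi.smul_apply, smul_eq_mul, sum_Icc_eq_sum_range,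
      Finset.sum_apply]
    refine (abs_sub _ _).trans ?_
    have h3 : (k : ℝ) / n ≤ 1 := (div_le_one hn0).2 (by exact_mod_cast hk)
    rw [abs_mul, abs_of_nonneg (by positivity : 0 ≤ (k : ℝ) / n)]
    have h4 := mul_le_mul h3 (hglob n le_rfl l) (abs_nonneg _) zero_le_one
    linarith [hglob k hk l]
  refine tent_argmax_of_bound (supSemi hp J) (P := V⁻¹ *ᵥ M.proj P p J M.Δ) (Z := Z) hε hn hk₀n
    hkn hk1.le hk2.le hb (hsig.trans (l2Semi_le_supSemi hp J _)) (hZb _ hk₀n) (hZb k hkn) ?_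
  have h := hmax.2 (M.k₀ n) hk1.le hk2.le
  simp only [cusum_eq (P := P) hM hS hp hn hk₀n] at h
  exact h

set_option maxHeartbeats 800000 in
/-- The rate of the sup-norm estimator. -/
theorem sup_rate (hε : 0 < ε) (hM : M.Standing P ε) {q : ℕ} {ν : ℝ} (hS : M.SmoothMeans q ν)
    (hf : M.DesignDensity) {r₁ r₂ : ℕ} (hE : M.ErrorMoments P r₁)
    (hT : M.TrajectoryMoments P r₂) (hD : M.DependenceDecay P r₂) {p : ℕ} (hp : 1 ≤ p)
    {J : ℕ → ℕ} (hJ : Tendsto J atTop atTop)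
    (hJn : Tendsto (fun n : ℕ => (J n : ℝ) ^ 2 / n) atTop (𝓝 0))
    (hrate : Tendsto (fun n : ℕ => (J n : ℝ) * n * M.momentSum P (min r₁ r₂) n (J n)
      * (J n * Real.sqrt (Real.log n / (n * max 1 (J n * M.EInvN P n)))) ^ (min r₁ r₂))
      atTop (𝓝 0))
    (hΔ : 0 < supNorm M.Δ) {khat : ℕ → Ω → ℕ} (hk : M.IsSupEstimator ε p J khat) :
    IsBigOP P (fun n ω => (khat n ω : ℝ) - (M.k₀ n : ℝ))
      (fun n => Real.sqrt (n * max 1 ((J n : ℝ) * M.EInvN P n) * Real.log n)) := by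
  obtain ⟨c, C, Kg, hc, hC, hKg, hgram⟩ := exists_goodGram_Vhat hM hf hp
  have hΔ2 := l2Norm_pos_of_supNorm_pos (continuousOn_Δ hS) hΔ
  obtain ⟨b, hb, J₀, hsig⟩ := exists_signal_lower_bound hM hf hp (continuousOn_Δ hS) hΔ2 hc hC
  obtain ⟨K0, hK0, hlay⟩ := exists_layered hM hS hf hE hT hD hp
  obtain ⟨Kv, hKv, hinv⟩ := exists_abs_inv_mulVec_le p hc hC
  have hr : 2 ≤ min r₁ r₂ := le_min (by linarith [hE.2.1]) (by linarith [hT.2.2.1])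
  set r := min r₁ r₂ with hrdef
  have hls := layerSum_pos
  set s2 : ℝ := (2 * layerSum) ^ 2 with hs2
  have hs20 : 0 < s2 := by positivity
  -- With `A = 6 log n` in the deviation inequality, `432` makes the variance part of the exponent
  -- at most `log n`. The exponential factor is then at most `n⁻⁵`, which beats the union bound over
  -- layers, classes, times and coefficients.
  set Kx : ℝ := Real.sqrt (432 * s2 * K0) with hKx
  have hKx0 : 0 < Kx := Real.sqrt_pos.2 (by positivity)
  have hKx2 : Kx ^ 2 = 432 * s2 * K0 := Real.sq_sqrt (by positivity)
  set C2 : ℝ := (1 + p) * K0 * ((2 * layerSum) ^ r * layerSum) * (6 / Kx) ^ r with hC2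
  intro δ hδ
  refine ⟨2 * (Kv * 2 * (2 * Kx)) / (ε * b), by positivity, ?_⟩
  have hev1 : ∀ᶠ n : ℕ in atTop, Kg * ((J n : ℝ) ^ 2 / n) < δ / 4 := by
    have h := hJn.const_mul Kg
    rw [mul_zero] at h
    exact h.eventually_lt_const (by positivity)
  have hev2 : ∀ᶠ n : ℕ in atTop, (4 * (1 + p) + (1 + p) * 4 / (216 * s2)) * ((J n : ℝ) ^ 2 / n)
      < δ / 4 := by
    have h := hJn.const_mul (4 * (1 + p) + (1 + p) * 4 / (216 * s2))
    rw [mul_zero] at h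
    exact h.eventually_lt_const (by positivity)
  have hev3 : ∀ᶠ n : ℕ in atTop, (J n : ℝ) ^ 2 / n < 1 := hJn.eventually_lt_const one_pos
  have hev4 := hrate.const_mul C2
  rw [mul_zero] at hev4
  have hlog : ∀ᶠ n : ℕ in atTop, 1 ≤ Real.log n :=
    (Real.tendsto_log_atTop.comp tendsto_natCast_atTop_atTop).eventually_ge_atTop 1
  filter_upwards [hev1, hev2, hev3, hev4.eventually_lt_const (by positivity : 0 < δ / 4), hlog,
    eventually_ge_atTop 1, hJ.eventually_ge_atTop 1,
    hJ.eventually_ge_atTop J₀, hk, hM.break_mem] with n h1 h2 h3 h4 h5 hn hJ1 hJ2 hkn hbr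
  set j := J n with hj
  have hjr : (1 : ℝ) ≤ j := by exact_mod_cast hJ1
  have hj0 : (0 : ℝ) < j := by linarith
  have hnr : (1 : ℝ) ≤ n := by exact_mod_cast hn
  have hn0 : (0 : ℝ) < n := by linarith
  set lg : ℝ := Real.log n with hlg
  have hlg0 : 0 < lg := by linarith
  set a : ℝ := max 1 ((j : ℝ) * M.EInvN P n) with ha
  have ha1 : 1 ≤ a := le_max_left _ _
  have ha0 : 0 < a := by linarith
  obtain ⟨L, htail⟩ := hlay n j hn hJ1
  have : Nonempty (Fin (j + p)) := ⟨⟨0, by omega⟩⟩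
  have hv0 := L.v_nonneg
  have hvb : K0 * M.momentSum P 2 n j ≤ K0 * (2 * a / (j : ℝ) ^ 2) := by
    gcongr
    exact momentSum_two_le n hJ1
  have hcard : ((Fintype.card (Fin (j + p)) : ℕ) : ℝ) ≤ (1 + p) * j := by
    rw [Fintype.card_fin]
    push_cast
    nlinarith [(Nat.cast_nonneg p : (0 : ℝ) ≤ p)]
  have hjn : (j : ℝ) ≤ n := by
    have := (div_lt_one hn0).1 h3
    nlinarith
  set w : ℝ := Real.sqrt (n * a * lg) with hw
  have hw0 : 0 < w := Real.sqrt_pos.2 (by positivity)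
  have hw2 : w ^ 2 = n * a * lg := Real.sq_sqrt (by positivity)
  -- The division by `j` anticipates the factor of order `j` lost when the Gram matrix is inverted
  -- in the sup norm.
  set x : ℝ := Kx * w / j with hx
  have hx0 : 0 < x := by positivity
  have hx2 : x ^ 2 = 432 * s2 * K0 * (n * a * lg) / (j : ℝ) ^ 2 := by
    rw [hx, div_pow, mul_pow, hKx2, hw2]
  have hAx : 6 * lg / x = 6 / Kx * (j * Real.sqrt (lg / (n * a))) := by
    have e : lg / w = Real.sqrt (lg / (n * a)) := by
      rw [eq_comm, Real.sqrt_eq_iff_mul_self_eq (by positivity) (by positivity)]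
      rw [← sq, div_pow, hw2]
      field_simp
    rw [← e, hx]
    field_simp
  set E0 : Set Ω := {ω | ¬ GoodGram p j c C (M.Vhat p j n ω)} with hE0
  set E1 : Set Ω := {ω | ∃ k ≤ n, ∃ l, x
    < |∑ i ∈ Finset.range k, M.cscore P p j n (1 + i) ω l|} with hE1
  have hP0 : P E0 ≤ ENNReal.ofReal (δ / 4) :=
    (hgram n j hn hJ1).trans (ENNReal.ofReal_le_ofReal h1.le)
  have hP1 : P E1 ≤ ENNReal.ofReal (δ / 2) := by
    have hΛ := M.momentSum_nonneg (P := P) r n j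
    refine (L.deviation 1 hr (by positivity) htail (by positivity : 0 < 6 * lg) hx0).trans
      (ENNReal.ofReal_le_ofReal ?_)
    set v : ℝ := K0 * M.momentSum P 2 n j with hv
    have hvx : v / x ^ 2 ≤ (216 * s2 * n * lg)⁻¹ := by
      calc v / x ^ 2 ≤ K0 * (2 * a / (j : ℝ) ^ 2) / x ^ 2 := by gcongr
        _ = _ := by
          rw [hx2]
          field_simp
          norm_num
    have hexp : -(6 * lg) + 6 * n * v * s2 * (6 * lg / x) ^ 2 ≤ -5 * lg := by
      have e : 6 * n * v * s2 * (6 * lg / x) ^ 2 = 216 * s2 * n * lg ^ 2 * (v / x ^ 2) := by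
        field_simp
        ring
      have : 216 * s2 * n * lg ^ 2 * (v / x ^ 2)
          ≤ 216 * s2 * n * lg ^ 2 * (216 * s2 * n * lg)⁻¹ := by
        gcongr
      have e2 : 216 * s2 * n * lg ^ 2 * (216 * s2 * n * lg)⁻¹ = lg := by
        field_simp
      rw [e]
      linarith
    have hexp' : Real.exp (-(6 * lg) + 6 * n * v * s2 * (6 * lg / x) ^ 2) ≤ ((n : ℝ) ^ 5)⁻¹ := by
      refine (Real.exp_le_exp.2 hexp).trans (le_of_eq ?_)
      rw [neg_mul, Real.exp_neg, show (5 : ℝ) * lg = ((5 : ℕ) : ℝ) * lg by norm_num, Real.exp_nat_mul,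
        hlg, Real.exp_log hn0]
    have t1 : Fintype.card (Fin (j + p)) * (2 * (n : ℝ) ^ 2 * (n + 1)
        * Real.exp (-(6 * lg) + 6 * n * v * s2 * (6 * lg / x) ^ 2))
        ≤ 4 * (1 + p) * ((j : ℝ) ^ 2 / n) := by
      calc Fintype.card (Fin (j + p)) * (2 * (n : ℝ) ^ 2 * (n + 1)
          * Real.exp (-(6 * lg) + 6 * n * v * s2 * (6 * lg / x) ^ 2))
          ≤ (1 + p) * j * (2 * (n : ℝ) ^ 2 * (n + n) * ((n : ℝ) ^ 5)⁻¹) := by gcongr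
        _ = 4 * (1 + p) * (j / (n : ℝ) ^ 2) := by
            field_simp
            ring
        _ ≤ 4 * (1 + p) * ((j : ℝ) ^ 2 / n) := by
            have hj2 : (j : ℝ) ≤ (j : ℝ) ^ 2 := le_self_pow₀ hjr two_ne_zero
            have hn2 : (n : ℝ) ≤ (n : ℝ) ^ 2 := le_self_pow₀ hnr two_ne_zero
            exact mul_le_mul_of_nonneg_left
              (div_le_div₀ (by positivity) hj2 hn0 hn2) (by positivity)
    have t2 : Fintype.card (Fin (j + p)) * (n * (K0 * M.momentSum P r n j)
        * ((2 * layerSum) ^ r * layerSum) * (6 * lg / x) ^ r) ≤ δ / 4 := by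
      refine le_trans ?_ h4.le
      calc Fintype.card (Fin (j + p)) * (n * (K0 * M.momentSum P r n j)
          * ((2 * layerSum) ^ r * layerSum) * (6 * lg / x) ^ r)
          ≤ (1 + p) * j * (n * (K0 * M.momentSum P r n j)
          * ((2 * layerSum) ^ r * layerSum) * (6 * lg / x) ^ r) := by gcongr
        _ = _ := by
            rw [hAx, mul_pow (6 / Kx), hC2]
            ring
    have t3 : Fintype.card (Fin (j + p)) * (4 * v / x ^ 2)
        ≤ (1 + p) * 4 / (216 * s2) * ((j : ℝ) ^ 2 / n) := by
      calc Fintype.card (Fin (j + p)) * (4 * v / x ^ 2)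
          = Fintype.card (Fin (j + p)) * (4 * (v / x ^ 2)) := by ring
        _ ≤ (1 + p) * j * (4 * (216 * s2 * n * 1)⁻¹) := by
            gcongr
            refine hvx.trans ?_
            gcongr
        _ = (1 + p) * 4 / (216 * s2) * (j / n) := by
            field_simp
        _ ≤ _ := by
            have hj2 : (j : ℝ) ≤ (j : ℝ) ^ 2 := le_self_pow₀ hjr two_ne_zero
            gcongr
    rw [mul_add, mul_add]
    linarith
  have hsub : {ω | 2 * (Kv * 2 * (2 * Kx)) / (ε * b) * w < |(khat n ω : ℝ) - (M.k₀ n : ℝ)|}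
      ⊆ E0 ∪ E1 := by
    intro ω hω
    by_contra hcon
    simp only [Set.mem_union, not_or] at hcon
    obtain ⟨g0, g1⟩ := hcon
    simp only [hE0, hE1, Set.mem_ofPred_eq, not_not, not_exists, not_and, not_lt] at g0 g1
    have hloc := sup_localization (P := P) hε hM hS hp hn hbr hKv (hinv j _ g0) hb
      (hsig j hJ2 _ g0) hx0 g1 (hkn ω)
    change 2 * (Kv * 2 * (2 * Kx)) / (ε * b) * w < |(khat n ω : ℝ) - (M.k₀ n : ℝ)| at hω
    refine absurd (hloc.trans ?_) (not_le.2 hω)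
    calc 2 * (Kv * (j + 1) * (2 * x)) / (ε * b)
        ≤ 2 * (Kv * (2 * j) * (2 * x)) / (ε * b) := by
          gcongr
          linarith
      _ = _ := by
          rw [hx]
          field_simp
  calc P {ω | 2 * (Kv * 2 * (2 * Kx)) / (ε * b) * w < |(khat n ω : ℝ) - (M.k₀ n : ℝ)|}
      ≤ P (E0 ∪ E1) := measure_mono hsub
    _ ≤ P E0 + P E1 := measure_union_le _ _
    _ ≤ ENNReal.ofReal (δ / 4) + ENNReal.ofReal (δ / 2) := add_le_add hP0 hP1
    _ ≤ ENNReal.ofReal δ := by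
        rw [← ENNReal.ofReal_add (by positivity) (by positivity)]
        exact ENNReal.ofReal_le_ofReal (by linarith)

end Model

end FTSBreak

namespace FTSBreak

set_option linter.unusedSectionVars false

/-! ### Consequences of the rate conditions -/

lemma tendsto_atTop_of_le_rpow {J : ℕ → ℕ} {g : ℕ → ℝ} {c s : ℝ} (hc : 0 ≤ c) (hs : 0 ≤ s)
    (hg : Tendsto g atTop atTop) (h : ∀ᶠ n in atTop, g n ≤ c * (J n : ℝ) ^ s) :
    Tendsto J atTop atTop := by
  refine tendsto_atTop.2 fun B => ?_
  filter_upwards [h, hg.eventually_gt_atTop (c * (B : ℝ) ^ s)] with n h1 h2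
  by_contra hcon
  push Not at hcon
  have h3 : (J n : ℝ) ^ s ≤ (B : ℝ) ^ s :=
    Real.rpow_le_rpow (Nat.cast_nonneg _) (by exact_mod_cast hcon.le) hs
  nlinarith [mul_le_mul_of_nonneg_left h3 hc]

lemma eventually_one_le_log : ∀ᶠ n : ℕ in atTop, 1 ≤ Real.log n :=
  (Real.tendsto_log_atTop.comp tendsto_natCast_atTop_atTop).eventually_ge_atTop 1

lemma tendsto_sq_div_of_log {J : ℕ → ℕ}
    (h : Tendsto (fun n : ℕ => (n : ℝ) ^ (-(1 / 2) : ℝ) * (J n : ℝ) * Real.log n) atTop (𝓝 0)) :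
    Tendsto (fun n : ℕ => (J n : ℝ) ^ 2 / n) atTop (𝓝 0) := by
  have h2 := h.pow 2
  rw [zero_pow two_ne_zero] at h2
  refine squeeze_zero' (Eventually.of_forall fun n => by positivity) ?_ h2
  filter_upwards [eventually_one_le_log, eventually_gt_atTop 0] with n h1 hn
  have hn0 : (0 : ℝ) < n := by exact_mod_cast hn
  have e : ((n : ℝ) ^ (-(1 / 2) : ℝ)) ^ 2 = (n : ℝ)⁻¹ := by
    rw [← Real.rpow_natCast, ← Real.rpow_mul hn0.le]
    norm_num
    rw [Real.rpow_neg_one]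
  rw [mul_pow, mul_pow, e]
  calc (J n : ℝ) ^ 2 / n = (n : ℝ)⁻¹ * (J n : ℝ) ^ 2 * 1 := by ring
    _ ≤ (n : ℝ)⁻¹ * (J n : ℝ) ^ 2 * Real.log n ^ 2 := by
        gcongr
        exact one_le_pow₀ h1

namespace Model

variable {Ω S : Type*} [MeasurableSpace Ω] [MeasurableSpace S] {P : Measure Ω}
  [IsProbabilityMeasure P] {M : Model Ω S} {ε : ℝ}

/-- Since `E(N⁻¹) ≤ 1`, the hypothesis gives `n J^(-q*) ≤ 1 + J ≤ 2 J` eventually, that is, `n ≤ 2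
J^(1+q*)`. -/
lemma tendsto_knots_of_isLittleO (hM : M.Standing P ε) {J : ℕ → ℕ}
    (hJ : ∀ᶠ n : ℕ in atTop, 1 ≤ J n) {qs : ℝ} (hqs : 0 ≤ qs)
    (h : (fun n : ℕ => (n : ℝ) * (J n : ℝ) ^ (-qs))
      =o[atTop] (fun n : ℕ => 1 + (J n : ℝ) * M.EInvN P n)) :
    Tendsto J atTop atTop := by
  refine tendsto_atTop_of_le_rpow (c := 2) (s := 1 + qs) (by norm_num) (by linarith)
    tendsto_natCast_atTop_atTop ?_
  filter_upwards [h.bound one_pos, hJ] with n h1 h2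
  have hj : (1 : ℝ) ≤ J n := by exact_mod_cast h2
  have hj0 : (0 : ℝ) < J n := by linarith
  have hE := EInvN_le_one hM n
  have hE0 := EInvN_pos hM n
  rw [Real.norm_of_nonneg (by positivity), Real.norm_of_nonneg (by positivity), one_mul] at h1
  have h3 : (n : ℝ) * (J n : ℝ) ^ (-qs) ≤ 2 * J n := by nlinarith
  rw [Real.rpow_neg hj0.le, ← div_eq_mul_inv, div_le_iff₀ (by positivity)] at h3
  rw [Real.rpow_add hj0, Real.rpow_one]
  linarith

/-- Two single terms suffice: `s = r` gives `J^(-r)`, and `s = 1` gives `E(N^(1-r)) J⁻¹`, which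
Jensen's inequality bounds below by `E(N⁻¹)^(r-1) J⁻¹`. -/
lemma max_pow_div_le_momentSum (hM : M.Standing P ε) {r n J : ℕ} (hr : 1 ≤ r) (hJ : 1 ≤ J) :
    (max 1 (J * M.EInvN P n)) ^ (r - 1) / (J : ℝ) ^ r ≤ M.momentSum P r n J := by
  have hJ0 : (0 : ℝ) < J := by exact_mod_cast hJ
  have hterm : ∀ s ∈ Finset.Icc 1 r, 0 ≤
      (∫ ω, (M.N n 1 ω : ℝ) ^ ((s : ℤ) - (r : ℤ)) ∂P) * (J : ℝ) ^ (-(s : ℤ)) := fun s _ =>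
    mul_nonneg (integral_nonneg fun ω => zpow_nonneg (Nat.cast_nonneg _) _)
      (zpow_nonneg hJ0.le _)
  rcases max_choice (1 : ℝ) (J * M.EInvN P n) with h | h
  · refine le_trans (le_of_eq ?_)
      (Finset.single_le_sum hterm (Finset.mem_Icc.2 ⟨hr, le_rfl⟩))
    rw [h]
    simp
  · refine le_trans ?_ (Finset.single_le_sum hterm (Finset.mem_Icc.2 ⟨le_rfl, hr⟩))
    rw [h]
    have hint : Integrable (fun ω => (M.N n 1 ω : ℝ)⁻¹) P := by
      have := integrable_N_zpow (P := P) hM n 1 (t := 0) (r := 1) (by norm_num)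
      simpa using this
    have e : ∀ ω, (M.N n 1 ω : ℝ) ^ (((1 : ℕ) : ℤ) - (r : ℤ)) = ((M.N n 1 ω : ℝ)⁻¹) ^ (r - 1) := by
      intro ω
      rw [inv_pow, ← zpow_natCast, ← zpow_neg, Nat.cast_sub hr]
      congr 1
      ring
    have hint2 : Integrable (fun ω => ((M.N n 1 ω : ℝ)⁻¹) ^ (r - 1)) P := by
      have := integrable_N_zpow (P := P) hM n 1 (t := 1) (r := r) hr
      simpa only [e] using this
    have hjen : M.EInvN P n ^ (r - 1) ≤ ∫ ω, ((M.N n 1 ω : ℝ)⁻¹) ^ (r - 1) ∂P :=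
      (convexOn_pow (r - 1)).map_integral_le (continuous_pow _).continuousOn isClosed_Ici
        (Eventually.of_forall fun ω => by simp) hint hint2
    simp only [e]
    calc ((J : ℝ) * M.EInvN P n) ^ (r - 1) / (J : ℝ) ^ r
        = M.EInvN P n ^ (r - 1) * (J : ℝ) ^ (-((1 : ℕ) : ℤ)) := by
          obtain ⟨r, rfl⟩ := Nat.exists_eq_add_of_le' hr
          rw [Nat.add_sub_cancel, mul_pow, pow_succ, Nat.cast_one, zpow_neg_one]
          field_simp
      _ ≤ _ := by gcongr

/-- The common form of the two knot regimes. -/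
lemma KnotRates.tendsto_zero (hM : M.Standing P ε) {p : ℕ} {J : ℕ → ℕ}
    (hJ : ∀ᶠ n : ℕ in atTop, 1 ≤ J n) {qs : ℝ} {r : ℕ} (hr : 3 ≤ r)
    (h : M.KnotRates P p J qs r) :
    Tendsto (fun n : ℕ => (J n : ℝ) ^ ((10 * (r : ℝ) - 8) / (3 * r - 2))
      * M.momentSum P r n (J n) ^ (2 / (r : ℝ)) * (n : ℝ) ^ (-(((r : ℝ) - 2) / (3 * r - 2)))
      * Real.log n / max 1 (J n * M.EInvN P n)) atTop (𝓝 0) := by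
  have hr3 : (3 : ℝ) ≤ r := by exact_mod_cast hr
  obtain ⟨-, ⟨h1, -, h3⟩ | ⟨-, -, h3⟩⟩ := h
  -- In the first regime the maximum is eventually `J E(N⁻¹)`; dividing by it supplies `E(N⁻¹)⁻¹`
  -- and lowers the exponent of `J` by one, from `10r-8` to `7r-6` over `3r-2`. In the second regime
  -- dividing by a maximum at least one only helps.
  · refine h3.congr' ?_
    filter_upwards [hJ, h1.eventually_ge_atTop 1] with n hj hEJ
    have hj0 : (0 : ℝ) < J n := by exact_mod_cast hj
    have hE0 := EInvN_pos hM n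
    rw [max_eq_right (by rwa [mul_comm]),
      show (10 * (r : ℝ) - 8) / (3 * r - 2) = (7 * (r : ℝ) - 6) / (3 * r - 2) + 1 by
        rw [div_add_one (by linarith)]
        ring, Real.rpow_add hj0, Real.rpow_one]
    field_simp
  · refine squeeze_zero' (Eventually.of_forall fun n => ?_) (Eventually.of_forall fun n => ?_) h3
    · have := M.momentSum_nonneg (P := P) r n (J n)
      have := Real.log_natCast_nonneg n
      positivity
    · have := M.momentSum_nonneg (P := P) r n (J n)
      have := Real.log_natCast_nonneg n
      exact div_le_self (by positivity) (le_max_left _ _)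

/-- In the first regime `J ≥ J E(N⁻¹) → ∞`. In the second the bias condition gives `√n ≤ J^(q*)`
eventually. -/
lemma KnotRates.tendsto_knots (hM : M.Standing P ε) {p : ℕ} {J : ℕ → ℕ}
    (hJ : ∀ᶠ n : ℕ in atTop, 1 ≤ J n) {qs : ℝ} (hqs : 0 ≤ qs) {r : ℕ}
    (h : M.KnotRates P p J qs r) : Tendsto J atTop atTop := by
  obtain ⟨-, ⟨h1, -, -⟩ | ⟨-, h2, -⟩⟩ := h
  · refine tendsto_atTop_of_le_rpow (c := 1) (s := 1) zero_le_one zero_le_one h1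
      (Eventually.of_forall fun n => ?_)
    rw [Real.rpow_one]
    exact mul_le_mul_of_nonneg_right (EInvN_le_one hM n) (Nat.cast_nonneg _)
  · refine tendsto_atTop_of_le_rpow (c := 1) (s := qs) zero_le_one hqs
      ((tendsto_rpow_atTop (by norm_num : (0 : ℝ) < 1 / 2)).comp tendsto_natCast_atTop_atTop) ?_
    filter_upwards [h2.eventually_le_const one_pos, eventually_one_le_log, hJ] with n h3 h4 hj
    have hj0 : (0 : ℝ) < J n := by exact_mod_cast hj
    have h5 : 1 ≤ Real.log n ^ (1 / 2 : ℝ) := Real.one_le_rpow h4 (by norm_num)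
    have h6 : (J n : ℝ) ^ (-qs) * (n : ℝ) ^ (1 / 2 : ℝ) ≤ 1 :=
      (le_mul_of_one_le_right (by positivity) h5).trans h3
    rw [Real.rpow_neg hj0.le, inv_mul_le_iff₀ (by positivity), mul_one] at h6
    simpa using h6

/-- From `Λ^(2/r) ≥ a / J²` the common rate quantity dominates `J^(α-2) n^(-γ)`, where `α =
(10r-8)/(3r-2)` and `γ = (r-2)/(3r-2)`. As `α - 2 ≥ 2γ`, it dominates `(J²/n)^γ`. -/
lemma KnotRates.tendsto_sq_div (hM : M.Standing P ε) {p : ℕ} {J : ℕ → ℕ}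
    (hJ : ∀ᶠ n : ℕ in atTop, 1 ≤ J n) {qs : ℝ} {r : ℕ} (hr : 3 ≤ r)
    (h : M.KnotRates P p J qs r) :
    Tendsto (fun n : ℕ => (J n : ℝ) ^ 2 / n) atTop (𝓝 0) := by
  have hr3 : (3 : ℝ) ≤ r := by exact_mod_cast hr
  have hd : 0 < 3 * (r : ℝ) - 2 := by linarith
  have hU := h.tendsto_zero hM hJ hr
  set γ : ℝ := ((r : ℝ) - 2) / (3 * r - 2) with hγ
  have hγ0 : 0 < γ := div_pos (by linarith) hd
  have hU' := hU.rpow_const (p := γ⁻¹) (Or.inr (by positivity))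
  rw [Real.zero_rpow (by positivity)] at hU'
  refine squeeze_zero' (Eventually.of_forall fun n => by positivity) ?_ hU'
  filter_upwards [hJ, eventually_one_le_log, eventually_gt_atTop 0] with n hj hl hn
  have hn0 : (0 : ℝ) < n := by exact_mod_cast hn
  have hj1 : (1 : ℝ) ≤ J n := by exact_mod_cast hj
  have hj0 : (0 : ℝ) < J n := by linarith
  rw [Real.le_rpow_inv_iff_of_pos (by positivity) (by
    have := M.momentSum_nonneg (P := P) r n (J n)
    positivity) hγ0]
  set a : ℝ := max 1 (J n * M.EInvN P n) with ha
  have ha1 : 1 ≤ a := le_max_left _ _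
  have ha0 : 0 < a := by linarith
  have hΛ : a / (J n : ℝ) ^ (2 : ℝ) ≤ M.momentSum P r n (J n) ^ (2 / (r : ℝ)) := by
    have h1 := Real.rpow_le_rpow (by positivity)
      (max_pow_div_le_momentSum (P := P) hM (n := n) (by omega : 1 ≤ r) hj)
      (by positivity : 0 ≤ 2 / (r : ℝ))
    refine le_trans ?_ h1
    rw [← ha, Real.div_rpow (by positivity) (by positivity), ← Real.rpow_natCast,
      ← Real.rpow_natCast, ← Real.rpow_mul ha0.le, ← Real.rpow_mul hj0.le,
      show (r : ℝ) * (2 / r) = 2 by field_simp]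
    gcongr
    refine Real.self_le_rpow_of_one_le ha1 ?_
    rw [Nat.cast_sub (by omega), Nat.cast_one, mul_div_assoc', le_div_iff₀ (by linarith)]
    linarith
  calc ((J n : ℝ) ^ 2 / n) ^ γ = (J n : ℝ) ^ (2 * γ) * (n : ℝ) ^ (-γ) := by
        rw [Real.div_rpow (by positivity) hn0.le, Real.rpow_neg hn0.le, ← Real.rpow_natCast,
          ← Real.rpow_mul hj0.le, Nat.cast_ofNat, div_eq_mul_inv]
    _ ≤ (J n : ℝ) ^ ((10 * (r : ℝ) - 8) / (3 * r - 2) - 2) * (n : ℝ) ^ (-γ) := by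
        gcongr
        rw [hγ, le_sub_iff_add_le, mul_div_assoc', div_add' _ _ _ hd.ne',
          div_le_div_iff_of_pos_right hd]
        linarith
    _ = (J n : ℝ) ^ ((10 * (r : ℝ) - 8) / (3 * r - 2)) * (a / (J n : ℝ) ^ (2 : ℝ))
        * (n : ℝ) ^ (-γ) * 1 / a := by
        rw [Real.rpow_sub hj0]
        field_simp
    _ ≤ _ := by
        have := M.momentSum_nonneg (P := P) r n (J n)
        gcongr

/-- The `r/2`-th power of the common rate quantity dominates: the factors in `Λ`, `log n` and `a`
match exactly, and for `r ≥ 3` the exponents of `J` and `n` are at least `r + 1` and `1 - r/2`. -/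
lemma KnotRates.tendsto_deviation (hM : M.Standing P ε) {p : ℕ} {J : ℕ → ℕ}
    (hJ : ∀ᶠ n : ℕ in atTop, 1 ≤ J n) {qs : ℝ} {r : ℕ} (hr : 3 ≤ r)
    (h : M.KnotRates P p J qs r) :
    Tendsto (fun n : ℕ => (J n : ℝ) * n * M.momentSum P r n (J n)
      * (J n * Real.sqrt (Real.log n / (n * max 1 (J n * M.EInvN P n)))) ^ r) atTop (𝓝 0) := by
  have hr3 : (3 : ℝ) ≤ r := by exact_mod_cast hr
  have hd : 0 < 3 * (r : ℝ) - 2 := by linarith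
  have hU := h.tendsto_zero hM hJ hr
  set γ : ℝ := ((r : ℝ) - 2) / (3 * r - 2) with hγ
  set α : ℝ := (10 * (r : ℝ) - 8) / (3 * r - 2) with hα
  have hU' := hU.rpow_const (p := (r : ℝ) / 2) (Or.inr (by positivity))
  rw [Real.zero_rpow (by positivity)] at hU'
  refine squeeze_zero' (Eventually.of_forall fun n => ?_) ?_ hU'
  · have := M.momentSum_nonneg (P := P) r n (J n)
    positivity
  filter_upwards [hJ, eventually_one_le_log, eventually_ge_atTop 1] with n hj hl hn
  have hn1 : (1 : ℝ) ≤ n := by exact_mod_cast hn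
  have hn0 : (0 : ℝ) < n := by linarith
  have hj1 : (1 : ℝ) ≤ J n := by exact_mod_cast hj
  have hj0 : (0 : ℝ) < J n := by linarith
  set Λ := M.momentSum P r n (J n) with hΛ
  have hΛ0 : 0 ≤ Λ := M.momentSum_nonneg (P := P) r n (J n)
  set a : ℝ := max 1 (J n * M.EInvN P n) with ha
  have ha1 : 1 ≤ a := le_max_left _ _
  have ha0 : 0 < a := by linarith
  set lg := Real.log n with hlg
  have hlg0 : 0 < lg := by linarith
  have e1 : Real.sqrt (lg / (n * a)) ^ r
      = lg ^ ((r : ℝ) / 2) / ((n : ℝ) ^ ((r : ℝ) / 2) * a ^ ((r : ℝ) / 2)) := by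
    rw [Real.sqrt_eq_rpow, ← Real.rpow_natCast, ← Real.rpow_mul (by positivity),
      show 1 / 2 * (r : ℝ) = r / 2 by ring, Real.div_rpow (by positivity) (by positivity),
      Real.mul_rpow hn0.le ha0.le]
  have e2 : (Λ ^ (2 / (r : ℝ))) ^ ((r : ℝ) / 2) = Λ := by
    rw [← Real.rpow_mul hΛ0, show 2 / (r : ℝ) * (r / 2) = 1 by field_simp, Real.rpow_one]
  have hJexp : (J n : ℝ) * (J n : ℝ) ^ r ≤ ((J n : ℝ) ^ α) ^ ((r : ℝ) / 2) := by
    rw [← Real.rpow_natCast, ← Real.rpow_one_add' hj0.le (by positivity), ← Real.rpow_mul hj0.le]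
    refine Real.rpow_le_rpow_of_exponent_le hj1 ?_
    rw [hα, div_mul_div_comm, le_div_iff₀ (by positivity)]
    nlinarith
  have hnexp : (n : ℝ) / (n : ℝ) ^ ((r : ℝ) / 2) ≤ ((n : ℝ) ^ (-γ)) ^ ((r : ℝ) / 2) := by
    rw [← Real.rpow_one_sub' hn0.le (by linarith), ← Real.rpow_mul hn0.le]
    refine Real.rpow_le_rpow_of_exponent_le hn1 ?_
    have : γ * ((r : ℝ) / 2) ≤ r / 2 - 1 := by
      rw [hγ, div_mul_div_comm, div_le_iff₀ (by positivity)]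
      nlinarith
    linarith
  calc (J n : ℝ) * n * Λ * (J n * Real.sqrt (lg / (n * a))) ^ r
      = (J n * (J n : ℝ) ^ r) * Λ * (n / (n : ℝ) ^ ((r : ℝ) / 2)) * lg ^ ((r : ℝ) / 2)
        / a ^ ((r : ℝ) / 2) := by
        rw [mul_pow, e1]
        field_simp
    _ ≤ ((J n : ℝ) ^ α) ^ ((r : ℝ) / 2) * Λ * ((n : ℝ) ^ (-γ)) ^ ((r : ℝ) / 2)
        * lg ^ ((r : ℝ) / 2) / a ^ ((r : ℝ) / 2) := by gcongr
    _ = _ := by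
        rw [Real.div_rpow (by positivity) ha0.le, Real.mul_rpow (by positivity) hlg0.le,
          Real.mul_rpow (by positivity) (by positivity),
          Real.mul_rpow (by positivity) (by positivity), e2]

end Model

end FTSBreak

/-! ### Both rates under the stated knot conditions -/

theorem mainTheorem4 {Ω S : Type*} [MeasurableSpace Ω] [MeasurableSpace S]
    (P : Measure Ω) [IsProbabilityMeasure P] (M : FTSBreak.Model Ω S)
    (ε : ℝ) (hε₀ : 0 < ε) (hε₁ : ε < 1 / 2) (hM : M.Standing P ε)
    (q : ℕ) (ν : ℝ) (r₁ r₂ : ℕ)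
    (hSmoothMeans : M.SmoothMeans q ν) (hDesignDensity : M.DesignDensity) (hErrorMoments : M.ErrorMoments P r₁) (hTrajectoryMoments : M.TrajectoryMoments P r₂) (hDependenceDecay : M.DependenceDecay P r₂)
    (p : ℕ) (hp : 1 ≤ p) (J : ℕ → ℕ) (hJ : ∀ᶠ n : ℕ in atTop, 1 ≤ J n) :
    ((fun n : ℕ => (n : ℝ) * (J n : ℝ) ^ (-((q : ℝ) + ν)))
          =o[atTop] (fun n : ℕ => 1 + (J n : ℝ) * M.EInvN P n) →
      Tendsto (fun n : ℕ => (n : ℝ) ^ (-(1 / 2) : ℝ) * (J n : ℝ) * Real.log n) atTop (𝓝 0) →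
      0 < FTSBreak.l2Norm M.Δ →
      ∀ khat : ℕ → Ω → ℕ, M.IsL2Estimator ε p J khat →
        FTSBreak.IsBigOP P (fun n ω => (khat n ω : ℝ) - (M.k₀ n : ℝ))
          (fun n => max 1 ((J n : ℝ) * M.EInvN P n))) ∧
    (M.KnotRates P p J ((q : ℝ) + ν) (min r₁ r₂) →
      0 < FTSBreak.supNorm M.Δ →
      ∀ khat : ℕ → Ω → ℕ, M.IsSupEstimator ε p J khat →
        FTSBreak.IsBigOP P (fun n ω => (khat n ω : ℝ) - (M.k₀ n : ℝ))
          (fun n : ℕ => (n : ℝ) ^ (1 / 2 : ℝ) * Real.log n ^ (1 / 2 : ℝ)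
            * max 1 ((J n : ℝ) ^ (1 / 2 : ℝ) * M.EInvN P n ^ (1 / 2 : ℝ)))) := by
  have hqs : 0 ≤ (q : ℝ) + ν := add_nonneg (Nat.cast_nonneg _) hSmoothMeans.2.1.le
  refine ⟨fun h1 h2 hΔ khat hk => ?_, fun hK hΔ khat hk => ?_⟩
  · exact FTSBreak.Model.l2_rate hε₀ hM hSmoothMeans hDesignDensity hErrorMoments
      hTrajectoryMoments hDependenceDecay hp
      (FTSBreak.Model.tendsto_knots_of_isLittleO hM hJ hqs h1)
      (FTSBreak.tendsto_sq_div_of_log h2) hΔ hk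
  · have hr : 3 ≤ min r₁ r₂ := le_min hErrorMoments.2.1 hTrajectoryMoments.2.2.1
    have h := FTSBreak.Model.sup_rate hε₀ hM hSmoothMeans hDesignDensity hErrorMoments
      hTrajectoryMoments hDependenceDecay hp (hK.tendsto_knots hM hJ hqs)
      (hK.tendsto_sq_div hM hJ hr) (hK.tendsto_deviation hM hJ hr) hΔ hk
    convert h using 2 with n
    have hE := (FTSBreak.Model.EInvN_pos hM n).le
    -- The square root is monotone, hence commutes with the maximum; this turns `√(n a log n)` into
    -- the product form of the rate.
    have hmax : max 1 ((J n : ℝ) ^ (1 / 2 : ℝ) * M.EInvN P n ^ (1 / 2 : ℝ))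
        = Real.sqrt (max 1 ((J n : ℝ) * M.EInvN P n)) := by
      rw [Monotone.map_max (fun _ _ h => Real.sqrt_le_sqrt h), Real.sqrt_one,
        Real.sqrt_mul (Nat.cast_nonneg _), Real.sqrt_eq_rpow, Real.sqrt_eq_rpow]
    rw [hmax, Real.sqrt_mul (by positivity), Real.sqrt_mul (by positivity), ← Real.sqrt_eq_rpow,
      ← Real.sqrt_eq_rpow]
    ring
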